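/- \textbf{Setting.} For $r>1/2$, $H^r=H^r(\mathbb R)$ is the real Sobolev space with $|f|_{H^r}=|(1-\partial_x^2)^{r/2}f|_{L^2}$. For $\varepsilon\in(0,1)$ and $s\ge 0$, $X^s$ is the space $H^{s+2}\times H^{s+2}$ with the $\varepsilon$-dependent norm $$|(\zeta,v)|_{X^s}^2=|\zeta|_{H^s}^2+\varepsilon^2|\zeta_x|_{H^s}^2+\varepsilon^2|\zeta_{xx}|_{H^s}^2+|v|_{H^s}^2+\varepsilon|v_x|_{H^s}^2+\varepsilon^2|v_{xx}|_{H^s}^2 .$$ For $U=(\zeta,v)$ put $h=1+\varepsilon\zeta$ and $\Im w=hw-\frac{\varepsilon}{3}\partial_x(h^3\partial_xw)+\frac{\varepsilon^2}{45}\partial_x^4w$. The extended Boussinesq system with source $(f_1,f_2)$ is $$\partial_t\zeta+\partial_x(hv)=f_1,\qquad \Im(\partial_tv+\varepsilon vv_x)+h\zeta_x-\varepsilon^2\zeta_{xxx}+\tfrac{2}{45}\varepsilon^2\zeta_{xxxxx}+\varepsilon^2\zeta_{xxx}+\tfrac23\varepsilon^2\partial_x(v_x^2)=f_2 .$$ Solutions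 on $[0,L]$ are understood with $\partial_t\zeta,\partial_tv\in L^\infty([0,L];H^2)$ and with the equations satisfied for almost every $t$, in the sense of distributions in $x$. \textbf{Theorem (Stability).} Let $s>3/2$, $h_{\min}>0$ and $M,\widetilde M\in\mathbb R$. There is a constant $K>0$, depending only on $s,h_{\min},M,\widetilde M$ (in particular not on $\varepsilon$ or $T$), such that the following holds for all $\varepsilon\in(0,1)$ and all $T>0$. Let $U=(\zeta,v)\in C([0,T/\sqrt\varepsilon];X^s)$ be a solution of the extended Boussinesq system with zero source, with $1+\varepsilon\zeta(t,x)\ge h_{\min}$ for all $t\in[0,T/\sqrt\varepsilon)$ and $x\in\mathbb R$, and with $\sup_{[0,T/\sqrt\varepsilon]}|U|_{X^s}\le M$. Let $\widetilde U=(\widetilde\zeta,\widetilde v)\in C([0,T/\sqrt\varepsilon];X^{s+1})$ be a solution of the system with source $\widetilde F=(f_1,f_2)\in L^\infty([0,T/\sqrt\varepsilon];X^s)$, with $\sup_{[0,T/\sqrt\varepsilon]}|\widetilde U|_{X^{s+1}}\le\widetilde M$. Then for all $0\le t\le T/\sqrt\varepsilon$ $$\sup_{0\le\tau\le t}|(U-\widetilde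 U)(\tau)|_{X^s}\le K\,e^{\sqrt\varepsilon\,K\,t}\Big(|(U-\widetilde U)(0)|_{X^s}+t\,|\widetilde F|_{L^\infty([0,t];X^s)}\Big).$$ In particular the left-hand side is at most $\widetilde C\,\big(|(U-\widetilde U)(0)|_{X^s}+t|\widetilde F|_{L^\infty([0,t];X^s)}\big)$ with $\widetilde C=Ke^{KT}$ independent of $\varepsilon$. -/

import Mathlib

namespace Boussinesq

noncomputable section

open MeasureTheory Set Filter Topology FourierTransform
open scoped ENNReal ContDiff

/-- The class in `L²(ℝ; ℂ)` of a real function (zero if the function is not square integrable). -/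
def toL2 (f : ℝ → ℝ) : Lp ℂ 2 (volume : Measure ℝ) :=
  open Classical in
  if hf : MemLp (fun x => (f x : ℂ)) 2 volume then hf.toLp _ else 0

/-- The Fourier transform of `Λ^r f`, where `Λ^r = (1 - ∂ₓ²)^(r/2)`. With the convention
`𝓕 f ξ = ∫ e^{-2πixξ} f x dx` the symbol of `Λ^r` is `(1 + (2πξ)²)^(r/2)`. -/
def besselFourier (r : ℝ) (f : ℝ → ℝ) (ξ : ℝ) : ℂ :=
  (((1 + (2 * Real.pi * ξ) ^ 2) ^ (r / 2) : ℝ) : ℂ) * (𝓕 (toL2 f) : Lp ℂ 2 (volume : Measure ℝ)) ξ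

/-- Membership in the real Sobolev space `H^r(ℝ)`, for `r > 1/2`. All orders used below are larger
than `1/2`, and an element of `H^r(ℝ)` is represented by its unique continuous representative. -/
def MemH (r : ℝ) (f : ℝ → ℝ) : Prop :=
  Continuous f ∧ MemLp (fun x => (f x : ℂ)) 2 volume ∧ MemLp (besselFourier r f) 2 volume

/-- The norm `|f|_{H^r} = |Λ^r f|_{L²}` (computed on the Fourier side, by Plancherel). -/
def normH (r : ℝ) (f : ℝ → ℝ) : ℝ :=
  (eLpNorm (besselFourier r f) 2 volume).toReal

/-- The `ε`-weighted norm of the energy space `X^s`, whose underlying space is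
`H^{s+2}(ℝ) × H^{s+2}(ℝ)`. -/
def normX (ε s : ℝ) (ζ v : ℝ → ℝ) : ℝ :=
  Real.sqrt (normH s ζ ^ 2 + ε ^ 2 * normH s (deriv ζ) ^ 2 + ε ^ 2 * normH s (deriv (deriv ζ)) ^ 2
    + normH s v ^ 2 + ε * normH s (deriv v) ^ 2 + ε ^ 2 * normH s (deriv (deriv v)) ^ 2)

/-- `(ζ, v) ∈ C([0, L]; X^s)`. -/
def ContX (ε s L : ℝ) (ζ v : ℝ → ℝ → ℝ) : Prop :=
  (∀ t ∈ Icc 0 L, MemH (s + 2) (ζ t) ∧ MemH (s + 2) (v t)) ∧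
  ∀ t₀ ∈ Icc 0 L,
    Tendsto (fun t => normX ε s (fun x => ζ t x - ζ t₀ x) (fun x => v t x - v t₀ x))
      (𝓝[Icc 0 L] t₀) (𝓝 0)

/-- `f ∈ L^∞([0, L]; H^r)`, for `r > 1/2`: almost every `f t` lies in `H^r`, the norm is essentially
bounded, and `f` is strongly measurable. (For a function with values in the separable space `H^r`,
strong measurability into `L²` and into `H^r` are the same.) -/
def MemLinfH (r L : ℝ) (f : ℝ → ℝ → ℝ) : Prop :=
  (∀ᵐ t ∂(volume.restrict (Icc 0 L)), MemH r (f t)) ∧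
  AEStronglyMeasurable (fun t => toL2 (f t)) (volume.restrict (Icc 0 L)) ∧
  eLpNorm (fun t => normH r (f t)) ⊤ (volume.restrict (Icc 0 L)) < ⊤

/-- The norm of `(f₁, f₂)` in `L^∞([0, t]; X^s)` (an essential supremum). -/
def normLinfX (ε s t : ℝ) (f₁ f₂ : ℝ → ℝ → ℝ) : ℝ :=
  (eLpNorm (fun τ => normX ε s (f₁ τ) (f₂ τ)) ⊤ (volume.restrict (Icc 0 t))).toReal

/-- `ut` is the (weak) time derivative of `u` on `[0, L]`. -/
def IsTimeDeriv (L : ℝ) (u ut : ℝ → ℝ → ℝ) : Prop :=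
  ∀ t ∈ Icc 0 L, ∀ x, IntervalIntegrable (fun τ => ut τ x) volume 0 t ∧
    u t x = u 0 x + ∫ τ in (0 : ℝ)..t, ut τ x

/-- The water depth `h = 1 + ε ζ`. -/
def depth (ε : ℝ) (ζ : ℝ → ℝ) (x : ℝ) : ℝ := 1 + ε * ζ x

/-- The fourth-order operator `w ↦ h w - (ε/3) ∂ₓ(h³ ∂ₓ w) + (ε²/45) ∂ₓ⁴ w`. It is formally
self-adjoint. -/
def opI (ε : ℝ) (h w : ℝ → ℝ) (x : ℝ) : ℝ :=
  h x * w x - ε / 3 * deriv (fun y => h y ^ 3 * deriv w y) x + ε ^ 2 / 45 * iteratedDeriv 4 w x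

/-- The momentum equation at a fixed time,
`ℑ (vt + ε v vₓ) + h ζₓ - ε² ζₓₓₓ + (2/45) ε² ζₓₓₓₓₓ + ε² ζₓₓₓ + ε² 𝒬[U] vₓ = f₂` with
`ℑ = opI ε h`, `h = 1 + ε ζ` and `𝒬[U] g = (2/3) ∂ₓ(vₓ g)`, in the sense of distributions:
the derivatives in `ℑ` and in `𝒬`, and two of the five in `ζₓₓₓₓₓ`, are moved to the
test function. -/
def Momentum (ε : ℝ) (ζ v vt f₂ : ℝ → ℝ) : Prop :=
  ∀ φ : ℝ → ℝ, ContDiff ℝ ∞ φ → HasCompactSupport φ →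
    (∫ x, (vt x + ε * (v x * deriv v x)) * opI ε (depth ε ζ) φ x)
      + (∫ x, depth ε ζ x * deriv ζ x * φ x)
      - ε ^ 2 * (∫ x, iteratedDeriv 3 ζ x * φ x)
      + 2 / 45 * ε ^ 2 * (∫ x, iteratedDeriv 3 ζ x * iteratedDeriv 2 φ x)
      + ε ^ 2 * (∫ x, iteratedDeriv 3 ζ x * φ x)
      - ε ^ 2 * (∫ x, 2 / 3 * (deriv v x * deriv v x) * deriv φ x)
    = ∫ x, f₂ x * φ x

/-- `(ζ, v)` solves the extended Boussinesq system with right-hand side `(f₁, f₂)` on `[0, L]`: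
the time derivatives exist in `L^∞([0, L]; H²)` and both equations hold for almost every time.
(`H²` is the form domain of the operator `ℑ` in front of the time derivative of `v`.) -/
def IsSolution (ε L : ℝ) (ζ v f₁ f₂ : ℝ → ℝ → ℝ) : Prop :=
  ∃ ζt vt : ℝ → ℝ → ℝ,
    MemLinfH 2 L ζt ∧ MemLinfH 2 L vt ∧ IsTimeDeriv L ζ ζt ∧ IsTimeDeriv L v vt ∧
    ∀ᵐ t ∂(volume.restrict (Icc 0 L)),
      (∀ x, ζt t x + deriv (fun y => depth ε (ζ t) y * v t y) x = f₁ t x) ∧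
      Momentum ε (ζ t) (v t) (vt t) (f₂ t)

end

end Boussinesq

namespace Boussinesq

open MeasureTheory Set Filter Topology FourierTransform
open scoped ENNReal ContDiff

noncomputable section

/-! Put e = √ε, X = 2πξ, η = ζ - ζ', w = v - v'. Uniformly in ε, the norm of X^s is equivalent to
the sum of the L² norms of ⟨X⟩^s (1 + e|X|)² η̂ and ⟨X⟩^s (1 + e|X|)² ŵ (`normX_le`, `Sn_le_normX`).
In the scale `Sb` of these weights products are bounded uniformly in e (`Sb.mul`), and a derivative
uses up one factor 1 + e|X| and costs 1/e (`Sb.deriv`). The nonlinear terms carry a factor e² and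
lose at most one 1/e, apart from a few that are put in divergence form or commuted. This leaves a
growth rate of order e = √ε, hence the time scale T/√ε.

The momentum equation is first rewritten as an identity for almost every frequency
(`momentum_fourier`). It is elliptic for the acceleration a = v_t + e² v v_x. Testing it against the
unknown gives an L² bound, because the depth is bounded below (`elliptic_coercive`). After division
by the symbol 1 + e²X²/3 + e⁴X⁴/45 every term with a variable coefficient gains a derivative
uniformly in e, and a bootstrap reaches order s (`elliptic_regularity`). So a has size O(1/e) and a
- a' has size O((E + eF)/e), where E bounds the difference and F the source.

Write h = 1 + e²ζ for the depth and P for the operator with the above symbol. The energy is |Λ^s η|²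
+ (P Λ^s w, Λ^s w) + (2/45) e⁴ ∫ h⁻¹ |Λ^s η_xx|². The first order terms η_x and w_x cancel in the
first two parts. The fifth order term (2/45) e⁴ η_xxxxx can only be cancelled by the third part.
There the elevation equation contributes h w_x, and the weight 1/h removes the factor h up to a
commutator. Transport terms are treated by a commutator estimate and an integration by parts. The
result is a derivative of the energy bounded by a constant times (eE + F)E
(`Slice.energy_inequality`). Terms in which a derivative falls on the second solution are controlled
by its bound in X^{s+1}.

Since η and w are not regular enough for this computation, Λ^s is replaced by a truncation at height
N. The energy is then a bounded quadratic form on L² along a Lipschitz curve, its derivative is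
estimated at almost every time with constants independent of N, and N tends to infinity by Fatou's
lemma. A Gronwall argument for the square root of the energy gives the exponential bound, linear in
t times the source (`gronwall_sqrt`).

No lower bound is assumed for the depth of the second solution, which the elliptic estimate of a -
a' needs. It holds as long as the difference is small. At the first time at which it might fail, the
bound obtained so far is already bounded below by a constant, and from then on the a priori bounds
of the two solutions suffice (`exists_stable_bound`). -/

/-! ### Fourier inversion on L¹ ∩ L² -/

theorem continuous_fourierInv_of_integrable {F : ℝ → ℂ} (h1 : Integrable F) :
    Continuous (𝓕⁻ F) := by
  rw [Real.fourierInv_eq_fourier_comp_neg]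
  exact VectorFourier.fourierIntegral_continuous Real.continuous_fourierChar
    (by exact continuous_inner) h1.comp_neg

theorem integral_fourierInv_mul_swap {F G : ℝ → ℂ} (hF : Integrable F) (hG : Integrable G) :
    ∫ x, 𝓕⁻ F x * G x = ∫ x, F x * 𝓕⁻ G x := by
  have := VectorFourier.integral_fourierIntegral_smul_eq_flip (μ := volume) (ν := volume)
    (L := innerₗ ℝ) Real.continuous_fourierChar (by exact continuous_inner) hF hG.comp_neg
  simp only [smul_eq_mul] at this
  have hfl : (innerₗ ℝ).flip = innerₗ ℝ := by ext; simp
  rw [hfl] at this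
  rw [Real.fourierInv_eq_fourier_comp_neg G]
  refine Eq.trans ?_ this
  rw [← integral_neg_eq_self]
  refine integral_congr_ae (ae_of_all _ fun x => ?_)
  simp only [Real.fourierInv_eq_fourier_neg, neg_neg]
  rfl

/-- The L² inverse transform is an extension by density, so it is compared with the integral through
tempered distributions: both have the same pairing with every smooth compactly supported function.
-/
theorem fourierInv_toLp_ae {F : ℝ → ℂ} (h1 : Integrable F) (h2 : MemLp F 2) :
    ((𝓕⁻ (h2.toLp F) : Lp ℂ 2 (volume : Measure ℝ)) : ℝ → ℂ) =ᵐ[volume] 𝓕⁻ F := by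
  set G : Lp ℂ 2 (volume : Measure ℝ) := 𝓕⁻ (h2.toLp F) with hG
  refine ae_eq_of_integral_contDiff_smul_eq ((Lp.memLp G).locallyIntegrable (by norm_num))
    (continuous_fourierInv_of_integrable h1).locallyIntegrable ?_
  intro φ hφ hc
  let ψ : SchwartzMap ℝ ℂ := HasCompactSupport.toSchwartzMap (f := fun x => (φ x : ℂ))
    (by exact hc.comp_left (g := fun y : ℝ => (y : ℂ)) (by simp))
    (by exact Complex.ofRealCLM.contDiff.comp hφ)
  have hψ : ∀ x, ψ x = (φ x : ℂ) := fun x => rfl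
  have e1 := Lp.fourierInv_toTemperedDistribution_eq (h2.toLp F)
  have e2 := congrArg (fun T => T ψ) e1
  simp only [TemperedDistribution.fourierInv_apply, Lp.toTemperedDistribution_apply] at e2
  simp only [Complex.real_smul, ← hψ]
  rw [← integral_fourierInv_mul_swap ψ.integrable h1]
  refine Eq.trans ?_ (e2.symm.trans ?_)
  · rfl
  · refine integral_congr_ae ?_
    filter_upwards [h2.coeFn_toLp] with x hx
    rw [hx, smul_eq_mul, SchwartzMap.fourierInv_coe]

/-- `f` is the inverse Fourier transform of `F ∈ L¹ ∩ L²`. -/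
def Rep (f F : ℝ → ℂ) : Prop := Integrable F ∧ MemLp F 2 ∧ f = 𝓕⁻ F

/-- The Fourier transform of a real square-integrable function, as a function. -/
def hat (f : ℝ → ℝ) : ℝ → ℂ := (𝓕 (toL2 f) : Lp ℂ 2 (volume : Measure ℝ))

theorem memLp_hat (f : ℝ → ℝ) : MemLp (hat f) 2 := Lp.memLp _

theorem Rep.continuous {f F : ℝ → ℂ} (h : Rep f F) : Continuous f := by
  rw [h.2.2]; exact continuous_fourierInv_of_integrable h.1

theorem Rep.ae_eq {f F : ℝ → ℂ} (h : Rep f F) :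
    ((𝓕⁻ (h.2.1.toLp F) : Lp ℂ 2 (volume : Measure ℝ)) : ℝ → ℂ) =ᵐ[volume] f := by
  exact (fourierInv_toLp_ae h.1 h.2.1).trans (by rw [← h.2.2])

theorem Rep.memLp {f F : ℝ → ℂ} (h : Rep f F) : MemLp f 2 :=
  (memLp_congr_ae h.ae_eq).1 (Lp.memLp _)

theorem Rep.toLp_eq {f F : ℝ → ℂ} (h : Rep f F) :
    𝓕 (h.memLp.toLp f) = h.2.1.toLp F := by
  have : h.memLp.toLp f = 𝓕⁻ (h.2.1.toLp F) := by
    refine Lp.ext (h.memLp.coeFn_toLp.trans h.ae_eq.symm)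
  rw [this, FourierInvPair.fourier_fourierInv_eq]

theorem Rep.congr {f F G : ℝ → ℂ} (h : Rep f F) (hFG : F =ᵐ[volume] G) : Rep f G := by
  refine ⟨h.1.congr hFG, (memLp_congr_ae hFG).1 h.2.1, ?_⟩
  rw [h.2.2]
  ext x
  rw [Real.fourierInv_eq, Real.fourierInv_eq]
  refine integral_congr_ae ?_
  filter_upwards [hFG] with y hy
  rw [hy]

/-- Real functions with integrable Fourier transform. -/
def Nice (f : ℝ → ℝ) : Prop := Rep (fun x => (f x : ℂ)) (hat f)

/-- Every computation rule for `hat` comes from this uniqueness: exhibiting f as the inverse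
transform of some F identifies its L² transform almost everywhere. -/
theorem hat_ae_eq {f : ℝ → ℝ} {F : ℝ → ℂ} (h : Rep (fun x => (f x : ℂ)) F) :
    hat f =ᵐ[volume] F := by
  have : toL2 f = h.memLp.toLp _ := by
    rw [toL2, dif_pos h.memLp]
  rw [hat, this, h.toLp_eq]
  exact h.2.1.coeFn_toLp

theorem nice_of_rep {f : ℝ → ℝ} {F : ℝ → ℂ} (h : Rep (fun x => (f x : ℂ)) F) : Nice f :=
  h.congr (hat_ae_eq h).symm

theorem fourierInv_add_of_integrable {F G : ℝ → ℂ} (hF : Integrable F) (hG : Integrable G) :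
    𝓕⁻ (F + G) = 𝓕⁻ F + 𝓕⁻ G := by
  rw [Real.fourierInv_eq_fourier_comp_neg, Real.fourierInv_eq_fourier_comp_neg,
    Real.fourierInv_eq_fourier_comp_neg]
  exact (VectorFourier.fourierIntegral_add Real.continuous_fourierChar
    (by exact continuous_inner) hF.comp_neg hG.comp_neg)

theorem Rep.add {f g F G : ℝ → ℂ} (hf : Rep f F) (hg : Rep g G) : Rep (f + g) (F + G) :=
  ⟨hf.1.add hg.1, hf.2.1.add hg.2.1, by
    rw [fourierInv_add_of_integrable hf.1 hg.1, hf.2.2, hg.2.2]⟩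

theorem Rep.smul {f F : ℝ → ℂ} (c : ℂ) (hf : Rep f F) : Rep (c • f) (c • F) :=
  ⟨hf.1.smul c, hf.2.1.const_smul c, by
    rw [hf.2.2, Real.fourierInv_eq_fourier_comp_neg, Real.fourierInv_eq_fourier_comp_neg]
    exact (VectorFourier.fourierIntegral_const_smul _ _ _ _ _).symm⟩

theorem Rep.hasDerivAt {f F : ℝ → ℂ} (hf : Rep f F)
    (h1 : Integrable fun ξ : ℝ => ((2 * Real.pi * ξ : ℝ) * Complex.I) * F ξ) (x : ℝ) :
    HasDerivAt f (𝓕⁻ (fun ξ : ℝ => ((2 * Real.pi * ξ : ℝ) * Complex.I) * F ξ) x) x := by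
  have h3 : Integrable (fun ξ : ℝ => ξ • F ξ) := by
    have := h1.const_mul (2 * Real.pi * Complex.I)⁻¹
    refine this.congr (ae_of_all _ fun ξ => ?_)
    simp only [Complex.real_smul]
    push_cast
    have : (2 * Real.pi * Complex.I : ℂ) ≠ 0 := by
      simp [Real.pi_ne_zero]
    field_simp
  have h4 : Integrable (fun ξ : ℝ => ξ • F (-ξ)) := by
    have := h3.comp_neg.neg
    refine this.congr (ae_of_all _ fun ξ => ?_)
    simp
  have := Real.hasDerivAt_fourier hf.1.comp_neg h4 x
  rw [hf.2.2, Real.fourierInv_eq_fourier_comp_neg, Real.fourierInv_eq_fourier_comp_neg]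
  convert this using 2
  congr 1
  funext ξ
  simp only [smul_eq_mul]
  push_cast
  ring

theorem Rep.norm_le {f F : ℝ → ℂ} (hf : Rep f F) (x : ℝ) : ‖f x‖ ≤ ∫ ξ, ‖F ξ‖ := by
  rw [hf.2.2, Real.fourierInv_eq]
  refine (norm_integral_le_integral_norm _).trans (le_of_eq ?_)
  simp

theorem Rep.integral_mul_conj {f g F G : ℝ → ℂ} (hf : Rep f F) (hg : Rep g G) :
    ∫ x, f x * (starRingEnd ℂ) (g x) = ∫ ξ, F ξ * (starRingEnd ℂ) (G ξ) := by
  have h := Lp.inner_fourier_eq (hg.memLp.toLp g) (hf.memLp.toLp f)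
  rw [hf.toLp_eq, hg.toLp_eq, L2.inner_def, L2.inner_def] at h
  have e1 : ∫ x, f x * (starRingEnd ℂ) (g x) =
      ∫ x, inner ℂ ((hg.memLp.toLp g) x) ((hf.memLp.toLp f) x) := by
    refine integral_congr_ae ?_
    filter_upwards [hf.memLp.coeFn_toLp, hg.memLp.coeFn_toLp] with x h1 h2
    rw [h1, h2]; simp
  have e2 : ∫ x, F x * (starRingEnd ℂ) (G x) =
      ∫ x, inner ℂ ((hg.2.1.toLp G) x) ((hf.2.1.toLp F) x) := by
    refine integral_congr_ae ?_
    filter_upwards [hf.2.1.coeFn_toLp, hg.2.1.coeFn_toLp] with x h1 h2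
    rw [h1, h2]; simp
  rw [e1, e2, h]

theorem Rep.eLpNorm_eq {f F : ℝ → ℂ} (hf : Rep f F) : eLpNorm f 2 volume = eLpNorm F 2 volume := by
  have h := Lp.norm_fourier_eq (hf.memLp.toLp f)
  rw [hf.toLp_eq, Lp.norm_toLp, Lp.norm_toLp] at h
  exact ((ENNReal.toReal_eq_toReal_iff' hf.2.1.2.ne hf.memLp.2.ne).1 h).symm

/-! ### Convolution estimates with weights -/

/-- Young's inequality L¹ * L² ⊆ L²: Cauchy–Schwarz with respect to p dt, after splitting p =
p^(1/2) p^(1/2), then Tonelli and translation invariance. -/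
theorem lintegral_sq_convolution_le {p q : ℝ → ℝ≥0∞} (hp : AEMeasurable p) (hq : AEMeasurable q) :
    ∫⁻ ξ, (∫⁻ t, p t * q (ξ - t)) ^ 2 ≤ (∫⁻ t, p t) ^ 2 * ∫⁻ t, q t ^ 2 := by
  have hqs : ∀ ξ, AEMeasurable fun t => q (ξ - t) := fun ξ =>
    hq.comp_quasiMeasurePreserving (quasiMeasurePreserving_sub_left volume ξ)
  have h1 : ∀ ξ, (∫⁻ t, p t * q (ξ - t)) ^ 2 ≤ (∫⁻ t, p t) * ∫⁻ t, p t * q (ξ - t) ^ 2 := by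
    intro ξ
    have h := ENNReal.lintegral_mul_le_Lp_mul_Lq volume (Real.HolderConjugate.two_two)
      (f := fun t => p t ^ (1 / 2 : ℝ)) (g := fun t => p t ^ (1 / 2 : ℝ) * q (ξ - t))
      (hp.pow_const _) ((hp.pow_const _).mul (hqs ξ))
    have e1 : ∀ a : ℝ≥0∞, a ^ (1 / 2 : ℝ) * a ^ (1 / 2 : ℝ) = a := by
      intro a
      rw [← ENNReal.rpow_add_of_nonneg _ _ (by norm_num) (by norm_num)]
      norm_num
    have e2 : ∀ a : ℝ≥0∞, (a ^ (1 / 2 : ℝ)) ^ 2 = a := by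
      intro a
      rw [sq, e1]
    simp only [Pi.mul_apply, ← mul_assoc, e1, ENNReal.rpow_two, mul_pow, e2] at h
    calc (∫⁻ t, p t * q (ξ - t)) ^ 2
        ≤ ((∫⁻ t, p t) ^ (1 / 2 : ℝ) * (∫⁻ t, p t * q (ξ - t) ^ 2) ^ (1 / 2 : ℝ)) ^ 2 := by gcongr
      _ = _ := by rw [mul_pow, e2, e2]
  calc ∫⁻ ξ, (∫⁻ t, p t * q (ξ - t)) ^ 2
      ≤ ∫⁻ ξ, (∫⁻ t, p t) * ∫⁻ t, p t * q (ξ - t) ^ 2 := lintegral_mono h1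
    _ = (∫⁻ t, p t) * ∫⁻ ξ, ∫⁻ t, p t * q (ξ - t) ^ 2 := by
      rw [lintegral_const_mul'']
      exact AEMeasurable.lintegral_prod_right'
        ((hp.comp_snd).mul ((hq.comp_quasiMeasurePreserving
          (quasiMeasurePreserving_sub_of_right_invariant volume volume)).pow_const 2))
    _ = (∫⁻ t, p t) * ∫⁻ t, ∫⁻ ξ, p t * q (ξ - t) ^ 2 := by
      rw [lintegral_lintegral_swap]
      exact ((hp.comp_snd).mul ((hq.comp_quasiMeasurePreserving
          (quasiMeasurePreserving_sub_of_right_invariant volume volume)).pow_const 2))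
    _ = (∫⁻ t, p t) * ∫⁻ t, p t * ∫⁻ ξ, q ξ ^ 2 := by
      congr 1
      refine lintegral_congr fun t => ?_
      rw [lintegral_const_mul'', lintegral_sub_right_eq_self (fun ξ => q ξ ^ 2) t]
      exact (hq.comp_quasiMeasurePreserving
        (measurePreserving_sub_right volume t).quasiMeasurePreserving).pow_const 2
    _ = _ := by
      rw [lintegral_mul_const'' _ hp, sq, mul_assoc]

theorem eLpNorm_convolution_le {p q : ℝ → ℝ≥0∞} (hp : AEMeasurable p) (hq : AEMeasurable q) :
    eLpNorm (fun ξ => ∫⁻ t, p t * q (ξ - t)) 2 volume ≤ (∫⁻ t, p t) * eLpNorm q 2 volume := by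
  have key : ∀ f : ℝ → ℝ≥0∞, eLpNorm f 2 volume = (∫⁻ x, f x ^ 2) ^ (1 / 2 : ℝ) := by
    intro f
    rw [eLpNorm_eq_lintegral_rpow_enorm_toReal (by norm_num) (by norm_num)]
    simp
  rw [key, key]
  calc _ ≤ ((∫⁻ t, p t) ^ 2 * ∫⁻ t, q t ^ 2) ^ (1 / 2 : ℝ) :=
        ENNReal.rpow_le_rpow (lintegral_sq_convolution_le hp hq) (by norm_num)
    _ = _ := by
      rw [ENNReal.mul_rpow_of_nonneg _ _ (by norm_num), ← ENNReal.rpow_natCast, ← ENNReal.rpow_mul]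
      norm_num

theorem eLpNorm_convolution_le' {p q : ℝ → ℝ≥0∞} (hp : AEMeasurable p) (hq : AEMeasurable q) :
    eLpNorm (fun ξ => ∫⁻ t, p t * q (ξ - t)) 2 volume ≤ eLpNorm p 2 volume * ∫⁻ t, q t := by
  have : (fun ξ => ∫⁻ t, p t * q (ξ - t)) = fun ξ => ∫⁻ t, q t * p (ξ - t) := by
    funext ξ
    rw [← lintegral_sub_left_eq_self _ ξ]
    refine lintegral_congr fun t => ?_
    simp [mul_comm]
  rw [this, mul_comm]
  exact eLpNorm_convolution_le hq hp

/-- The weighted norm `‖w F‖_{L²}`. -/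
def nW (w : ℝ → ℝ) (F : ℝ → ℂ) : ℝ≥0∞ := eLpNorm (fun ξ => (w ξ : ℂ) * F ξ) 2 volume

/-- The weighted norm `‖w F‖_{L¹}`. -/
def nW1 (w : ℝ → ℝ) (F : ℝ → ℂ) : ℝ≥0∞ := ∫⁻ ξ, ‖(w ξ : ℂ) * F ξ‖ₑ

theorem enorm_ofReal_mul {w : ℝ} (hw : 0 ≤ w) (z : ℂ) :
    ‖(w : ℂ) * z‖ₑ = ENNReal.ofReal w * ‖z‖ₑ := by
  rw [enorm_mul, ← ofReal_norm (w : ℂ), Complex.norm_real, Real.norm_of_nonneg hw]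

theorem nW_eq_enorm (w : ℝ → ℝ) (F : ℝ → ℂ) :
    nW w F = eLpNorm (fun ξ => ‖(w ξ : ℂ) * F ξ‖ₑ) 2 volume := (eLpNorm_enorm _).symm

theorem nW_congr {w : ℝ → ℝ} {F G : ℝ → ℂ} (h : F =ᵐ[volume] G) : nW w F = nW w G := by
  refine eLpNorm_congr_ae ?_
  filter_upwards [h] with ξ hξ
  rw [hξ]

theorem aemeasurable_comp_sub {r : ℝ → ℝ≥0∞} (h : AEMeasurable r) (ξ : ℝ) :
    AEMeasurable fun t => r (ξ - t) :=
  h.comp_quasiMeasurePreserving (quasiMeasurePreserving_sub_left volume ξ)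

theorem aemeasurable_convolution {r q : ℝ → ℝ≥0∞} (hr : AEMeasurable r) (hq : AEMeasurable q) :
    AEMeasurable fun ξ => ∫⁻ t, r t * q (ξ - t) :=
  AEMeasurable.lintegral_prod_right'
    ((hr.comp_snd).mul ((hq.comp_quasiMeasurePreserving
      (quasiMeasurePreserving_sub_of_right_invariant volume volume))))

theorem eLpNorm_le_of_enorm_le_convolution {H : ℝ → ℂ} {a b c d : ℝ → ℝ≥0∞} (ha : AEMeasurable a)
    (hb : AEMeasurable b) (hc : AEMeasurable c) (hd : AEMeasurable d) {C : ℝ≥0∞}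
    (hH : ∀ ξ, ‖H ξ‖ₑ ≤ C * ∫⁻ t, (a t * b (ξ - t) + c t * d (ξ - t))) :
    eLpNorm H 2 volume ≤
      C * (eLpNorm a 2 volume * (∫⁻ t, b t) + (∫⁻ t, c t) * eLpNorm d 2 volume) := by
  have h1 : eLpNorm H 2 volume ≤ C * eLpNorm ((fun ξ => ∫⁻ t, a t * b (ξ - t)) +
      fun ξ => ∫⁻ t, c t * d (ξ - t)) 2 volume := by
    refine eLpNorm_le_mul_eLpNorm_of_ae_le_mul'' 2 ((aemeasurable_convolution ha hb).add
      (aemeasurable_convolution hc hd)).aestronglyMeasurable (ae_of_all _ fun ξ => (hH ξ).trans ?_)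
    rw [lintegral_add_left' (f := fun t => a t * b (ξ - t))
      (ha.mul (aemeasurable_comp_sub hb ξ))]
    exact le_rfl
  refine h1.trans ?_
  refine mul_le_mul_right ?_ C
  refine (eLpNorm_add_le (aemeasurable_convolution ha hb).aestronglyMeasurable
    (aemeasurable_convolution hc hd).aestronglyMeasurable (by norm_num)).trans ?_
  exact add_le_add (eLpNorm_convolution_le' ha hb) (eLpNorm_convolution_le hc hd)

theorem aemeasurable_weighted {w : ℝ → ℝ} {F : ℝ → ℂ} (hw : Measurable w)
    (hF : AEStronglyMeasurable F) : AEMeasurable fun ξ => ‖(w ξ : ℂ) * F ξ‖ₑ :=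
  ((Complex.measurable_ofReal.comp hw).aestronglyMeasurable.mul hF).enorm

/-- The common form of the product and commutator estimates: once the kernel is dominated by a sum
of two products of weights, each summand is a convolution in which one factor is measured in L² and
the other in L¹. -/
theorem bilinear_bound {F G : ℝ → ℂ} (hF : AEStronglyMeasurable F) (hG : AEStronglyMeasurable G)
    (K : ℝ → ℝ → ℂ) {w₁ w₂ w₃ w₄ : ℝ → ℝ} (h₁ : Measurable w₁) (h₂ : Measurable w₂)
    (h₃ : Measurable w₃) (h₄ : Measurable w₄) (p₁ : ∀ x, 0 ≤ w₁ x) (p₂ : ∀ x, 0 ≤ w₂ x)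
    (p₃ : ∀ x, 0 ≤ w₃ x) (p₄ : ∀ x, 0 ≤ w₄ x) {C : ℝ} (hC : 0 ≤ C)
    (hK : ∀ ξ t, ‖K ξ t‖ ≤ C * (w₁ t * w₂ (ξ - t) + w₃ t * w₄ (ξ - t))) :
    eLpNorm (fun ξ => ∫ t, K ξ t * (F t * G (ξ - t))) 2 volume ≤
      ENNReal.ofReal C * (nW w₁ F * nW1 w₂ G + nW1 w₃ F * nW w₄ G) := by
  rw [nW_eq_enorm, nW_eq_enorm]
  refine eLpNorm_le_of_enorm_le_convolution (aemeasurable_weighted h₁ hF)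
    (aemeasurable_weighted h₂ hG) (aemeasurable_weighted h₃ hF) (aemeasurable_weighted h₄ hG)
    fun ξ => ?_
  refine (enorm_integral_le_lintegral_enorm _).trans ?_
  rw [← lintegral_const_mul' _ _ ENNReal.ofReal_ne_top]
  refine lintegral_mono fun t => ?_
  simp only [enorm_ofReal_mul (p₁ _), enorm_ofReal_mul (p₂ _), enorm_ofReal_mul (p₃ _),
    enorm_ofReal_mul (p₄ _)]
  rw [enorm_mul, enorm_mul]
  have hk : ‖K ξ t‖ₑ ≤ ENNReal.ofReal C * (ENNReal.ofReal (w₁ t) * ENNReal.ofReal (w₂ (ξ - t)) +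
      ENNReal.ofReal (w₃ t) * ENNReal.ofReal (w₄ (ξ - t))) := by
    rw [← ENNReal.ofReal_mul (p₁ _), ← ENNReal.ofReal_mul (p₃ _),
      ← ENNReal.ofReal_add (mul_nonneg (p₁ _) (p₂ _)) (mul_nonneg (p₃ _) (p₄ _)),
      ← ENNReal.ofReal_mul hC, ← ofReal_norm]
    exact ENNReal.ofReal_le_ofReal (hK ξ t)
  refine (mul_le_mul_left hk _).trans (le_of_eq ?_)
  ring

/-- Convolution of complex functions on the line. -/
def cv (F G : ℝ → ℂ) (ξ : ℝ) : ℂ := ∫ t, F t * G (ξ - t)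

open scoped Convolution in
theorem cv_eq (F G : ℝ → ℂ) : cv F G = F ⋆[ContinuousLinearMap.mul ℂ ℂ, volume] G := rfl

open scoped Convolution in
theorem integrable_cv {F G : ℝ → ℂ} (hF : Integrable F) (hG : Integrable G) :
    Integrable (cv F G) := by
  rw [cv_eq]
  exact hF.integrable_convolution _ hG

theorem nW_one (F : ℝ → ℂ) : nW (fun _ => 1) F = eLpNorm F 2 volume := by
  simp [nW]

theorem nW1_one (F : ℝ → ℂ) : nW1 (fun _ => 1) F = ∫⁻ ξ, ‖F ξ‖ₑ := by
  simp [nW1]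

theorem memLp_cv {F G : ℝ → ℂ} (hF : Integrable F) (hG : Integrable G) (hG2 : MemLp G 2) :
    MemLp (cv F G) 2 := by
  refine ⟨(integrable_cv hF hG).1, ?_⟩
  have := eLpNorm_le_of_enorm_le_convolution (H := cv F G) (a := 0) (b := 0) (C := 1)
    aemeasurable_const aemeasurable_const hF.1.enorm hG.1.enorm (fun ξ => by
      refine (enorm_integral_le_lintegral_enorm _).trans ?_
      simp [enorm_mul])
  refine this.trans_lt ?_
  simp only [one_mul, Pi.zero_apply, lintegral_zero, mul_zero, zero_add]
  exact ENNReal.mul_lt_top hF.2 (by rw [eLpNorm_enorm]; exact hG2.2)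

theorem Rep.mul {f g F G : ℝ → ℂ} (hf : Rep f F) (hg : Rep g G) : Rep (f * g) (cv F G) := by
  refine ⟨integrable_cv hf.1 hg.1, memLp_cv hf.1 hg.1 hg.2.1, ?_⟩
  funext x
  rw [Real.fourierInv_eq_fourier_neg, cv_eq, Real.fourier_mul_convolution_eq hf.1 hg.1,
    ← Real.fourierInv_eq_fourier_neg, ← Real.fourierInv_eq_fourier_neg, ← hf.2.2, ← hg.2.2]
  rfl

/-! ### The Japanese bracket and its truncation -/

/-- The Japanese bracket `(1 + x²)^(r/2)`. -/
def jap (r x : ℝ) : ℝ := (1 + x ^ 2) ^ (r / 2)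

theorem one_le_one_add_sq (x : ℝ) : 1 ≤ 1 + x ^ 2 := by nlinarith [sq_nonneg x]

theorem one_add_sq_pos (x : ℝ) : 0 < 1 + x ^ 2 := by positivity

theorem jap_pos (r x : ℝ) : 0 < jap r x := Real.rpow_pos_of_pos (one_add_sq_pos x) _

theorem one_le_jap {r : ℝ} (hr : 0 ≤ r) (x : ℝ) : 1 ≤ jap r x :=
  Real.one_le_rpow (one_le_one_add_sq x) (by positivity)

theorem jap_mono {r q : ℝ} (h : r ≤ q) (x : ℝ) : jap r x ≤ jap q x :=
  Real.rpow_le_rpow_of_exponent_le (one_le_one_add_sq x) (by linarith)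

theorem jap_add (r q x : ℝ) : jap (r + q) x = jap r x * jap q x := by
  rw [jap, jap, jap, ← Real.rpow_add (one_add_sq_pos x), add_div]

theorem jap_zero (x : ℝ) : jap 0 x = 1 := by simp [jap]

theorem jap_two (x : ℝ) : jap 2 x = 1 + x ^ 2 := by simp [jap]

theorem continuous_jap (r : ℝ) : Continuous (jap r) := by
  unfold jap
  exact Continuous.rpow_const (by fun_prop) fun x => Or.inl (one_add_sq_pos x).ne'

theorem abs_le_jap_one (x : ℝ) : |x| ≤ jap 1 x := by
  rw [jap, ← Real.sqrt_eq_rpow]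
  exact Real.abs_le_sqrt (by linarith)

theorem jap_one_le (x : ℝ) : jap 1 x ≤ 1 + |x| := by
  rw [jap, ← Real.sqrt_eq_rpow]
  refine Real.sqrt_le_iff.2 ⟨by positivity, ?_⟩
  nlinarith [abs_nonneg x, sq_abs x]

theorem jap_le_jap {r : ℝ} (hr : 0 ≤ r) {x y : ℝ} (h : |x| ≤ |y|) : jap r x ≤ jap r y :=
  Real.rpow_le_rpow (by positivity) (by have := sq_le_sq.2 h; linarith) (by positivity)

/-- Sub-additivity of the bracket up to a constant. -/
theorem jap_add_le {r : ℝ} (hr : 0 ≤ r) (x y : ℝ) :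
    jap r (x + y) ≤ 2 ^ r * (jap r x + jap r y) := by
  have key : ∀ a b : ℝ, |a| ≤ |b| → jap r (a + b) ≤ 2 ^ r * jap r b := by
    intro a b hab
    have h4 : (4 : ℝ) ^ (r / 2) = 2 ^ r := by
      rw [show (4 : ℝ) = 2 ^ (2 : ℝ) by norm_num, ← Real.rpow_mul (by norm_num)]
      congr 1; ring
    rw [jap, jap, ← h4, ← Real.mul_rpow (by norm_num) (by positivity)]
    refine Real.rpow_le_rpow (by positivity) ?_ (by positivity)
    have := sq_le_sq.2 hab
    nlinarith [sq_nonneg (a - b)]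
  rcases le_total |x| |y| with h | h
  · refine (key x y h).trans ?_
    have := (jap_pos r x).le
    gcongr; linarith
  · rw [add_comm]
    refine (key y x h).trans ?_
    have := (jap_pos r y).le
    gcongr; linarith

theorem jap_add_le_mul {r : ℝ} (hr : 0 ≤ r) (x y : ℝ) :
    jap r (x + y) ≤ 2 ^ r * (jap r x * jap r y) := by
  have h4 : (4 : ℝ) ^ (r / 2) = 2 ^ r := by
    rw [show (4 : ℝ) = 2 ^ (2 : ℝ) by norm_num, ← Real.rpow_mul (by norm_num)]
    congr 1; ring
  rw [jap, jap, jap, ← h4, ← Real.mul_rpow (by positivity) (by positivity),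
    ← Real.mul_rpow (by norm_num) (by positivity)]
  refine Real.rpow_le_rpow (by positivity) ?_ (by positivity)
  nlinarith [sq_nonneg (x - y), sq_nonneg (x * y)]

/-- A `1`-Lipschitz truncation of the identity on `[0, ∞)`, equal to the identity on `[0, N]`. -/
def tent (N u : ℝ) : ℝ := max 0 (min u (2 * N - u))

theorem tent_nonneg (N u : ℝ) : 0 ≤ tent N u := le_max_left _ _

theorem tent_le {N u : ℝ} (hu : 0 ≤ u) : tent N u ≤ u := max_le hu (min_le_left _ _)

theorem tent_eq {N u : ℝ} (hu : 0 ≤ u) (h : u ≤ N) : tent N u = u := by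
  rw [tent, min_eq_left (by linarith), max_eq_right hu]

theorem tent_eq_zero {N u : ℝ} (h : 2 * N ≤ u) : tent N u = 0 :=
  max_eq_left ((min_le_right _ _).trans (by linarith))

theorem continuous_tent (N : ℝ) : Continuous (tent N) := by
  unfold tent; fun_prop

/-- The Lipschitz constant does not depend on N, which makes the commutator estimates uniform in the
truncation. -/
theorem abs_tent_sub_le (N u v : ℝ) : |tent N u - tent N v| ≤ |u - v| := by
  unfold tent
  have h1 := le_abs_self (u - v)
  have h2 := neg_abs_le (u - v)
  rw [abs_le]
  constructor <;> simp only [max_def, min_def] <;> split_ifs <;> linarith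

/-- Mean value theorem: the derivative s z ⟨z⟩^(s-2) is at most s ⟨z⟩^(s-1) in modulus, and since s
≥ 1 the latter is controlled on the segment by its values at the endpoints. -/
theorem abs_jap_sub_le {s : ℝ} (hs : 1 ≤ s) (x y : ℝ) :
    |jap s x - jap s y| ≤ s * |x - y| * (jap (s - 1) x + jap (s - 1) y) := by
  have hd : ∀ z, HasDerivAt (jap s) (s * z * jap (s - 2) z) z := by
    intro z
    have h1 : HasDerivAt (fun z : ℝ => 1 + z ^ 2) (2 * z) z := by
      simpa using ((hasDerivAt_pow 2 z).const_add 1)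
    have h2 := h1.rpow_const (p := s / 2) (Or.inl (one_add_sq_pos z).ne')
    refine h2.congr_deriv ?_
    rw [jap, show s / 2 - 1 = (s - 2) / 2 by ring]
    ring
  have hb : ∀ z ∈ uIcc y x, ‖s * z * jap (s - 2) z‖ ≤ s * (jap (s - 1) x + jap (s - 1) y) := by
    intro z hz
    have h1 : |z| * jap (s - 2) z ≤ jap (s - 1) z := by
      rw [show s - 1 = 1 + (s - 2) by ring, jap_add]
      exact mul_le_mul_of_nonneg_right (abs_le_jap_one z) (jap_pos _ _).le
    have h2 : jap (s - 1) z ≤ jap (s - 1) x + jap (s - 1) y := by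
      have hx := (jap_pos (s - 1) x).le
      have hy := (jap_pos (s - 1) y).le
      have : |z| ≤ max |y| |x| := by
        rcases mem_uIcc.1 hz with h | h
        · exact abs_le_max_abs_abs h.1 h.2
        · rw [max_comm]; exact abs_le_max_abs_abs h.1 h.2
      rcases le_max_iff.1 this with h | h
      · have := jap_le_jap (r := s - 1) (by linarith) h; linarith
      · have := jap_le_jap (r := s - 1) (by linarith) h; linarith
    rw [Real.norm_eq_abs, abs_mul, abs_mul, abs_of_pos (jap_pos _ _), abs_of_nonneg (by linarith),
      mul_assoc]
    exact mul_le_mul_of_nonneg_left (h1.trans h2) (by linarith)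
  have := (convex_uIcc y x).norm_image_sub_le_of_norm_hasDerivWithin_le
    (fun z hz => (hd z).hasDerivWithinAt) hb left_mem_uIcc right_mem_uIcc
  rw [Real.norm_eq_abs, Real.norm_eq_abs] at this
  linarith

/-- The symbol x² times the truncated ⟨x⟩^s has order s + 2, so its increments cost |x - y| times
order s + 1. The factor a² is kept on the smaller of the two points, where it is at most ⟨b⟩². -/
theorem abs_sq_mul_tent_sub_le {s : ℝ} (hs : 1 ≤ s) (N x y : ℝ) :
    |x ^ 2 * tent N (jap s x) - y ^ 2 * tent N (jap s y)| ≤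
      (2 + 4 * s) * |x - y| * (jap (s + 1) x + jap (s + 1) y) := by
  have key : ∀ a b : ℝ, |a| ≤ |b| →
      |a ^ 2 * tent N (jap s a) - b ^ 2 * tent N (jap s b)| ≤
      (2 + 4 * s) * |a - b| * jap (s + 1) b := by
    intro a b hab
    have e : a ^ 2 * tent N (jap s a) - b ^ 2 * tent N (jap s b) =
        (a - b) * ((a + b) * tent N (jap s b)) + a ^ 2 * (tent N (jap s a) - tent N (jap s b)) := by
      ring
    have h1 : |(a + b) * tent N (jap s b)| ≤ 2 * jap (s + 1) b := by
      rw [abs_mul, abs_of_nonneg (tent_nonneg _ _)]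
      have h2 : |a + b| ≤ 2 * jap 1 b := by
        have := abs_add_le a b
        have := abs_le_jap_one b
        linarith
      calc |a + b| * tent N (jap s b) ≤ (2 * jap 1 b) * jap s b :=
            mul_le_mul h2 (tent_le (jap_pos _ _).le) (tent_nonneg _ _)
              (by have := jap_pos 1 b; positivity)
        _ = _ := by rw [jap_add]; ring
    have h3 : a ^ 2 * |tent N (jap s a) - tent N (jap s b)| ≤
        2 * s * |a - b| * jap (s + 1) b := by
      have h4 := (abs_tent_sub_le N (jap s a) (jap s b)).trans (abs_jap_sub_le hs a b)
      have h5 := jap_le_jap (r := s - 1) (by linarith) hab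
      have h6 : a ^ 2 ≤ jap 2 b := by
        rw [jap_two]; have := sq_le_sq.2 hab; linarith
      calc a ^ 2 * |tent N (jap s a) - tent N (jap s b)|
          ≤ jap 2 b * (s * |a - b| * (2 * jap (s - 1) b)) := by
            refine mul_le_mul h6 (h4.trans ?_) (abs_nonneg _) (jap_pos _ _).le
            have : 0 ≤ s * |a - b| := by positivity
            exact mul_le_mul_of_nonneg_left (by linarith) this
        _ = 2 * s * |a - b| * (jap 2 b * jap (s - 1) b) := by ring
        _ = _ := by rw [← jap_add]; congr 2; ring
    rw [e]
    refine (abs_add_le _ _).trans ?_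
    rw [abs_mul, abs_mul (a ^ 2), abs_of_nonneg (sq_nonneg a)]
    have h7 := mul_le_mul_of_nonneg_left h1 (abs_nonneg (a - b))
    have h8 : 0 ≤ s * (|a - b| * jap (s + 1) b) :=
      mul_nonneg (by linarith) (mul_nonneg (abs_nonneg _) (jap_pos _ _).le)
    linarith
  have hx := (jap_pos (s + 1) x).le
  have hy := (jap_pos (s + 1) y).le
  have hc : 0 ≤ (2 + 4 * s) * |x - y| := by positivity
  rcases le_total |x| |y| with h | h
  · exact (key x y h).trans (mul_le_mul_of_nonneg_left (by linarith) hc)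
  · rw [abs_sub_comm, abs_sub_comm x y] at *
    exact (key y x h).trans (mul_le_mul_of_nonneg_left (by linarith) hc)

/-! ### The weighted Sobolev calculus: embedding, products, derivatives -/

/-- The weight `⟨X⟩^s (1 + e|X|)^k`, `X = 2πξ`. -/
def sw (s e : ℝ) (k : ℕ) (ξ : ℝ) : ℝ :=
  jap s (2 * Real.pi * ξ) * (1 + e * |2 * Real.pi * ξ|) ^ k

/-- The weight `(1 + |X|) (1 + e|X|)^k`. -/
def lw (e : ℝ) (k : ℕ) (ξ : ℝ) : ℝ :=
  (1 + |2 * Real.pi * ξ|) * (1 + e * |2 * Real.pi * ξ|) ^ k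

theorem continuous_sw (s e : ℝ) (k : ℕ) : Continuous (sw s e k) := by
  unfold sw
  exact ((continuous_jap s).comp (by fun_prop)).mul (by fun_prop)

theorem continuous_lw (e : ℝ) (k : ℕ) : Continuous (lw e k) := by
  unfold lw; fun_prop

theorem sw_nonneg {e : ℝ} (he : 0 ≤ e) (s : ℝ) (k : ℕ) (ξ : ℝ) : 0 ≤ sw s e k ξ :=
  mul_nonneg (jap_pos _ _).le (by positivity)

theorem lw_nonneg {e : ℝ} (he : 0 ≤ e) (k : ℕ) (ξ : ℝ) : 0 ≤ lw e k ξ := by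
  unfold lw; positivity

theorem memLp_jap_neg {r : ℝ} (hr : r < -(1 / 2)) :
    MemLp (fun ξ : ℝ => jap r (2 * Real.pi * ξ)) 2 volume := by
  have h0 : Continuous fun ξ : ℝ => jap r (2 * Real.pi * ξ) :=
    (continuous_jap r).comp (by fun_prop)
  rw [memLp_two_iff_integrable_sq h0.aestronglyMeasurable]
  have h := (integrable_rpow_neg_one_add_norm_sq (E := ℝ) (μ := volume) (r := -(2 * r))
    (by simp; linarith)).comp_mul_left' (R := 2 * Real.pi) (by positivity)
  refine h.congr (ae_of_all _ fun ξ => ?_)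
  simp only [jap]
  rw [← Real.rpow_mul_natCast (one_add_sq_pos _).le, Real.norm_eq_abs, sq_abs]
  congr 1
  push_cast; ring

/-- The embedding constant of `H^s` into functions with `(1 + |X|) f̂ ∈ L¹`. -/
def embC (s : ℝ) : ℝ :=
  2 * (eLpNorm (fun ξ : ℝ => jap (1 - s) (2 * Real.pi * ξ)) 2 volume).toReal

/-- Cauchy–Schwarz against ⟨X⟩^(1-s), which is square integrable precisely because s > 3/2. The
factor 2 in `embC` comes from 1 + |X| ≤ 2⟨X⟩. -/
theorem nW1_le {s : ℝ} (hs : 3 / 2 < s) {e : ℝ} (he : 0 ≤ e) (k : ℕ) {F : ℝ → ℂ}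
    (hF : AEStronglyMeasurable F) :
    nW1 (lw e k) F ≤ ENNReal.ofReal (embC s) * nW (sw s e k) F := by
  have hm := memLp_jap_neg (r := 1 - s) (by linarith)
  have h1 : ∀ ξ, ‖(lw e k ξ : ℂ) * F ξ‖ₑ ≤ 2 * (‖jap (1 - s) (2 * Real.pi * ξ)‖ₑ *
      ‖(sw s e k ξ : ℂ) * F ξ‖ₑ) := by
    intro ξ
    rw [enorm_ofReal_mul (lw_nonneg he k ξ), enorm_ofReal_mul (sw_nonneg he s k ξ),
      Real.enorm_of_nonneg (jap_pos _ _).le, ← mul_assoc, ← mul_assoc, mul_assoc 2,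
      ← ENNReal.ofReal_mul (jap_pos _ _).le, ← ENNReal.ofReal_ofNat 2,
      ← ENNReal.ofReal_mul (by norm_num)]
    refine mul_le_mul_left (ENNReal.ofReal_le_ofReal ?_) _
    have e1 : jap (1 - s) (2 * Real.pi * ξ) * sw s e k ξ =
        jap 1 (2 * Real.pi * ξ) * (1 + e * |2 * Real.pi * ξ|) ^ k := by
      rw [sw, ← mul_assoc, ← jap_add]; congr 2; ring
    rw [e1, lw, ← mul_assoc]
    refine mul_le_mul_of_nonneg_right ?_ (by positivity)
    have := abs_le_jap_one (2 * Real.pi * ξ)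
    have := one_le_jap zero_le_one (2 * Real.pi * ξ)
    linarith
  have hmeas : AEStronglyMeasurable (fun ξ => (sw s e k ξ : ℂ) * F ξ) :=
    (Complex.continuous_ofReal.comp (continuous_sw s e k)).aestronglyMeasurable.mul hF
  calc nW1 (lw e k) F ≤ ∫⁻ ξ, 2 * (‖jap (1 - s) (2 * Real.pi * ξ)‖ₑ *
      ‖(sw s e k ξ : ℂ) * F ξ‖ₑ) := lintegral_mono h1
    _ = 2 * ∫⁻ ξ, (‖jap (1 - s) (2 * Real.pi * ξ)‖ₑ * ‖(sw s e k ξ : ℂ) * F ξ‖ₑ) := by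
        rw [lintegral_const_mul' _ _ (by norm_num)]
    _ ≤ 2 * (eLpNorm (fun ξ : ℝ => jap (1 - s) (2 * Real.pi * ξ)) 2 volume *
        nW (sw s e k) F) := by
        refine mul_le_mul_right ?_ _
        have := ENNReal.lintegral_mul_le_Lp_mul_Lq volume (Real.HolderConjugate.two_two)
          hm.1.enorm hmeas.enorm
        simpa [nW, eLpNorm_eq_lintegral_rpow_enorm_toReal] using this
    _ = _ := by
        rw [embC, ENNReal.ofReal_mul (by norm_num), ENNReal.ofReal_toReal hm.2.ne,
          ENNReal.ofReal_ofNat, mul_assoc]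

theorem nW_mono {w w' : ℝ → ℝ} (h0 : ∀ ξ, 0 ≤ w ξ) (h : ∀ ξ, w ξ ≤ w' ξ) (F : ℝ → ℂ) :
    nW w F ≤ nW w' F := by
  refine eLpNorm_mono_enorm fun ξ => ?_
  rw [enorm_ofReal_mul (h0 ξ), enorm_ofReal_mul ((h0 ξ).trans (h ξ))]
  exact mul_le_mul_left (ENNReal.ofReal_le_ofReal (h ξ)) _

theorem nW1_mono {w w' : ℝ → ℝ} (h0 : ∀ ξ, 0 ≤ w ξ) (h : ∀ ξ, w ξ ≤ w' ξ) (F : ℝ → ℂ) :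
    nW1 w F ≤ nW1 w' F := by
  refine lintegral_mono fun ξ => ?_
  rw [enorm_ofReal_mul (h0 ξ), enorm_ofReal_mul ((h0 ξ).trans (h ξ))]
  exact mul_le_mul_left (ENNReal.ofReal_le_ofReal (h ξ)) _

theorem nW_const_mul {c : ℝ} (hc : 0 ≤ c) (w : ℝ → ℝ) (F : ℝ → ℂ) :
    nW (fun ξ => c * w ξ) F = ENNReal.ofReal c * nW w F := by
  have : (fun ξ => ((c * w ξ : ℝ) : ℂ) * F ξ) = (c : ℂ) • fun ξ => (w ξ : ℂ) * F ξ := by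
    funext ξ; simp [mul_assoc]
  rw [nW, this, eLpNorm_const_smul, nW]
  congr 1
  rw [← ofReal_norm, Complex.norm_real, Real.norm_of_nonneg hc]

theorem nW_add_le {w : ℝ → ℝ} (hw : Measurable w) {F G : ℝ → ℂ} (hF : AEStronglyMeasurable F)
    (hG : AEStronglyMeasurable G) : nW w (F + G) ≤ nW w F + nW w G := by
  have hm := (Complex.measurable_ofReal.comp hw).aestronglyMeasurable (μ := volume)
  refine le_trans (le_of_eq ?_) (eLpNorm_add_le (hm.mul hF) (hm.mul hG) (by norm_num))
  rw [nW]
  congr 1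
  funext ξ
  simp [mul_add]

theorem nW_smul (w : ℝ → ℝ) (c : ℂ) (F : ℝ → ℂ) : nW w (c • F) = ‖c‖ₑ * nW w F := by
  rw [nW, nW, ← eLpNorm_const_smul]
  congr 1
  funext ξ
  simp; ring

theorem hat_aestronglyMeasurable (f : ℝ → ℝ) : AEStronglyMeasurable (hat f) := (memLp_hat f).1

section rules

variable {f g : ℝ → ℝ}

theorem Nice.add_rep (hf : Nice f) (hg : Nice g) :
    Rep (fun x => ((f x + g x : ℝ) : ℂ)) (hat f + hat g) := by
  have := Rep.add hf hg
  refine (congrArg (fun u => Rep u (hat f + hat g)) ?_).mp this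
  funext x; simp

theorem Nice.smul_rep (hf : Nice f) (c : ℝ) :
    Rep (fun x => ((c * f x : ℝ) : ℂ)) ((c : ℂ) • hat f) := by
  have := Rep.smul (c : ℂ) hf
  refine (congrArg (fun u => Rep u ((c : ℂ) • hat f)) ?_).mp this
  funext x; simp

theorem Nice.mul_rep (hf : Nice f) (hg : Nice g) :
    Rep (fun x => ((f x * g x : ℝ) : ℂ)) (cv (hat f) (hat g)) := by
  have := Rep.mul hf hg
  refine (congrArg (fun u => Rep u (cv (hat f) (hat g))) ?_).mp this
  funext x; simp

theorem Nice.sub_rep (hf : Nice f) (hg : Nice g) :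
    Rep (fun x => ((f x - g x : ℝ) : ℂ)) (hat f - hat g) := by
  have := Rep.add hf (Rep.smul (-1) hg)
  have e : hat f - hat g = hat f + (-1 : ℂ) • hat g := by
    funext; simp [sub_eq_add_neg]
  rw [e]
  refine (congrArg (fun u => Rep u (hat f + (-1 : ℂ) • hat g)) ?_).mp this
  funext x; simp [sub_eq_add_neg]

theorem Nice.add (hf : Nice f) (hg : Nice g) : Nice fun x => f x + g x :=
  nice_of_rep (hf.add_rep hg)

theorem Nice.sub (hf : Nice f) (hg : Nice g) : Nice fun x => f x - g x :=
  nice_of_rep (hf.sub_rep hg)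

theorem Nice.const_mul (hf : Nice f) (c : ℝ) : Nice fun x => c * f x :=
  nice_of_rep (hf.smul_rep c)

theorem Nice.mul (hf : Nice f) (hg : Nice g) : Nice fun x => f x * g x :=
  nice_of_rep (hf.mul_rep hg)

theorem hat_add (hf : Nice f) (hg : Nice g) : hat (fun x => f x + g x) =ᵐ[volume] hat f + hat g :=
  hat_ae_eq (hf.add_rep hg)

theorem hat_sub (hf : Nice f) (hg : Nice g) : hat (fun x => f x - g x) =ᵐ[volume] hat f - hat g :=
  hat_ae_eq (hf.sub_rep hg)

theorem hat_const_mul (hf : Nice f) (c : ℝ) :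
    hat (fun x => c * f x) =ᵐ[volume] (c : ℂ) • hat f :=
  hat_ae_eq (hf.smul_rep c)

theorem hat_mul (hf : Nice f) (hg : Nice g) :
    hat (fun x => f x * g x) =ᵐ[volume] cv (hat f) (hat g) :=
  hat_ae_eq (hf.mul_rep hg)

end rules

/-- The symbol `iX` of `∂ₓ`. -/
def ix (ξ : ℝ) : ℂ := ((2 * Real.pi * ξ : ℝ) : ℂ) * Complex.I

theorem continuous_ix : Continuous ix := by unfold ix; fun_prop

theorem norm_ix (ξ : ℝ) : ‖ix ξ‖ = |2 * Real.pi * ξ| := by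
  rw [ix, norm_mul, Complex.norm_I, mul_one, Complex.norm_real, Real.norm_eq_abs]

theorem rep_deriv {f : ℝ → ℝ} (hf : Nice f) (h1 : Integrable fun ξ => ix ξ * hat f ξ)
    (h2 : MemLp (fun ξ => ix ξ * hat f ξ) 2) :
    Differentiable ℝ f ∧ Rep (fun x => ((deriv f x : ℝ) : ℂ)) fun ξ => ix ξ * hat f ξ := by
  have hd := fun x => hf.hasDerivAt h1 x
  have hr : ∀ x, HasDerivAt f (𝓕⁻ (fun ξ => ix ξ * hat f ξ) x).re x := by
    intro x
    have := Complex.reCLM.hasFDerivAt.comp_hasDerivAt x (hd x)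
    exact this
  refine ⟨fun x => (hr x).differentiableAt, h1, h2, ?_⟩
  funext x
  have h3 : HasDerivAt (fun x => (f x : ℂ)) ((deriv f x : ℝ) : ℂ) x :=
    ((hr x).differentiableAt.hasDerivAt).ofReal_comp
  exact h3.unique (hd x)

/-- `f` has an integrable Fourier transform and `‖⟨X⟩^s (1 + e|X|)^k f̂‖ ≤ B`. -/
def Sb (s e : ℝ) (k : ℕ) (f : ℝ → ℝ) (B : ℝ) : Prop :=
  Nice f ∧ 0 ≤ B ∧ nW (sw s e k) (hat f) ≤ ENNReal.ofReal B

/-- The algebra constant. -/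
def algC (s : ℝ) : ℝ := 1 + 2 * 2 ^ s * embC s

theorem embC_nonneg (s : ℝ) : 0 ≤ embC s := by unfold embC; positivity

theorem one_le_algC (s : ℝ) : 1 ≤ algC s := by
  have := embC_nonneg s
  unfold algC
  have : 0 ≤ 2 * (2 : ℝ) ^ s * embC s := by positivity
  linarith

theorem sw_mono_k {e : ℝ} (he : 0 ≤ e) (s : ℝ) {k l : ℕ} (h : k ≤ l) (ξ : ℝ) :
    sw s e k ξ ≤ sw s e l ξ := by
  refine mul_le_mul_of_nonneg_left (pow_le_pow_right₀ ?_ h) (jap_pos _ _).le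
  have : 0 ≤ e * |2 * Real.pi * ξ| := by positivity
  linarith

theorem sw_add_le {s : ℝ} (hs : 0 ≤ s) {e : ℝ} (he : 0 ≤ e) (k : ℕ) (x y : ℝ) :
    sw s e k (x + y) ≤ 2 ^ s * (sw s e k x * (1 + e * |2 * Real.pi * y|) ^ k +
      (1 + e * |2 * Real.pi * x|) ^ k * sw s e k y) := by
  have h1 := jap_add_le hs (2 * Real.pi * x) (2 * Real.pi * y)
  have h2 : (1 + e * |2 * Real.pi * (x + y)|) ≤
      (1 + e * |2 * Real.pi * x|) * (1 + e * |2 * Real.pi * y|) := by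
    have : |2 * Real.pi * (x + y)| ≤ |2 * Real.pi * x| + |2 * Real.pi * y| := by
      rw [mul_add]; exact abs_add_le _ _
    have h3 := mul_le_mul_of_nonneg_left this he
    have h4 : 0 ≤ (e * |2 * Real.pi * x|) * (e * |2 * Real.pi * y|) := by positivity
    linarith
  have h3 := pow_le_pow_left₀ (by positivity) h2 k
  unfold sw
  rw [mul_add (2 * Real.pi)] at *
  calc _ ≤ (2 ^ s * (jap s (2 * Real.pi * x) + jap s (2 * Real.pi * y))) *
        ((1 + e * |2 * Real.pi * x|) * (1 + e * |2 * Real.pi * y|)) ^ k := by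
        refine mul_le_mul h1 h3 (by positivity) ?_
        have := jap_pos s (2 * Real.pi * x)
        have := jap_pos s (2 * Real.pi * y)
        positivity
    _ = _ := by rw [mul_pow]; ring

section rules

variable {s e : ℝ} {k l : ℕ} {f g : ℝ → ℝ} {A B : ℝ}

theorem Sb.nice (h : Sb s e k f A) : Nice f := h.1

theorem Sb.nonneg (h : Sb s e k f A) : 0 ≤ A := h.2.1

theorem Sb.mono (h : Sb s e k f A) (hAB : A ≤ B) : Sb s e k f B :=
  ⟨h.1, h.2.1.trans hAB, h.2.2.trans (ENNReal.ofReal_le_ofReal hAB)⟩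

theorem Sb.mono_k (he : 0 ≤ e) (h : Sb s e l f A) (hkl : k ≤ l) : Sb s e k f A :=
  ⟨h.1, h.2.1, (nW_mono (sw_nonneg he s k) (sw_mono_k he s hkl) _).trans h.2.2⟩

theorem Sb.add (hf : Sb s e k f A) (hg : Sb s e k g B) :
    Sb s e k (fun x => f x + g x) (A + B) := by
  refine ⟨hf.1.add hg.1, add_nonneg hf.2.1 hg.2.1, ?_⟩
  rw [nW_congr (hat_add hf.1 hg.1), ENNReal.ofReal_add hf.2.1 hg.2.1]
  exact (nW_add_le (continuous_sw s e k).measurable (memLp_hat f).1 (memLp_hat g).1).trans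
    (add_le_add hf.2.2 hg.2.2)

theorem Sb.const_mul (hf : Sb s e k f A) (c : ℝ) : Sb s e k (fun x => c * f x) (|c| * A) := by
  refine ⟨hf.1.const_mul c, mul_nonneg (abs_nonneg _) hf.2.1, ?_⟩
  rw [nW_congr (hat_const_mul hf.1 c), nW_smul, ENNReal.ofReal_mul (abs_nonneg _),
    ← ofReal_norm, Complex.norm_real, Real.norm_eq_abs]
  exact mul_le_mul_right hf.2.2 _

theorem Sb.sub (hf : Sb s e k f A) (hg : Sb s e k g B) :
    Sb s e k (fun x => f x - g x) (A + B) := by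
  have h := hf.add (hg.const_mul (-1))
  simp only [abs_neg, abs_one, one_mul] at h
  simpa only [neg_mul, one_mul, ← sub_eq_add_neg] using h

theorem Sb.nW1_le (hs : 3 / 2 < s) (he : 0 ≤ e) (h : Sb s e k f A) :
    nW1 (lw e k) (hat f) ≤ ENNReal.ofReal (embC s * A) := by
  rw [ENNReal.ofReal_mul (embC_nonneg s)]
  exact (Boussinesq.nW1_le hs he k (memLp_hat f).1).trans (mul_le_mul_right h.2.2 _)

/-- The bracket is sub-additive up to 2^s and 1 + e|X| is submultiplicative, so in the convolution
one factor carries the full weight while the other needs only (1 + e|X|)^k in L¹, which the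
embedding provides. The constant is therefore independent of e. -/
theorem Sb.mul (hs : 3 / 2 < s) (he : 0 ≤ e) (hf : Sb s e k f A) (hg : Sb s e k g B) :
    Sb s e k (fun x => f x * g x) (algC s * A * B) := by
  have hA := hf.2.1
  have hB := hg.2.1
  have hC := embC_nonneg s
  refine ⟨hf.1.mul hg.1, mul_nonneg (mul_nonneg (by have := one_le_algC s; linarith) hA) hB, ?_⟩
  rw [nW_congr (hat_mul hf.1 hg.1)]
  have e1 : nW (sw s e k) (cv (hat f) (hat g)) =
      eLpNorm (fun ξ => ∫ t, (sw s e k ξ : ℂ) * (hat f t * hat g (ξ - t))) 2 volume := by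
    rw [nW]
    congr 1
    funext ξ
    rw [cv, integral_const_mul]
  have hl : ∀ t, (1 + e * |2 * Real.pi * t|) ^ k ≤ lw e k t := by
    intro t
    refine le_mul_of_one_le_left (by positivity) ?_
    have := abs_nonneg (2 * Real.pi * t); linarith
  rw [e1]
  have hk := bilinear_bound (memLp_hat f).1 (memLp_hat g).1 (fun ξ _ => (sw s e k ξ : ℂ))
    (continuous_sw s e k).measurable (continuous_lw e k).measurable
    (continuous_lw e k).measurable (continuous_sw s e k).measurable
    (sw_nonneg he s k) (lw_nonneg he k) (lw_nonneg he k) (sw_nonneg he s k)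
    (C := 2 ^ s) (by positivity) (fun ξ t => by
      rw [Complex.norm_real, Real.norm_of_nonneg (sw_nonneg he s k ξ)]
      have h1 := sw_add_le (by linarith : 0 ≤ s) he k t (ξ - t)
      rw [add_sub_cancel] at h1
      refine h1.trans ?_
      have := hl t
      have := hl (ξ - t)
      have := sw_nonneg he s k t
      have := sw_nonneg he s k (ξ - t)
      gcongr)
  refine hk.trans ?_
  calc _ ≤ ENNReal.ofReal (2 ^ s) * (ENNReal.ofReal A * ENNReal.ofReal (embC s * B) +
        ENNReal.ofReal (embC s * A) * ENNReal.ofReal B) := by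
        gcongr
        · exact hf.2.2
        · exact hg.nW1_le hs he
        · exact hf.nW1_le hs he
        · exact hg.2.2
    _ = ENNReal.ofReal (2 ^ s * (A * (embC s * B) + embC s * A * B)) := by
        rw [← ENNReal.ofReal_mul hA, ← ENNReal.ofReal_mul (by positivity),
          ← ENNReal.ofReal_add (by positivity) (by positivity),
          ← ENNReal.ofReal_mul (by positivity)]
    _ ≤ _ := by
        refine ENNReal.ofReal_le_ofReal ?_
        have : algC s * A * B = A * B + 2 ^ s * (A * (embC s * B) + embC s * A * B) := by
          unfold algC; ring
        rw [this]
        have := mul_nonneg hA hB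
        linarith

theorem nW1_one_le (hs : 3 / 2 < s) (he : 0 ≤ e) (h : Sb s e k f A) :
    ∫⁻ ξ, ‖hat f ξ‖ₑ ≤ ENNReal.ofReal (embC s * A) := by
  refine le_trans ?_ (h.nW1_le hs he)
  rw [← nW1_one]
  refine nW1_mono (fun _ => zero_le_one) (fun ξ => ?_) _
  have h1 : 1 ≤ 1 + e * |2 * Real.pi * ξ| := by
    have : 0 ≤ e * |2 * Real.pi * ξ| := by positivity
    linarith
  have := abs_nonneg (2 * Real.pi * ξ)
  exact one_le_mul_of_one_le_of_one_le (by linarith) (one_le_pow₀ h1)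

theorem nW1_ix_le (hs : 3 / 2 < s) (he : 0 ≤ e) (h : Sb s e k f A) :
    ∫⁻ ξ, ‖ix ξ * hat f ξ‖ₑ ≤ ENNReal.ofReal (embC s * A) := by
  refine le_trans ?_ (h.nW1_le hs he)
  refine lintegral_mono fun ξ => ?_
  rw [enorm_mul, enorm_ofReal_mul (lw_nonneg he k ξ), ← ofReal_norm (ix ξ), norm_ix]
  refine mul_le_mul_left (ENNReal.ofReal_le_ofReal ?_) _
  have h1 : 1 ≤ 1 + e * |2 * Real.pi * ξ| := by
    have : 0 ≤ e * |2 * Real.pi * ξ| := by positivity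
    linarith
  have := abs_nonneg (2 * Real.pi * ξ)
  calc _ ≤ 1 + |2 * Real.pi * ξ| := by linarith
    _ ≤ _ := le_mul_of_one_le_right (by linarith) (one_le_pow₀ h1)

theorem eLpNorm_ix_le (hs : 3 / 2 < s) (he : 0 ≤ e) (h : Sb s e k f A) :
    eLpNorm (fun ξ => ix ξ * hat f ξ) 2 volume ≤ ENNReal.ofReal A := by
  refine le_trans (eLpNorm_mono_enorm fun ξ => ?_) h.2.2
  rw [enorm_mul, enorm_ofReal_mul (sw_nonneg he s k ξ), ← ofReal_norm (ix ξ), norm_ix]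
  refine mul_le_mul_left (ENNReal.ofReal_le_ofReal ?_) _
  have h1 : 1 ≤ 1 + e * |2 * Real.pi * ξ| := by
    have : 0 ≤ e * |2 * Real.pi * ξ| := by positivity
    linarith
  calc _ ≤ jap s (2 * Real.pi * ξ) :=
        (abs_le_jap_one _).trans (jap_mono (by linarith) _)
    _ ≤ _ := le_mul_of_one_le_right (jap_pos _ _).le (one_le_pow₀ h1)

theorem Sb.rep_deriv (hs : 3 / 2 < s) (he : 0 ≤ e) (h : Sb s e k f A) :
    Differentiable ℝ f ∧ Rep (fun x => ((deriv f x : ℝ) : ℂ)) fun ξ => ix ξ * hat f ξ := by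
  have hm : AEStronglyMeasurable (fun ξ => ix ξ * hat f ξ) :=
    continuous_ix.aestronglyMeasurable.mul (memLp_hat f).1
  exact Boussinesq.rep_deriv h.1 ⟨hm, (nW1_ix_le hs he h).trans_lt ENNReal.ofReal_lt_top⟩
    ⟨hm, (eLpNorm_ix_le hs he h).trans_lt ENNReal.ofReal_lt_top⟩

theorem Sb.differentiable (hs : 3 / 2 < s) (he : 0 ≤ e) (h : Sb s e k f A) :
    Differentiable ℝ f := (h.rep_deriv hs he).1

theorem Sb.nice_deriv (hs : 3 / 2 < s) (he : 0 ≤ e) (h : Sb s e k f A) : Nice (deriv f) :=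
  nice_of_rep (h.rep_deriv hs he).2

theorem Sb.hat_deriv (hs : 3 / 2 < s) (he : 0 ≤ e) (h : Sb s e k f A) :
    hat (deriv f) =ᵐ[volume] fun ξ => ix ξ * hat f ξ := hat_ae_eq (h.rep_deriv hs he).2

/-- One factor of the weight pays for the derivative: |X| ≤ (1 + e|X|)/e. -/
theorem Sb.deriv (hs : 3 / 2 < s) (he : 0 < e) (h : Sb s e (k + 1) f A) :
    Sb s e k (deriv f) (A / e) := by
  refine ⟨h.nice_deriv hs he.le, div_nonneg h.2.1 he.le, ?_⟩
  rw [nW_congr (h.hat_deriv hs he.le)]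
  have h1 : nW (sw s e k) (fun ξ => ix ξ * hat f ξ) ≤ nW (fun ξ => e⁻¹ * sw s e (k + 1) ξ) (hat f) := by
    refine eLpNorm_mono_enorm fun ξ => ?_
    have h0 : 0 ≤ e⁻¹ * sw s e (k + 1) ξ := mul_nonneg (by positivity) (sw_nonneg he.le _ _ _)
    rw [enorm_ofReal_mul (sw_nonneg he.le s k ξ), enorm_ofReal_mul h0, enorm_mul,
      ← ofReal_norm (ix ξ), norm_ix, ← mul_assoc, ← ENNReal.ofReal_mul (sw_nonneg he.le s k ξ)]
    refine mul_le_mul_left (ENNReal.ofReal_le_ofReal ?_) _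
    have h2 : sw s e (k + 1) ξ = sw s e k ξ * (1 + e * |2 * Real.pi * ξ|) := by
      rw [sw, sw, pow_succ]; ring
    rw [h2, inv_mul_eq_div, le_div_iff₀ he]
    have := sw_nonneg he.le s k ξ
    nlinarith
  refine h1.trans ?_
  rw [nW_const_mul (by positivity), div_eq_inv_mul, ENNReal.ofReal_mul (by positivity)]
  exact mul_le_mul_right h.2.2 _

theorem rep_abs_le {f : ℝ → ℝ} {F : ℝ → ℂ} (h : Rep (fun x => ((f x : ℝ) : ℂ)) F) {B : ℝ}
    (hB : 0 ≤ B) (hF : ∫⁻ ξ, ‖F ξ‖ₑ ≤ ENNReal.ofReal B) (x : ℝ) : |f x| ≤ B := by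
  have := h.norm_le x
  rw [Complex.norm_real, Real.norm_eq_abs, integral_norm_eq_lintegral_enorm h.1.1] at this
  exact this.trans (ENNReal.toReal_le_of_le_ofReal hB hF)

theorem Sb.abs_le (hs : 3 / 2 < s) (he : 0 ≤ e) (h : Sb s e k f A) (x : ℝ) :
    |f x| ≤ embC s * A :=
  rep_abs_le h.1 (mul_nonneg (embC_nonneg s) h.2.1) (nW1_one_le hs he h) x

theorem Sb.abs_deriv_le (hs : 3 / 2 < s) (he : 0 ≤ e) (h : Sb s e k f A) (x : ℝ) :
    |_root_.deriv f x| ≤ embC s * A :=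
  rep_abs_le (h.rep_deriv hs he).2 (mul_nonneg (embC_nonneg s) h.2.1) (nW1_ix_le hs he h) x

end rules

/-! ### Truncated multipliers and integration by parts -/

/-- The truncation of the symbol of `Λ^s`. -/
def lam (s N ξ : ℝ) : ℝ := tent N (jap s (2 * Real.pi * ξ))

/-- The truncation of the symbol of `-∂ₓ² Λ^s`. -/
def mu (s N ξ : ℝ) : ℝ := (2 * Real.pi * ξ) ^ 2 * lam s N ξ

theorem lam_nonneg (s N ξ : ℝ) : 0 ≤ lam s N ξ := tent_nonneg _ _

theorem mu_nonneg (s N ξ : ℝ) : 0 ≤ mu s N ξ := mul_nonneg (sq_nonneg _) (lam_nonneg _ _ _)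

theorem lam_le (s N ξ : ℝ) : lam s N ξ ≤ jap s (2 * Real.pi * ξ) := tent_le (jap_pos _ _).le

theorem continuous_lam (s N : ℝ) : Continuous (lam s N) :=
  (continuous_tent N).comp ((continuous_jap s).comp (by fun_prop))

theorem continuous_mu (s N : ℝ) : Continuous (mu s N) := by
  unfold mu
  exact Continuous.mul (by fun_prop) (continuous_lam s N)

theorem pow_mul_lam_le {s : ℝ} (hs : 1 ≤ s) (N : ℝ) (m : ℕ) (ξ : ℝ) :
    (1 + |2 * Real.pi * ξ|) ^ m * lam s N ξ ≤ (1 + 2 * |N|) ^ m * (2 * |N|) := by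
  by_cases h : 2 * N ≤ jap s (2 * Real.pi * ξ)
  · rw [lam, tent_eq_zero h, mul_zero]; positivity
  · push Not at h
    have h1 := lam_le s N ξ
    have h2 : |2 * Real.pi * ξ| ≤ jap s (2 * Real.pi * ξ) :=
      (abs_le_jap_one _).trans (jap_mono hs _)
    have h3 := le_abs_self N
    refine mul_le_mul (pow_le_pow_left₀ (by positivity) (by linarith) m) (by linarith)
      (lam_nonneg _ _ _) (by positivity)

theorem memLp_mul_of_bounded {ψ F : ℝ → ℂ} (hψ : AEStronglyMeasurable ψ) {C : ℝ}
    (hC : ∀ ξ, ‖ψ ξ‖ ≤ C) (hF : MemLp F 2) : MemLp (fun ξ => ψ ξ * F ξ) 2 :=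
  MemLp.of_le_mul (c := C) hF (hψ.mul hF.1) (ae_of_all _ fun ξ => by
    rw [norm_mul]; exact mul_le_mul_of_nonneg_right (hC ξ) (norm_nonneg _))

/-- On the support of `lam` one has |X| ≤ ⟨X⟩^s ≤ 2|N|, so a polynomial multiple of it is bounded
and square integrable. This gives all integrability and differentiability of truncated quantities;
the bounds depend on N and are never used quantitatively. -/
theorem bandLimited {s : ℝ} (hs : 1 ≤ s) {N C : ℝ} {m : ℕ} {ψ F : ℝ → ℂ}
    (hψ : AEStronglyMeasurable ψ)
    (hC : ∀ ξ, ‖ψ ξ‖ ≤ C * ((1 + |2 * Real.pi * ξ|) ^ m * lam s N ξ)) (hF : MemLp F 2) :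
    Integrable (fun ξ => ψ ξ * F ξ) ∧ MemLp (fun ξ => ψ ξ * F ξ) 2 := by
  have hC0 : ∀ ξ, ‖ψ ξ‖ ≤ |C| * ((1 + |2 * Real.pi * ξ|) ^ m * lam s N ξ) := fun ξ =>
    (hC ξ).trans (mul_le_mul_of_nonneg_right (le_abs_self C)
      (mul_nonneg (by positivity) (lam_nonneg _ _ _)))
  have hψ2 : MemLp ψ 2 := by
    refine MemLp.of_le_mul (c := |C| * ((1 + 2 * |N|) ^ (m + 1) * (2 * |N|)))
      (memLp_jap_neg (r := -1) (by norm_num)) hψ (ae_of_all _ fun ξ => (hC0 ξ).trans ?_)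
    rw [Real.norm_of_nonneg (jap_pos _ _).le, mul_assoc |C|]
    refine mul_le_mul_of_nonneg_left ?_ (abs_nonneg C)
    have h1 := pow_mul_lam_le hs N (m + 1) ξ
    have h2 : jap (-1) (2 * Real.pi * ξ) * jap 1 (2 * Real.pi * ξ) = 1 := by
      rw [← jap_add, neg_add_cancel, jap_zero]
    have h3 := jap_one_le (2 * Real.pi * ξ)
    have h4 : 1 ≤ (1 + |2 * Real.pi * ξ|) * jap (-1) (2 * Real.pi * ξ) := by
      refine h2.symm.le.trans ?_
      rw [mul_comm]
      exact mul_le_mul_of_nonneg_right h3 (jap_pos _ _).le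
    calc (1 + |2 * Real.pi * ξ|) ^ m * lam s N ξ
        ≤ ((1 + |2 * Real.pi * ξ|) ^ m * lam s N ξ) *
          ((1 + |2 * Real.pi * ξ|) * jap (-1) (2 * Real.pi * ξ)) :=
          le_mul_of_one_le_right (mul_nonneg (by positivity) (lam_nonneg _ _ _)) h4
      _ = ((1 + |2 * Real.pi * ξ|) ^ (m + 1) * lam s N ξ) * jap (-1) (2 * Real.pi * ξ) := by ring
      _ ≤ _ := mul_le_mul_of_nonneg_right h1 (jap_pos _ _).le
  refine ⟨hψ2.integrable_mul hF, memLp_mul_of_bounded hψ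
    (C := |C| * ((1 + 2 * |N|) ^ m * (2 * |N|))) (fun ξ => (hC0 ξ).trans ?_) hF⟩
  exact mul_le_mul_of_nonneg_left (pow_mul_lam_le hs N m ξ) (abs_nonneg C)

/-- The function with Fourier transform `mu F`. -/
def tf (s N : ℝ) (F : ℝ → ℂ) : ℝ → ℂ := 𝓕⁻ fun ξ => (mu s N ξ : ℂ) * F ξ

theorem norm_mu_le (s N ξ : ℝ) :
    ‖(mu s N ξ : ℂ)‖ ≤ 1 * ((1 + |2 * Real.pi * ξ|) ^ 2 * lam s N ξ) := by
  rw [Complex.norm_real, Real.norm_of_nonneg (mu_nonneg _ _ _), mu, one_mul, ← sq_abs]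
  have := abs_nonneg (2 * Real.pi * ξ)
  have := lam_nonneg s N ξ
  gcongr
  linarith

theorem norm_mu_ix_le (s N ξ : ℝ) :
    ‖(mu s N ξ : ℂ) * ix ξ‖ ≤ 1 * ((1 + |2 * Real.pi * ξ|) ^ 3 * lam s N ξ) := by
  rw [norm_mul, norm_ix]
  have h := norm_mu_le s N ξ
  have h1 := abs_nonneg (2 * Real.pi * ξ)
  have h2 := lam_nonneg s N ξ
  calc _ ≤ (1 * ((1 + |2 * Real.pi * ξ|) ^ 2 * lam s N ξ)) * (1 + |2 * Real.pi * ξ|) :=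
        mul_le_mul h (by linarith) h1 (by positivity)
    _ = _ := by ring

theorem aesm_mu (s N : ℝ) : AEStronglyMeasurable fun ξ => (mu s N ξ : ℂ) :=
  (Complex.continuous_ofReal.comp (continuous_mu s N)).aestronglyMeasurable

theorem rep_tf {s : ℝ} (hs : 1 ≤ s) (N : ℝ) {F : ℝ → ℂ} (hF : MemLp F 2) :
    Rep (tf s N F) fun ξ => (mu s N ξ : ℂ) * F ξ :=
  ⟨(bandLimited hs (aesm_mu s N) (norm_mu_le s N) hF).1,
    (bandLimited hs (aesm_mu s N) (norm_mu_le s N) hF).2, rfl⟩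

theorem bandLimited_mu_ix {s : ℝ} (hs : 1 ≤ s) (N : ℝ) {F : ℝ → ℂ} (hF : MemLp F 2) :
    Integrable (fun ξ => (mu s N ξ : ℂ) * (ix ξ * F ξ)) ∧
      MemLp (fun ξ => (mu s N ξ : ℂ) * (ix ξ * F ξ)) 2 := by
  have := bandLimited hs ((aesm_mu s N).mul continuous_ix.aestronglyMeasurable)
    (norm_mu_ix_le s N) hF
  simpa only [mul_assoc, Pi.mul_apply] using this

theorem rep_tf_ix {s : ℝ} (hs : 1 ≤ s) (N : ℝ) {F : ℝ → ℂ} (hF : MemLp F 2) :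
    Rep (tf s N fun ξ => ix ξ * F ξ) fun ξ => (mu s N ξ : ℂ) * (ix ξ * F ξ) :=
  ⟨(bandLimited_mu_ix hs N hF).1, (bandLimited_mu_ix hs N hF).2, rfl⟩

theorem hasDerivAt_tf {s : ℝ} (hs : 1 ≤ s) (N : ℝ) {F : ℝ → ℂ} (hF : MemLp F 2) (x : ℝ) :
    HasDerivAt (tf s N F) (tf s N (fun ξ => ix ξ * F ξ) x) x := by
  have e : (fun ξ => (mu s N ξ : ℂ) * (ix ξ * F ξ)) =
      fun ξ => ix ξ * ((mu s N ξ : ℂ) * F ξ) := by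
    funext ξ; ring
  have h := (rep_tf hs N hF).hasDerivAt (by
    have := (bandLimited_mu_ix hs N hF).1
    rw [e] at this
    exact this) x
  have e2 : tf s N (fun ξ => ix ξ * F ξ) x = 𝓕⁻ (fun ξ => ix ξ * ((mu s N ξ : ℂ) * F ξ)) x := by
    rw [tf, e]
  rw [e2]
  exact h

theorem integrable_mul_conj {p : ℝ → ℝ} {a b : ℝ → ℂ} (hp : AEStronglyMeasurable p) {P : ℝ}
    (hP : ∀ x, |p x| ≤ P) (ha : MemLp a 2) (hb : MemLp b 2) :
    Integrable fun x => (p x : ℂ) * a x * (starRingEnd ℂ) (b x) := by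
  have h1 : MemLp (fun x => (p x : ℂ) * a x) 2 :=
    memLp_mul_of_bounded (Complex.continuous_ofReal.comp_aestronglyMeasurable hp) (C := P)
      (fun x => by rw [Complex.norm_real]; exact hP x) ha
  exact h1.integrable_mul hb.star

theorem norm_integral_mul_conj_le {p : ℝ → ℝ} {a b : ℝ → ℂ} {P A B : ℝ}
    (hP : ∀ x, |p x| ≤ P) (ha : MemLp a 2) (hb : MemLp b 2) (hA0 : 0 ≤ A) (hB0 : 0 ≤ B)
    (hA : eLpNorm a 2 volume ≤ ENNReal.ofReal A) (hB : eLpNorm b 2 volume ≤ ENNReal.ofReal B) :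
    ‖∫ x, (p x : ℂ) * a x * (starRingEnd ℂ) (b x)‖ ≤ P * A * B := by
  have hP0 : 0 ≤ P := (abs_nonneg _).trans (hP 0)
  have h1 : ∫⁻ x, ‖(p x : ℂ) * a x * (starRingEnd ℂ) (b x)‖ₑ ≤
      ENNReal.ofReal P * (ENNReal.ofReal A * ENNReal.ofReal B) := by
    calc _ ≤ ∫⁻ x, ENNReal.ofReal P * (‖a x‖ₑ * ‖b x‖ₑ) := by
          refine lintegral_mono fun x => ?_
          rw [enorm_mul, enorm_mul, mul_assoc]
          refine mul_le_mul ?_ ?_ zero_le zero_le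
          · rw [← ofReal_norm, Complex.norm_real]
            exact ENNReal.ofReal_le_ofReal (hP x)
          · rw [← ofReal_norm ((starRingEnd ℂ) (b x)), RCLike.norm_conj, ofReal_norm]
      _ = ENNReal.ofReal P * ∫⁻ x, (‖a x‖ₑ * ‖b x‖ₑ) :=
          lintegral_const_mul' _ _ ENNReal.ofReal_ne_top
      _ ≤ ENNReal.ofReal P * (eLpNorm a 2 volume * eLpNorm b 2 volume) := by
          refine mul_le_mul_right ?_ _
          have := ENNReal.lintegral_mul_le_Lp_mul_Lq volume (Real.HolderConjugate.two_two)
            ha.1.enorm hb.1.enorm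
          simpa [eLpNorm_eq_lintegral_rpow_enorm_toReal] using this
      _ ≤ _ := by gcongr
  refine (norm_integral_le_lintegral_norm _).trans ?_
  simp only [ofReal_norm]
  refine ENNReal.toReal_le_of_le_ofReal (by positivity) (h1.trans (le_of_eq ?_))
  rw [← ENNReal.ofReal_mul hA0, ← ENNReal.ofReal_mul hP0, mul_assoc]

/-- Integration by parts in a transport term. -/
theorem abs_re_integral_transport_le {p p' : ℝ → ℝ} {g g' : ℝ → ℂ} {P P' B : ℝ}
    (hp : ∀ x, HasDerivAt p (p' x) x) (hp' : AEStronglyMeasurable p')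
    (hg : ∀ x, HasDerivAt g (g' x) x)
    (hP : ∀ x, |p x| ≤ P) (hP' : ∀ x, |p' x| ≤ P') (m : MemLp g 2) (m' : MemLp g' 2)
    (hB0 : 0 ≤ B) (hB : eLpNorm g 2 volume ≤ ENNReal.ofReal B) :
    |(∫ x, (p x : ℂ) * g' x * (starRingEnd ℂ) (g x)).re| ≤ P' * B * B := by
  have hpm : AEStronglyMeasurable p volume :=
    (continuous_iff_continuousAt.2 fun x => (hp x).continuousAt).aestronglyMeasurable
  have i1 := integrable_mul_conj hpm hP m' m
  have i2 := integrable_mul_conj hpm hP m m'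
  have i3 := integrable_mul_conj hp' hP' m m
  have i4 := integrable_mul_conj hpm hP m m
  have hz := integral_eq_zero_of_hasDerivAt_of_integrable
    (f := fun x => (p x : ℂ) * g x * (starRingEnd ℂ) (g x))
    (f' := fun x => (p' x : ℂ) * g x * (starRingEnd ℂ) (g x) +
      (p x : ℂ) * g' x * (starRingEnd ℂ) (g x) + (p x : ℂ) * g x * (starRingEnd ℂ) (g' x))
    (fun x => by
      have hc : HasDerivAt (fun y => (starRingEnd ℂ) (g y)) ((starRingEnd ℂ) (g' x)) x :=
        (hg x).star
      have := (((hp x).ofReal_comp).mul (hg x)).mul hc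
      refine this.congr_deriv ?_
      simp only [Pi.mul_apply]
      ring) ((i3.add i1).add i2) i4
  rw [integral_add (f := fun x => (p' x : ℂ) * g x * (starRingEnd ℂ) (g x) +
      (p x : ℂ) * g' x * (starRingEnd ℂ) (g x)) (i3.add i1) i2, integral_add i3 i1] at hz
  -- The two terms in which g is differentiated are conjugate to each other, so their real part is
  -- minus half the term containing p'.
  have hconj : ∫ x, (p x : ℂ) * g x * (starRingEnd ℂ) (g' x) =
      (starRingEnd ℂ) (∫ x, (p x : ℂ) * g' x * (starRingEnd ℂ) (g x)) := by
    rw [← integral_conj]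
    refine integral_congr_ae (ae_of_all _ fun x => ?_)
    simp only [map_mul, Complex.conj_ofReal, Complex.conj_conj]
    ring
  rw [hconj] at hz
  have h3 := norm_integral_mul_conj_le hP' m m hB0 hB0 hB hB
  have h5 := congrArg Complex.re hz
  simp only [Complex.add_re, Complex.conj_re, Complex.zero_re] at h5
  have h6 := (Complex.abs_re_le_norm _).trans h3
  have h7 := abs_nonneg (∫ x, (p' x : ℂ) * g x * (starRingEnd ℂ) (g x)).re
  set a := (∫ x, (p' x : ℂ) * g x * (starRingEnd ℂ) (g x)).re
  set b := (∫ x, (p x : ℂ) * g' x * (starRingEnd ℂ) (g x)).re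
  have h8 : b = -(1 / 2) * a := by linarith
  rw [h8, abs_mul]
  norm_num
  linarith

/-! ### Commutator and transport estimates -/

/-- The two orders above s fit into (1 + e|X|)² at the price of e⁻². This is the source of the
powers of 1/e in the estimates of top order. -/
theorem jap_sq_weight_le {s e : ℝ} (he : 0 < e) (he1 : e ≤ 1) (ξ : ℝ) :
    |2 * Real.pi * ξ| * jap (s + 1) (2 * Real.pi * ξ) ≤ (e ^ 2)⁻¹ * sw s e 2 ξ := by
  have h1 := jap_one_le (2 * Real.pi * ξ)
  have h2 := abs_nonneg (2 * Real.pi * ξ)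
  have h3 := (jap_pos s (2 * Real.pi * ξ)).le
  have key : |2 * Real.pi * ξ| * (1 + |2 * Real.pi * ξ|) * e ^ 2 ≤
      (1 + e * |2 * Real.pi * ξ|) ^ 2 := by
    set a := |2 * Real.pi * ξ|
    have h4 : e ^ 2 ≤ e := by nlinarith
    have h5 := mul_le_mul_of_nonneg_right h4 h2
    nlinarith [mul_nonneg he.le h2]
  have he2 : 0 < e ^ 2 := by positivity
  rw [jap_add, sw, inv_mul_eq_div, le_div_iff₀ he2]
  calc _ ≤ jap s (2 * Real.pi * ξ) * (|2 * Real.pi * ξ| * (1 + |2 * Real.pi * ξ|) * e ^ 2) := by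
        have : |2 * Real.pi * ξ| * (jap s (2 * Real.pi * ξ) * jap 1 (2 * Real.pi * ξ)) * e ^ 2 =
          jap s (2 * Real.pi * ξ) * (|2 * Real.pi * ξ| * jap 1 (2 * Real.pi * ξ) * e ^ 2) := by ring
        rw [this]
        gcongr
    _ ≤ _ := mul_le_mul_of_nonneg_left key h3

theorem mu_le_sw {s e : ℝ} (he : 0 < e) (N ξ : ℝ) : mu s N ξ ≤ (e ^ 2)⁻¹ * sw s e 2 ξ := by
  have h3 := (jap_pos s (2 * Real.pi * ξ)).le
  have he2 : 0 < e ^ 2 := by positivity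
  have hl := lam_le s N ξ
  rw [sw, inv_mul_eq_div, le_div_iff₀ he2, mu, ← sq_abs]
  have h2 : 0 ≤ e * |2 * Real.pi * ξ| := by positivity
  calc _ = lam s N ξ * (e * |2 * Real.pi * ξ|) ^ 2 := by ring
    _ ≤ _ := mul_le_mul hl (pow_le_pow_left₀ h2 (by linarith) 2) (by positivity) h3

theorem nW_mu_le {s e : ℝ} (he : 0 < e) (N : ℝ) {f : ℝ → ℝ} {A : ℝ} (h : Sb s e 2 f A) :
    eLpNorm (fun ξ => (mu s N ξ : ℂ) * hat f ξ) 2 volume ≤ ENNReal.ofReal (A / e ^ 2) := by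
  refine (nW_mono (mu_nonneg s N) (mu_le_sw he N) (hat f)).trans ?_
  rw [nW_const_mul (by positivity), div_eq_inv_mul, ENNReal.ofReal_mul (by positivity)]
  exact mul_le_mul_right h.2.2 _

theorem nW_lam_le {s e : ℝ} (he : 0 ≤ e) (N : ℝ) {k : ℕ} {f : ℝ → ℝ} {A : ℝ} (h : Sb s e k f A) :
    eLpNorm (fun ξ => (lam s N ξ : ℂ) * hat f ξ) 2 volume ≤ ENNReal.ofReal A := by
  refine (nW_mono (lam_nonneg s N) (fun ξ => (lam_le s N ξ).trans ?_) (hat f)).trans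
    (h.mono_k he (Nat.zero_le k)).2.2
  simp [sw]

/-- The constant of the commutator estimate. -/
def commC (s : ℝ) : ℝ := 2 * ((2 + 4 * s) * (2 ^ (s + 1) + 1)) * embC s

theorem commC_nonneg {s : ℝ} (hs : 0 ≤ s) : 0 ≤ commC s := by
  have := embC_nonneg s
  unfold commC
  positivity

/-- The commutator is a bilinear form whose kernel is the increment of `mu`. This increment has a
factor |X| of the frequency of f and a weight of order s + 1, which is split between f and u_x. In
either case the high frequency factor carries s + 2 derivatives in all and the other one is a first
derivative in L¹. -/
theorem commutator_bound {s e : ℝ} (hs : 3 / 2 < s) (he : 0 < e) (he1 : e ≤ 1) (N : ℝ)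
    {f u : ℝ → ℝ} {A B : ℝ} (hf : Sb s e 2 f A) (hu : Sb s e 2 u B) :
    eLpNorm (fun ξ => (mu s N ξ : ℂ) * cv (hat f) (fun η => ix η * hat u η) ξ -
      cv (hat f) (fun η => (mu s N η : ℂ) * (ix η * hat u η)) ξ) 2 volume ≤
      ENNReal.ofReal (commC s * A * B / e ^ 2) := by
  have hA := hf.2.1
  have hB := hu.2.1
  have hE := embC_nonneg s
  have hr := (hu.rep_deriv hs he.le).2
  set U : ℝ → ℂ := fun η => ix η * hat u η with hU
  have hfi := hf.1.1
  have hUi := hr.1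
  have hμU : Integrable fun η => (mu s N η : ℂ) * U η :=
    (bandLimited (by linarith) (aesm_mu s N) (norm_mu_le s N) hr.2.1).1
  have hs1 : (1 : ℝ) ≤ s := by linarith
  -- Both convolutions exist for almost every frequency, where they combine into one integral with
  -- kernel μ(ξ) - μ(ξ - t).
  have e1 : (fun ξ => (mu s N ξ : ℂ) * cv (hat f) U ξ -
      cv (hat f) (fun η => (mu s N η : ℂ) * U η) ξ) =ᵐ[volume]
      fun ξ => ∫ t, ((mu s N ξ - mu s N (ξ - t) : ℝ) : ℂ) * (hat f t * U (ξ - t)) := by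
    filter_upwards [hfi.ae_convolution_exists (ContinuousLinearMap.mul ℂ ℂ) hUi,
      hfi.ae_convolution_exists (ContinuousLinearMap.mul ℂ ℂ) hμU] with ξ h1 h2
    have h1' : Integrable fun t => hat f t * U (ξ - t) := h1
    have h2' : Integrable fun t => hat f t * ((mu s N (ξ - t) : ℂ) * U (ξ - t)) := h2
    rw [cv, cv, ← integral_const_mul, ← integral_sub (h1'.const_mul _) h2']
    refine integral_congr_ae (ae_of_all _ fun t => ?_)
    push_cast
    ring
  rw [eLpNorm_congr_ae e1]
  have cX : Measurable fun t : ℝ => |2 * Real.pi * t| := by fun_prop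
  have cJ : Measurable fun t : ℝ => jap (s + 1) (2 * Real.pi * t) :=
    ((continuous_jap _).comp (by fun_prop)).measurable
  have hk := bilinear_bound (memLp_hat f).1 hr.2.1.1
    (fun ξ t => ((mu s N ξ - mu s N (ξ - t) : ℝ) : ℂ))
    (w₁ := fun t => |2 * Real.pi * t| * jap (s + 1) (2 * Real.pi * t)) (w₂ := fun _ => 1)
    (w₃ := fun t => |2 * Real.pi * t|) (w₄ := fun t => jap (s + 1) (2 * Real.pi * t))
    (cX.mul cJ) measurable_const cX cJ
    (fun t => mul_nonneg (abs_nonneg _) (jap_pos _ _).le) (fun _ => zero_le_one)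
    (fun t => abs_nonneg _) (fun t => (jap_pos _ _).le)
    (C := (2 + 4 * s) * (2 ^ (s + 1) + 1)) (by positivity) (fun ξ t => by
      rw [Complex.norm_real, Real.norm_eq_abs]
      have h1 := abs_sq_mul_tent_sub_le hs1 N (2 * Real.pi * ξ) (2 * Real.pi * (ξ - t))
      have h2 := jap_add_le (r := s + 1) (by linarith) (2 * Real.pi * t) (2 * Real.pi * (ξ - t))
      rw [show 2 * Real.pi * t + 2 * Real.pi * (ξ - t) = 2 * Real.pi * ξ by ring] at h2
      rw [show 2 * Real.pi * ξ - 2 * Real.pi * (ξ - t) = 2 * Real.pi * t by ring] at h1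
      refine h1.trans ?_
      have h3 := (jap_pos (s + 1) (2 * Real.pi * t)).le
      have h4 := (jap_pos (s + 1) (2 * Real.pi * (ξ - t))).le
      have h5 : 0 ≤ (2 + 4 * s) * |2 * Real.pi * t| := by positivity
      have h6 : jap (s + 1) (2 * Real.pi * ξ) + jap (s + 1) (2 * Real.pi * (ξ - t)) ≤
          (2 ^ (s + 1) + 1) * (jap (s + 1) (2 * Real.pi * t) +
            jap (s + 1) (2 * Real.pi * (ξ - t))) := by linarith
      refine (mul_le_mul_of_nonneg_left h6 h5).trans (le_of_eq ?_)
      ring)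
  refine hk.trans ?_
  have he2 : 0 < e ^ 2 := by positivity
  have b1 : nW (fun t => |2 * Real.pi * t| * jap (s + 1) (2 * Real.pi * t)) (hat f) ≤
      ENNReal.ofReal (A / e ^ 2) := by
    refine (nW_mono (fun t => mul_nonneg (abs_nonneg _) (jap_pos _ _).le)
      (jap_sq_weight_le he he1) (hat f)).trans ?_
    rw [nW_const_mul (by positivity), div_eq_inv_mul, ENNReal.ofReal_mul (by positivity)]
    exact mul_le_mul_right hf.2.2 _
  have b2 : nW1 (fun _ => 1) U ≤ ENNReal.ofReal (embC s * B) := by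
    rw [nW1_one]; exact nW1_ix_le hs he.le hu
  have b3 : nW1 (fun t => |2 * Real.pi * t|) (hat f) ≤ ENNReal.ofReal (embC s * A) := by
    refine le_trans (le_of_eq ?_) (nW1_ix_le hs he.le hf)
    refine lintegral_congr fun ξ => ?_
    rw [enorm_ofReal_mul (abs_nonneg _), enorm_mul, ← ofReal_norm (ix ξ), norm_ix]
  have b4 : nW (fun t => jap (s + 1) (2 * Real.pi * t)) U ≤ ENNReal.ofReal (B / e ^ 2) := by
    have : nW (fun t => jap (s + 1) (2 * Real.pi * t)) U =
        nW (fun t => |2 * Real.pi * t| * jap (s + 1) (2 * Real.pi * t)) (hat u) := by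
      refine eLpNorm_congr_enorm_ae (ae_of_all _ fun ξ => ?_)
      rw [enorm_ofReal_mul (jap_pos _ _).le, hU, enorm_mul, ← ofReal_norm (ix ξ), norm_ix,
        enorm_ofReal_mul (mul_nonneg (abs_nonneg _) (jap_pos _ _).le), ← mul_assoc,
        ← ENNReal.ofReal_mul (jap_pos _ _).le, mul_comm (jap _ _)]
    rw [this]
    refine (nW_mono (fun t => mul_nonneg (abs_nonneg _) (jap_pos _ _).le)
      (jap_sq_weight_le he he1) (hat u)).trans ?_
    rw [nW_const_mul (by positivity), div_eq_inv_mul, ENNReal.ofReal_mul (by positivity)]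
    exact mul_le_mul_right hu.2.2 _
  calc _ ≤ ENNReal.ofReal ((2 + 4 * s) * (2 ^ (s + 1) + 1)) *
        (ENNReal.ofReal (A / e ^ 2) * ENNReal.ofReal (embC s * B) +
          ENNReal.ofReal (embC s * A) * ENNReal.ofReal (B / e ^ 2)) := by
        gcongr
    _ = _ := by
        rw [← ENNReal.ofReal_mul (by positivity), ← ENNReal.ofReal_mul (by positivity),
          ← ENNReal.ofReal_add (by positivity) (by positivity),
          ← ENNReal.ofReal_mul (by positivity)]
        congr 1
        unfold commC
        field_simp
        ring

/-- The pairing `∫ ρ T F \overline{T G}`. -/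
def pairT (s N : ℝ) (ρ : ℝ → ℝ) (F G : ℝ → ℂ) : ℂ :=
  ∫ x, (ρ x : ℂ) * tf s N F x * (starRingEnd ℂ) (tf s N G x)

theorem tf_congr (s N : ℝ) {F G : ℝ → ℂ} (h : F =ᵐ[volume] G) : tf s N F = tf s N G := by
  funext x
  rw [tf, tf, Real.fourierInv_eq, Real.fourierInv_eq]
  refine integral_congr_ae ?_
  filter_upwards [h] with ξ hξ
  rw [hξ]

theorem tf_add {s : ℝ} (hs : 1 ≤ s) (N : ℝ) {F G : ℝ → ℂ} (hF : MemLp F 2) (hG : MemLp G 2) :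
    tf s N (F + G) = tf s N F + tf s N G := by
  rw [tf, tf, tf, ← fourierInv_add_of_integrable (rep_tf hs N hF).1 (rep_tf hs N hG).1]
  congr 1
  funext ξ
  simp [mul_add]

theorem tf_smul {s : ℝ} (hs : 1 ≤ s) (N : ℝ) {F : ℝ → ℂ} (c : ℂ) (hF : MemLp F 2) :
    tf s N (c • F) = c • tf s N F := by
  have := (Rep.smul c (rep_tf hs N hF)).2.2
  rw [this, tf]
  congr 1
  funext ξ
  simp; ring

section pairT

variable {s N : ℝ} {ρ : ℝ → ℝ} {R : ℝ} {F F' G : ℝ → ℂ}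

theorem integrable_pairT (hs : 1 ≤ s) (hρ : AEStronglyMeasurable ρ) (hR : ∀ x, |ρ x| ≤ R)
    (hF : MemLp F 2) (hG : MemLp G 2) :
    Integrable fun x => (ρ x : ℂ) * tf s N F x * (starRingEnd ℂ) (tf s N G x) :=
  integrable_mul_conj hρ hR (rep_tf hs N hF).memLp (rep_tf hs N hG).memLp

theorem pairT_add (hs : 1 ≤ s) (hρ : AEStronglyMeasurable ρ) (hR : ∀ x, |ρ x| ≤ R)
    (hF : MemLp F 2) (hF' : MemLp F' 2) (hG : MemLp G 2) :
    pairT s N ρ (F + F') G = pairT s N ρ F G + pairT s N ρ F' G := by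
  rw [pairT, pairT, pairT, ← integral_add (integrable_pairT hs hρ hR hF hG)
    (integrable_pairT hs hρ hR hF' hG), tf_add hs N hF hF']
  refine integral_congr_ae (ae_of_all _ fun x => ?_)
  simp only [Pi.add_apply]
  ring

theorem pairT_smul (hs : 1 ≤ s) (c : ℂ) (hF : MemLp F 2) :
    pairT s N ρ (c • F) G = c * pairT s N ρ F G := by
  rw [pairT, pairT, ← integral_const_mul, tf_smul hs N c hF]
  refine integral_congr_ae (ae_of_all _ fun x => ?_)
  simp only [Pi.smul_apply, smul_eq_mul]
  ring

theorem norm_pairT_le (hs : 1 ≤ s) (hR : ∀ x, |ρ x| ≤ R) (hF : MemLp F 2) (hG : MemLp G 2)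
    {A B : ℝ} (hA0 : 0 ≤ A) (hB0 : 0 ≤ B)
    (hA : eLpNorm (fun ξ => (mu s N ξ : ℂ) * F ξ) 2 volume ≤ ENNReal.ofReal A)
    (hB : eLpNorm (fun ξ => (mu s N ξ : ℂ) * G ξ) 2 volume ≤ ENNReal.ofReal B) :
    ‖pairT s N ρ F G‖ ≤ R * A * B :=
  norm_integral_mul_conj_le hR (rep_tf hs N hF).memLp (rep_tf hs N hG).memLp hA0 hB0
    (by rw [(rep_tf hs N hF).eLpNorm_eq]; exact hA)
    (by rw [(rep_tf hs N hG).eLpNorm_eq]; exact hB)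

end pairT

theorem Sb.continuous_deriv {s e : ℝ} (hs : 3 / 2 < s) (he : 0 ≤ e) {k : ℕ} {f : ℝ → ℝ} {A : ℝ}
    (hf : Sb s e k f A) : Continuous (_root_.deriv f) :=
  Complex.continuous_re.comp (hf.rep_deriv hs he).2.continuous

/-- Commuting a coefficient with the truncated operator inside the pairing. -/
theorem norm_pairT_commutator_le {s e : ℝ} (hs : 3 / 2 < s) (he : 0 < e) (he1 : e ≤ 1) (N : ℝ)
    {f u : ℝ → ℝ} {A B R D : ℝ} (hf : Sb s e 2 f A) (hu : Sb s e 2 u B) {ρ : ℝ → ℝ}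
    (hρ : AEStronglyMeasurable ρ) (hR : ∀ x, |ρ x| ≤ R) {G : ℝ → ℂ} (hG : MemLp G 2)
    (hD0 : 0 ≤ D) (hD : eLpNorm (fun ξ => (mu s N ξ : ℂ) * G ξ) 2 volume ≤ ENNReal.ofReal D) :
    ‖pairT s N ρ (cv (hat f) fun η => ix η * hat u η) G -
      ∫ x, ((ρ x * f x : ℝ) : ℂ) * tf s N (fun η => ix η * hat u η) x *
        (starRingEnd ℂ) (tf s N G x)‖ ≤ R * (commC s * A * B / e ^ 2) * D := by
  have hs1 : (1 : ℝ) ≤ s := by linarith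
  have hr := (hu.rep_deriv hs he.le).2
  set U : ℝ → ℂ := fun η => ix η * hat u η with hU
  have hcv : MemLp (cv (hat f) U) 2 := memLp_cv hf.1.1 hr.1 hr.2.1
  have hT := rep_tf hs1 N hcv
  have hgU := rep_tf hs1 N hr.2.1
  have hgG := rep_tf hs1 N hG
  -- The product of f with the truncated derivative of u has transform f̂ * (μ Û), so T(f u_x) - f T
  -- u_x has the commutator as its Fourier transform.
  have hprod := Rep.mul hf.1 hgU
  have hdiff := hT.add (hprod.smul (-1))
  have hfb := fun x => hf.abs_le hs he.le x
  have hρf : ∀ x, |ρ x * f x| ≤ R * (embC s * A) := fun x => by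
    rw [abs_mul]
    exact mul_le_mul (hR x) (hfb x) (abs_nonneg _) ((abs_nonneg _).trans (hR x))
  have hfc : Continuous f := (hf.differentiable hs he.le).continuous
  have e1 : pairT s N ρ (cv (hat f) U) G -
      ∫ x, ((ρ x * f x : ℝ) : ℂ) * tf s N U x * (starRingEnd ℂ) (tf s N G x) =
      ∫ x, (ρ x : ℂ) * (tf s N (cv (hat f) U) + (-1 : ℂ) • ((fun x => (f x : ℂ)) * tf s N U)) x *
        (starRingEnd ℂ) (tf s N G x) := by
    rw [pairT, ← integral_sub (integrable_pairT hs1 hρ hR hcv hG)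
      (integrable_mul_conj (p := fun x => ρ x * f x) (hρ.mul hfc.aestronglyMeasurable) hρf
        hgU.memLp hgG.memLp)]
    refine integral_congr_ae (ae_of_all _ fun x => ?_)
    simp only [Pi.add_apply, Pi.smul_apply, Pi.mul_apply, smul_eq_mul]
    push_cast
    ring
  rw [e1]
  have hA := hf.2.1
  have hB := hu.2.1
  have hc := commC_nonneg (s := s) (by linarith)
  refine norm_integral_mul_conj_le hR hdiff.memLp hgG.memLp (by positivity) hD0 ?_ ?_
  · rw [hdiff.eLpNorm_eq]
    refine le_trans (le_of_eq ?_) (commutator_bound hs he he1 N hf hu)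
    congr 1
    funext ξ
    simp [sub_eq_add_neg, hU]
  · rw [hgG.eLpNorm_eq]; exact hD

/-- The transport estimate. -/
theorem abs_re_pairT_transport_le {s e : ℝ} (hs : 3 / 2 < s) (he : 0 < e) (he1 : e ≤ 1) (N : ℝ)
    {f u : ℝ → ℝ} {A B R : ℝ} (hf : Sb s e 2 f A) (hu : Sb s e 2 u B) {ρ ρ' : ℝ → ℝ}
    (hρ : ∀ x, HasDerivAt ρ (ρ' x) x) (hρ' : Continuous ρ') (hR : ∀ x, |ρ x| ≤ R)
    (hR' : ∀ x, |ρ' x| ≤ R) :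
    |(pairT s N ρ (cv (hat f) fun η => ix η * hat u η) (hat u)).re| ≤
      R * (commC s + 2 * embC s) * A * (B / e ^ 2) ^ 2 := by
  have hs1 : (1 : ℝ) ≤ s := by linarith
  have hρc : Continuous ρ := continuous_iff_continuousAt.2 fun x => (hρ x).continuousAt
  have hB := hu.2.1
  have hA := hf.2.1
  have hE := embC_nonneg s
  have hD := nW_mu_le (s := s) he N hu
  have h1 := norm_pairT_commutator_le hs he he1 N hf hu hρc.aestronglyMeasurable hR (memLp_hat u)
    (D := B / e ^ 2) (by positivity) hD
  have hR0 : 0 ≤ R := (abs_nonneg _).trans (hR 0)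
  have hgu := rep_tf hs1 N (memLp_hat u)
  have hfd := hf.differentiable hs he.le
  have hfc' : Continuous (deriv f) := hf.continuous_deriv hs he.le
  -- With the coefficient outside the operator, the pairing is ∫ ρ f g' ḡ for g = T u. The
  -- derivative of ρ f is bounded by the sum of two terms of size R · embC · A.
  have h2 := abs_re_integral_transport_le (p := fun x => ρ x * f x)
    (p' := fun x => ρ' x * f x + ρ x * deriv f x) (g := tf s N (hat u))
    (g' := tf s N fun η => ix η * hat u η)
    (P := R * (embC s * A)) (P' := 2 * (R * (embC s * A))) (B := B / e ^ 2)
    (fun x => (hρ x).mul (hfd x).hasDerivAt)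
    ((hρ'.mul hfd.continuous).add (hρc.mul hfc')).aestronglyMeasurable
    (hasDerivAt_tf hs1 N (memLp_hat u))
    (fun x => by
      rw [abs_mul]
      exact mul_le_mul (hR x) (hf.abs_le hs he.le x) (abs_nonneg _) hR0)
    (fun x => by
      refine (abs_add_le _ _).trans ?_
      rw [abs_mul, abs_mul, two_mul]
      exact add_le_add (mul_le_mul (hR' x) (hf.abs_le hs he.le x) (abs_nonneg _) hR0)
        (mul_le_mul (hR x) (hf.abs_deriv_le hs he.le x) (abs_nonneg _) hR0))
    hgu.memLp (rep_tf_ix hs1 N (memLp_hat u)).memLp (by positivity)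
    (by rw [hgu.eLpNorm_eq]; exact hD)
  have h3 := (Complex.abs_re_le_norm _).trans h1
  rw [Complex.sub_re] at h3
  have h4 := abs_add_le ((pairT s N ρ (cv (hat f) fun η => ix η * hat u η) (hat u)).re -
    (∫ x, ((ρ x * f x : ℝ) : ℂ) * tf s N (fun η => ix η * hat u η) x *
        (starRingEnd ℂ) (tf s N (hat u) x)).re)
    (∫ x, ((ρ x * f x : ℝ) : ℂ) * tf s N (fun η => ix η * hat u η) x *
        (starRingEnd ℂ) (tf s N (hat u) x)).re
  rw [sub_add_cancel] at h4
  refine h4.trans ((add_le_add h3 h2).trans (le_of_eq ?_))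
  ring

/-! ### Elliptic estimates for the operator in front of the acceleration -/

/-- The weight `⟨X⟩^r`. -/
def jw (r ξ : ℝ) : ℝ := jap r (2 * Real.pi * ξ)

theorem jw_pos (r ξ : ℝ) : 0 < jw r ξ := jap_pos _ _

theorem continuous_jw (r : ℝ) : Continuous (jw r) := (continuous_jap r).comp (by fun_prop)

theorem sw_zero (s e : ℝ) : sw s e 0 = jw s := by
  funext ξ; simp [sw, jw]

/-- The constant in `‖⟨X⟩^(r-1) F‖_{L¹} ≤ C ‖⟨X⟩^r F‖_{L²}`. -/
def jawC : ℝ := (eLpNorm (jw (-1)) 2 volume).toReal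

theorem nW1_jw_le (r : ℝ) {F : ℝ → ℂ} (hF : AEStronglyMeasurable F) :
    nW1 (jw (r - 1)) F ≤ ENNReal.ofReal jawC * nW (jw r) F := by
  have hm : MemLp (jw (-1)) 2 volume := memLp_jap_neg (r := -1) (by norm_num)
  have hmeas : AEStronglyMeasurable (fun ξ => (jw r ξ : ℂ) * F ξ) :=
    (Complex.continuous_ofReal.comp (continuous_jw r)).aestronglyMeasurable.mul hF
  calc nW1 (jw (r - 1)) F ≤ ∫⁻ ξ, (‖jw (-1) ξ‖ₑ * ‖(jw r ξ : ℂ) * F ξ‖ₑ) := by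
        refine lintegral_mono fun ξ => le_of_eq ?_
        rw [enorm_ofReal_mul (jw_pos _ _).le, enorm_ofReal_mul (jw_pos _ _).le,
          Real.enorm_of_nonneg (jw_pos _ _).le, ← mul_assoc, ← ENNReal.ofReal_mul (jw_pos _ _).le]
        congr 2
        rw [jw, jw, jw, ← jap_add]
        congr 1; ring
    _ ≤ eLpNorm (jw (-1)) 2 volume * nW (jw r) F := by
        have := ENNReal.lintegral_mul_le_Lp_mul_Lq volume (Real.HolderConjugate.two_two)
          hm.1.enorm hmeas.enorm
        simpa [nW, eLpNorm_eq_lintegral_rpow_enorm_toReal] using this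
    _ = _ := by rw [jawC, ENNReal.ofReal_toReal hm.2.ne]

/-- Products of `H^s` functions with functions of lower regularity. -/
theorem nW_cv_le {s q : ℝ} (hq : 0 ≤ q) (hqs : q ≤ s - 1) {F G : ℝ → ℂ}
    (hF : AEStronglyMeasurable F) (hG : AEStronglyMeasurable G) :
    nW (jw q) (cv F G) ≤ ENNReal.ofReal (2 ^ s * jawC) * nW (jw s) F * nW (jw q) G := by
  have e1 : nW (jw q) (cv F G) =
      eLpNorm (fun ξ => ∫ t, (jw q ξ : ℂ) * (F t * G (ξ - t))) 2 volume := by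
    rw [nW]
    congr 1
    funext ξ
    rw [cv, integral_const_mul]
  rw [e1]
  -- Submultiplicativity of the bracket puts the whole weight on both factors, so one of the two
  -- summands of the bilinear bound is empty. The L¹ norm of F at order q ≤ s - 1 is then controlled
  -- at order s.
  have hk := bilinear_bound hF hG (fun ξ _ => (jw q ξ : ℂ)) (w₁ := fun _ => 0) (w₂ := fun _ => 0)
    measurable_const measurable_const (continuous_jw q).measurable (continuous_jw q).measurable
    (fun _ => le_rfl) (fun _ => le_rfl) (fun t => (jw_pos q t).le) (fun t => (jw_pos q t).le)
    (C := 2 ^ s) (by positivity) (fun ξ t => by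
      rw [Complex.norm_real, Real.norm_of_nonneg (jw_pos q ξ).le]
      have h := jap_add_le_mul hq (2 * Real.pi * t) (2 * Real.pi * (ξ - t))
      rw [show 2 * Real.pi * t + 2 * Real.pi * (ξ - t) = 2 * Real.pi * ξ by ring] at h
      have h1 : 0 ≤ jw q t * jw q (ξ - t) := mul_nonneg (jw_pos q t).le (jw_pos q _).le
      have h2 : (2 : ℝ) ^ q ≤ 2 ^ s := Real.rpow_le_rpow_of_exponent_le (by norm_num) (by linarith)
      simp only [mul_zero, zero_add]
      exact h.trans (mul_le_mul_of_nonneg_right h2 h1))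
  refine hk.trans ?_
  have h3 : nW1 (jw q) F ≤ ENNReal.ofReal jawC * nW (jw s) F :=
    (nW1_mono (fun ξ => (jw_pos q ξ).le) (fun ξ => jap_mono hqs _) F).trans (nW1_jw_le s hF)
  have h4 : nW (fun _ => (0 : ℝ)) F = 0 := by simp [nW]
  rw [h4, zero_mul, zero_add, ENNReal.ofReal_mul (by positivity), mul_assoc, mul_assoc]
  calc _ ≤ ENNReal.ofReal (2 ^ s) * ((ENNReal.ofReal jawC * nW (jw s) F) * nW (jw q) G) := by
        gcongr
    _ = _ := by ring

/-- Functions of class `H²`. -/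
def H2 (z : ℝ → ℝ) : Prop := Nice z ∧ nW (jw 2) (hat z) < ⊤

theorem H2.rep_deriv {z : ℝ → ℝ} (h : H2 z) :
    Differentiable ℝ z ∧ Rep (fun x => ((deriv z x : ℝ) : ℂ)) fun ξ => ix ξ * hat z ξ := by
  have hm : AEStronglyMeasurable (fun ξ => ix ξ * hat z ξ) :=
    continuous_ix.aestronglyMeasurable.mul (memLp_hat z).1
  have hX : ∀ ξ, |2 * Real.pi * ξ| ≤ jw (2 - 1) ξ := fun ξ => by
    rw [jw, show (2 - 1 : ℝ) = 1 by norm_num]; exact abs_le_jap_one _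
  have hb : ∀ (r ξ : ℝ), |2 * Real.pi * ξ| ≤ jw r ξ →
      ‖ix ξ * hat z ξ‖ₑ ≤ ‖(jw r ξ : ℂ) * hat z ξ‖ₑ := fun r ξ hr => by
    rw [enorm_mul, enorm_ofReal_mul (jw_pos r ξ).le, ← ofReal_norm (ix ξ), norm_ix]
    exact mul_le_mul_left (ENNReal.ofReal_le_ofReal hr) _
  refine Boussinesq.rep_deriv h.1 ⟨hm, ?_⟩ ⟨hm, ?_⟩
  · refine (lintegral_mono fun ξ => hb (2 - 1) ξ (hX ξ)).trans_lt
      ((nW1_jw_le 2 (memLp_hat z).1).trans_lt (ENNReal.mul_lt_top ENNReal.ofReal_lt_top h.2))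
  · refine (eLpNorm_mono_enorm fun ξ => hb 2 ξ ((hX ξ).trans (jap_mono (by norm_num) _))).trans_lt h.2

theorem H2.nice_deriv {z : ℝ → ℝ} (h : H2 z) : Nice (deriv z) := nice_of_rep h.rep_deriv.2

theorem H2.hat_deriv {z : ℝ → ℝ} (h : H2 z) : hat (deriv z) =ᵐ[volume] fun ξ => ix ξ * hat z ξ :=
  hat_ae_eq h.rep_deriv.2

theorem ix_mul_cv {F G : ℝ → ℂ} (hF : Integrable F) (hG : Integrable G)
    (hF' : Integrable fun ξ => ix ξ * F ξ) (hG' : Integrable fun ξ => ix ξ * G ξ) :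
    (fun ξ => ix ξ * cv F G ξ) =ᵐ[volume]
      cv (fun ξ => ix ξ * F ξ) G + cv F (fun ξ => ix ξ * G ξ) := by
  filter_upwards [hF'.ae_convolution_exists (ContinuousLinearMap.mul ℂ ℂ) hG,
    hF.ae_convolution_exists (ContinuousLinearMap.mul ℂ ℂ) hG'] with ξ h1 h2
  have h1' : Integrable fun t => (ix t * F t) * G (ξ - t) := h1
  have h2' : Integrable fun t => F t * (ix (ξ - t) * G (ξ - t)) := h2
  rw [Pi.add_apply, cv, cv, cv, ← integral_const_mul, ← integral_add h1' h2']
  refine integral_congr_ae (ae_of_all _ fun t => ?_)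
  simp only [ix]
  push_cast
  ring

/-- The symbol `1 + e²X²/3 + e⁴X⁴/45`. -/
def psym (e ξ : ℝ) : ℝ :=
  1 + e ^ 2 / 3 * (2 * Real.pi * ξ) ^ 2 + e ^ 4 / 45 * (2 * Real.pi * ξ) ^ 4

theorem one_le_psym (e ξ : ℝ) : 1 ≤ psym e ξ := by
  unfold psym
  have : 0 ≤ e ^ 2 / 3 * (2 * Real.pi * ξ) ^ 2 + e ^ 4 / 45 * (2 * Real.pi * ξ) ^ 4 := by
    positivity
  linarith

theorem psym_eq (e ξ : ℝ) : psym e ξ =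
    1 + (e * |2 * Real.pi * ξ|) ^ 2 / 3 + (e * |2 * Real.pi * ξ|) ^ 4 / 45 := by
  have h2 := sq_abs (2 * Real.pi * ξ)
  have h4 : |2 * Real.pi * ξ| ^ 4 = (2 * Real.pi * ξ) ^ 4 := by
    rw [show 4 = 2 * 2 by norm_num, pow_mul, h2, ← pow_mul]
  rw [psym, mul_pow e, mul_pow e, h2, h4]
  ring

/-- The cubic polynomial `((1 + e²a)³ - 1) / e²`. -/
def rho (e : ℝ) (a : ℝ → ℝ) (x : ℝ) : ℝ :=
  3 * a x + (3 * e ^ 2 * (a x * a x) + e ^ 4 * (a x * (a x * a x)))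

theorem rho_eq (e : ℝ) (a : ℝ → ℝ) (x : ℝ) : 1 + e ^ 2 * rho e a x = (1 + e ^ 2 * a x) ^ 3 := by
  unfold rho; ring

def rhoC (s A : ℝ) : ℝ := 3 * A + (3 * (algC s * A * A) + algC s * A * (algC s * A * A))

theorem rhoC_nonneg {s A : ℝ} (hA : 0 ≤ A) : 0 ≤ rhoC s A := by
  have := one_le_algC s
  unfold rhoC; positivity

theorem Sb.rho {s e : ℝ} (hs : 3 / 2 < s) (he : 0 ≤ e) (he1 : e ≤ 1) {k : ℕ} {a : ℝ → ℝ} {A : ℝ}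
    (h : Sb s e k a A) : Sb s e k (Boussinesq.rho e a) (rhoC s A) := by
  have hA := h.2.1
  have hC := one_le_algC s
  have h2 := h.mul hs he h
  have h3 := h.mul hs he h2
  refine ((h.const_mul 3).add ((h2.const_mul (3 * e ^ 2)).add (h3.const_mul (e ^ 4)))).mono ?_
  have e2 : |3 * e ^ 2| ≤ 3 := by
    rw [abs_of_nonneg (by positivity)]; nlinarith
  have e4 : |e ^ 4| ≤ 1 := by
    rw [abs_of_nonneg (by positivity)]; exact pow_le_one₀ he he1
  have e3 : |(3 : ℝ)| = 3 := abs_of_nonneg (by norm_num)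
  rw [e3]
  unfold rhoC
  have h4 : 0 ≤ algC s * A * A := by positivity
  have h5 : 0 ≤ algC s * A * (algC s * A * A) := by positivity
  nlinarith

theorem integrable_conj {a b : ℝ → ℂ} (ha : MemLp a 2) (hb : MemLp b 2) :
    Integrable fun x => a x * (starRingEnd ℂ) (b x) := ha.integrable_mul hb.star

theorem norm_integral_conj_le {a b : ℝ → ℂ} {A B : ℝ} (ha : MemLp a 2) (hb : MemLp b 2)
    (hA0 : 0 ≤ A) (hB0 : 0 ≤ B) (hA : eLpNorm a 2 volume ≤ ENNReal.ofReal A)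
    (hB : eLpNorm b 2 volume ≤ ENNReal.ofReal B) :
    ‖∫ x, a x * (starRingEnd ℂ) (b x)‖ ≤ A * B := by
  have := norm_integral_mul_conj_le (p := fun _ => 1) (P := 1) (by simp) ha hb hA0 hB0 hA hB
  simpa using this

theorem re_integral_conj_self {a : ℝ → ℂ} (ha : MemLp a 2) :
    (∫ x, a x * (starRingEnd ℂ) (a x)).re = (eLpNorm a 2 volume).toReal ^ 2 := by
  have h := inner_self_eq_norm_sq (𝕜 := ℂ) (ha.toLp a)
  rw [L2.inner_def, Lp.norm_toLp] at h
  rw [← h]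
  refine congrArg Complex.re (integral_congr_ae ?_)
  filter_upwards [ha.coeFn_toLp] with x hx
  rw [hx, RCLike.inner_apply]

theorem integral_add_three {f₁ f₂ f₃ : ℝ → ℂ} (h₁ : Integrable f₁) (h₂ : Integrable f₂)
    (h₃ : Integrable f₃) :
    ∫ x, (f₁ x + f₂ x + f₃ x) = (∫ x, f₁ x) + (∫ x, f₂ x) + ∫ x, f₃ x := by
  rw [integral_add (f := fun x => f₁ x + f₂ x) (h₁.add h₂) h₃, integral_add h₁ h₂]

theorem integral_add_five {f₁ f₂ f₃ f₄ f₅ : ℝ → ℂ} (h₁ : Integrable f₁) (h₂ : Integrable f₂)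
    (h₃ : Integrable f₃) (h₄ : Integrable f₄) (h₅ : Integrable f₅) :
    ∫ x, (f₁ x + f₂ x + f₃ x + f₄ x + f₅ x) =
      (∫ x, f₁ x) + (∫ x, f₂ x) + (∫ x, f₃ x) + (∫ x, f₄ x) + ∫ x, f₅ x := by
  rw [integral_add (f := fun x => f₁ x + f₂ x + f₃ x + f₄ x) (((h₁.add h₂).add h₃).add h₄) h₅,
    integral_add (f := fun x => f₁ x + f₂ x + f₃ x) ((h₁.add h₂).add h₃) h₄,
    integral_add_three h₁ h₂ h₃]

theorem conj_ix (ξ : ℝ) : (starRingEnd ℂ) (ix ξ) = -ix ξ := by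
  rw [ix, map_mul, Complex.conj_ofReal, Complex.conj_I, mul_neg]

/-- Testing the equation with z. On the left the depth times z² is at least c z², and the first
order terms combine into (e²/3) ∫ h³ z_x² ≥ 0. The fourth order term is kept, since it absorbs the
part of the right-hand side paired with Y = (eX)² ẑ. -/
theorem elliptic_coercive {s e A c g : ℝ} (hs : 3 / 2 < s) (he : 0 < e) (he1 : e ≤ 1)
    (hc : 0 < c) {a z : ℝ → ℝ} (ha : Sb s e 1 a A) (hz : H2 z) (hh : ∀ x, c ≤ 1 + e ^ 2 * a x)
    {G : ℝ → ℂ} (hG : AEStronglyMeasurable G) (hg0 : 0 ≤ g)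
    (hGg : nW (sw s e 1) G ≤ ENNReal.ofReal g)
    (heq : ∀ᵐ ξ, (psym e ξ : ℂ) * hat z ξ + (e ^ 2 : ℝ) * hat (fun x => a x * z x) ξ -
      (e ^ 4 / 3 : ℝ) * (ix ξ * hat (fun x => rho e a x * deriv z x) ξ) = (psym e ξ : ℂ) * G ξ) :
    eLpNorm (hat z) 2 volume ≤ ENNReal.ofReal ((2 + c) / c * g) := by
  have hdz := hz.rep_deriv.2
  have hr := ha.rho hs he.le he1
  have haz := ha.1.mul hz.1
  have hrz := hr.1.mul hz.nice_deriv
  set Z := hat z with hZ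
  set D : ℝ → ℂ := fun ξ => ix ξ * Z ξ with hD
  let y2 : ℝ → ℝ := fun ξ => (e * |2 * Real.pi * ξ|) ^ 2
  have hy2 : Continuous y2 := by fun_prop
  have hy2m : AEStronglyMeasurable (fun ξ => (y2 ξ : ℂ)) :=
    (Complex.continuous_ofReal.comp hy2).aestronglyMeasurable
  set Y : ℝ → ℂ := fun ξ => (y2 ξ : ℂ) * Z ξ with hY
  set YG : ℝ → ℂ := fun ξ => (y2 ξ : ℂ) * G ξ with hYG
  have mZ : MemLp Z 2 := memLp_hat z
  have mD : MemLp D 2 := hdz.2.1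
  have y2nn : ∀ ξ, 0 ≤ y2 ξ := fun ξ => by positivity
  have mY : MemLp Y 2 := by
    refine ⟨hy2m.mul mZ.1, lt_of_le_of_lt ?_ hz.2⟩
    refine nW_mono y2nn (fun ξ => ?_) Z
    rw [jw, jap_two]
    have : y2 ξ = e ^ 2 * (2 * Real.pi * ξ) ^ 2 := by simp only [y2, mul_pow, sq_abs]
    rw [this]
    have h1 : e ^ 2 ≤ 1 := pow_le_one₀ he.le he1
    nlinarith [sq_nonneg (2 * Real.pi * ξ)]
  have bG : eLpNorm G 2 volume ≤ ENNReal.ofReal g := by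
    refine le_trans ?_ hGg
    rw [← nW_one]
    refine nW_mono (fun _ => zero_le_one) (fun ξ => ?_) G
    refine one_le_mul_of_one_le_of_one_le (one_le_jap (by linarith) _) (one_le_pow₀ ?_)
    have : 0 ≤ e * |2 * Real.pi * ξ| := by positivity
    linarith
  -- One factor e|X| is absorbed by ⟨X⟩^s, the other by 1 + e|X|; order one in e thus suffices for
  -- (eX)² G.
  have bYG : eLpNorm YG 2 volume ≤ ENNReal.ofReal g := by
    refine le_trans (nW_mono y2nn (fun ξ => ?_) G) hGg
    rw [sw, pow_one]
    have h1 : |2 * Real.pi * ξ| ≤ jap s (2 * Real.pi * ξ) :=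
      (abs_le_jap_one _).trans (jap_mono (by linarith) _)
    have h2 : 0 ≤ e * |2 * Real.pi * ξ| := by positivity
    have h3 := mul_le_mul_of_nonneg_right he1 (abs_nonneg (2 * Real.pi * ξ))
    calc y2 ξ = (e * |2 * Real.pi * ξ|) * (e * |2 * Real.pi * ξ|) := by simp only [y2, sq]
      _ ≤ jap s (2 * Real.pi * ξ) * (1 + e * |2 * Real.pi * ξ|) :=
        mul_le_mul (by linarith) (by linarith) h2 (jap_pos _ _).le
  have mG : MemLp G 2 := ⟨hG, bG.trans_lt ENNReal.ofReal_lt_top⟩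
  have mYG : MemLp YG 2 := ⟨hy2m.mul hG, bYG.trans_lt ENNReal.ofReal_lt_top⟩
  have maz := memLp_hat fun x => a x * z x
  have mrz := memLp_hat fun x => rho e a x * deriv z x
  -- the energy identity on the Fourier side
  have hpt : (fun ξ => Z ξ * (starRingEnd ℂ) (Z ξ) +
      ((e ^ 2 / 3 : ℝ) : ℂ) * (D ξ * (starRingEnd ℂ) (D ξ)) +
      ((1 / 45 : ℝ) : ℂ) * (Y ξ * (starRingEnd ℂ) (Y ξ)) +
      ((e ^ 2 : ℝ) : ℂ) * (hat (fun x => a x * z x) ξ * (starRingEnd ℂ) (Z ξ)) +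
      ((e ^ 4 / 3 : ℝ) : ℂ) * (hat (fun x => rho e a x * deriv z x) ξ * (starRingEnd ℂ) (D ξ)))
      =ᵐ[volume] fun ξ => G ξ * (starRingEnd ℂ) (Z ξ) +
      ((1 / 3 : ℝ) : ℂ) * (YG ξ * (starRingEnd ℂ) (Z ξ)) +
      ((1 / 45 : ℝ) : ℂ) * (YG ξ * (starRingEnd ℂ) (Y ξ)) := by
    filter_upwards [heq] with ξ hξ
    have e1 : (psym e ξ : ℂ) = 1 + (1 / 3 : ℝ) * (y2 ξ : ℂ) + (1 / 45 : ℝ) * (y2 ξ : ℂ) ^ 2 := by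
      rw [psym_eq]; simp only [y2]; push_cast; ring
    have e2 : ix ξ * ix ξ * (e ^ 2 : ℝ) = -(y2 ξ : ℂ) := by
      have : y2 ξ = e ^ 2 * (2 * Real.pi * ξ) ^ 2 := by simp only [y2, mul_pow, sq_abs]
      rw [this, ix]
      push_cast
      linear_combination (e ^ 2 * (2 * Real.pi * ξ) ^ 2 : ℂ) * Complex.I_mul_I
    have h1 := congrArg (fun w => w * (starRingEnd ℂ) (Z ξ)) hξ
    simp only [hD, hY, hYG, map_mul, conj_ix, Complex.conj_ofReal]
    rw [e1] at h1
    push_cast at h1 e2 ⊢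
    linear_combination h1 - (Z ξ * (starRingEnd ℂ) (Z ξ)) / 3 * e2
  have hint := integral_congr_ae hpt
  have iZ := integrable_conj mZ mZ
  have iD := (integrable_conj mD mD).const_mul ((e ^ 2 / 3 : ℝ) : ℂ)
  have iY := (integrable_conj mY mY).const_mul ((1 / 45 : ℝ) : ℂ)
  have ia := (integrable_conj maz mZ).const_mul ((e ^ 2 : ℝ) : ℂ)
  have ir := (integrable_conj mrz mD).const_mul ((e ^ 4 / 3 : ℝ) : ℂ)
  have jG := integrable_conj mG mZ
  have jY := (integrable_conj mYG mZ).const_mul ((1 / 3 : ℝ) : ℂ)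
  have jYY := (integrable_conj mYG mY).const_mul ((1 / 45 : ℝ) : ℂ)
  rw [integral_add_five iZ iD iY ia ir, integral_add_three jG jY jYY] at hint
  simp only [integral_const_mul] at hint
  have hre := congrArg Complex.re hint
  simp only [Complex.add_re, Complex.re_ofReal_mul] at hre
  -- The products with coefficients are returned to the physical side, where the lower bound of the
  -- depth holds pointwise.
  have real_pair : ∀ {p q : ℝ → ℝ} {P Q : ℝ → ℂ}, Rep (fun x => ((p x : ℝ) : ℂ)) P →
      Rep (fun x => ((q x : ℝ) : ℂ)) Q →
      (∫ ξ, P ξ * (starRingEnd ℂ) (Q ξ)).re = ∫ x, p x * q x := by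
    intro p q P Q hp hq
    rw [← hp.integral_mul_conj hq]
    have : (fun x => ((p x : ℝ) : ℂ) * (starRingEnd ℂ) ((q x : ℝ) : ℂ)) =
        fun x => ((p x * q x : ℝ) : ℂ) := by
      funext x; rw [Complex.conj_ofReal]; push_cast; ring
    rw [this, integral_complex_ofReal, Complex.ofReal_re]
  have int_pair : ∀ {p q : ℝ → ℝ} {P Q : ℝ → ℂ}, Rep (fun x => ((p x : ℝ) : ℂ)) P →
      Rep (fun x => ((q x : ℝ) : ℂ)) Q → Integrable fun x => p x * q x := by
    intro p q P Q hp hq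
    have := (integrable_conj hp.memLp hq.memLp).re
    refine this.congr (ae_of_all _ fun x => ?_)
    simp
  have p1 := real_pair hz.1 hz.1
  have p2 := real_pair haz hz.1
  have p3 := real_pair hrz hdz
  have p4 := real_pair hdz hdz
  rw [← hZ] at p1 p2
  rw [p2, p3, p4, re_integral_conj_self mY] at hre
  have q1 : c * (∫ x, z x * z x) ≤ (∫ x, z x * z x) + e ^ 2 * ∫ x, a x * z x * z x := by
    rw [← integral_const_mul, ← integral_const_mul, ← integral_add (int_pair hz.1 hz.1)
      ((int_pair haz hz.1).const_mul _)]
    refine integral_mono ((int_pair hz.1 hz.1).const_mul _) ((int_pair hz.1 hz.1).add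
      ((int_pair haz hz.1).const_mul _)) fun x => ?_
    have := mul_le_mul_of_nonneg_right (hh x) (mul_self_nonneg (z x))
    linarith
  have q2 : 0 ≤ (∫ x, deriv z x * deriv z x) +
      e ^ 2 * ∫ x, rho e a x * deriv z x * deriv z x := by
    rw [← integral_const_mul, ← integral_add (int_pair hdz hdz)
      ((int_pair hrz hdz).const_mul _)]
    refine integral_nonneg fun x => ?_
    have h1 : 0 ≤ 1 + e ^ 2 * rho e a x := by
      rw [rho_eq]; exact pow_nonneg (hc.le.trans (hh x)) 3
    have := mul_nonneg h1 (mul_self_nonneg (deriv z x))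
    simp only [Pi.zero_apply]
    linarith
  have hu := re_integral_conj_self mZ
  rw [p1] at hu
  rw [p1] at hre
  set u := (eLpNorm Z 2 volume).toReal with hu_def
  set m := (eLpNorm Y 2 volume).toReal with hm_def
  have u0 : 0 ≤ u := ENNReal.toReal_nonneg
  have m0 : 0 ≤ m := ENNReal.toReal_nonneg
  have bZ : eLpNorm Z 2 volume ≤ ENNReal.ofReal u := by
    rw [hu_def, ENNReal.ofReal_toReal mZ.2.ne]
  have bY : eLpNorm Y 2 volume ≤ ENNReal.ofReal m := by
    rw [hm_def, ENNReal.ofReal_toReal mY.2.ne]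
  have t1 := (Complex.re_le_norm _).trans (norm_integral_conj_le mG mZ hg0 u0 bG bZ)
  have t2 := (Complex.re_le_norm _).trans (norm_integral_conj_le mYG mZ hg0 u0 bYG bZ)
  have t3 := (Complex.re_le_norm _).trans (norm_integral_conj_le mYG mY hg0 m0 bYG bY)
  rw [hu] at q1 hre
  have q3 : c * u ^ 2 + m ^ 2 / 45 ≤ 2 * g * u + g * m / 45 := by
    have : 0 ≤ e ^ 2 / 3 * ((∫ x, deriv z x * deriv z x) +
      e ^ 2 * ∫ x, rho e a x * deriv z x * deriv z x) := by positivity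
    nlinarith [mul_nonneg hg0 u0]
  have q4 : c * u ^ 2 ≤ 2 * g * u + g ^ 2 := by nlinarith [sq_nonneg (g - 2 * m), sq_nonneg g]
  -- Completing the square in c u² ≤ 2 g u + g², multiplied by c; taking roots gives c u ≤ (2 + c)
  -- g.
  have q5 : (c * u - g) ^ 2 ≤ ((1 + c) * g) ^ 2 := by nlinarith [sq_nonneg g, sq_nonneg (c * g)]
  have q6 := abs_le_of_sq_le_sq q5 (by positivity)
  have q7 : u ≤ (2 + c) / c * g := by
    rw [div_mul_eq_mul_div, le_div_iff₀ hc]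
    linarith [(abs_le.1 q6).2]
  exact bZ.trans (ENNReal.ofReal_le_ofReal q7)

theorem nW_mul_le {w w' : ℝ → ℝ} {m : ℝ → ℂ} {C : ℝ} (hw : ∀ ξ, 0 ≤ w ξ) (hw' : ∀ ξ, 0 ≤ w' ξ)
    (hC : 0 ≤ C) (h : ∀ ξ, w ξ * ‖m ξ‖ ≤ C * w' ξ) (F : ℝ → ℂ) :
    nW w (fun ξ => m ξ * F ξ) ≤ ENNReal.ofReal C * nW w' F := by
  rw [← nW_const_mul hC]
  refine eLpNorm_mono_enorm fun ξ => ?_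
  rw [enorm_ofReal_mul (hw ξ), enorm_ofReal_mul (mul_nonneg hC (hw' ξ)), enorm_mul, ← mul_assoc,
    ← ofReal_norm (m ξ), ← ENNReal.ofReal_mul (hw ξ)]
  exact mul_le_mul_left (ENNReal.ofReal_le_ofReal (h ξ)) _

theorem continuous_psym (e : ℝ) : Continuous (psym e) := by unfold psym; fun_prop

theorem psym_pos (e ξ : ℝ) : 0 < psym e ξ := zero_lt_one.trans_le (one_le_psym e ξ)

theorem le_psym_one (e ξ : ℝ) : e * |2 * Real.pi * ξ| ≤ psym e ξ := by
  rw [psym_eq]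
  set y := e * |2 * Real.pi * ξ|
  have : 0 ≤ y ^ 4 := by positivity
  nlinarith [sq_nonneg (y - 3 / 2)]

theorem le_psym_two (e ξ : ℝ) : (e * |2 * Real.pi * ξ|) ^ 2 ≤ 3 * psym e ξ := by
  rw [psym_eq]
  set y := e * |2 * Real.pi * ξ|
  have : 0 ≤ y ^ 4 := by positivity
  nlinarith

theorem le_psym_four (e ξ : ℝ) : (e * |2 * Real.pi * ξ|) ^ 4 ≤ 45 * psym e ξ := by
  rw [psym_eq]
  set y := e * |2 * Real.pi * ξ|
  have : 0 ≤ y ^ 2 := by positivity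
  nlinarith

/-- Interpolation between the second and the fourth power: y³ ≤ (y² + y⁴)/2, whence 24 = (3 + 45)/2.
-/
theorem le_psym_three (e ξ : ℝ) :
    (e * |2 * Real.pi * ξ|) ^ 3 ≤ 24 * psym e ξ := by
  have h2 := le_psym_two e ξ
  have h4 := le_psym_four e ξ
  set y := e * |2 * Real.pi * ξ|
  nlinarith [sq_nonneg (y ^ 2 - y)]

theorem norm_div_psym (e ξ : ℝ) (w : ℂ) : ‖w / (psym e ξ : ℂ)‖ = ‖w‖ / psym e ξ := by
  rw [norm_div, Complex.norm_real, Real.norm_of_nonneg (psym_pos e ξ).le]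

theorem aesm_div_psym (e : ℝ) {w : ℝ → ℂ} (hw : Continuous w) {F : ℝ → ℂ}
    (hF : AEStronglyMeasurable F) :
    AEStronglyMeasurable fun ξ => w ξ / (psym e ξ : ℂ) * F ξ := by
  refine AEStronglyMeasurable.mul (Continuous.aestronglyMeasurable ?_) hF
  exact hw.div (Complex.continuous_ofReal.comp (continuous_psym e))
    fun ξ => by exact_mod_cast (psym_pos e ξ).ne'

/-- The form of the elliptic equation in which no derivative falls on `z` inside a product. -/
theorem elliptic_split {s e A : ℝ} (hs : 3 / 2 < s) (he : 0 < e) (he1 : e ≤ 1) {a z : ℝ → ℝ}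
    (ha : Sb s e 1 a A) (hz : H2 z) {G : ℝ → ℂ}
    (heq : ∀ᵐ ξ, (psym e ξ : ℂ) * hat z ξ + (e ^ 2 : ℝ) * hat (fun x => a x * z x) ξ -
      (e ^ 4 / 3 : ℝ) * (ix ξ * hat (fun x => rho e a x * deriv z x) ξ) = (psym e ξ : ℂ) * G ξ) :
    hat z =ᵐ[volume] G +
      ((fun ξ => -((e ^ 2 : ℝ) : ℂ) / (psym e ξ : ℂ) * hat (fun x => a x * z x) ξ) +
      ((fun ξ => ((e ^ 4 / 3 : ℝ) : ℂ) * ix ξ ^ 2 / (psym e ξ : ℂ) *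
        hat (fun x => rho e a x * z x) ξ) +
      fun ξ => -((e ^ 3 / 3 : ℝ) : ℂ) * ix ξ / (psym e ξ : ℂ) *
        hat (fun x => e * deriv (rho e a) x * z x) ξ)) := by
  have hr := ha.rho hs he.le he1
  have hr1 := (hr.nice_deriv hs he.le).const_mul e
  have hR := (hr.rep_deriv hs he.le).2
  have hD := hz.rep_deriv.2
  have hre : Rep (fun x => ((e * deriv (rho e a) x : ℝ) : ℂ))
      ((e : ℂ) • fun ξ => ix ξ * hat (rho e a) ξ) := by
    have := Rep.smul (e : ℂ) hR
    refine (congrArg (fun u => Rep u ((e : ℂ) • fun ξ => ix ξ * hat (rho e a) ξ)) ?_).mp this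
    funext x; simp
  have c1 := hat_ae_eq (f := fun x => rho e a x * deriv z x)
    (F := cv (hat (rho e a)) fun ξ => ix ξ * hat z ξ) (by
      have := Rep.mul hr.1 hD
      refine (congrArg (fun u => Rep u _) ?_).mp this
      funext x; simp)
  have c2 := hat_mul hr.1 hz.1
  have c3 := hat_ae_eq (f := fun x => e * deriv (rho e a) x * z x)
    (F := cv ((e : ℂ) • fun ξ => ix ξ * hat (rho e a) ξ) (hat z)) (by
      have := Rep.mul hre hz.1
      refine (congrArg (fun u => Rep u _) ?_).mp this
      funext x; simp)
  have c4 := ix_mul_cv hr.1.1 hz.1.1 hR.1 hD.1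
  filter_upwards [heq, c1, c2, c3, c4] with ξ h0 h1 h2 h3 h4
  have h5 : cv ((e : ℂ) • fun ξ => ix ξ * hat (rho e a) ξ) (hat z) ξ =
      (e : ℂ) * cv (fun ξ => ix ξ * hat (rho e a) ξ) (hat z) ξ := by
    rw [cv, cv, ← integral_const_mul]
    refine integral_congr_ae (ae_of_all _ fun t => ?_)
    simp only [Pi.smul_apply, smul_eq_mul]
    ring
  simp only [Pi.add_apply] at h4 ⊢
  rw [h2, h3, h5]
  rw [h1] at h0
  have hp : (psym e ξ : ℂ) ≠ 0 := by exact_mod_cast (psym_pos e ξ).ne'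
  field_simp
  push_cast at h0 ⊢
  linear_combination h0 - e ^ 4 / 3 * ix ξ * h4

/-- With ρ z_x = (ρ z)_x - ρ_x z and the division by `psym`, each term with a coefficient is a
multiplier applied to a product with z itself, and the multiplier remains bounded by 9 after
multiplication by 1 + |X|, uniformly in e. The largest contribution is e⁴X²(1 + |X|)/3, bounded by
(3 + 24)/3 times the symbol. One factor e is left with ρ_x because e ρ_x is bounded at order s. -/
theorem elliptic_step {s e A q : ℝ} (hs : 3 / 2 < s) (he : 0 < e) (he1 : e ≤ 1) {a z : ℝ → ℝ}
    (ha : Sb s e 1 a A) (hz : H2 z) {G : ℝ → ℂ} (hG : AEStronglyMeasurable G)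
    (heq : ∀ᵐ ξ, (psym e ξ : ℂ) * hat z ξ + (e ^ 2 : ℝ) * hat (fun x => a x * z x) ξ -
      (e ^ 4 / 3 : ℝ) * (ix ξ * hat (fun x => rho e a x * deriv z x) ξ) = (psym e ξ : ℂ) * G ξ)
    {om : ℝ → ℝ} (hom : Continuous om) (hom0 : ∀ ξ, 0 ≤ om ξ) (hom1 : ∀ ξ, om ξ ≤ 1 + |2 * Real.pi * ξ|) :
    nW (fun ξ => jw q ξ * om ξ) (hat z) ≤ nW (fun ξ => jw q ξ * om ξ) G +
      (ENNReal.ofReal 9 * nW (jw q) (hat fun x => a x * z x) +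
      (ENNReal.ofReal 9 * nW (jw q) (hat fun x => rho e a x * z x) +
      ENNReal.ofReal 9 * nW (jw q) (hat fun x => e * deriv (rho e a) x * z x))) := by
  have hj : ∀ ξ, 0 ≤ jw q ξ := fun ξ => (jw_pos q ξ).le
  have hw : ∀ ξ, 0 ≤ jw q ξ * om ξ := fun ξ => mul_nonneg (hj ξ) (hom0 ξ)
  have hwm : Measurable fun ξ => jw q ξ * om ξ := ((continuous_jw q).mul hom).measurable
  have m1 := aesm_div_psym e (continuous_const (y := -((e ^ 2 : ℝ) : ℂ)))
    (memLp_hat fun x => a x * z x).1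
  have m2 := aesm_div_psym e ((continuous_const (y := ((e ^ 4 / 3 : ℝ) : ℂ))).mul
    (continuous_ix.pow 2)) (memLp_hat fun x => rho e a x * z x).1
  have m3 := aesm_div_psym e ((continuous_const (y := -((e ^ 3 / 3 : ℝ) : ℂ))).mul
    continuous_ix) (memLp_hat fun x => e * deriv (rho e a) x * z x).1
  have key : ∀ (m : ℝ → ℂ), (∀ ξ, (1 + |2 * Real.pi * ξ|) * ‖m ξ‖ ≤ 9) → ∀ F : ℝ → ℂ,
      nW (fun ξ => jw q ξ * om ξ) (fun ξ => m ξ * F ξ) ≤ ENNReal.ofReal 9 * nW (jw q) F := by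
    intro m hm F
    refine nW_mul_le hw hj (by norm_num) (fun ξ => ?_) F
    have h1 := mul_le_mul_of_nonneg_right (hom1 ξ) (norm_nonneg (m ξ))
    calc jw q ξ * om ξ * ‖m ξ‖ = jw q ξ * (om ξ * ‖m ξ‖) := by ring
      _ ≤ jw q ξ * 9 := mul_le_mul_of_nonneg_left (h1.trans (hm ξ)) (hj ξ)
      _ = _ := mul_comm _ _
  have he2 : e ^ 2 ≤ 1 := pow_le_one₀ he.le he1
  rw [nW_congr (elliptic_split hs he he1 ha hz heq)]
  refine (nW_add_le hwm hG (m1.add (m2.add m3))).trans (add_le_add le_rfl ?_)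
  refine (nW_add_le hwm m1 (m2.add m3)).trans (add_le_add (key _ (fun ξ => ?_) _) ?_)
  · rw [norm_div_psym, norm_neg, Complex.norm_real, Real.norm_of_nonneg (by positivity),
      ← mul_div_assoc, div_le_iff₀ (psym_pos e ξ)]
    have h1 := le_psym_one e ξ
    have h2 := one_le_psym e ξ
    have h3 : e * (e * |2 * Real.pi * ξ|) ≤ 1 * (e * |2 * Real.pi * ξ|) :=
      mul_le_mul_of_nonneg_right he1 (by positivity)
    nlinarith
  refine (nW_add_le hwm m2 m3).trans (add_le_add (key _ (fun ξ => ?_) _) (key _ (fun ξ => ?_) _))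
  · simp only [Pi.mul_apply, Pi.pow_apply]
    rw [norm_div_psym, norm_mul, norm_pow, norm_ix, Complex.norm_real,
      Real.norm_of_nonneg (by positivity), ← mul_div_assoc, div_le_iff₀ (psym_pos e ξ)]
    have h2 := le_psym_two e ξ
    have h3 := le_psym_three e ξ
    set y := |2 * Real.pi * ξ|
    have y0 : 0 ≤ y := abs_nonneg _
    have h4 : e ^ 2 * (e * y) ^ 2 ≤ 1 * (e * y) ^ 2 :=
      mul_le_mul_of_nonneg_right he2 (by positivity)
    have h5 : e * (e * y) ^ 3 ≤ 1 * (e * y) ^ 3 :=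
      mul_le_mul_of_nonneg_right he1 (by positivity)
    have : (1 + y) * (e ^ 4 / 3 * y ^ 2) = (e ^ 2 * (e * y) ^ 2 + e * (e * y) ^ 3) / 3 := by ring
    rw [this]
    linarith
  · simp only [Pi.mul_apply]
    rw [norm_div_psym, norm_mul, norm_neg, norm_ix, Complex.norm_real,
      Real.norm_of_nonneg (by positivity), ← mul_div_assoc, div_le_iff₀ (psym_pos e ξ)]
    have h1 := le_psym_one e ξ
    have h2 := le_psym_two e ξ
    have h6 := psym_pos e ξ
    set y := |2 * Real.pi * ξ|
    have y0 : 0 ≤ y := abs_nonneg _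
    have h4 : e ^ 2 * (e * y) ≤ 1 * (e * y) :=
      mul_le_mul_of_nonneg_right he2 (by positivity)
    have h5 : e * (e * y) ^ 2 ≤ 1 * (e * y) ^ 2 :=
      mul_le_mul_of_nonneg_right he1 (by positivity)
    have : (1 + y) * (e ^ 3 / 3 * y) = (e ^ 2 * (e * y) + e * (e * y) ^ 2) / 3 := by ring
    rw [this]
    linarith

def prodC (s : ℝ) : ℝ := 2 ^ s * jawC + algC s

theorem prodC_nonneg (s : ℝ) : 0 ≤ prodC s := by
  have := one_le_algC s
  unfold prodC jawC
  positivity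

/-- Two regimes: for q ≤ s - 1 the embedding of the coefficient suffices, and q = s is the algebra
property. Orders strictly between are avoided by the choice of steps in the bootstrap. -/
theorem nW_product_le {s e q F b : ℝ} (hs : 3 / 2 < s) (he : 0 ≤ e) (hq : 0 ≤ q)
    (hqs : q ≤ s - 1 ∨ q = s) {f z : ℝ → ℝ} (hf : Sb s e 0 f F) (hz : Nice z) (hb0 : 0 ≤ b)
    (hb : nW (jw q) (hat z) ≤ ENNReal.ofReal b) :
    nW (jw q) (hat fun x => f x * z x) ≤ ENNReal.ofReal (prodC s * F * b) := by
  have hF := hf.2.1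
  have hA := one_le_algC s
  have hJ : 0 ≤ 2 ^ s * jawC := by unfold jawC; positivity
  rcases hqs with h | rfl
  · rw [nW_congr (hat_mul hf.1 hz)]
    refine (nW_cv_le hq h (memLp_hat f).1 (memLp_hat z).1).trans ?_
    have h1 := hf.2.2
    rw [sw_zero] at h1
    calc _ ≤ ENNReal.ofReal (2 ^ s * jawC) * ENNReal.ofReal F * ENNReal.ofReal b := by gcongr
      _ = ENNReal.ofReal (2 ^ s * jawC * F * b) := by
        rw [← ENNReal.ofReal_mul hJ, ← ENNReal.ofReal_mul (by positivity)]
      _ ≤ _ := by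
        refine ENNReal.ofReal_le_ofReal ?_
        unfold prodC
        have : 0 ≤ algC s * F * b := by positivity
        nlinarith
  · have h1 : Sb q e 0 z b := ⟨hz, hb0, by rw [sw_zero]; exact hb⟩
    have h2 := (hf.mul hs he h1).2.2
    rw [sw_zero] at h2
    refine h2.trans (ENNReal.ofReal_le_ofReal ?_)
    unfold prodC
    have : 0 ≤ 2 ^ q * jawC * F * b := by positivity
    nlinarith

/-- The factor lost in each step of the elliptic bootstrap. -/
def stepC (s A : ℝ) : ℝ := 9 * prodC s * (A + 2 * rhoC s A)

theorem elliptic_step_real {s e A q b g : ℝ} (hs : 3 / 2 < s) (he : 0 < e) (he1 : e ≤ 1)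
    {a z : ℝ → ℝ} (ha : Sb s e 1 a A) (hz : H2 z) {G : ℝ → ℂ} (hG : AEStronglyMeasurable G)
    (heq : ∀ᵐ ξ, (psym e ξ : ℂ) * hat z ξ + (e ^ 2 : ℝ) * hat (fun x => a x * z x) ξ -
      (e ^ 4 / 3 : ℝ) * (ix ξ * hat (fun x => rho e a x * deriv z x) ξ) = (psym e ξ : ℂ) * G ξ)
    {om : ℝ → ℝ} (hom : Continuous om) (hom0 : ∀ ξ, 0 ≤ om ξ) (hom1 : ∀ ξ, om ξ ≤ 1 + |2 * Real.pi * ξ|)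
    (hq : 0 ≤ q) (hqs : q ≤ s - 1 ∨ q = s) (hb0 : 0 ≤ b)
    (hb : nW (jw q) (hat z) ≤ ENNReal.ofReal b) (hg0 : 0 ≤ g)
    (hg : nW (fun ξ => jw q ξ * om ξ) G ≤ ENNReal.ofReal g) :
    nW (fun ξ => jw q ξ * om ξ) (hat z) ≤ ENNReal.ofReal (g + stepC s A * b) := by
  have hr := ha.rho hs he.le he1
  have hr1 : Sb s e 0 (fun x => e * deriv (rho e a) x) (rhoC s A) := by
    refine ((hr.deriv hs he).const_mul e).mono (le_of_eq ?_)
    rw [abs_of_pos he]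
    field_simp
  have hA := ha.2.1
  have hP := prodC_nonneg s
  have hR := rhoC_nonneg (s := s) hA
  have p1 := nW_product_le hs he.le hq hqs (ha.mono_k he.le zero_le_one) hz.1 hb0 hb
  have p2 := nW_product_le hs he.le hq hqs (hr.mono_k he.le zero_le_one) hz.1 hb0 hb
  have p3 := nW_product_le hs he.le hq hqs hr1 hz.1 hb0 hb
  refine (elliptic_step hs he he1 ha hz hG heq hom hom0 hom1).trans ?_
  calc _ ≤ ENNReal.ofReal g + (ENNReal.ofReal 9 * ENNReal.ofReal (prodC s * A * b) +
        (ENNReal.ofReal 9 * ENNReal.ofReal (prodC s * rhoC s A * b) +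
        ENNReal.ofReal 9 * ENNReal.ofReal (prodC s * rhoC s A * b))) := by gcongr
    _ = _ := by
        rw [← ENNReal.ofReal_mul (by norm_num), ← ENNReal.ofReal_mul (by norm_num),
          ← ENNReal.ofReal_add (by positivity) (by positivity),
          ← ENNReal.ofReal_add (by positivity) (by positivity),
          ← ENNReal.ofReal_add (by positivity) (by positivity)]
        congr 1
        unfold stepC
        ring

/-- The constants of the elliptic bootstrap. -/
def bootC (s c A : ℝ) : ℕ → ℝ
  | 0 => (2 + c) / c
  | n + 1 => 1 + stepC s A * bootC s c A n

theorem stepC_nonneg {s A : ℝ} (hA : 0 ≤ A) : 0 ≤ stepC s A := by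
  have := prodC_nonneg s
  have := rhoC_nonneg (s := s) hA
  unfold stepC; positivity

theorem bootC_nonneg {s c A : ℝ} (hc : 0 < c) (hA : 0 ≤ A) (n : ℕ) : 0 ≤ bootC s c A n := by
  induction n with
  | zero => unfold bootC; positivity
  | succ n ih =>
    have := stepC_nonneg (s := s) hA
    unfold bootC; positivity

def ellC (s c A : ℝ) : ℝ := bootC s c A (⌈s⌉₊ + 1)

/-- Starting from the coercive L² bound, each step raises the regularity of z by one until order s,
which takes ⌈s⌉ steps. The constants do not involve e. -/
theorem elliptic_regularity {s e A c g : ℝ} (hs : 3 / 2 < s) (he : 0 < e) (he1 : e ≤ 1)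
    (hc : 0 < c) {a z : ℝ → ℝ} (ha : Sb s e 1 a A) (hz : H2 z) (hh : ∀ x, c ≤ 1 + e ^ 2 * a x)
    {G : ℝ → ℂ} (hG : AEStronglyMeasurable G) (hg0 : 0 ≤ g)
    (hGg : nW (sw s e 1) G ≤ ENNReal.ofReal g)
    (heq : ∀ᵐ ξ, (psym e ξ : ℂ) * hat z ξ + (e ^ 2 : ℝ) * hat (fun x => a x * z x) ξ -
      (e ^ 4 / 3 : ℝ) * (ix ξ * hat (fun x => rho e a x * deriv z x) ξ) = (psym e ξ : ℂ) * G ξ) :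
    Sb s e 1 z (ellC s c A * g) := by
  have hA := ha.2.1
  have chain : ∀ n : ℕ, nW (jw (min (n : ℝ) s)) (hat z) ≤ ENNReal.ofReal (bootC s c A n * g) := by
    intro n
    induction n with
    | zero =>
      have h1 := elliptic_coercive hs he he1 hc ha hz hh hG hg0 hGg heq
      have h2 : jw (min ((0 : ℕ) : ℝ) s) = fun _ => 1 := by
        funext ξ
        rw [Nat.cast_zero, min_eq_left (by linarith), jw, jap_zero]
      rw [h2, nW_one]
      exact h1
    | succ n ih =>
      have hb0 := mul_nonneg (bootC_nonneg (s := s) hc hA n) hg0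
      -- Stopping at s - 1 keeps q in the range of the product estimate and makes q + 1 equal to min
      -- (n + 1) s.
      set q := min (n : ℝ) (s - 1) with hq
      have hq0 : 0 ≤ q := le_min (Nat.cast_nonneg n) (by linarith)
      have hqn : q ≤ min (n : ℝ) s := min_le_min le_rfl (by linarith)
      have hq1 : min ((n + 1 : ℕ) : ℝ) s = q + 1 := by
        rw [hq, ← min_add_add_right]; push_cast; congr 1; ring
      have hb : nW (jw q) (hat z) ≤ ENNReal.ofReal (bootC s c A n * g) :=
        (nW_mono (fun ξ => (jw_pos q ξ).le) (fun ξ => jap_mono hqn _) _).trans ih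
      have hw : jw (q + 1) = fun ξ => jw q ξ * jw 1 ξ := by
        funext ξ; exact jap_add q 1 _
      have hgw : nW (fun ξ => jw q ξ * jw 1 ξ) G ≤ ENNReal.ofReal g := by
        rw [← hw]
        refine (nW_mono (fun ξ => (jw_pos _ ξ).le) (fun ξ => ?_) G).trans hGg
        have h1 : q + 1 ≤ s := by have := min_le_right (n : ℝ) (s - 1); linarith
        refine (jap_mono h1 _).trans (le_mul_of_one_le_right (jap_pos _ _).le ?_)
        rw [pow_one]
        have : 0 ≤ e * |2 * Real.pi * ξ| := by positivity
        linarith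
      have := elliptic_step_real hs he he1 ha hz hG heq (continuous_jw 1)
        (fun ξ => (jw_pos 1 ξ).le) (fun ξ => jap_one_le _) hq0
        (Or.inl (min_le_right _ _)) hb0 hb hg0 hgw
      rw [hq1, hw]
      refine this.trans (le_of_eq ?_)
      congr 1
      rw [bootC]; ring
  have hN := chain ⌈s⌉₊
  rw [min_eq_right (Nat.le_ceil s)] at hN
  have hb0 := mul_nonneg (bootC_nonneg (s := s) hc hA ⌈s⌉₊) hg0
  have hsw : sw s e 1 = fun ξ => jw s ξ * (1 + e * |2 * Real.pi * ξ|) := by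
    funext ξ; rw [sw, pow_one, jw]
  refine ⟨hz.1, mul_nonneg (bootC_nonneg hc hA _) hg0, ?_⟩
  rw [hsw] at hGg ⊢
  -- A last step at q = s: the derivative gained is spent on the factor 1 + e|X| ≤ 1 + |X|.
  have := elliptic_step_real hs he he1 ha hz hG heq (om := fun ξ => 1 + e * |2 * Real.pi * ξ|)
    (by fun_prop) (fun ξ => by positivity) (fun ξ => by
      have := mul_le_mul_of_nonneg_right he1 (abs_nonneg (2 * Real.pi * ξ)); linarith)
    (by linarith) (Or.inr rfl) hb0 hN hg0 hGg
  refine this.trans (le_of_eq ?_)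
  congr 1
  rw [ellC, bootC]; ring

/-- The elliptic estimate in the form used for the time derivative of the velocity. -/
theorem elliptic_estimate {s e A c B : ℝ} (hs : 3 / 2 < s) (he : 0 < e) (he1 : e ≤ 1)
    (hc : 0 < c) {a z p q κ : ℝ → ℝ} (ha : Sb s e 1 a A) (hz : H2 z)
    (hh : ∀ x, c ≤ 1 + e ^ 2 * a x) (hp : Sb s e 0 p (B / e)) (hq : Sb s e 0 q B)
    (hκ : Sb s e 2 κ B)
    (heq : ∀ᵐ ξ, (psym e ξ : ℂ) * hat z ξ + (e ^ 2 : ℝ) * hat (fun x => a x * z x) ξ -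
      (e ^ 4 / 3 : ℝ) * (ix ξ * hat (fun x => rho e a x * deriv z x) ξ) +
      (hat p ξ + (2 / 45 * e ^ 4 : ℝ) * (((2 * Real.pi * ξ) ^ 4 : ℝ) * (ix ξ * hat κ ξ)) +
        ix ξ * hat q ξ) = 0) :
    Sb s e 1 z (ellC s c A * (8 * (B / e))) := by
  have hB := hq.2.1
  have m1 := aesm_div_psym e (continuous_const (y := (-1 : ℂ))) (memLp_hat p).1
  have m2 := aesm_div_psym e ((continuous_const (y := ((-(2 / 45 * e ^ 4) : ℝ) : ℂ))).mul
    (((Complex.continuous_ofReal.comp (f := fun ξ : ℝ => (2 * Real.pi * ξ) ^ 4)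
      (by fun_prop))).mul continuous_ix)) (memLp_hat κ).1
  have m3 := aesm_div_psym e continuous_ix.neg (memLp_hat q).1
  -- G is minus the source divided by `psym`. Its three parts are bounded by 2, 2 and 4 times B/e,
  -- whence the factor 8.
  refine elliptic_regularity hs he he1 hc ha hz hh (m1.add (m2.add m3)) (by positivity) ?_ ?_
  · have hw := (continuous_sw s e 1).measurable
    have hw0 := sw_nonneg he.le s 1
    have hj : ∀ ξ, 0 < jap s (2 * Real.pi * ξ) := fun ξ => jap_pos _ _
    have b1 : nW (sw s e 1) (fun ξ => (-1 : ℂ) / (psym e ξ : ℂ) * hat p ξ) ≤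
        ENNReal.ofReal (2 * (B / e)) := by
      refine (nW_mul_le hw0 (sw_nonneg he.le s 0) zero_le_two (fun ξ => ?_) (hat p)).trans ?_
      · rw [norm_div_psym, norm_neg, norm_one, ← mul_div_assoc, div_le_iff₀ (psym_pos e ξ), sw, sw,
          pow_one, pow_zero]
        have h1 := le_psym_one e ξ
        have h2 := one_le_psym e ξ
        have := mul_le_mul_of_nonneg_left (add_le_add h2 h1) (hj ξ).le
        linarith
      · rw [ENNReal.ofReal_mul zero_le_two]
        exact mul_le_mul_right hp.2.2 _
    -- Of the five derivatives of κ, four are compensated by e⁴ and the symbol. The fifth uses the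
    -- second factor 1 + e|X| available for κ and costs 1/e.
    have b2 : nW (sw s e 1) (fun ξ => ((-(2 / 45 * e ^ 4) : ℝ) : ℂ) *
        ((((2 * Real.pi * ξ) ^ 4 : ℝ) : ℂ) * ix ξ) / (psym e ξ : ℂ) * hat κ ξ) ≤
        ENNReal.ofReal (2 * (B / e)) := by
      refine (nW_mul_le hw0 (sw_nonneg he.le s 2) (C := 2 / e) (by positivity)
        (fun ξ => ?_) (hat κ)).trans ?_
      · rw [norm_div_psym, norm_mul, norm_mul, norm_ix, Complex.norm_real, Complex.norm_real,
          Real.norm_eq_abs, abs_neg, abs_of_nonneg (by positivity), Real.norm_of_nonneg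
          (by positivity), ← mul_div_assoc, div_le_iff₀ (psym_pos e ξ), sw, sw, pow_one]
        have h4 := le_psym_four e ξ
        have e4 : (2 * Real.pi * ξ) ^ 4 = |2 * Real.pi * ξ| ^ 4 := by
          rw [show 4 = 2 * 2 by norm_num, pow_mul, pow_mul, sq_abs]
        rw [e4]
        set y := |2 * Real.pi * ξ|
        have y0 : 0 ≤ y := abs_nonneg _
        set J := jap s (2 * Real.pi * ξ)
        have hJ := hj ξ
        have hP := psym_pos e ξ
        have h5 : J * (1 + e * y) * (2 / 45 * e ^ 4 * (y ^ 4 * y)) =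
            (2 / e) * J * ((e * y) * (1 + e * y) * (e * y) ^ 4 / 45) := by
          field_simp
        rw [h5]
        have h6 : (e * y) * (1 + e * y) * (e * y) ^ 4 / 45 ≤ (1 + e * y) ^ 2 * psym e ξ := by
          have ey : 0 ≤ e * y := by positivity
          have h7 : (e * y) * (1 + e * y) ≤ (1 + e * y) ^ 2 := by nlinarith
          have h8 := mul_le_mul h7 h4 (by positivity) (by positivity)
          linarith
        have h9 := mul_le_mul_of_nonneg_left h6 (by positivity : 0 ≤ (2 / e) * J)
        refine h9.trans (le_of_eq ?_)
        ring
      · refine (mul_le_mul_right hκ.2.2 _).trans (le_of_eq ?_)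
        rw [← ENNReal.ofReal_mul (by positivity)]
        congr 1; ring
    have b3 : nW (sw s e 1) (fun ξ => -ix ξ / (psym e ξ : ℂ) * hat q ξ) ≤
        ENNReal.ofReal (4 * (B / e)) := by
      refine (nW_mul_le hw0 (sw_nonneg he.le s 0) (C := 4 / e) (by positivity)
        (fun ξ => ?_) (hat q)).trans ?_
      · rw [norm_div_psym, norm_neg, norm_ix, ← mul_div_assoc, div_le_iff₀ (psym_pos e ξ), sw, sw,
          pow_one, pow_zero, mul_one]
        have h1 := le_psym_one e ξ
        have h2 := le_psym_two e ξ
        set y := |2 * Real.pi * ξ|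
        set J := jap s (2 * Real.pi * ξ)
        have hJ := hj ξ
        have h5 : J * (1 + e * y) * y = (1 / e) * J * (e * y + (e * y) ^ 2) := by
          field_simp
        rw [h5]
        have h9 := mul_le_mul_of_nonneg_left (add_le_add h1 h2) (by positivity : 0 ≤ (1 / e) * J)
        refine h9.trans (le_of_eq ?_)
        ring
      · refine (mul_le_mul_right hq.2.2 _).trans (le_of_eq ?_)
        rw [← ENNReal.ofReal_mul (by positivity)]
        congr 1; ring
    refine (nW_add_le hw m1 (m2.add m3)).trans ((add_le_add le_rfl (nW_add_le hw m2 m3)).trans ?_)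
    refine (add_le_add b1 (add_le_add b2 b3)).trans (le_of_eq ?_)
    have hBe : 0 ≤ B / e := by positivity
    rw [← ENNReal.ofReal_add (by positivity) (by positivity),
      ← ENNReal.ofReal_add (by positivity) (by positivity)]
    congr 1; ring
  · filter_upwards [heq] with ξ hξ
    have hP : (psym e ξ : ℂ) ≠ 0 := by exact_mod_cast (psym_pos e ξ).ne'
    simp only [Pi.add_apply]
    have : (psym e ξ : ℂ) * (-1 / (psym e ξ : ℂ) * hat p ξ +
        (((-(2 / 45 * e ^ 4) : ℝ) : ℂ) * ((((2 * Real.pi * ξ) ^ 4 : ℝ) : ℂ) * ix ξ) /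
          (psym e ξ : ℂ) * hat κ ξ + -ix ξ / (psym e ξ : ℂ) * hat q ξ)) =
        -(hat p ξ) + ((-(2 / 45 * e ^ 4) : ℝ) : ℂ) * ((((2 * Real.pi * ξ) ^ 4 : ℝ) : ℂ) * ix ξ) *
          hat κ ξ - ix ξ * hat q ξ := by
      field_simp
      ring
    refine Eq.trans ?_ this.symm
    push_cast at hξ ⊢
    linear_combination hξ

/-! ### Comparison of the weighted norms with the energy norm -/

theorem continuous_weight_aesm {w : ℝ → ℝ} (hw : Continuous w) {F : ℝ → ℂ}
    (hF : AEStronglyMeasurable F) : AEStronglyMeasurable fun ξ => (w ξ : ℂ) * F ξ :=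
  (Complex.continuous_ofReal.comp hw).aestronglyMeasurable.mul hF

theorem normH_eq (r : ℝ) (f : ℝ → ℝ) : normH r f = (nW (jw r) (hat f)).toReal := rfl

theorem MemH.nW_lt {r : ℝ} {f : ℝ → ℝ} (h : MemH r f) : nW (jw r) (hat f) < ⊤ := h.2.2.2

/-- For r > 1/2 the transform is integrable, being the product of ⟨X⟩^(-r) and an L² function. The
inversion formula then holds almost everywhere, hence everywhere as both sides are continuous. -/
theorem MemH.nice {r : ℝ} (hr : 1 / 2 < r) {f : ℝ → ℝ} (h : MemH r f) : Nice f := by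
  have h1 : Integrable (hat f) := by
    have h2 : MemLp (fun ξ => ((jap (-r) (2 * Real.pi * ξ) : ℝ) : ℂ)) 2 volume :=
      (memLp_jap_neg (r := -r) (by linarith)).ofReal
    have h3 : Integrable fun ξ => ((jap (-r) (2 * Real.pi * ξ) : ℝ) : ℂ) * besselFourier r f ξ :=
      h2.integrable_mul h.2.2
    refine h3.congr (ae_of_all _ fun ξ => ?_)
    have : besselFourier r f ξ = (jap r (2 * Real.pi * ξ) : ℂ) * hat f ξ := rfl
    dsimp only
    rw [this, ← mul_assoc, ← Complex.ofReal_mul, ← jap_add]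
    simp [jap_zero]
  refine ⟨h1, memLp_hat f, ?_⟩
  have e1 : (memLp_hat f).toLp (hat f) = 𝓕 (toL2 f) := Lp.toLp_coeFn _ _
  have e2 := fourierInv_toLp_ae h1 (memLp_hat f)
  rw [e1, FourierPair.fourierInv_fourier_eq] at e2
  have e3 : toL2 f = h.2.1.toLp _ := by rw [toL2, dif_pos h.2.1]
  rw [e3] at e2
  exact (Continuous.ae_eq_iff_eq volume (Complex.continuous_ofReal.comp h.1)
    (continuous_fourierInv_of_integrable h1)).1 (h.2.1.coeFn_toLp.symm.trans e2)

theorem MemH.h2 {f : ℝ → ℝ} (h : MemH 2 f) : H2 f := ⟨h.nice (by norm_num), h.nW_lt⟩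

/-- The weighted norm of order two. -/
def Sn (s e : ℝ) (f : ℝ → ℝ) : ℝ := (nW (sw s e 2) (hat f)).toReal

theorem sw_two_le {s e : ℝ} (he : 0 ≤ e) (he1 : e ≤ 1) (ξ : ℝ) :
    sw s e 2 ξ ≤ 2 * jw (s + 2) ξ := by
  rw [sw, jw, jap_add, jap_two]
  have h1 : e * |2 * Real.pi * ξ| ≤ |2 * Real.pi * ξ| := mul_le_of_le_one_left (abs_nonneg _) he1
  have h0 : 0 ≤ e * |2 * Real.pi * ξ| := by positivity
  have h2 := sq_abs (2 * Real.pi * ξ)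
  have : (1 + e * |2 * Real.pi * ξ|) ^ 2 ≤ 2 * (1 + (2 * Real.pi * ξ) ^ 2) := by
    nlinarith [sq_nonneg (|2 * Real.pi * ξ| - 1)]
  have := mul_le_mul_of_nonneg_left this (jap_pos s (2 * Real.pi * ξ)).le
  linarith

theorem sb_of_nW_lt {s e : ℝ} (he : 0 ≤ e) (he1 : e ≤ 1) {f : ℝ → ℝ} (hf : Nice f)
    (h : nW (jw (s + 2)) (hat f) < ⊤) : Sb s e 2 f (Sn s e f) := by
  refine ⟨hf, ENNReal.toReal_nonneg, ?_⟩
  rw [Sn, ENNReal.ofReal_toReal]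
  refine ((nW_mono (sw_nonneg he s 2) (sw_two_le he he1) _).trans_lt ?_).ne
  rw [nW_const_mul zero_le_two]
  exact ENNReal.mul_lt_top ENNReal.ofReal_lt_top h

theorem MemH.sb {s e : ℝ} (hs : 3 / 2 < s) (he : 0 ≤ e) (he1 : e ≤ 1) {f : ℝ → ℝ}
    (h : MemH (s + 2) f) : Sb s e 2 f (Sn s e f) :=
  sb_of_nW_lt he he1 (h.nice (by linarith)) h.nW_lt

theorem Sb.of_le {r s e : ℝ} (hrs : r ≤ s) (he : 0 ≤ e) {k : ℕ} {f : ℝ → ℝ} {A : ℝ}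
    (h : Sb s e k f A) : Sb r e k f A :=
  ⟨h.1, h.2.1, (nW_mono (sw_nonneg he r k) (fun _ => mul_le_mul_of_nonneg_right (jap_mono hrs _)
    (by positivity)) _).trans h.2.2⟩

/-- Here the derivative is paid by one order of smoothness instead of a power of 1/e. This is how
the X^{s+1} bound of the second solution is used. -/
theorem Sb.deriv_succ {s e : ℝ} (hs : 3 / 2 < s) (he : 0 ≤ e) {k : ℕ} {f : ℝ → ℝ} {A : ℝ}
    (h : Sb (s + 1) e k f A) : Sb s e k (_root_.deriv f) A := by
  refine ⟨h.nice_deriv (by linarith) he, h.2.1, ?_⟩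
  rw [nW_congr (h.hat_deriv (by linarith) he)]
  refine (nW_mul_le (w' := sw (s + 1) e k) (C := 1) (sw_nonneg he s k)
    (sw_nonneg he _ k) zero_le_one (fun ξ => ?_) (hat f)).trans ?_
  · rw [norm_ix, sw, sw, jap_add]
    have h1 := abs_le_jap_one (2 * Real.pi * ξ)
    have h2 := mul_le_mul_of_nonneg_left h1 (mul_nonneg (jap_pos s (2 * Real.pi * ξ)).le
      (by positivity : 0 ≤ (1 + e * |2 * Real.pi * ξ|) ^ k))
    linarith
  · rw [ENNReal.ofReal_one, one_mul]
    exact h.2.2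

theorem Sb.normH_le {s e : ℝ} (he : 0 ≤ e) {k : ℕ} {f : ℝ → ℝ} {A : ℝ} (h : Sb s e k f A) :
    normH s f ≤ A := by
  have := (h.mono_k he (Nat.zero_le k)).2.2
  rw [sw_zero] at this
  exact ENNReal.toReal_le_of_le_ofReal h.2.1 this

theorem normH_nonneg (r : ℝ) (f : ℝ → ℝ) : 0 ≤ normH r f := ENNReal.toReal_nonneg

theorem normX_nonneg (ε s : ℝ) (ζ v : ℝ → ℝ) : 0 ≤ normX ε s ζ v := Real.sqrt_nonneg _

theorem normX_le {s e A B : ℝ} (hs : 3 / 2 < s) (he : 0 < e) (he1 : e ≤ 1) {ζ v : ℝ → ℝ}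
    (hζ : Sb s e 2 ζ A) (hv : Sb s e 2 v B) : normX (e ^ 2) s ζ v ≤ 2 * (A + B) := by
  have hA := hζ.2.1
  have hB := hv.2.1
  refine Real.sqrt_le_iff.2 ⟨by positivity, ?_⟩
  have key : ∀ {f : ℝ → ℝ} {D : ℝ}, Sb s e 2 f D → normH s f ^ 2 ≤ D ^ 2 ∧
      e ^ 2 * normH s (deriv f) ^ 2 ≤ D ^ 2 ∧ (e ^ 2) ^ 2 * normH s (deriv (deriv f)) ^ 2 ≤ D ^ 2 := by
    intro f D h
    have h1 := h.deriv hs he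
    have h2 := h1.deriv hs he
    have n0 := h.normH_le he.le
    have n1 := h1.normH_le he.le
    have n2 := h2.normH_le he.le
    rw [le_div_iff₀ he] at n1
    rw [le_div_iff₀ he, le_div_iff₀ he] at n2
    have p0 := normH_nonneg s f
    have p1 := normH_nonneg s (deriv f)
    have p2 := normH_nonneg s (deriv (deriv f))
    refine ⟨by gcongr, ?_, ?_⟩
    · rw [← mul_pow]; gcongr; linarith
    · rw [← mul_pow]; gcongr; linarith
  obtain ⟨a0, a1, a2⟩ := key hζ
  obtain ⟨b0, b1, b2⟩ := key hv
  have e2 : e ^ 2 ≤ 1 := pow_le_one₀ he.le he1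
  have : (e ^ 2) ^ 2 * normH s (deriv ζ) ^ 2 ≤ e ^ 2 * normH s (deriv ζ) ^ 2 := by
    refine mul_le_mul_of_nonneg_right ?_ (sq_nonneg _)
    nlinarith [sq_nonneg e]
  nlinarith [mul_nonneg hA hB, sq_nonneg A, sq_nonneg B]

/-- From (1 + e|X|)² ≤ 2(1 + e²X²): the first derivative is interpolated between f and its second
derivative. Hence the different weights of ζ_x and v_x in the energy norm are immaterial. -/
theorem Sn_le_normH {s e A : ℝ} (hs : 3 / 2 < s) (he : 0 < e) {f : ℝ → ℝ}
    (h : Sb s e 2 f A) : Sn s e f ≤ 2 * (normH s f + e ^ 2 * normH s (deriv (deriv f))) := by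
  have h1 := h.deriv hs he
  have h2 := h1.deriv hs he
  have hh : hat (deriv (deriv f)) =ᵐ[volume] fun ξ => ix ξ * (ix ξ * hat f ξ) := by
    filter_upwards [h1.hat_deriv hs he.le, h.hat_deriv hs he.le] with ξ a b
    rw [a, b]
  have f0 := (h.mono_k he.le (Nat.zero_le 2)).2.2.trans_lt ENNReal.ofReal_lt_top
  have f2 := h2.2.2.trans_lt ENNReal.ofReal_lt_top
  rw [sw_zero] at f0 f2
  have hF := (memLp_hat f).1
  have main : nW (sw s e 2) (hat f) ≤ ENNReal.ofReal 2 * (nW (jw s) (hat f) +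
      ENNReal.ofReal (e ^ 2) * nW (jw s) (hat (deriv (deriv f)))) := by
    have e1 : ENNReal.ofReal (e ^ 2) * nW (jw s) (hat (deriv (deriv f))) =
        nW (fun ξ => e ^ 2 * (jw s ξ * (2 * Real.pi * ξ) ^ 2)) (hat f) := by
      rw [nW_const_mul (sq_nonneg e), nW_congr hh]
      congr 1
      refine eLpNorm_congr_enorm_ae (ae_of_all _ fun ξ => ?_)
      rw [enorm_ofReal_mul (jw_pos s ξ).le, enorm_ofReal_mul (by
        have := (jw_pos s ξ).le; positivity), enorm_mul, enorm_mul, ← ofReal_norm (ix ξ), norm_ix,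
        ENNReal.ofReal_mul (jw_pos s ξ).le, ← sq_abs (2 * Real.pi * ξ),
        ENNReal.ofReal_pow (abs_nonneg _)]
      ring
    rw [e1]
    have e2 : nW (sw s e 2) (hat f) ≤
        nW (fun ξ => 2 * (jw s ξ + e ^ 2 * (jw s ξ * (2 * Real.pi * ξ) ^ 2))) (hat f) := by
      refine nW_mono (sw_nonneg he.le s 2) (fun ξ => ?_) _
      rw [sw, jw]
      have h3 : (1 + e * |2 * Real.pi * ξ|) ^ 2 ≤ 2 * (1 + e ^ 2 * (2 * Real.pi * ξ) ^ 2) := by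
        rw [← sq_abs (2 * Real.pi * ξ)]
        nlinarith [sq_nonneg (e * |2 * Real.pi * ξ| - 1)]
      have := mul_le_mul_of_nonneg_left h3 (jap_pos s (2 * Real.pi * ξ)).le
      linarith
    refine e2.trans ?_
    rw [nW_const_mul zero_le_two]
    gcongr
    have e3 : nW (fun ξ => jw s ξ + e ^ 2 * (jw s ξ * (2 * Real.pi * ξ) ^ 2)) (hat f) =
        eLpNorm ((fun ξ => (jw s ξ : ℂ) * hat f ξ) +
          fun ξ => ((e ^ 2 * (jw s ξ * (2 * Real.pi * ξ) ^ 2) : ℝ) : ℂ) * hat f ξ) 2 volume := by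
      refine eLpNorm_congr_ae (ae_of_all _ fun ξ => ?_)
      simp only [Pi.add_apply]
      push_cast
      ring
    rw [e3]
    refine eLpNorm_add_le (continuous_weight_aesm (continuous_jw s) hF) (continuous_weight_aesm ?_ hF)
      (by norm_num)
    have := continuous_jw s
    fun_prop
  have hfin : ENNReal.ofReal (e ^ 2) * nW (jw s) (hat (deriv (deriv f))) ≠ ⊤ :=
    (ENNReal.mul_lt_top ENNReal.ofReal_lt_top f2).ne
  have := ENNReal.toReal_mono (ENNReal.mul_ne_top ENNReal.ofReal_ne_top
    (ENNReal.add_ne_top.2 ⟨f0.ne, hfin⟩)) main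
  rwa [ENNReal.toReal_mul, ENNReal.toReal_add f0.ne hfin, ENNReal.toReal_mul,
    ENNReal.toReal_ofReal zero_le_two, ENNReal.toReal_ofReal (sq_nonneg e)] at this

theorem Sn_le_normX {s e A B : ℝ} (hs : 3 / 2 < s) (he : 0 < e) {ζ v : ℝ → ℝ}
    (hζ : Sb s e 2 ζ A) (hv : Sb s e 2 v B) :
    Sn s e ζ ≤ 4 * normX (e ^ 2) s ζ v ∧ Sn s e v ≤ 4 * normX (e ^ 2) s ζ v := by
  have h1 := Sn_le_normH hs he hζ
  have h2 := Sn_le_normH hs he hv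
  have key : ∀ a : ℝ, 0 ≤ a → a ^ 2 ≤ normH s ζ ^ 2 + (e ^ 2) ^ 2 * normH s (deriv ζ) ^ 2 +
      (e ^ 2) ^ 2 * normH s (deriv (deriv ζ)) ^ 2 + normH s v ^ 2 +
      e ^ 2 * normH s (deriv v) ^ 2 + (e ^ 2) ^ 2 * normH s (deriv (deriv v)) ^ 2 →
      a ≤ normX (e ^ 2) s ζ v := fun a _ h => Real.le_sqrt_of_sq_le h
  have p1 := mul_nonneg (sq_nonneg (e ^ 2)) (sq_nonneg (normH s (deriv ζ)))
  have p2 := mul_nonneg (sq_nonneg (e ^ 2)) (sq_nonneg (normH s (deriv (deriv ζ))))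
  have p3 := mul_nonneg (sq_nonneg e) (sq_nonneg (normH s (deriv v)))
  have p4 := mul_nonneg (sq_nonneg (e ^ 2)) (sq_nonneg (normH s (deriv (deriv v))))
  have p5 := sq_nonneg (normH s ζ)
  have p6 := sq_nonneg (normH s v)
  have n1 := key (normH s ζ) (normH_nonneg _ _) (by linarith)
  have n2 := key (normH s v) (normH_nonneg _ _) (by linarith)
  have n3 := key (e ^ 2 * normH s (deriv (deriv ζ)))
    (mul_nonneg (sq_nonneg e) (normH_nonneg _ _)) (by rw [mul_pow]; linarith)
  have n4 := key (e ^ 2 * normH s (deriv (deriv v)))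
    (mul_nonneg (sq_nonneg e) (normH_nonneg _ _)) (by rw [mul_pow]; linarith)
  constructor <;> linarith

theorem sb_of_normX_le {s e C : ℝ} (hs : 3 / 2 < s) (he : 0 < e) (he1 : e ≤ 1) {ζ v : ℝ → ℝ}
    (hζ : MemH (s + 2) ζ) (hv : MemH (s + 2) v) (h : normX (e ^ 2) s ζ v ≤ C) :
    Sb s e 2 ζ (4 * C) ∧ Sb s e 2 v (4 * C) := by
  have h1 := hζ.sb hs he.le he1
  have h2 := hv.sb hs he.le he1
  have h3 := Sn_le_normX hs he h1 h2
  exact ⟨h1.mono (by linarith), h2.mono (by linarith)⟩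

/-! ### From the distributional momentum equation to the Fourier side -/

/-- Smooth compactly supported functions. -/
def Test (φ : ℝ → ℝ) : Prop := ContDiff ℝ ∞ φ ∧ HasCompactSupport φ

theorem jw_natCast_le (m : ℕ) (ξ : ℝ) : jw m ξ ≤ (2 * Real.pi) ^ m * (1 + ‖ξ‖) ^ m := by
  have h1 : jw m ξ = jap 1 (2 * Real.pi * ξ) ^ m := by
    rw [jw, jap, jap, ← Real.rpow_mul_natCast (one_add_sq_pos _).le]
    congr 1; ring
  have h2 : jap 1 (2 * Real.pi * ξ) ≤ 2 * Real.pi * (1 + ‖ξ‖) := by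
    refine (jap_one_le _).trans ?_
    rw [abs_mul, abs_of_pos (by positivity : (0 : ℝ) < 2 * Real.pi), Real.norm_eq_abs]
    have := Real.pi_gt_three
    nlinarith [abs_nonneg ξ]
  rw [h1, ← mul_pow]
  exact pow_le_pow_left₀ (jap_pos _ _).le h2 m

theorem Test.rep {φ : ℝ → ℝ} (h : Test φ) :
    Rep (fun x => (φ x : ℂ)) (𝓕 fun x => (φ x : ℂ)) ∧
      ∀ r : ℝ, ∃ C : ℝ, ∀ ξ, jw r ξ * ‖𝓕 (fun x => (φ x : ℂ)) ξ‖ ≤ C := by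
  let ψ : SchwartzMap ℝ ℂ := HasCompactSupport.toSchwartzMap (f := fun x => (φ x : ℂ))
    (by exact h.2.comp_left (g := fun y : ℝ => (y : ℂ)) (by simp))
    (by exact Complex.ofRealCLM.contDiff.comp h.1)
  have hψ : (ψ : ℝ → ℂ) = fun x => (φ x : ℂ) := rfl
  have hF : ((𝓕 ψ : SchwartzMap ℝ ℂ) : ℝ → ℂ) = 𝓕 fun x => (φ x : ℂ) := by
    rw [SchwartzMap.fourier_coe, hψ]
  refine ⟨⟨?_, ?_, ?_⟩, fun r => ?_⟩
  · rw [← hF]; exact (𝓕 ψ).integrable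
  · rw [← hF]; exact (𝓕 ψ).memLp 2
  · rw [← hF, ← SchwartzMap.fourierInv_coe, FourierPair.fourierInv_fourier_eq, hψ]
  · obtain ⟨m, hm⟩ := exists_nat_ge r
    refine ⟨(2 * Real.pi) ^ m * (2 ^ m *
      ((Finset.Iic (m, 0)).sup fun m => SchwartzMap.seminorm ℝ m.1 m.2) (𝓕 ψ)), fun ξ => ?_⟩
    have h1 := SchwartzMap.one_add_le_sup_seminorm_apply (𝕜 := ℝ) (m := (m, 0)) le_rfl le_rfl (𝓕 ψ) ξ
    rw [norm_iteratedFDeriv_zero, hF] at h1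
    have h2 : jw r ξ ≤ (2 * Real.pi) ^ m * (1 + ‖ξ‖) ^ m := (jap_mono hm _).trans (jw_natCast_le m ξ)
    calc _ ≤ (2 * Real.pi) ^ m * (1 + ‖ξ‖) ^ m * ‖𝓕 (fun x => (φ x : ℂ)) ξ‖ := by gcongr
      _ = (2 * Real.pi) ^ m * ((1 + ‖ξ‖) ^ m * ‖𝓕 (fun x => (φ x : ℂ)) ξ‖) := by ring
      _ ≤ _ := by gcongr

theorem Test.nice {φ : ℝ → ℝ} (h : Test φ) : Nice φ := nice_of_rep h.rep.1

theorem Test.decay {φ : ℝ → ℝ} (h : Test φ) (r : ℝ) :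
    ∃ C : ℝ, ∀ᵐ ξ, jw r ξ * ‖hat φ ξ‖ ≤ C := by
  obtain ⟨C, hC⟩ := h.rep.2 r
  refine ⟨C, ?_⟩
  filter_upwards [hat_ae_eq h.rep.1] with ξ hξ
  rw [hξ]; exact hC ξ

theorem Test.nW_lt {φ : ℝ → ℝ} (h : Test φ) (r : ℝ) : nW (jw r) (hat φ) < ⊤ := by
  obtain ⟨C, hC⟩ := h.decay (r + 1)
  have h1 : MemLp (fun ξ => jap (-1) (2 * Real.pi * ξ)) 2 volume := memLp_jap_neg (by norm_num)
  refine (eLpNorm_le_mul_eLpNorm_of_ae_le_mul (f := fun ξ => (jw r ξ : ℂ) * hat φ ξ)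
    (g := fun ξ => jap (-1) (2 * Real.pi * ξ)) (c := C) ?_ 2).trans_lt
    (ENNReal.mul_lt_top ENNReal.ofReal_lt_top h1.2)
  filter_upwards [hC] with ξ hξ
  rw [norm_mul, Complex.norm_real, Real.norm_of_nonneg (jw_pos r ξ).le,
    Real.norm_of_nonneg (jap_pos _ _).le]
  have e1 : jw r ξ = jw (r + 1) ξ * jap (-1) (2 * Real.pi * ξ) := by
    rw [jw, jw, ← jap_add]; congr 1; ring
  rw [e1]
  have := mul_le_mul_of_nonneg_right hξ (jap_pos (-1) (2 * Real.pi * ξ)).le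
  linarith

theorem Test.sb {φ : ℝ → ℝ} (h : Test φ) (s : ℝ) : Sb s 1 2 φ (Sn s 1 φ) :=
  sb_of_nW_lt zero_le_one le_rfl h.nice (h.nW_lt _)

theorem Test.deriv {φ : ℝ → ℝ} (h : Test φ) : Test (deriv φ) :=
  ⟨(contDiff_infty_iff_deriv.1 h.1).2, h.2.deriv⟩

theorem Test.iteratedDeriv {φ : ℝ → ℝ} (h : Test φ) (k : ℕ) : Test (iteratedDeriv k φ) := by
  induction k with
  | zero => rwa [iteratedDeriv_zero]
  | succ k ih => rw [iteratedDeriv_succ]; exact ih.deriv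

theorem Test.hat_deriv {φ : ℝ → ℝ} (h : Test φ) :
    hat (_root_.deriv φ) =ᵐ[volume] fun ξ => ix ξ * hat φ ξ :=
  (h.sb 2).hat_deriv (by norm_num) zero_le_one

theorem Test.hat_iteratedDeriv {φ : ℝ → ℝ} (h : Test φ) (k : ℕ) :
    hat (_root_.iteratedDeriv k φ) =ᵐ[volume] fun ξ => ix ξ ^ k * hat φ ξ := by
  induction k with
  | zero => simp [iteratedDeriv_zero]
  | succ k ih =>
    rw [iteratedDeriv_succ]
    filter_upwards [(h.iteratedDeriv k).hat_deriv, ih] with ξ h1 h2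
    rw [h1, h2]; ring

/-- Square integrable up to a polynomial weight. -/
def PolyL2 (F : ℝ → ℂ) : Prop := ∃ r : ℝ, MemLp (fun ξ => (jw (-r) ξ : ℂ) * F ξ) 2

theorem memLp_jw_of_le {r q : ℝ} (h : r ≤ q) {F : ℝ → ℂ}
    (hF : MemLp (fun ξ => (jw (-r) ξ : ℂ) * F ξ) 2) :
    MemLp (fun ξ => (jw (-q) ξ : ℂ) * F ξ) 2 := by
  have h1 : ∀ ξ, (jw (-q) ξ : ℂ) * F ξ = (jw (r - q) ξ : ℂ) * ((jw (-r) ξ : ℂ) * F ξ) := by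
    intro ξ
    rw [← mul_assoc, ← Complex.ofReal_mul, jw, jw, jw, ← jap_add]
    congr 3; ring
  simp_rw [h1]
  refine memLp_mul_of_bounded (Complex.continuous_ofReal.comp
    (continuous_jw _)).aestronglyMeasurable (C := 1) (fun ξ => ?_) hF
  rw [Complex.norm_real, Real.norm_of_nonneg (jw_pos _ ξ).le, ← jap_zero (2 * Real.pi * ξ)]
  exact jap_mono (by linarith) _

theorem PolyL2.add {F G : ℝ → ℂ} (hF : PolyL2 F) (hG : PolyL2 G) :
    PolyL2 fun ξ => F ξ + G ξ := by
  obtain ⟨r, hr⟩ := hF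
  obtain ⟨q, hq⟩ := hG
  refine ⟨max r q, ?_⟩
  have := (memLp_jw_of_le (le_max_left r q) hr).add (memLp_jw_of_le (le_max_right r q) hq)
  refine (memLp_congr_ae (ae_of_all _ fun ξ => ?_)).1 this
  simp only [Pi.add_apply]
  ring

theorem PolyL2.const_mul {F : ℝ → ℂ} (hF : PolyL2 F) (c : ℂ) : PolyL2 fun ξ => c * F ξ := by
  obtain ⟨r, hr⟩ := hF
  refine ⟨r, (memLp_congr_ae (ae_of_all _ fun ξ => ?_)).1 (hr.const_mul c)⟩
  ring

theorem PolyL2.neg_ix_mul {F : ℝ → ℂ} (hF : PolyL2 F) : PolyL2 fun ξ => -ix ξ * F ξ := by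
  obtain ⟨r, hr⟩ := hF
  refine ⟨r + 1, ?_⟩
  have h1 : ∀ ξ, (jw (-(r + 1)) ξ : ℂ) * (-ix ξ * F ξ) =
      ((jw (-1) ξ : ℂ) * -ix ξ) * ((jw (-r) ξ : ℂ) * F ξ) := by
    intro ξ
    have : jw (-(r + 1)) ξ = jw (-1) ξ * jw (-r) ξ := by
      rw [jw, jw, jw, ← jap_add]; congr 1; ring
    rw [this]; push_cast; ring
  simp_rw [h1]
  refine memLp_mul_of_bounded (((Complex.continuous_ofReal.comp
    (continuous_jw _)).mul continuous_ix.neg).aestronglyMeasurable) (C := 1) (fun ξ => ?_) hr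
  rw [norm_mul, norm_neg, norm_ix, Complex.norm_real, Real.norm_of_nonneg (jw_pos _ ξ).le]
  have h2 := mul_le_mul_of_nonneg_left (abs_le_jap_one (2 * Real.pi * ξ)) (jw_pos (-1) ξ).le
  refine h2.trans (le_of_eq ?_)
  rw [jw, ← jap_add]; simp [jap_zero]

theorem polyL2_hat (g : ℝ → ℝ) (k : ℕ) : PolyL2 fun ξ => (-ix ξ) ^ k * hat g ξ := by
  induction k with
  | zero =>
    refine ⟨0, (memLp_congr_ae (ae_of_all _ fun ξ => ?_)).1 (memLp_hat g)⟩
    simp [jw, jap_zero]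
  | succ k ih =>
    have := ih.neg_ix_mul
    refine (congrArg PolyL2 (funext fun ξ => ?_)).mp this
    ring

theorem PolyL2.mul_conj_test {F : ℝ → ℂ} (hF : PolyL2 F) {φ : ℝ → ℝ} (h : Test φ) :
    Integrable (fun ξ => F ξ * (starRingEnd ℂ) (hat φ ξ)) ∧
      MemLp (fun ξ => F ξ * (starRingEnd ℂ) (hat φ ξ)) 2 := by
  obtain ⟨r, hr⟩ := hF
  have hm : AEStronglyMeasurable fun ξ => (jw r ξ : ℂ) * (starRingEnd ℂ) (hat φ ξ) :=
    continuous_weight_aesm (continuous_jw r)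
      (Complex.continuous_conj.comp_aestronglyMeasurable (memLp_hat φ).1)
  have h1 : ∀ ξ, F ξ * (starRingEnd ℂ) (hat φ ξ) = ((jw r ξ : ℂ) * (starRingEnd ℂ) (hat φ ξ)) *
      ((jw (-r) ξ : ℂ) * F ξ) := by
    intro ξ
    have h2 : (jw r ξ : ℂ) * (jw (-r) ξ : ℂ) = 1 := by
      rw [← Complex.ofReal_mul, jw, jw, ← jap_add]; simp [jap_zero]
    linear_combination -(F ξ * (starRingEnd ℂ) (hat φ ξ)) * h2
  have hen : ∀ ξ, ‖(jw r ξ : ℂ) * (starRingEnd ℂ) (hat φ ξ)‖ₑ = ‖(jw r ξ : ℂ) * hat φ ξ‖ₑ := by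
    intro ξ
    rw [enorm_mul, enorm_mul, ← ofReal_norm ((starRingEnd ℂ) (hat φ ξ)), Complex.norm_conj, ofReal_norm]
  have m2 : MemLp (fun ξ => (jw r ξ : ℂ) * (starRingEnd ℂ) (hat φ ξ)) 2 :=
    ⟨hm, (eLpNorm_congr_enorm_ae (ae_of_all _ hen)).trans_lt (h.nW_lt r)⟩
  simp_rw [h1]
  refine ⟨m2.integrable_mul hr, ?_⟩
  obtain ⟨C, hC⟩ := h.decay r
  refine hr.of_le_mul (c := C) (hm.mul hr.1) ?_
  filter_upwards [hC] with ξ hξ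
  rw [norm_mul]
  refine mul_le_mul_of_nonneg_right ?_ (norm_nonneg _)
  rw [norm_mul, Complex.norm_real, Real.norm_of_nonneg (jw_pos _ ξ).le, Complex.norm_conj]
  exact hξ

theorem Nice.integrable_mul {f g : ℝ → ℝ} (hf : Nice f) (hg : Nice g) :
    Integrable fun x => f x * g x := by
  have h1 := Rep.memLp hf
  have h2 := Rep.memLp hg
  have h3 : Integrable fun x => ((f x * g x : ℝ) : ℂ) := by
    refine (h1.integrable_mul h2).congr (ae_of_all _ fun x => ?_)
    simp
  exact h3.re

/-- Parseval with all derivatives on the test function. Their symbols return to g with a sign, so no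
regularity of g is needed. -/
theorem Nice.integral_mul_test {g φ : ℝ → ℝ} (hg : Nice g) (h : Test φ) (k : ℕ) :
    ((∫ x, g x * iteratedDeriv k φ x : ℝ) : ℂ) =
      ∫ ξ, ((-ix ξ) ^ k * hat g ξ) * (starRingEnd ℂ) (hat φ ξ) := by
  have h1 := Rep.integral_mul_conj hg (h.iteratedDeriv k).nice
  rw [← integral_complex_ofReal]
  refine Eq.trans (integral_congr_ae (ae_of_all _ fun x => ?_)) (h1.trans (integral_congr_ae ?_))
  · simp
  · filter_upwards [h.hat_iteratedDeriv k] with ξ hξ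
    rw [hξ, map_mul, map_pow, conj_ix]
    ring

theorem Rep.translate {f F : ℝ → ℂ} (h : Rep f F) (y : ℝ) :
    Rep (fun x => f (x - y)) fun ξ => (Real.fourierChar (-(ξ * y)) : ℂ) * F ξ := by
  have hc : Continuous fun ξ : ℝ => (Real.fourierChar (-(ξ * y)) : ℂ) :=
    continuous_subtype_val.comp (Real.continuous_fourierChar.comp (by fun_prop))
  have hm : AEStronglyMeasurable fun ξ : ℝ => (Real.fourierChar (-(ξ * y)) : ℂ) :=
    hc.aestronglyMeasurable
  have hb : ∀ ξ : ℝ, ‖(Real.fourierChar (-(ξ * y)) : ℂ)‖ ≤ 1 := fun ξ => (Circle.norm_coe _).le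
  refine ⟨h.1.bdd_mul hm (ae_of_all _ hb), memLp_mul_of_bounded hm hb h.2.1, ?_⟩
  funext x
  rw [h.2.2, Real.fourierInv_eq, Real.fourierInv_eq]
  refine integral_congr_ae (ae_of_all _ fun ξ => ?_)
  simp only [Circle.smul_def, smul_eq_mul]
  rw [← mul_assoc, ← Circle.coe_mul, ← AddChar.map_add_eq_mul]
  congr 3
  simp only [RCLike.inner_apply, conj_trivial]
  ring

theorem Test.translate {φ : ℝ → ℝ} (h : Test φ) (y : ℝ) : Test fun x => φ (x - y) :=
  ⟨h.1.comp (contDiff_id.sub contDiff_const), h.2.comp_homeomorph (Homeomorph.subRight y)⟩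

theorem ae_eq_zero_of_fourierInv_eq_zero {F : ℝ → ℂ} (h1 : Integrable F) (h2 : MemLp F 2)
    (h : ∀ y, 𝓕⁻ F y = 0) : F =ᵐ[volume] 0 := by
  have h3 : (𝓕⁻ (h2.toLp F) : Lp ℂ 2 (volume : Measure ℝ)) = 0 := by
    refine Lp.ext (((fourierInv_toLp_ae h1 h2).trans (ae_of_all _ h)).trans ?_)
    exact (Lp.coeFn_zero ℂ 2 volume).symm
  have h4 : h2.toLp F = 0 := by
    have := congrArg (fun G : Lp ℂ 2 (volume : Measure ℝ) => 𝓕 G) h3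
    simp only [FourierInvPair.fourier_fourierInv_eq] at this
    rw [this]
    exact (Lp.fourierTransformₗᵢ ℝ ℂ).map_zero
  exact h2.coeFn_toLp.symm.trans ((Lp.ext_iff.1 h4).trans (Lp.coeFn_zero ℂ 2 volume))

/-- The transform of a nonnegative bump supported close to the origin stays near its integral on a
bounded set of frequencies. -/
theorem exists_test_hat_ne_zero (n : ℕ) :
    ∃ φ, Test φ ∧ ∀ᵐ ξ : ℝ, |ξ| ≤ n → hat φ ξ ≠ 0 := by
  -- With this radius the phase |2πxξ| is at most 1/2 for |ξ| ≤ n, because π < 4; the transform then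
  -- differs from the integral of the bump by at most half of it.
  have hn : (0 : ℝ) < 1 / (16 * (n + 1)) := by positivity
  let b : ContDiffBump (0 : ℝ) := ⟨1 / (16 * (n + 1)) / 2, 1 / (16 * (n + 1)), by positivity,
    by linarith⟩
  have hb : Test b := ⟨b.contDiff, b.hasCompactSupport⟩
  refine ⟨b, hb, ?_⟩
  filter_upwards [hat_ae_eq hb.rep.1] with ξ hξ hle h0
  rw [hξ] at h0
  have hint : Integrable b := b.continuous.integrable_of_hasCompactSupport b.hasCompactSupport
  have hintc : Integrable fun x => (b x : ℂ) := hint.ofReal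
  have hpos : 0 < ∫ x, b x := b.integral_pos
  have h1 : ‖𝓕 (fun x => (b x : ℂ)) ξ - ∫ x, (b x : ℂ)‖ ≤ ∫ x, 1 / 2 * b x := by
    rw [Real.fourier_eq]
    have hi : Integrable fun v : ℝ => Real.fourierChar (-inner ℝ v ξ) • (b v : ℂ) := by
      have hc : Continuous fun v : ℝ => (Real.fourierChar (-inner ℝ v ξ) : ℂ) :=
        continuous_subtype_val.comp (Real.continuous_fourierChar.comp (by fun_prop))
      exact hintc.bdd_mul (c := 1) hc.aestronglyMeasurable (ae_of_all _ fun x => (Circle.norm_coe _).le)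
    rw [← integral_sub hi hintc]
    refine norm_integral_le_of_norm_le (hint.const_mul _) (ae_of_all _ fun x => ?_)
    by_cases hx : |x| < 1 / (16 * (n + 1))
    · have e1 : Real.fourierChar (-inner ℝ x ξ) • (b x : ℂ) - (b x : ℂ) =
          (Complex.exp (Complex.I * ((2 * Real.pi * (-(x * ξ)) : ℝ) : ℂ)) - 1) * (b x : ℂ) := by
        rw [Circle.smul_def, Real.fourierChar_apply, smul_eq_mul]
        simp only [RCLike.inner_apply, conj_trivial]
        rw [sub_mul, one_mul]
        congr 3
        push_cast
        ring
      rw [e1, norm_mul, Complex.norm_real, Real.norm_of_nonneg b.nonneg]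
      refine mul_le_mul_of_nonneg_right (Real.norm_exp_I_mul_ofReal_sub_one_le.trans ?_) b.nonneg
      rw [Real.norm_eq_abs, abs_mul, abs_mul, abs_neg, abs_mul, abs_two, abs_of_pos Real.pi_pos]
      have h2 : |x| * |ξ| ≤ 1 / (16 * (n + 1)) * n := by gcongr
      have h3 : 1 / (16 * ((n : ℝ) + 1)) * n ≤ 1 / 16 := by
        rw [div_mul_eq_mul_div, div_le_div_iff₀ (by positivity) (by norm_num)]
        linarith
      have := Real.pi_lt_four
      nlinarith [Real.pi_pos, mul_nonneg (abs_nonneg x) (abs_nonneg ξ)]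
    · have : b x = 0 := b.zero_of_le_dist (by
        rw [Real.dist_eq, sub_zero]; exact not_lt.1 hx)
      simp [this]
  rw [h0, zero_sub, norm_neg, integral_const_mul] at h1
  rw [integral_complex_ofReal, Complex.norm_real, Real.norm_of_nonneg hpos.le] at h1
  linarith

/-- Testing with all translates of φ shows that the inverse transform of F times the conjugate of φ̂
vanishes everywhere, hence that product vanishes almost everywhere. A sequence of test functions
whose transforms do not vanish on |ξ| ≤ n then gives F = 0. -/
theorem PolyL2.ae_eq_zero {F : ℝ → ℂ} (hF : PolyL2 F)
    (h : ∀ φ, Test φ → ∫ ξ, F ξ * (starRingEnd ℂ) (hat φ ξ) = 0) : F =ᵐ[volume] 0 := by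
  have key : ∀ φ, Test φ → ∀ᵐ ξ, F ξ * (starRingEnd ℂ) (hat φ ξ) = 0 := by
    intro φ hφ
    obtain ⟨h1, h2⟩ := hF.mul_conj_test hφ
    refine ae_eq_zero_of_fourierInv_eq_zero h1 h2 fun y => ?_
    rw [← h _ (hφ.translate y), Real.fourierInv_eq]
    refine integral_congr_ae ?_
    filter_upwards [hat_ae_eq (f := fun x => φ (x - y)) (Rep.translate hφ.nice y)] with ξ hξ
    rw [hξ, Circle.smul_def, smul_eq_mul, map_mul, ← Circle.coe_inv_eq_conj,
      ← AddChar.map_neg_eq_inv]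
    simp only [RCLike.inner_apply, conj_trivial, neg_neg]
    rw [mul_comm y ξ]
    ring
  choose φ hφ hne using exists_test_hat_ne_zero
  filter_upwards [ae_all_iff.2 hne, ae_all_iff.2 fun n => key _ (hφ n)] with ξ h1 h2
  obtain ⟨n, hn⟩ := exists_nat_ge |ξ|
  exact (mul_eq_zero.1 (h2 n)).resolve_right fun h3 => h1 n hn (by simpa using h3)

/-- The good velocity derivative `∂ₜv + e²v∂ₓv`. -/
def accel (e : ℝ) (v vt : ℝ → ℝ) (x : ℝ) : ℝ := vt x + e ^ 2 * (v x * deriv v x)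

/-- The product v v_x has order s + 1 > 2, so the acceleration is as regular as v_t is assumed to
be. -/
theorem h2_accel {s : ℝ} (hs : 3 / 2 < s) (e : ℝ) {v vt : ℝ → ℝ} (hv : MemH (s + 2) v)
    (hvt : MemH 2 vt) : H2 (accel e v vt) := by
  have hvn : Nice v := hv.nice (by linarith)
  have h1 : Sb (s + 1 + 1) 1 0 v (nW (jw (s + 2)) (hat v)).toReal := by
    refine ⟨hvn, ENNReal.toReal_nonneg, ?_⟩
    rw [sw_zero, show s + 1 + 1 = s + 2 by ring, ENNReal.ofReal_toReal hv.nW_lt.ne]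
  have h2 := (h1.of_le (r := s + 1) (by linarith) zero_le_one).mul (by linarith) zero_le_one
    (h1.deriv_succ (by linarith) zero_le_one)
  have h3 := h2.const_mul (e ^ 2)
  refine ⟨hvt.h2.1.add h3.1, ?_⟩
  have h4 := h3.2.2
  rw [sw_zero] at h4
  have h5 : nW (jw 2) (hat fun x => e ^ 2 * (v x * deriv v x)) < ⊤ :=
    ((nW_mono (fun ξ => (jw_pos 2 ξ).le) (fun ξ => jap_mono (by linarith) _) _).trans h4).trans_lt
      ENNReal.ofReal_lt_top
  have h6 : nW (jw 2) (hat (accel e v vt)) = _ := nW_congr (hat_add hvt.h2.1 h3.1)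
  rw [h6]
  exact (nW_add_le (continuous_jw 2).measurable (memLp_hat _).1 (memLp_hat _).1).trans_lt
    (ENNReal.add_lt_top.2 ⟨hvt.h2.2, h5⟩)

theorem integral_mul_deriv_eq_neg {u v : ℝ → ℝ} (hu : Differentiable ℝ u) (hv : Differentiable ℝ v)
    (nu : Nice u) (nv : Nice v) (nu' : Nice (deriv u)) (nv' : Nice (deriv v)) :
    ∫ x, u x * deriv v x = -∫ x, deriv u x * v x :=
  integral_mul_deriv_eq_deriv_mul_of_integrable (fun x _ => (hu x).hasDerivAt)
    (fun x _ => (hv x).hasDerivAt) (nu.integrable_mul nv') (nu'.integrable_mul nv)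
    (nu.integrable_mul nv)

/-- A is only of class H², so a single derivative is moved from φ to A in the second order term,
with the cube of the depth written as 1 + e²ρ; the fourth order term stays on φ. -/
theorem integral_mul_opI {s e B : ℝ} (hs : 3 / 2 < s) (he : 0 ≤ e) (he1 : e ≤ 1)
    {ζ A φ : ℝ → ℝ} (hζ : Sb s e 2 ζ B) (hA : H2 A) (hφ : Test φ) :
    ∫ x, A x * opI (e ^ 2) (depth (e ^ 2) ζ) φ x =
      (∫ x, A x * iteratedDeriv 0 φ x) + e ^ 2 * (∫ x, ζ x * A x * iteratedDeriv 0 φ x) +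
      e ^ 2 / 3 * ((∫ x, deriv A x * iteratedDeriv 1 φ x) +
        e ^ 2 * ∫ x, rho e ζ x * deriv A x * iteratedDeriv 1 φ x) +
      e ^ 4 / 45 * ∫ x, A x * iteratedDeriv 4 φ x := by
  have hr := hζ.rho hs he he1
  have nφ' := hφ.deriv.nice
  have dφ' : Differentiable ℝ (deriv φ) := (hφ.deriv.sb 2).differentiable (by norm_num) zero_le_one
  have dr := hr.differentiable hs he
  have nrd := hr.nice_deriv hs he
  set g : ℝ → ℝ := fun y => deriv φ y + e ^ 2 * (rho e ζ y * deriv φ y) with hg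
  have dg : Differentiable ℝ g := dφ'.add ((dr.mul dφ').const_mul (e ^ 2))
  have ng : Nice g := nφ'.add ((hr.1.mul nφ').const_mul (e ^ 2))
  have eg : deriv g = fun y => deriv (deriv φ) y +
      e ^ 2 * (deriv (rho e ζ) y * deriv φ y + rho e ζ y * deriv (deriv φ) y) := by
    funext y
    exact ((dφ' y).hasDerivAt.add (((dr y).hasDerivAt.mul (dφ' y).hasDerivAt).const_mul
      (e ^ 2))).deriv
  have ng' : Nice (deriv g) := by
    rw [eg]
    exact hφ.deriv.deriv.nice.add (((nrd.mul nφ').add (hr.1.mul hφ.deriv.deriv.nice)).const_mul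
      (e ^ 2))
  have e0 : (fun y => depth (e ^ 2) ζ y ^ 3 * deriv φ y) = g := by
    funext y
    rw [hg, depth, ← rho_eq]
    ring
  have n4 := (hφ.iteratedDeriv 4).nice
  have i1 := hA.1.integrable_mul hφ.nice
  have i2 := (hζ.1.mul hA.1).integrable_mul hφ.nice
  have i3 := hA.1.integrable_mul ng'
  have i4 := hA.1.integrable_mul n4
  have i5 := hA.nice_deriv.integrable_mul nφ'
  have i6 := (hr.1.mul hA.nice_deriv).integrable_mul nφ'
  have ibp := integral_mul_deriv_eq_neg hA.rep_deriv.1 dg hA.1 ng hA.nice_deriv ng'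
  have e1 : ∫ x, deriv A x * g x = (∫ x, deriv A x * deriv φ x) +
      e ^ 2 * ∫ x, rho e ζ x * deriv A x * deriv φ x := by
    rw [← integral_const_mul, ← integral_add i5 (i6.const_mul _)]
    refine integral_congr_ae (ae_of_all _ fun x => ?_)
    simp only [hg]; ring
  have e2 : ∫ x, A x * opI (e ^ 2) (depth (e ^ 2) ζ) φ x =
      ∫ x, (A x * φ x + e ^ 2 * (ζ x * A x * φ x) + -(e ^ 2 / 3) * (A x * deriv g x) +
        e ^ 4 / 45 * (A x * iteratedDeriv 4 φ x)) := by
    refine integral_congr_ae (ae_of_all _ fun x => ?_)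
    simp only [opI, e0]
    rw [depth]; ring
  rw [e2, integral_add, integral_add, integral_add, integral_const_mul, integral_const_mul,
    integral_const_mul, ibp, e1, iteratedDeriv_zero, iteratedDeriv_one]
  · ring
  · exact i1
  · exact i2.const_mul _
  · exact i1.add (i2.const_mul _)
  · exact i3.const_mul _
  · exact (i1.add (i2.const_mul _)).add (i3.const_mul _)
  · exact i4.const_mul _

theorem PolyL2.integral_add {F G : ℝ → ℂ} (hF : PolyL2 F) (hG : PolyL2 G) {φ : ℝ → ℝ}
    (h : Test φ) : ∫ ξ, (F ξ + G ξ) * (starRingEnd ℂ) (hat φ ξ) =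
      (∫ ξ, F ξ * (starRingEnd ℂ) (hat φ ξ)) + ∫ ξ, G ξ * (starRingEnd ℂ) (hat φ ξ) := by
  rw [← MeasureTheory.integral_add (hF.mul_conj_test h).1 (hG.mul_conj_test h).1]
  simp_rw [add_mul]

theorem PolyL2.integral_const_mul (F : ℝ → ℂ) {φ : ℝ → ℝ} (c : ℂ) :
    ∫ ξ, c * F ξ * (starRingEnd ℂ) (hat φ ξ) = c * ∫ ξ, F ξ * (starRingEnd ℂ) (hat φ ξ) := by
  simp_rw [mul_assoc]
  exact MeasureTheory.integral_const_mul _ _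

/-- The momentum equation on the Fourier side. -/
theorem momentum_fourier {s e B D : ℝ} (hs : 3 / 2 < s) (he : 0 < e) (he1 : e ≤ 1)
    {ζ v vt f : ℝ → ℝ} (hζ : Sb s e 2 ζ B) (hv : Sb s e 2 v D) (hA : H2 (accel e v vt))
    (hf : Nice f) (hm : Momentum (e ^ 2) ζ v vt f) :
    ∀ᵐ ξ, (psym e ξ : ℂ) * hat (accel e v vt) ξ +
      (e ^ 2 : ℝ) * hat (fun x => ζ x * accel e v vt x) ξ -
      (e ^ 4 / 3 : ℝ) * (ix ξ * hat (fun x => rho e ζ x * deriv (accel e v vt) x) ξ) +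
      (hat (fun x => deriv ζ x + e ^ 2 * (ζ x * deriv ζ x) - f x) ξ +
        (2 / 45 * e ^ 4 : ℝ) * (((2 * Real.pi * ξ) ^ 4 : ℝ) * (ix ξ * hat ζ ξ)) +
        ix ξ * hat (fun x => 2 / 3 * e ^ 4 * (deriv v x * deriv v x)) ξ) = 0 := by
  have hr := hζ.rho hs he.le he1
  have h1 := hζ.deriv hs he
  have h2 := h1.deriv hs he
  have hvd := hv.nice_deriv hs he.le
  have hh3 : iteratedDeriv 3 ζ = deriv (deriv (deriv ζ)) := by
    rw [iteratedDeriv_succ, iteratedDeriv_succ, iteratedDeriv_one]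
  have n3 : Nice (iteratedDeriv 3 ζ) := by rw [hh3]; exact h2.nice_deriv hs he.le
  set A := accel e v vt with hAdef
  set p : ℝ → ℝ := fun x => deriv ζ x + e ^ 2 * (ζ x * deriv ζ x) - f x with hp
  have np0 : Nice fun x => deriv ζ x + e ^ 2 * (ζ x * deriv ζ x) :=
    h1.1.add ((hζ.1.mul h1.1).const_mul (e ^ 2))
  have np : Nice p := np0.sub hf
  set q : ℝ → ℝ := fun x => 2 / 3 * e ^ 4 * (deriv v x * deriv v x) with hq
  have nq : Nice q := (hvd.mul hvd).const_mul (2 / 3 * e ^ 4)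
  have nζA := hζ.1.mul hA.1
  have nrA := hr.1.mul hA.nice_deriv
  -- the residual as a sum of terms `(-ix)^k ĝ`
  have P := fun g k => polyL2_hat g k
  have p1 := P A 0
  have p2 := (P (fun x => ζ x * A x) 0).const_mul ((e ^ 2 : ℝ) : ℂ)
  have p3 := P (deriv A) 1
  have p4 := (P (fun x => rho e ζ x * deriv A x) 1).const_mul ((e ^ 2 : ℝ) : ℂ)
  have p34 := (p3.add p4).const_mul ((e ^ 2 / 3 : ℝ) : ℂ)
  have p5 := (P A 4).const_mul ((e ^ 4 / 45 : ℝ) : ℂ)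
  have p7 := (P (iteratedDeriv 3 ζ) 2).const_mul ((2 / 45 * e ^ 4 : ℝ) : ℂ)
  have p8 := (P q 1).const_mul ((-1 : ℝ) : ℂ)
  have pAll := ((((p1.add p2).add p34).add p5).add (P p 0)).add (p7.add p8)
  have hzero := pAll.ae_eq_zero (fun φ hφ => by
    have m1 := hm φ hφ.1 hφ.2
    have i1 := np0.integrable_mul hφ.nice
    have i2 := hf.integrable_mul hφ.nice
    have ep : ∫ x, p x * iteratedDeriv 0 φ x =
        (∫ x, depth (e ^ 2) ζ x * deriv ζ x * φ x) - ∫ x, f x * φ x := by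
      rw [iteratedDeriv_zero]
      rw [← integral_sub ?_ i2]
      · refine integral_congr_ae (ae_of_all _ fun x => ?_)
        simp only [hp, depth]; ring
      · refine i1.congr (ae_of_all _ fun x => ?_)
        simp only [depth]; ring
    have eq1 : ∫ x, q x * iteratedDeriv 1 φ x =
        (e ^ 2) ^ 2 * ∫ x, 2 / 3 * (deriv v x * deriv v x) * deriv φ x := by
      rw [iteratedDeriv_one, ← integral_const_mul]
      refine integral_congr_ae (ae_of_all _ fun x => ?_)
      simp only [hq]; ring
    have m2 := integral_mul_opI hs he.le he1 hζ hA hφ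
    have m3 : ∫ x, (vt x + e ^ 2 * (v x * deriv v x)) * opI (e ^ 2) (depth (e ^ 2) ζ) φ x =
      ∫ x, A x * opI (e ^ 2) (depth (e ^ 2) ζ) φ x := rfl
    rw [m3, m2] at m1
    -- The two third order terms of the momentum equation cancel at this point.
    have m4 : (∫ x, A x * iteratedDeriv 0 φ x) + e ^ 2 * (∫ x, ζ x * A x * iteratedDeriv 0 φ x) +
        e ^ 2 / 3 * ((∫ x, deriv A x * iteratedDeriv 1 φ x) +
          e ^ 2 * ∫ x, rho e ζ x * deriv A x * iteratedDeriv 1 φ x) +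
        e ^ 4 / 45 * (∫ x, A x * iteratedDeriv 4 φ x) + (∫ x, p x * iteratedDeriv 0 φ x) +
        (2 / 45 * e ^ 4 * (∫ x, iteratedDeriv 3 ζ x * iteratedDeriv 2 φ x) +
          -1 * ∫ x, q x * iteratedDeriv 1 φ x) = 0 := by
      rw [ep, eq1]; linear_combination m1
    have m5 := congrArg (fun r : ℝ => (r : ℂ)) m4
    simp only [Complex.ofReal_add, Complex.ofReal_mul (_ : ℝ), Complex.ofReal_zero] at m5
    rw [hA.1.integral_mul_test hφ, nζA.integral_mul_test hφ, hA.nice_deriv.integral_mul_test hφ,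
      nrA.integral_mul_test hφ, hA.1.integral_mul_test hφ, np.integral_mul_test hφ,
      n3.integral_mul_test hφ, nq.integral_mul_test hφ] at m5
    rw [← Complex.ofReal_mul (2 / 45) (e ^ 4)] at m5
    refine Eq.trans ?_ m5
    refine (PolyL2.integral_add ((((p1.add p2).add p34).add p5).add (P p 0)) (p7.add p8) hφ).trans
      (congrArg₂ _ ?_ ?_)
    · refine (PolyL2.integral_add (((p1.add p2).add p34).add p5) (P p 0) hφ).trans
        (congrArg₂ _ ?_ rfl)
      refine (PolyL2.integral_add ((p1.add p2).add p34) p5 hφ).trans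
        (congrArg₂ _ ?_ (PolyL2.integral_const_mul _ _))
      refine (PolyL2.integral_add (p1.add p2) p34 hφ).trans (congrArg₂ _ ?_ ?_)
      · exact (PolyL2.integral_add p1 p2 hφ).trans
          (congrArg₂ _ rfl (PolyL2.integral_const_mul _ _))
      · refine (PolyL2.integral_const_mul _ _).trans (congrArg _ ?_)
        exact (PolyL2.integral_add p3 p4 hφ).trans
          (congrArg₂ _ rfl (PolyL2.integral_const_mul _ _))
    · exact (PolyL2.integral_add p7 p8 hφ).trans
          (congrArg₂ _ (PolyL2.integral_const_mul _ _) (PolyL2.integral_const_mul _ _)))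
  filter_upwards [hzero, hA.hat_deriv, h2.hat_deriv hs he.le, h1.hat_deriv hs he.le,
    hζ.hat_deriv hs he.le] with ξ z0 z1 z2 z3 z4
  simp only [Pi.zero_apply] at z0
  rw [hh3, z1, z2, z3, z4] at z0
  have hX : ix ξ ^ 2 = -(((2 * Real.pi * ξ) ^ 2 : ℝ) : ℂ) := by
    rw [ix, mul_pow, Complex.I_sq]; push_cast; ring
  have h4 : ((2 * Real.pi * ξ) ^ 4 : ℝ) = ((2 * Real.pi * ξ) ^ 2) ^ 2 := by ring
  rw [psym, h4]
  generalize (2 * Real.pi * ξ) ^ 2 = Y at hX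
  push_cast at z0 hX ⊢
  have hX4 : ix ξ ^ 4 = (Y : ℂ) ^ 2 := by rw [show 4 = 2 * 2 by norm_num, pow_mul, hX]; ring
  have hX5 : ix ξ ^ 5 = (Y : ℂ) ^ 2 * ix ξ := by rw [pow_succ, hX4]
  linear_combination z0 + (e ^ 2 / 3 * hat A ξ) * hX - (e ^ 4 / 45 * hat A ξ) * hX4 -
    (2 / 45 * e ^ 4 * hat ζ ξ) * hX5

/-! ### The difference of two solutions at a fixed time -/

/-- The data of two solutions at a fixed time: `a` and `a'` are the accelerations, `ηt` and `wt` the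
time derivatives of the differences. -/
structure Slice (s e c C E F : ℝ) (ζ v ζ' v' a a' f₁ f₂ ηt wt : ℝ → ℝ) : Prop where
  hs : 3 / 2 < s
  he : 0 < e
  he1 : e ≤ 1
  hc : 0 < c
  hζ : Sb s e 2 ζ C
  hv : Sb s e 2 v C
  hζ' : Sb s e 2 ζ' C
  hv' : Sb s e 2 v' C
  hζ'x : Sb s e 2 (deriv ζ') C
  hv'x : Sb s e 2 (deriv v') C
  hη : Sb s e 2 (fun x => ζ x - ζ' x) E
  hw : Sb s e 2 (fun x => v x - v' x) E
  hf₁ : Sb s e 2 f₁ F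
  hf₂ : Sb s e 2 f₂ F
  hh : ∀ x, c ≤ 1 + e ^ 2 * ζ x
  hh' : ∀ x, c ≤ 1 + e ^ 2 * ζ' x
  ha : H2 a
  ha' : H2 a'
  eqa : ∀ᵐ ξ, (psym e ξ : ℂ) * hat a ξ +
      (e ^ 2 : ℝ) * hat (fun x => ζ x * a x) ξ -
      (e ^ 4 / 3 : ℝ) * (ix ξ * hat (fun x => rho e ζ x * deriv a x) ξ) +
      (hat (fun x => deriv ζ x + e ^ 2 * (ζ x * deriv ζ x)) ξ +
        (2 / 45 * e ^ 4 : ℝ) * (((2 * Real.pi * ξ) ^ 4 : ℝ) * (ix ξ * hat ζ ξ)) +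
        ix ξ * hat (fun x => 2 / 3 * e ^ 4 * (deriv v x * deriv v x)) ξ) = 0
  eqa' : ∀ᵐ ξ, (psym e ξ : ℂ) * hat a' ξ +
      (e ^ 2 : ℝ) * hat (fun x => ζ' x * a' x) ξ -
      (e ^ 4 / 3 : ℝ) * (ix ξ * hat (fun x => rho e ζ' x * deriv a' x) ξ) +
      (hat (fun x => deriv ζ' x + e ^ 2 * (ζ' x * deriv ζ' x) - f₂ x) ξ +
        (2 / 45 * e ^ 4 : ℝ) * (((2 * Real.pi * ξ) ^ 4 : ℝ) * (ix ξ * hat ζ' ξ)) +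
        ix ξ * hat (fun x => 2 / 3 * e ^ 4 * (deriv v' x * deriv v' x)) ξ) = 0
  eqη : ∀ x, ηt x = -((1 + e ^ 2 * ζ x) * (deriv v x - deriv v' x)) -
      e ^ 2 * (v x * (deriv ζ x - deriv ζ' x)) -
      (e ^ 2 * (deriv ζ' x * (v x - v' x)) + e ^ 2 * ((ζ x - ζ' x) * deriv v' x) + f₁ x)
  eqw : ∀ x, wt x = a x - a' x -
      e ^ 2 * (v x * (deriv v x - deriv v' x) + (v x - v' x) * deriv v' x)

theorem Sb.congr {s e : ℝ} {k : ℕ} {f g : ℝ → ℝ} {A B : ℝ} (h : Sb s e k f A) (hfg : ∀ x, g x = f x)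
    (hAB : A ≤ B) : Sb s e k g B := by
  rw [funext hfg]; exact h.mono hAB

/-- The bound of the acceleration, up to the factor `1 / e`. -/
def accC (s c C : ℝ) : ℝ := ellC s c C * (8 * (C + algC s * C * C))

theorem ellC_nonneg {s c A : ℝ} (hc : 0 < c) (hA : 0 ≤ A) : 0 ≤ ellC s c A := bootC_nonneg hc hA _

theorem accC_nonneg {s c C : ℝ} (hc : 0 < c) (hC : 0 ≤ C) : 0 ≤ accC s c C := by
  have := ellC_nonneg (s := s) hc hC
  have := one_le_algC s
  unfold accC; positivity

/-- The Lipschitz constant of `ζ ↦ (h³ - 1) / e²`. -/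
def rhoL (s C : ℝ) : ℝ := 3 + 6 * algC s * C + 3 * algC s ^ 2 * C ^ 2

def accDC (s c C : ℝ) : ℝ :=
  1 + algC s * accC s c C + 2 * algC s * C + (4 / 3 * algC s * C + algC s * rhoL s C * accC s c C / 3)

/-- The bound of the difference of the accelerations, up to the factor `(E + eF) / e`. -/
def accDiffC (s c C : ℝ) : ℝ := ellC s c C * (8 * accDC s c C)

namespace Slice

variable {s e c C E F : ℝ} {ζ v ζ' v' a a' f₁ f₂ ηt wt : ℝ → ℝ}

theorem nonneg_C (S : Slice s e c C E F ζ v ζ' v' a a' f₁ f₂ ηt wt) : 0 ≤ C := S.hζ.2.1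
theorem nonneg_E (S : Slice s e c C E F ζ v ζ' v' a a' f₁ f₂ ηt wt) : 0 ≤ E := S.hη.2.1
theorem nonneg_F (S : Slice s e c C E F ζ v ζ' v' a a' f₁ f₂ ηt wt) : 0 ≤ F := S.hf₁.2.1

theorem deriv_η (S : Slice s e c C E F ζ v ζ' v' a a' f₁ f₂ ηt wt) (x : ℝ) :
    deriv (fun x => ζ x - ζ' x) x = deriv ζ x - deriv ζ' x :=
  deriv_fun_sub (S.hζ.differentiable S.hs S.he.le x) (S.hζ'.differentiable S.hs S.he.le x)

theorem deriv_w (S : Slice s e c C E F ζ v ζ' v' a a' f₁ f₂ ηt wt) (x : ℝ) :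
    deriv (fun x => v x - v' x) x = deriv v x - deriv v' x :=
  deriv_fun_sub (S.hv.differentiable S.hs S.he.le x) (S.hv'.differentiable S.hs S.he.le x)

theorem deriv_a_sub (S : Slice s e c C E F ζ v ζ' v' a a' f₁ f₂ ηt wt) (x : ℝ) :
    deriv (fun x => a x - a' x) x = deriv a x - deriv a' x :=
  deriv_fun_sub (S.ha.rep_deriv.1 x) (S.ha'.rep_deriv.1 x)

theorem sb_ηx (S : Slice s e c C E F ζ v ζ' v' a a' f₁ f₂ ηt wt) :
    Sb s e 1 (fun x => deriv ζ x - deriv ζ' x) (E / e) :=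
  (S.hη.deriv S.hs S.he).congr (fun x => (S.deriv_η x).symm) le_rfl

theorem sb_wx (S : Slice s e c C E F ζ v ζ' v' a a' f₁ f₂ ηt wt) :
    Sb s e 1 (fun x => deriv v x - deriv v' x) (E / e) :=
  (S.hw.deriv S.hs S.he).congr (fun x => (S.deriv_w x).symm) le_rfl

/-- The elliptic estimate with B independent of e: the zero order source contains ζ_x, of size C/e,
while e⁴ v_x² loses two factors 1/e and remains bounded. -/
theorem sb_a (S : Slice s e c C E F ζ v ζ' v' a a' f₁ f₂ ηt wt) : Sb s e 1 a (accC s c C / e) := by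
  have hs := S.hs
  have he := S.he
  have he1 := S.he1
  have hC := S.nonneg_C
  have ha := one_le_algC s
  have e2 : e ^ 2 ≤ 1 := pow_le_one₀ he.le he1
  have d1 := (S.hζ.deriv hs he).mono_k he.le zero_le_one
  have d2 := (S.hv.deriv hs he).mono_k he.le zero_le_one
  have hp := d1.add (((S.hζ.mono_k he.le zero_le_two).mul hs he.le d1).const_mul (e ^ 2))
  have hq := (d2.mul hs he.le d2).const_mul (2 / 3 * e ^ 4)
  have hB : 0 ≤ algC s * C * C := by positivity
  have := elliptic_estimate (B := C + algC s * C * C) hs he he1 S.hc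
    (S.hζ.mono_k he.le one_le_two) S.ha S.hh (hp.mono ?_) (hq.mono ?_) (S.hζ.mono (by linarith)) S.eqa
  · refine this.mono (le_of_eq ?_)
    rw [accC]; ring
  · rw [abs_of_nonneg (sq_nonneg e)]
    have h1 : C / e + e ^ 2 * (algC s * C * (C / e)) = (C + e ^ 2 * (algC s * C * C)) / e := by ring
    rw [h1]
    have := mul_le_of_le_one_left hB e2
    exact div_le_div_of_nonneg_right (by linarith) he.le
  · rw [abs_of_nonneg (by positivity)]
    have h1 : 2 / 3 * e ^ 4 * (algC s * (C / e) * (C / e)) = 2 / 3 * (e ^ 2 * (algC s * C * C)) := by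
      field_simp
    rw [h1]
    have := mul_le_of_le_one_left hB e2
    linarith

/-- `ρ(ζ) - ρ(ζ')` is controlled by `ζ - ζ'`. -/
theorem sb_rho_sub (S : Slice s e c C E F ζ v ζ' v' a a' f₁ f₂ ηt wt) :
    Sb s e 2 (fun x => rho e ζ x - rho e ζ' x) (rhoL s C * E) := by
  have hs := S.hs
  have he := S.he.le
  have hC := S.nonneg_C
  have hE := S.nonneg_E
  have ha := one_le_algC s
  have e2 : e ^ 2 ≤ 1 := pow_le_one₀ he S.he1
  have e4 : e ^ 4 ≤ 1 := pow_le_one₀ he S.he1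
  have h1 := S.hη.const_mul 3
  have h2 := (S.hη.mul hs he (S.hζ.add S.hζ')).const_mul (3 * e ^ 2)
  have h3 := (S.hη.mul hs he (((S.hζ.mul hs he S.hζ).add (S.hζ.mul hs he S.hζ')).add
    (S.hζ'.mul hs he S.hζ'))).const_mul (e ^ 4)
  refine ((h1.add h2).add h3).congr (fun x => by simp only [rho]; ring) ?_
  rw [abs_of_nonneg (by positivity : (0 : ℝ) ≤ 3 * e ^ 2), abs_of_nonneg (by positivity : 0 ≤ e ^ 4),
    rhoL]
  have p1 : 0 ≤ algC s * E * (C + C) := by positivity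
  have p2 : 0 ≤ algC s * E * (algC s * C * C + algC s * C * C + algC s * C * C) := by positivity
  have q1 := mul_le_of_le_one_left p1 e2
  have q2 := mul_le_of_le_one_left p2 e4
  norm_num
  nlinarith

/-- The zero order source in the equation of the difference of the accelerations. -/
def srcP (e : ℝ) (ζ ζ' a f₂ : ℝ → ℝ) (x : ℝ) : ℝ :=
  e ^ 2 * ((ζ x - ζ' x) * a x) + ((deriv ζ x - deriv ζ' x) +
    e ^ 2 * (ζ x * (deriv ζ x - deriv ζ' x) + (ζ x - ζ' x) * deriv ζ' x) + f₂ x)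

/-- The first order source in the equation of the difference of the accelerations. -/
def srcQ (e : ℝ) (ζ v ζ' v' a : ℝ → ℝ) (x : ℝ) : ℝ :=
  2 / 3 * e ^ 4 * ((deriv v x + deriv v' x) * (deriv v x - deriv v' x)) -
    e ^ 4 / 3 * ((rho e ζ x - rho e ζ' x) * deriv a x)

/-- The coefficients are those of the second solution, as in ζ a - ζ' a' = ζ'(a - a') + (ζ - ζ') a.
The remaining factors a and a_x belong to the solution without source, whose bound does not involve
F. -/
theorem eq_sub (S : Slice s e c C E F ζ v ζ' v' a a' f₁ f₂ ηt wt) :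
    ∀ᵐ ξ, (psym e ξ : ℂ) * hat (fun x => a x - a' x) ξ +
      (e ^ 2 : ℝ) * hat (fun x => ζ' x * (a x - a' x)) ξ -
      (e ^ 4 / 3 : ℝ) * (ix ξ * hat (fun x => rho e ζ' x * deriv (fun x => a x - a' x) x) ξ) +
      (hat (srcP e ζ ζ' a f₂) ξ + (2 / 45 * e ^ 4 : ℝ) * (((2 * Real.pi * ξ) ^ 4 : ℝ) *
        (ix ξ * hat (fun x => ζ x - ζ' x) ξ)) + ix ξ * hat (srcQ e ζ v ζ' v' a) ξ) = 0 := by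
  have hs := S.hs
  have he := S.he.le
  have na := S.ha.1
  have na' := S.ha'.1
  have nr := (S.hζ.rho hs he S.he1).1
  have nr' := (S.hζ'.rho hs he S.he1).1
  have nd := S.hζ.nice_deriv hs he
  have nd' := S.hζ'.nice_deriv hs he
  have nv := S.hv.nice_deriv hs he
  have nv' := S.hv'.nice_deriv hs he
  have h1 := hat_sub na na'
  have h2 := hat_sub (S.hζ.1.mul na) (S.hζ'.1.mul na')
  have h3 := hat_sub (nr.mul S.ha.nice_deriv) (nr'.mul S.ha'.nice_deriv)
  have h4 := hat_sub (nd.add ((S.hζ.1.mul nd).const_mul (e ^ 2)))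
    ((nd'.add ((S.hζ'.1.mul nd').const_mul (e ^ 2))).sub S.hf₂.1)
  have h5 := hat_sub ((nv.mul nv).const_mul (2 / 3 * e ^ 4)) ((nv'.mul nv').const_mul (2 / 3 * e ^ 4))
  have h6 := hat_sub S.hζ.1 S.hζ'.1
  have nz := na.sub na'
  have nzx := S.ha.nice_deriv.sub S.ha'.nice_deriv
  have nη := S.hζ.1.sub S.hζ'.1
  have k2 := hat_add (S.hζ'.1.mul nz) (nη.mul na)
  have k3 := hat_add (nr'.mul nzx) ((nr.sub nr').mul S.ha.nice_deriv)
  have nP0 := (nd.sub nd').add ((((S.hζ.1.mul (nd.sub nd')).add (nη.mul nd')).const_mul (e ^ 2))) |>.add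
    S.hf₂.1
  have k4 := hat_add ((nη.mul na).const_mul (e ^ 2)) nP0
  have k4' := hat_const_mul (nη.mul na) (e ^ 2)
  have nQ := ((nv.add nv').mul (nv.sub nv')).const_mul (2 / 3 * e ^ 4)
  have k5 := hat_sub nQ (((nr.sub nr').mul S.ha.nice_deriv).const_mul (e ^ 4 / 3))
  have k5' := hat_const_mul ((nr.sub nr').mul S.ha.nice_deriv) (e ^ 4 / 3)
  have r2 : (fun x => ζ x * a x - ζ' x * a' x) =
      fun x => ζ' x * (a x - a' x) + (ζ x - ζ' x) * a x := by funext x; ring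
  have r3 : (fun x => rho e ζ x * deriv a x - rho e ζ' x * deriv a' x) =
      fun x => rho e ζ' x * (deriv a x - deriv a' x) + (rho e ζ x - rho e ζ' x) * deriv a x := by
    funext x; ring
  have r4 : (fun x => deriv ζ x + e ^ 2 * (ζ x * deriv ζ x) -
      (deriv ζ' x + e ^ 2 * (ζ' x * deriv ζ' x) - f₂ x)) = fun x => (deriv ζ x - deriv ζ' x) +
    e ^ 2 * (ζ x * (deriv ζ x - deriv ζ' x) + (ζ x - ζ' x) * deriv ζ' x) + f₂ x := by funext x; ring
  have r5 : (fun x => 2 / 3 * e ^ 4 * (deriv v x * deriv v x) -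
      2 / 3 * e ^ 4 * (deriv v' x * deriv v' x)) = fun x =>
      2 / 3 * e ^ 4 * ((deriv v x + deriv v' x) * (deriv v x - deriv v' x)) := by funext x; ring
  rw [r2] at h2
  rw [r3] at h3
  rw [r4] at h4
  rw [r5] at h5
  simp only [S.deriv_a_sub]
  unfold srcP srcQ
  filter_upwards [S.eqa, S.eqa', h1, h2, h3, h4, h5, h6, k2, k3, k4, k4', k5, k5']
    with ξ E1 E2 h1 h2 h3 h4 h5 h6 k2 k3 k4 k4' k5 k5'
  simp only [Pi.add_apply, Pi.sub_apply, Pi.smul_apply, smul_eq_mul] at *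
  rw [k4, k4', k5, k5', h1, h4, h5, h6]
  rw [k2] at h2
  rw [k3] at h3
  push_cast at *
  linear_combination E1 - E2 + e ^ 2 * h2 - e ^ 4 / 3 * ix ξ * h3

/-- Each product loses two factors 1/e against e⁴: one from each of v_x + v'_x and w_x, and two from
a_x. -/
theorem sb_srcQ (S : Slice s e c C E F ζ v ζ' v' a a' f₁ f₂ ηt wt) :
    Sb s e 0 (srcQ e ζ v ζ' v' a)
      (e ^ 2 * ((4 / 3 * algC s * C + algC s * rhoL s C * accC s c C / 3) * E)) := by
  have hs := S.hs
  have he := S.he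
  have h1 := (((((S.hv.deriv hs he).add (S.hv'.deriv hs he)).mul hs he.le S.sb_wx).const_mul
    (2 / 3 * e ^ 4)).mono_k he.le zero_le_one)
  have h2 := (((S.sb_rho_sub.mono_k he.le zero_le_two).mul hs he.le (S.sb_a.deriv hs he)).const_mul
    (e ^ 4 / 3))
  refine (h1.sub h2).congr (fun x => rfl) (le_of_eq ?_)
  rw [abs_of_nonneg (by positivity), abs_of_nonneg (by positivity)]
  have := he.ne'
  field_simp
  ring

theorem sb_srcP (S : Slice s e c C E F ζ v ζ' v' a a' f₁ f₂ ηt wt) :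
    Sb s e 0 (srcP e ζ ζ' a f₂) ((1 + algC s * accC s c C + 2 * algC s * C) * (E + e * F) / e) := by
  have hs := S.hs
  have he := S.he
  have hC := S.nonneg_C
  have hE := S.nonneg_E
  have hF := S.nonneg_F
  have ha := one_le_algC s
  have hA := accC_nonneg (s := s) S.hc hC
  have e2 : e ^ 2 ≤ 1 := pow_le_one₀ he.le S.he1
  have z0 := S.hζ.mono_k he.le (Nat.zero_le 2)
  have n0 := S.hη.mono_k he.le (Nat.zero_le 2)
  have x0 := S.sb_ηx.mono_k he.le (Nat.zero_le 1)
  have zx0 := (S.hζ'.deriv hs he).mono_k he.le (Nat.zero_le 1)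
  have h1 := (n0.mul hs he.le (S.sb_a.mono_k he.le (Nat.zero_le 1))).const_mul (e ^ 2)
  have h2 := ((z0.mul hs he.le x0).add (n0.mul hs he.le zx0)).const_mul (e ^ 2)
  refine (h1.add ((x0.add h2).add (S.hf₂.mono_k he.le (Nat.zero_le 2)))).congr (fun x => rfl) ?_
  rw [abs_of_nonneg (sq_nonneg e)]
  have h3 : e ^ 2 * (algC s * E * (accC s c C / e)) +
      (E / e + e ^ 2 * (algC s * C * (E / e) + algC s * E * (C / e)) + F) =
      (E + e * F + e ^ 2 * (algC s * accC s c C * E) + e ^ 2 * (2 * algC s * C * E)) / e := by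
    have := he.ne'
    field_simp
    ring
  rw [h3]
  refine div_le_div_of_nonneg_right ?_ he.le
  have p1 : 0 ≤ algC s * accC s c C * E := by positivity
  have p2 : 0 ≤ 2 * algC s * C * E := by positivity
  have p3 : 0 ≤ algC s * accC s c C * (e * F) := by positivity
  have p4 : 0 ≤ 2 * algC s * C * (e * F) := by positivity
  have q1 := mul_le_of_le_one_left p1 e2
  have q2 := mul_le_of_le_one_left p2 e2
  linarith

theorem rhoL_nonneg (hC : 0 ≤ C) : 0 ≤ rhoL s C := by
  have := one_le_algC s
  unfold rhoL; positivity

theorem one_le_accDC (hc : 0 < c) (hC : 0 ≤ C) : 1 ≤ accDC s c C := by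
  have := one_le_algC s
  have := rhoL_nonneg (s := s) hC
  have := accC_nonneg (s := s) hc hC
  have : 0 ≤ algC s * accC s c C + 2 * algC s * C +
    (4 / 3 * algC s * C + algC s * rhoL s C * accC s c C / 3) := by positivity
  unfold accDC
  linarith

theorem accDiffC_nonneg (hc : 0 < c) (hC : 0 ≤ C) : 0 ≤ accDiffC s c C := by
  have := ellC_nonneg (s := s) hc hC
  have := one_le_accDC (s := s) hc hC
  unfold accDiffC; positivity

theorem h2_sub {f g : ℝ → ℝ} (hf : H2 f) (hg : H2 g) : H2 fun x => f x - g x := by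
  refine ⟨hf.1.sub hg.1, ?_⟩
  rw [nW_congr (hat_sub hf.1 hg.1), sub_eq_add_neg]
  refine (nW_add_le (continuous_jw 2).measurable (memLp_hat _).1 (memLp_hat _).1.neg).trans_lt
    (ENNReal.add_lt_top.2 ⟨hf.2, ?_⟩)
  have := nW_smul (jw 2) (-1) (hat g)
  rw [neg_one_smul] at this
  rw [this]
  exact ENNReal.mul_lt_top (by simp) hg.2

/-- The elliptic estimate for a - a'. Its operator involves the depth of the second solution, so
this is where a lower bound of that depth enters. -/
theorem sb_z (S : Slice s e c C E F ζ v ζ' v' a a' f₁ f₂ ηt wt) :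
    Sb s e 1 (fun x => a x - a' x) (accDiffC s c C * (E + e * F) / e) := by
  have hs := S.hs
  have he := S.he
  have hC := S.nonneg_C
  have hE := S.nonneg_E
  have hF := S.nonneg_F
  have ha := one_le_algC s
  have hA := accC_nonneg (s := s) S.hc hC
  have hR := rhoL_nonneg (s := s) hC
  have e2 : e ^ 2 ≤ 1 := pow_le_one₀ he.le S.he1
  have hD := one_le_accDC (s := s) S.hc hC
  have hG : 0 ≤ E + e * F := by positivity
  have hk : 0 ≤ 4 / 3 * algC s * C + algC s * rhoL s C * accC s c C / 3 := by positivity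
  have hk' : 0 ≤ 1 + algC s * accC s c C + 2 * algC s * C := by positivity
  have eF : 0 ≤ e * F := by positivity
  refine (elliptic_estimate (B := accDC s c C * (E + e * F)) hs he S.he1 S.hc
    (S.hζ'.mono_k he.le one_le_two) (h2_sub S.ha S.ha') S.hh' (S.sb_srcP.mono ?_) (S.sb_srcQ.mono ?_)
    (S.hη.mono ?_) S.eq_sub).mono (le_of_eq ?_)
  · refine div_le_div_of_nonneg_right (mul_le_mul_of_nonneg_right ?_ hG) he.le
    unfold accDC; linarith
  · refine (mul_le_of_le_one_left (by positivity) e2).trans ?_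
    refine mul_le_mul ?_ (by linarith) hE (by linarith)
    unfold accDC; linarith
  · nlinarith
  · rw [accDiffC]; ring

/-- The part of the equation of the surface elevation without derivative loss. -/
def remη (e : ℝ) (ζ v ζ' v' f₁ : ℝ → ℝ) (x : ℝ) : ℝ :=
  e ^ 2 * ((ζ x * (deriv v x - deriv v' x) + v x * (deriv ζ x - deriv ζ' x)) +
    (deriv ζ' x * (v x - v' x) + (ζ x - ζ' x) * deriv v' x)) + f₁ x

/-- The nonlinear part of the equation of the velocity. -/
def advW (v v' : ℝ → ℝ) (x : ℝ) : ℝ := v x * (deriv v x - deriv v' x) + (v x - v' x) * deriv v' x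

/-- The zero order part of the equation of the velocity. -/
def remK (e : ℝ) (ζ v ζ' v' a a' f₂ : ℝ → ℝ) (x : ℝ) : ℝ :=
  e ^ 2 * ((ζ' x * (a x - a' x) + (ζ x - ζ' x) * a x) + ((ζ x * (deriv ζ x - deriv ζ' x) +
    (ζ x - ζ' x) * deriv ζ' x) + advW v v' x)) + f₂ x

/-- The first order part of the equation of the velocity. -/
def remL (e : ℝ) (ζ v ζ' v' a a' : ℝ → ℝ) (x : ℝ) : ℝ :=
  e ^ 4 / 3 * (rho e ζ' x * deriv (fun x => a x - a' x) x + deriv (advW v v') x) -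
    srcQ e ζ v ζ' v' a x

def remηC (s C : ℝ) : ℝ := 1 + 4 * algC s * C

theorem sb_remη (S : Slice s e c C E F ζ v ζ' v' a a' f₁ f₂ ηt wt) :
    Sb s e 0 (remη e ζ v ζ' v' f₁) (remηC s C * (e * E + F)) := by
  have hs := S.hs
  have he := S.he
  have hC := S.nonneg_C
  have hE := S.nonneg_E
  have hF := S.nonneg_F
  have ha := one_le_algC s
  have h1 := ((S.hζ.mono_k he.le one_le_two).mul hs he.le S.sb_wx).add
    ((S.hv.mono_k he.le one_le_two).mul hs he.le S.sb_ηx)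
  have h2 := ((S.hζ'x.mul hs he.le S.hw).add (S.hη.mul hs he.le S.hv'x)).mono_k he.le one_le_two
  have h3 := ((h1.add h2).const_mul (e ^ 2)).add (S.hf₁.mono_k he.le one_le_two)
  refine (h3.mono_k he.le zero_le_one).congr (fun x => rfl) ?_
  rw [abs_of_nonneg (sq_nonneg e), remηC]
  have h4 : e ^ 2 * (algC s * C * (E / e) + algC s * C * (E / e) + (algC s * C * E + algC s * E * C)) =
      2 * (algC s * C) * (e * E) + e * (2 * (algC s * C) * (e * E)) := by
    have := he.ne'
    field_simp
    ring
  rw [h4]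
  have h5 := mul_le_of_le_one_left (by positivity : 0 ≤ 2 * (algC s * C) * (e * E)) S.he1
  have h6 : 0 ≤ e * E := by positivity
  have h7 : 0 ≤ algC s * C * F := by positivity
  linarith

theorem sb_advW (S : Slice s e c C E F ζ v ζ' v' a a' f₁ f₂ ηt wt) :
    Sb s e 1 (advW v v') (2 * algC s * C * E / e) := by
  have hs := S.hs
  have he := S.he
  have hC := S.nonneg_C
  have hE := S.nonneg_E
  have ha := one_le_algC s
  have h1 := ((S.hv.mono_k he.le one_le_two).mul hs he.le S.sb_wx).add
    ((S.hw.mul hs he.le S.hv'x).mono_k he.le one_le_two)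
  refine h1.congr (fun x => rfl) ?_
  have h4 : algC s * C * (E / e) + algC s * E * C = (algC s * C * E + e * (algC s * C * E)) / e := by
    have := he.ne'
    field_simp
  rw [h4]
  refine div_le_div_of_nonneg_right ?_ he.le
  have := mul_le_of_le_one_left (by positivity : 0 ≤ algC s * C * E) S.he1
  linarith

def remKC (s c C : ℝ) : ℝ :=
  1 + algC s * C * accDiffC s c C + algC s * accC s c C + 4 * algC s * C

theorem sb_remK (S : Slice s e c C E F ζ v ζ' v' a a' f₁ f₂ ηt wt) :
    Sb s e 0 (remK e ζ v ζ' v' a a' f₂) (remKC s c C * (e * E + F)) := by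
  have hs := S.hs
  have he := S.he
  have hC := S.nonneg_C
  have hE := S.nonneg_E
  have hF := S.nonneg_F
  have ha := one_le_algC s
  have hA := accC_nonneg (s := s) S.hc hC
  have hD := accDiffC_nonneg (s := s) S.hc hC
  have h1 := ((S.hζ'.mono_k he.le one_le_two).mul hs he.le S.sb_z).add
    ((S.hη.mono_k he.le one_le_two).mul hs he.le S.sb_a)
  have h2 := ((S.hζ.mono_k he.le one_le_two).mul hs he.le S.sb_ηx).add
    ((S.hη.mono_k he.le one_le_two).mul hs he.le (S.hζ'.deriv hs he))
  have h3 := ((h1.add (h2.add S.sb_advW)).const_mul (e ^ 2)).add (S.hf₂.mono_k he.le one_le_two)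
  refine (h3.mono_k he.le zero_le_one).congr (fun x => rfl) ?_
  rw [abs_of_nonneg (sq_nonneg e), remKC]
  have h4 : e ^ 2 * (algC s * C * (accDiffC s c C * (E + e * F) / e) + algC s * E * (accC s c C / e) +
      (algC s * C * (E / e) + algC s * E * (C / e) + 2 * algC s * C * E / e)) =
      algC s * C * accDiffC s c C * (e * E) + e ^ 2 * (algC s * C * accDiffC s c C * F) +
        algC s * accC s c C * (e * E) + 4 * algC s * C * (e * E) := by
    have := he.ne'
    field_simp
    ring
  rw [h4]
  have h5 := mul_le_of_le_one_left (by positivity : 0 ≤ algC s * C * accDiffC s c C * F)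
    (pow_le_one₀ he.le S.he1 : e ^ 2 ≤ 1)
  have h6 : 0 ≤ e * E := by positivity
  have h7 : 0 ≤ algC s * C * F := by positivity
  have h8 : 0 ≤ algC s * accC s c C * F := by positivity
  linarith

def remLC (s c C : ℝ) : ℝ :=
  algC s * rhoC s C * accDiffC s c C + 2 * algC s * C +
    (4 / 3 * algC s * C + algC s * rhoL s C * accC s c C / 3)

/-- The additional factor e is essential: this remainder is in divergence form and will be paired
with w_x, of size E/e. -/
theorem sb_remL (S : Slice s e c C E F ζ v ζ' v' a a' f₁ f₂ ηt wt) :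
    Sb s e 0 (remL e ζ v ζ' v' a a') (e * (remLC s c C * (e * E + F))) := by
  have hs := S.hs
  have he := S.he
  have hC := S.nonneg_C
  have hE := S.nonneg_E
  have hF := S.nonneg_F
  have ha := one_le_algC s
  have hA := accC_nonneg (s := s) S.hc hC
  have hD := accDiffC_nonneg (s := s) S.hc hC
  have hR := rhoL_nonneg (s := s) hC
  have hR' := rhoC_nonneg (s := s) hC
  have h1 := ((((S.hζ'.rho hs he.le S.he1).mono_k he.le zero_le_two).mul hs he.le
    (S.sb_z.deriv hs he)).add (S.sb_advW.deriv hs he)).const_mul (e ^ 4 / 3)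
  refine (h1.sub S.sb_srcQ).congr (fun x => rfl) ?_
  rw [abs_of_nonneg (by positivity), remLC]
  set k := 4 / 3 * algC s * C + algC s * rhoL s C * accC s c C / 3 with hk
  have hk0 : 0 ≤ k := by positivity
  have h4 : e ^ 4 / 3 * (algC s * rhoC s C * (accDiffC s c C * (E + e * F) / e / e) +
      2 * algC s * C * E / e / e) + e ^ 2 * (k * E) =
      e * (1 / 3 * (algC s * rhoC s C * accDiffC s c C) * (e * E) +
        1 / 3 * (e ^ 2 * (algC s * rhoC s C * accDiffC s c C * F)) +
        1 / 3 * (2 * algC s * C) * (e * E) + k * (e * E)) := by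
    have := he.ne'
    field_simp
  rw [h4]
  refine mul_le_mul_of_nonneg_left ?_ he.le
  have h5 := mul_le_of_le_one_left (by positivity : 0 ≤ algC s * rhoC s C * accDiffC s c C * F)
    (pow_le_one₀ he.le S.he1 : e ^ 2 ≤ 1)
  have p1 : 0 ≤ algC s * rhoC s C * accDiffC s c C * F := by positivity
  have p2 : 0 ≤ algC s * rhoC s C * accDiffC s c C * (e * E) := by positivity
  have p3 : 0 ≤ 2 * algC s * C * (e * E) := by positivity
  have p4 : 0 ≤ 2 * algC s * C * F := by positivity
  have p5 : 0 ≤ k * F := by positivity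
  linarith

theorem hat_ηt (S : Slice s e c C E F ζ v ζ' v' a a' f₁ f₂ ηt wt) :
    ∀ᵐ ξ, hat ηt ξ = -(ix ξ * hat (fun x => v x - v' x) ξ) - hat (remη e ζ v ζ' v' f₁) ξ := by
  have h1 : ηt = fun x => (-1) * (deriv (fun x => v x - v' x) x) - remη e ζ v ζ' v' f₁ x := by
    funext x
    rw [S.eqη x, S.deriv_w, remη]; ring
  have n1 := S.hw.nice_deriv S.hs S.he.le
  have h2 := hat_sub (n1.const_mul (-1)) S.sb_remη.1
  rw [h1]
  filter_upwards [h2, hat_const_mul n1 (-1), S.hw.hat_deriv S.hs S.he.le] with ξ a b d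
  rw [a, Pi.sub_apply, b, Pi.smul_apply, d]
  simp

/-- Since w_t = (a - a') - e² g with g the advection term, the symbol times ŵ_t follows from the
elliptic equation of a - a' minus e² times the symbol applied to ĝ. Of the latter, the constant part
joins `remK`, the X² part joins `remL` as a derivative, and the X⁴ part is left for the transport
estimate. -/
theorem psym_hat_wt (S : Slice s e c C E F ζ v ζ' v' a a' f₁ f₂ ηt wt) :
    ∀ᵐ ξ, (psym e ξ : ℂ) * hat wt ξ = -(ix ξ * hat (fun x => ζ x - ζ' x) ξ) -
      (2 / 45 * e ^ 4 : ℝ) * (((2 * Real.pi * ξ) ^ 4 : ℝ) * (ix ξ * hat (fun x => ζ x - ζ' x) ξ)) -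
      hat (remK e ζ v ζ' v' a a' f₂) ξ + ix ξ * hat (remL e ζ v ζ' v' a a') ξ -
      (e ^ 6 / 45 : ℝ) * (((2 * Real.pi * ξ) ^ 4 : ℝ) * hat (advW v v') ξ) := by
  have hs := S.hs
  have he := S.he
  have nz := S.sb_z.1
  have ng := S.sb_advW.1
  have ngx := S.sb_advW.nice_deriv hs he.le
  have nη := S.hη.1
  have nηx := S.hη.nice_deriv hs he.le
  have nP := S.sb_srcP.1
  have nQ := S.sb_srcQ.1
  have nζz := S.hζ'.1.mul nz
  have nzx := ((S.hζ'.rho hs he.le S.he1).1.mul (S.sb_z.nice_deriv hs he.le))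
  have h1 : wt = fun x => (a x - a' x) - e ^ 2 * advW v v' x := by
    funext x
    rw [S.eqw x, advW]
  have hK : remK e ζ v ζ' v' a a' f₂ = fun x => e ^ 2 * (ζ' x * (a x - a' x) + advW v v' x) +
      (srcP e ζ ζ' a f₂ x - deriv (fun x => ζ x - ζ' x) x) := by
    funext x
    rw [S.deriv_η, srcP, remK]; ring
  have hL : remL e ζ v ζ' v' a a' = fun x =>
      e ^ 4 / 3 * (rho e ζ' x * deriv (fun x => a x - a' x) x + deriv (advW v v') x) -
    srcQ e ζ v ζ' v' a x := rfl
  rw [h1, hK, hL]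
  filter_upwards [hat_sub nz (ng.const_mul (e ^ 2)), hat_const_mul ng (e ^ 2),
    hat_add ((nζz.add ng).const_mul (e ^ 2)) (nP.sub nηx), hat_const_mul (nζz.add ng) (e ^ 2),
    hat_add nζz ng, hat_sub nP nηx, hat_sub ((nzx.add ngx).const_mul (e ^ 4 / 3)) nQ,
    hat_const_mul (nzx.add ngx) (e ^ 4 / 3), hat_add nzx ngx, S.hη.hat_deriv hs he.le,
    S.sb_advW.hat_deriv hs he.le, S.eq_sub] with ξ t1 t2 t3 t4 t5 t6 t7 t8 t9 t10 t11 t12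
  simp only [Pi.add_apply, Pi.sub_apply, Pi.smul_apply, smul_eq_mul] at *
  rw [t1, t2, t3, t4, t5, t6, t7, t8, t9, t10, t11]
  have hX : ix ξ ^ 2 = -(((2 * Real.pi * ξ) ^ 2 : ℝ) : ℂ) := by
    rw [ix, mul_pow, Complex.I_sq]; push_cast; ring
  have h4 : ((2 * Real.pi * ξ) ^ 4 : ℝ) = ((2 * Real.pi * ξ) ^ 2) ^ 2 := by ring
  have hps : (psym e ξ : ℂ) = 1 + e ^ 2 / 3 * (((2 * Real.pi * ξ) ^ 2 : ℝ) : ℂ) +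
      e ^ 4 / 45 * (((2 * Real.pi * ξ) ^ 2 : ℝ) : ℂ) ^ 2 := by
    rw [psym]; push_cast; ring
  rw [h4] at t12 ⊢
  rw [hps] at t12 ⊢
  generalize (2 * Real.pi * ξ) ^ 2 = Y at *
  push_cast at *
  linear_combination t12 - (e ^ 4 / 3 * hat (advW v v') ξ) * hX

end Slice

/-! ### The energy inequality -/

theorem pairT_congr {s N : ℝ} {ρ : ℝ → ℝ} {F F' G : ℝ → ℂ} (h : F =ᵐ[volume] F') :
    pairT s N ρ F G = pairT s N ρ F' G := by
  rw [pairT, pairT, tf_congr s N h]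

theorem pairT_one {s : ℝ} (hs : 1 ≤ s) (N : ℝ) {F G : ℝ → ℂ} (hF : MemLp F 2) (hG : MemLp G 2) :
    pairT s N (fun _ => 1) F G =
      ∫ ξ, ((mu s N ξ : ℂ) * F ξ) * (starRingEnd ℂ) ((mu s N ξ : ℂ) * G ξ) := by
  rw [← Rep.integral_mul_conj (rep_tf hs N hF) (rep_tf hs N hG), pairT]
  simp

theorem re_integral_eq_zero {D : ℝ → ℂ} (hD : Integrable D) (h : ∀ᵐ ξ, (D ξ).re = 0) :
    (∫ ξ, D ξ).re = 0 := by
  have h1 : (∫ ξ, D ξ).re = ∫ ξ, (D ξ).re := (integral_re hD).symm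
  rw [h1, integral_congr_ae h, integral_zero]

theorem memLp_lam_mul {s : ℝ} (hs : 1 ≤ s) (N : ℝ) {F : ℝ → ℂ} (hF : MemLp F 2) :
    MemLp (fun ξ => (lam s N ξ : ℂ) * F ξ) 2 := by
  refine memLp_mul_of_bounded (Complex.continuous_ofReal.comp
    (continuous_lam s N)).aestronglyMeasurable (C := 2 * |N|) (fun ξ => ?_) hF
  have := pow_mul_lam_le hs N 0 ξ
  rw [Complex.norm_real, Real.norm_of_nonneg (lam_nonneg _ _ _)]
  simpa using this

theorem psym_le_pow {e : ℝ} (he : 0 ≤ e) (he1 : e ≤ 1) (ξ : ℝ) :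
    psym e ξ ≤ (1 + |2 * Real.pi * ξ|) ^ 4 := by
  rw [psym_eq]
  have h1 : e * |2 * Real.pi * ξ| ≤ |2 * Real.pi * ξ| := mul_le_of_le_one_left (abs_nonneg _) he1
  have h0 : 0 ≤ e * |2 * Real.pi * ξ| := by positivity
  set y := |2 * Real.pi * ξ|
  have h2 : (e * y) ^ 2 ≤ y ^ 2 := pow_le_pow_left₀ h0 h1 2
  have h4 : (e * y) ^ 4 ≤ y ^ 4 := pow_le_pow_left₀ h0 h1 4
  have hy : 0 ≤ y := abs_nonneg _
  have y3 : 0 ≤ y ^ 3 := by positivity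
  have : 0 ≤ y ^ 4 := by positivity
  nlinarith [sq_nonneg y]

theorem memLp_psym_lam_mul {s e : ℝ} (hs : 1 ≤ s) (he : 0 ≤ e) (he1 : e ≤ 1) (N : ℝ) {F : ℝ → ℂ}
    (hF : MemLp F 2) : MemLp (fun ξ => ((psym e ξ * lam s N ξ : ℝ) : ℂ) * F ξ) 2 := by
  refine memLp_mul_of_bounded (Complex.continuous_ofReal.comp
    ((continuous_psym e).mul (continuous_lam s N))).aestronglyMeasurable
    (C := (1 + 2 * |N|) ^ 4 * (2 * |N|)) (fun ξ => ?_) hF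
  rw [Complex.norm_real, Real.norm_of_nonneg (mul_nonneg (psym_pos e ξ).le (lam_nonneg _ _ _))]
  exact (mul_le_mul_of_nonneg_right (psym_le_pow he he1 ξ) (lam_nonneg _ _ _)).trans
    (pow_mul_lam_le hs N 4 ξ)

theorem Sb.memLp_ix {s e : ℝ} (hs : 3 / 2 < s) (he : 0 ≤ e) {k : ℕ} {f : ℝ → ℝ} {A : ℝ}
    (h : Sb s e k f A) : MemLp (fun ξ => ix ξ * hat f ξ) 2 := (h.rep_deriv hs he).2.2.1

/-- The bound of `1 / h` and of its derivative. -/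
def invC (s c C : ℝ) : ℝ := 1 / c + embC s * C / c ^ 2

namespace Slice

variable {s e c C E F : ℝ} {ζ v ζ' v' a a' f₁ f₂ ηt wt : ℝ → ℝ}

theorem hasDerivAt_inv (S : Slice s e c C E F ζ v ζ' v' a a' f₁ f₂ ηt wt) (x : ℝ) :
    HasDerivAt (fun x => (1 + e ^ 2 * ζ x)⁻¹)
      (-(e ^ 2 * deriv ζ x) / (1 + e ^ 2 * ζ x) ^ 2) x := by
  have h1 := ((S.hζ.differentiable S.hs S.he.le x).hasDerivAt.const_mul (e ^ 2)).const_add 1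
  exact h1.inv (S.hc.trans_le (S.hh x)).ne'

theorem continuous_inv (S : Slice s e c C E F ζ v ζ' v' a a' f₁ f₂ ηt wt) :
    Continuous fun x => -(e ^ 2 * deriv ζ x) / (1 + e ^ 2 * ζ x) ^ 2 := by
  have h1 := (S.hζ.differentiable S.hs S.he.le).continuous
  have h2 := S.hζ.continuous_deriv S.hs S.he.le
  exact Continuous.div (by fun_prop) (by fun_prop) fun x =>
    (pow_pos (S.hc.trans_le (S.hh x)) 2).ne'

theorem abs_inv_le (S : Slice s e c C E F ζ v ζ' v' a a' f₁ f₂ ηt wt) (x : ℝ) :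
    |(1 + e ^ 2 * ζ x)⁻¹| ≤ invC s c C := by
  have hc := S.hc
  have hC := S.nonneg_C
  have he := embC_nonneg s
  rw [abs_inv, abs_of_pos (hc.trans_le (S.hh x)), invC]
  have h1 : (1 + e ^ 2 * ζ x)⁻¹ ≤ 1 / c := by rw [one_div]; exact inv_anti₀ hc (S.hh x)
  have : 0 ≤ embC s * C / c ^ 2 := by positivity
  linarith

theorem abs_deriv_inv_le (S : Slice s e c C E F ζ v ζ' v' a a' f₁ f₂ ηt wt) (x : ℝ) :
    |-(e ^ 2 * deriv ζ x) / (1 + e ^ 2 * ζ x) ^ 2| ≤ invC s c C := by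
  have hc := S.hc
  have hC := S.nonneg_C
  have he := embC_nonneg s
  have hd := S.hζ.abs_deriv_le S.hs S.he.le x
  have e2 : e ^ 2 ≤ 1 := pow_le_one₀ S.he.le S.he1
  rw [abs_div, abs_neg, abs_mul, abs_of_nonneg (sq_nonneg e),
    abs_of_nonneg (a := (1 + e ^ 2 * ζ x) ^ 2) (sq_nonneg _), invC]
  have h1 : e ^ 2 * |deriv ζ x| / (1 + e ^ 2 * ζ x) ^ 2 ≤ embC s * C / c ^ 2 := by
    refine div_le_div₀ (by positivity) ?_ (by positivity) (pow_le_pow_left₀ hc.le (S.hh x) 2)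
    exact (mul_le_of_le_one_left (abs_nonneg _) e2).trans hd
  have : 0 ≤ 1 / c := by positivity
  linarith

/-- The derivative is skew: the two integrands add up to i times a real number. -/
theorem re_transport_cancel (S : Slice s e c C E F ζ v ζ' v' a a' f₁ f₂ ηt wt) (N : ℝ) :
    (∫ ξ, ((mu s N ξ : ℂ) * (ix ξ * hat (fun x => ζ x - ζ' x) ξ)) *
        (starRingEnd ℂ) ((mu s N ξ : ℂ) * hat (fun x => v x - v' x) ξ)).re +
      (∫ ξ, ((mu s N ξ : ℂ) * (ix ξ * hat (fun x => v x - v' x) ξ)) *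
        (starRingEnd ℂ) ((mu s N ξ : ℂ) * hat (fun x => ζ x - ζ' x) ξ)).re = 0 := by
  have hs1 : 1 ≤ s := by have := S.hs; linarith
  have i1 := integrable_conj (bandLimited_mu_ix hs1 N (memLp_hat fun x => ζ x - ζ' x)).2
    (rep_tf hs1 N (memLp_hat fun x => v x - v' x)).2.1
  have i2 := integrable_conj (bandLimited_mu_ix hs1 N (memLp_hat fun x => v x - v' x)).2
    (rep_tf hs1 N (memLp_hat fun x => ζ x - ζ' x)).2.1
  rw [← Complex.add_re, ← integral_add i1 i2]
  refine re_integral_eq_zero (i1.add i2) (ae_of_all _ fun ξ => ?_)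
  simp only [ix, map_mul, Complex.conj_ofReal, Complex.add_re, Complex.mul_re, Complex.mul_im,
    Complex.ofReal_re, Complex.ofReal_im, Complex.I_re, Complex.I_im, Complex.conj_re,
    Complex.conj_im]
  ring

/-- The energy identity for the part of the energy that is diagonal on the Fourier side. -/
theorem re_diagonal (S : Slice s e c C E F ζ v ζ' v' a a' f₁ f₂ ηt wt) (N : ℝ) :
    (∫ ξ, ((lam s N ξ : ℂ) * hat ηt ξ) *
        (starRingEnd ℂ) ((lam s N ξ : ℂ) * hat (fun x => ζ x - ζ' x) ξ)).re +
      (∫ ξ, (((psym e ξ * lam s N ξ : ℝ) : ℂ) * hat wt ξ) *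
        (starRingEnd ℂ) ((lam s N ξ : ℂ) * hat (fun x => v x - v' x) ξ)).re =
    -(∫ ξ, ((lam s N ξ : ℂ) * hat (remη e ζ v ζ' v' f₁) ξ) *
        (starRingEnd ℂ) ((lam s N ξ : ℂ) * hat (fun x => ζ x - ζ' x) ξ)).re -
      (∫ ξ, ((lam s N ξ : ℂ) * hat (remK e ζ v ζ' v' a a' f₂) ξ) *
        (starRingEnd ℂ) ((lam s N ξ : ℂ) * hat (fun x => v x - v' x) ξ)).re -
      (∫ ξ, ((lam s N ξ : ℂ) * hat (remL e ζ v ζ' v' a a') ξ) *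
        (starRingEnd ℂ) ((lam s N ξ : ℂ) * (ix ξ * hat (fun x => v x - v' x) ξ))).re -
      2 / 45 * e ^ 4 * (∫ ξ, ((mu s N ξ : ℂ) * (ix ξ * hat (fun x => ζ x - ζ' x) ξ)) *
        (starRingEnd ℂ) ((mu s N ξ : ℂ) * hat (fun x => v x - v' x) ξ)).re -
      e ^ 6 / 45 * (∫ ξ, ((mu s N ξ : ℂ) * hat (advW v v') ξ) *
        (starRingEnd ℂ) ((mu s N ξ : ℂ) * hat (fun x => v x - v' x) ξ)).re := by
  have hs1 : 1 ≤ s := by have := S.hs; linarith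
  have L := fun f : ℝ → ℝ => memLp_lam_mul hs1 N (memLp_hat f)
  have M := fun f : ℝ → ℝ => (rep_tf hs1 N (memLp_hat f)).2.1
  have i1 := integrable_conj (L ηt) (L fun x => ζ x - ζ' x)
  have i2 := integrable_conj (memLp_psym_lam_mul hs1 S.he.le S.he1 N (memLp_hat wt))
    (L fun x => v x - v' x)
  have i3 := integrable_conj (L (remη e ζ v ζ' v' f₁)) (L fun x => ζ x - ζ' x)
  have i4 := integrable_conj (L (remK e ζ v ζ' v' a a' f₂)) (L fun x => v x - v' x)
  have i5 := integrable_conj (L (remL e ζ v ζ' v' a a'))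
    (memLp_lam_mul hs1 N (S.hw.memLp_ix S.hs S.he.le))
  have i6 := integrable_conj (bandLimited_mu_ix hs1 N (memLp_hat fun x => ζ x - ζ' x)).2
    (M fun x => v x - v' x)
  have i7 := integrable_conj (M (advW v v')) (M fun x => v x - v' x)
  have i6' := i6.const_mul ((2 / 45 * e ^ 4 : ℝ) : ℂ)
  have i7' := i7.const_mul ((e ^ 6 / 45 : ℝ) : ℂ)
  -- At each frequency the first order terms of the two equations form a skew pair and cancel. The
  -- fifth order term has no counterpart in the diagonal part of the elevation energy and survives.
  have key := re_integral_eq_zero (((i1.add i2).add (i3.add i4)).add ((i5.add i6').add i7')) (by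
    filter_upwards [S.hat_ηt, S.psym_hat_wt] with ξ h1 h2
    simp only [Pi.add_apply]
    rw [h1, show (((psym e ξ * lam s N ξ : ℝ) : ℂ) * hat wt ξ) =
      (lam s N ξ : ℂ) * ((psym e ξ : ℂ) * hat wt ξ) by push_cast; ring, h2]
    have hmu : mu s N ξ = (2 * Real.pi * ξ) ^ 2 * lam s N ξ := rfl
    rw [hmu]
    generalize hat (fun x => ζ x - ζ' x) ξ = H
    generalize hat (fun x => v x - v' x) ξ = W
    generalize hat (remη e ζ v ζ' v' f₁) ξ = R
    generalize hat (remK e ζ v ζ' v' a a' f₂) ξ = K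
    generalize hat (remL e ζ v ζ' v' a a') ξ = l
    generalize hat (advW v v') ξ = g
    have h4 : ((2 * Real.pi * ξ) ^ 4 : ℝ) = ((2 * Real.pi * ξ) ^ 2) ^ 2 := by ring
    rw [h4]
    have hix : ix ξ = ((2 * Real.pi * ξ : ℝ) : ℂ) * Complex.I := rfl
    rw [hix]
    generalize 2 * Real.pi * ξ = X
    generalize lam s N ξ = y
    simp only [map_mul, Complex.conj_ofReal, Complex.add_re, Complex.sub_re, Complex.sub_im,
      Complex.neg_re, Complex.neg_im, Complex.add_im, Complex.mul_re, Complex.mul_im,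
      Complex.ofReal_re, Complex.ofReal_im, Complex.I_re, Complex.I_im, Complex.conj_re,
      Complex.conj_im, Complex.conj_I]
    ring)
  rw [integral_add' ((i1.add i2).add (i3.add i4)) ((i5.add i6').add i7'),
    integral_add' (i1.add i2) (i3.add i4), integral_add' i1 i2, integral_add' i3 i4,
    integral_add' (i5.add i6') i7', integral_add' i5 i6', integral_const_mul, integral_const_mul] at key
  simp only [Complex.add_re, Complex.re_ofReal_mul] at key
  linarith

theorem invC_nonneg (hc : 0 < c) (hC : 0 ≤ C) : 0 ≤ invC s c C := by
  have := embC_nonneg s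
  unfold invC; positivity

/-- The terms of the elevation equation that can be differentiated twice. -/
def rem2 (e : ℝ) (ζ v ζ' v' f₁ : ℝ → ℝ) (x : ℝ) : ℝ :=
  e ^ 2 * (deriv ζ' x * (v x - v' x) + (ζ x - ζ' x) * deriv v' x) + f₁ x

/-- Both products involve η and w themselves and a derivative of the second solution of order two in
the weights, so they can be measured under the top order operator. -/
theorem sb_rem2 (S : Slice s e c C E F ζ v ζ' v' a a' f₁ f₂ ηt wt) :
    Sb s e 2 (rem2 e ζ v ζ' v' f₁) ((1 + 2 * algC s * C) * (e * E + F)) := by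
  have hs := S.hs
  have he := S.he
  have hC := S.nonneg_C
  have hE := S.nonneg_E
  have hF := S.nonneg_F
  have ha := one_le_algC s
  have h1 := (((S.hζ'x.mul hs he.le S.hw).add (S.hη.mul hs he.le S.hv'x)).const_mul (e ^ 2)).add S.hf₁
  refine h1.congr (fun x => rfl) ?_
  rw [abs_of_nonneg (sq_nonneg e)]
  have h2 : 0 ≤ 2 * algC s * C * (e * E) := by positivity
  have h3 := mul_le_of_le_one_left h2 S.he1
  have h4 : 0 ≤ 2 * algC s * C * F := by positivity
  have h5 : 0 ≤ e * E := by positivity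
  have h6 : e ^ 2 * (algC s * C * E + algC s * E * C) = e * (2 * algC s * C * (e * E)) := by ring
  rw [h6]
  linarith

/-- The pairing of the time derivative of the elevation, with the top order term isolated. -/
theorem re_pairT_elevation (S : Slice s e c C E F ζ v ζ' v' a a' f₁ f₂ ηt wt) (N : ℝ) :
    |(pairT s N (fun x => (1 + e ^ 2 * ζ x)⁻¹) (hat ηt) (hat fun x => ζ x - ζ' x)).re +
      (∫ ξ, ((mu s N ξ : ℂ) * (ix ξ * hat (fun x => v x - v' x) ξ)) *
        (starRingEnd ℂ) ((mu s N ξ : ℂ) * hat (fun x => ζ x - ζ' x) ξ)).re| ≤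
    invC s c C * (2 * commC s + 2 * embC s) * C * E ^ 2 / e ^ 2 +
      invC s c C * (1 + 2 * algC s * C) * (e * E + F) * E / e ^ 4 := by
  have hs := S.hs
  have hs1 : 1 ≤ s := by linarith
  have he := S.he
  have hC := S.nonneg_C
  have hE := S.nonneg_E
  have hF := S.nonneg_F
  have hI := invC_nonneg (s := s) S.hc hC
  have ha := one_le_algC s
  set ρ : ℝ → ℝ := fun x => (1 + e ^ 2 * ζ x)⁻¹ with hρdef
  set η : ℝ → ℝ := fun x => ζ x - ζ' x with hηdef
  set w : ℝ → ℝ := fun x => v x - v' x with hwdef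
  have hηS : Sb s e 2 η E := S.hη
  have hwS : Sb s e 2 w E := S.hw
  have dη : ∀ x, deriv η x = deriv ζ x - deriv ζ' x := S.deriv_η
  have dw : ∀ x, deriv w x = deriv v x - deriv v' x := S.deriv_w
  have hρd : Differentiable ℝ ρ := fun x => (S.hasDerivAt_inv x).differentiableAt
  have hρ : AEStronglyMeasurable ρ := hρd.continuous.aestronglyMeasurable
  have nwx := hwS.nice_deriv hs he.le
  have nηx := hηS.nice_deriv hs he.le
  have c1 : hat (fun x => ζ x * deriv w x) =ᵐ[volume] cv (hat ζ) fun ξ => ix ξ * hat w ξ :=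
    hat_ae_eq (by
      refine (congrArg (fun u => Rep u _) ?_).mp (Rep.mul S.hζ.1 (hwS.rep_deriv hs he.le).2)
      funext x; simp)
  have c2 : hat (fun x => v x * deriv η x) =ᵐ[volume] cv (hat v) fun ξ => ix ξ * hat η ξ :=
    hat_ae_eq (by
      refine (congrArg (fun u => Rep u _) ?_).mp (Rep.mul S.hv.1 (hηS.rep_deriv hs he.le).2)
      funext x; simp)
  have n1 := S.hζ.1.mul nwx
  have n2 := S.hv.1.mul nηx
  have e0 : ηt = fun x => (-1) * deriv w x + ((-e ^ 2) * (ζ x * deriv w x) +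
      ((-e ^ 2) * (v x * deriv η x) + (-1) * rem2 e ζ v ζ' v' f₁ x)) := by
    funext x
    rw [S.eqη x, dw, dη, rem2]; ring
  have dec : hat ηt =ᵐ[volume] ((-1 : ℝ) : ℂ) • (fun ξ => ix ξ * hat w ξ) +
      (((-e ^ 2 : ℝ) : ℂ) • hat (fun x => ζ x * deriv w x) +
      (((-e ^ 2 : ℝ) : ℂ) • hat (fun x => v x * deriv η x) +
        ((-1 : ℝ) : ℂ) • hat (rem2 e ζ v ζ' v' f₁))) := by
    rw [e0]
    have m1 := nwx.const_mul (-1)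
    have m2 := n1.const_mul (-e ^ 2)
    have m3 := n2.const_mul (-e ^ 2)
    have m4 := S.sb_rem2.1.const_mul (-1)
    filter_upwards [hat_add m1 (m2.add (m3.add m4)), hat_add m2 (m3.add m4), hat_add m3 m4,
      hat_const_mul nwx (-1), hat_const_mul n1 (-e ^ 2), hat_const_mul n2 (-e ^ 2),
      hat_const_mul S.sb_rem2.1 (-1), hwS.hat_deriv hs he.le] with ξ q1 q2 q3 q4 q5 q6 q7 q8
    rw [q1, Pi.add_apply, q2, Pi.add_apply, q3, Pi.add_apply, q4, q5, q6, q7]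
    simp only [Pi.add_apply, Pi.smul_apply, q8]
  have L0 := hwS.memLp_ix hs he.le
  have L1 := memLp_hat fun x => ζ x * deriv w x
  have L2 := memLp_hat fun x => v x * deriv η x
  have L3 := memLp_hat (rem2 e ζ v ζ' v' f₁)
  have LH := memLp_hat η
  have hD := nW_mu_le he N hηS
  have b1 := norm_pairT_commutator_le hs he S.he1 N S.hζ hwS hρ S.abs_inv_le LH (by positivity) hD
  have b2 := abs_re_pairT_transport_le hs he S.he1 N S.hv hηS S.hasDerivAt_inv S.continuous_inv
    S.abs_inv_le S.abs_deriv_inv_le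
  have b3 := norm_pairT_le hs1 S.abs_inv_le L3 LH (by have := S.sb_rem2.2.1; positivity)
    (by positivity) (nW_mu_le he N S.sb_rem2) hD
  -- Once ζ has been commuted out of the operator, ρ + e²ρζ = 1 with ρ the inverse depth: the weight
  -- disappears and the constant coefficient pairing needed for the cancellation remains.
  have tot : pairT s N ρ (fun ξ => ix ξ * hat w ξ) (hat η) + ((e ^ 2 : ℝ) : ℂ) *
      ∫ x, ((ρ x * ζ x : ℝ) : ℂ) * tf s N (fun η => ix η * hat w η) x *
        (starRingEnd ℂ) (tf s N (hat η) x) =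
      ∫ ξ, ((mu s N ξ : ℂ) * (ix ξ * hat w ξ)) * (starRingEnd ℂ) ((mu s N ξ : ℂ) * hat η ξ) := by
    rw [← pairT_one hs1 N L0 LH, pairT, pairT, ← integral_const_mul, ← integral_add]
    · refine integral_congr_ae (ae_of_all _ fun x => ?_)
      have hne := (S.hc.trans_le (S.hh x)).ne'
      have : ((ρ x : ℝ) : ℂ) + ((e ^ 2 : ℝ) : ℂ) * ((ρ x * ζ x : ℝ) : ℂ) = 1 := by
        rw [← Complex.ofReal_mul, ← Complex.ofReal_add, ← Complex.ofReal_one]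
        congr 1
        simp only [hρdef]
        field_simp
      dsimp only
      rw [Complex.ofReal_one, ← this]
      ring
    · exact integrable_pairT hs1 hρ S.abs_inv_le L0 LH
    · refine Integrable.const_mul ?_ _
      refine integrable_mul_conj (P := invC s c C * (embC s * C))
        (hρ.mul (S.hζ.differentiable hs he.le).continuous.aestronglyMeasurable) (fun x => ?_)
        (rep_tf hs1 N L0).memLp (rep_tf hs1 N LH).memLp
      rw [abs_mul]
      exact mul_le_mul (S.abs_inv_le x) (S.hζ.abs_le hs he.le x) (abs_nonneg _) hI
  rw [pairT_congr dec, pairT_add hs1 hρ S.abs_inv_le (L0.const_smul _)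
      ((L1.const_smul _).add ((L2.const_smul _).add (L3.const_smul _))) LH,
    pairT_add hs1 hρ S.abs_inv_le (L1.const_smul _) ((L2.const_smul _).add (L3.const_smul _)) LH,
    pairT_add hs1 hρ S.abs_inv_le (L2.const_smul _) (L3.const_smul _) LH,
    pairT_smul hs1 _ L0, pairT_smul hs1 _ L1, pairT_smul hs1 _ L2, pairT_smul hs1 _ L3,
    pairT_congr c1, pairT_congr c2, ← tot]
  have b1' := (Complex.abs_re_le_norm _).trans b1
  have b3' := (Complex.abs_re_le_norm _).trans b3
  simp only [Complex.add_re, Complex.sub_re, Complex.re_ofReal_mul] at b1' ⊢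
  set P1 := (pairT s N ρ (cv (hat ζ) fun ξ => ix ξ * hat w ξ) (hat η)).re
  set P2 := (pairT s N ρ (cv (hat v) fun ξ => ix ξ * hat η ξ) (hat η)).re
  set P3 := (pairT s N ρ (hat (rem2 e ζ v ζ' v' f₁)) (hat η)).re
  set J := (∫ x, ((ρ x * ζ x : ℝ) : ℂ) * tf s N (fun η => ix η * hat w η) x *
        (starRingEnd ℂ) (tf s N (hat η) x)).re
  set P0 := (pairT s N ρ (fun ξ => ix ξ * hat w ξ) (hat η)).re
  have e1 : -1 * P0 + (-e ^ 2 * P1 + (-e ^ 2 * P2 + -1 * P3)) + (P0 + e ^ 2 * J) =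
      -(e ^ 2 * (P1 - J)) - e ^ 2 * P2 - P3 := by ring
  rw [e1]
  have e2 := sq_nonneg e
  have t1 : |e ^ 2 * (P1 - J)| ≤ e ^ 2 * (invC s c C * (commC s * C * E / e ^ 2) * (E / e ^ 2)) := by
    rw [abs_mul, abs_of_nonneg e2]; exact mul_le_mul_of_nonneg_left b1' e2
  have t2 : |e ^ 2 * P2| ≤ e ^ 2 * (invC s c C * (commC s + 2 * embC s) * C * (E / e ^ 2) ^ 2) := by
    rw [abs_mul, abs_of_nonneg e2]; exact mul_le_mul_of_nonneg_left b2 e2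
  have t3 : |-(e ^ 2 * (P1 - J)) - e ^ 2 * P2 - P3| ≤ |e ^ 2 * (P1 - J)| + |e ^ 2 * P2| + |P3| := by
    refine (abs_sub _ _).trans (add_le_add_left ((abs_sub _ _).trans ?_) _)
    rw [abs_neg]
  refine t3.trans ((add_le_add (add_le_add t1 t2) b3').trans (le_of_eq ?_))
  have := he.ne'
  field_simp
  ring

/-- The constant of the energy inequality. -/
def enC (s c C : ℝ) : ℝ :=
  remηC s C + remKC s c C + remLC s c C + (commC s + 2 * embC s + algC s) * C +
    (invC s c C * (2 * commC s + 2 * embC s) * C + invC s c C * (1 + 2 * algC s * C))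

/-- The weighted top order part is added so that its leading term cancels the fifth order term of
the diagonal identity. What remains is three lower order pairings, the advection at top order and
the commutator errors. In the last two the factors e⁶ and e⁴ absorb the negative powers of e. -/
theorem energy_inequality (S : Slice s e c C E F ζ v ζ' v' a a' f₁ f₂ ηt wt) (N : ℝ) :
    |(∫ ξ, ((lam s N ξ : ℂ) * hat ηt ξ) *
        (starRingEnd ℂ) ((lam s N ξ : ℂ) * hat (fun x => ζ x - ζ' x) ξ)).re +
      (∫ ξ, (((psym e ξ * lam s N ξ : ℝ) : ℂ) * hat wt ξ) *
        (starRingEnd ℂ) ((lam s N ξ : ℂ) * hat (fun x => v x - v' x) ξ)).re +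
      2 / 45 * e ^ 4 *
        (pairT s N (fun x => (1 + e ^ 2 * ζ x)⁻¹) (hat ηt) (hat fun x => ζ x - ζ' x)).re| ≤
    enC s c C * (e * E + F) * E := by
  have hs := S.hs
  have hs1 : 1 ≤ s := by linarith
  have he := S.he
  have hC := S.nonneg_C
  have hE := S.nonneg_E
  have hF := S.nonneg_F
  have hI := invC_nonneg (s := s) S.hc hC
  have ha := one_le_algC s
  have hcm := commC_nonneg (s := s) (by linarith)
  have hem := embC_nonneg s
  have r0 := S.re_diagonal N
  have r1 := S.re_pairT_elevation N
  have r2 := S.re_transport_cancel N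
  have L := fun f : ℝ → ℝ => memLp_lam_mul hs1 N (memLp_hat f)
  have lη := nW_lam_le he.le N S.hη
  have lw := nW_lam_le he.le N S.hw
  have b1 := (Complex.abs_re_le_norm _).trans (norm_integral_conj_le (L (remη e ζ v ζ' v' f₁))
    (L fun x => ζ x - ζ' x) S.sb_remη.2.1 hE (nW_lam_le he.le N S.sb_remη) lη)
  have b2 := (Complex.abs_re_le_norm _).trans (norm_integral_conj_le (L (remK e ζ v ζ' v' a a' f₂))
    (L fun x => v x - v' x) S.sb_remK.2.1 hE (nW_lam_le he.le N S.sb_remK) lw)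
  have lwx : eLpNorm (fun ξ => (lam s N ξ : ℂ) * (ix ξ * hat (fun x => v x - v' x) ξ)) 2 volume ≤
      ENNReal.ofReal (E / e) := by
    refine le_of_eq_of_le (eLpNorm_congr_ae ?_) (nW_lam_le he.le N (S.hw.deriv hs he))
    filter_upwards [S.hw.hat_deriv hs he.le] with ξ h
    rw [h]
  have b3 := (Complex.abs_re_le_norm _).trans (norm_integral_conj_le (L (remL e ζ v ζ' v' a a'))
    (memLp_lam_mul hs1 N (S.hw.memLp_ix hs he.le)) S.sb_remL.2.1 (by positivity)
    (nW_lam_le he.le N S.sb_remL) lwx)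
  -- the advection term
  have n1 := S.hv.1.mul (S.hw.nice_deriv hs he.le)
  have sb2 := S.hw.mul hs he.le S.hv'x
  have c1 : hat (fun x => v x * deriv (fun x => v x - v' x) x) =ᵐ[volume]
      cv (hat v) fun ξ => ix ξ * hat (fun x => v x - v' x) ξ := hat_ae_eq (by
    refine (congrArg (fun u => Rep u _) ?_).mp (Rep.mul S.hv.1 (S.hw.rep_deriv hs he.le).2)
    funext x; simp)
  have dec : hat (advW v v') =ᵐ[volume] hat (fun x => v x * deriv (fun x => v x - v' x) x) +
      hat (fun x => (v x - v' x) * deriv v' x) := by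
    have e0 : advW v v' = fun x => v x * deriv (fun x => v x - v' x) x +
        (v x - v' x) * deriv v' x := by
      funext x; rw [advW, S.deriv_w]
    rw [e0]
    exact hat_add n1 sb2.1
  have b4 := abs_re_pairT_transport_le (ρ := fun _ => 1) (ρ' := fun _ => 0) (R := 1) hs he S.he1 N
    S.hv S.hw (fun x => hasDerivAt_const x 1) continuous_const (fun x => by simp) (fun x => by simp)
  have b5 := (Complex.abs_re_le_norm _).trans (norm_pairT_le (ρ := fun _ => 1) (R := 1) hs1
    (fun x => by simp) (memLp_hat fun x => (v x - v' x) * deriv v' x)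
    (memLp_hat fun x => v x - v' x) (by have := sb2.2.1; positivity) (by positivity)
    (nW_mu_le he N sb2) (nW_mu_le he N S.hw))
  rw [← pairT_one hs1 N (memLp_hat (advW v v')) (memLp_hat _), pairT_congr dec,
    pairT_add (R := 1) hs1 aestronglyMeasurable_const (fun x => by simp) (memLp_hat _) (memLp_hat _)
      (memLp_hat _), pairT_congr c1, Complex.add_re] at r0
  set D1 := (∫ ξ, ((lam s N ξ : ℂ) * hat ηt ξ) *
        (starRingEnd ℂ) ((lam s N ξ : ℂ) * hat (fun x => ζ x - ζ' x) ξ)).re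
  set D2 := (∫ ξ, (((psym e ξ * lam s N ξ : ℝ) : ℂ) * hat wt ξ) *
        (starRingEnd ℂ) ((lam s N ξ : ℂ) * hat (fun x => v x - v' x) ξ)).re
  set D3 := (pairT s N (fun x => (1 + e ^ 2 * ζ x)⁻¹) (hat ηt) (hat fun x => ζ x - ζ' x)).re
  set A1 := (∫ ξ, ((lam s N ξ : ℂ) * hat (remη e ζ v ζ' v' f₁) ξ) *
        (starRingEnd ℂ) ((lam s N ξ : ℂ) * hat (fun x => ζ x - ζ' x) ξ)).re
  set A2 := (∫ ξ, ((lam s N ξ : ℂ) * hat (remK e ζ v ζ' v' a a' f₂) ξ) *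
        (starRingEnd ℂ) ((lam s N ξ : ℂ) * hat (fun x => v x - v' x) ξ)).re
  set A3 := (∫ ξ, ((lam s N ξ : ℂ) * hat (remL e ζ v ζ' v' a a') ξ) *
        (starRingEnd ℂ) ((lam s N ξ : ℂ) * (ix ξ * hat (fun x => v x - v' x) ξ))).re
  set A4 := (pairT s N (fun _ => 1) (cv (hat v) fun ξ => ix ξ * hat (fun x => v x - v' x) ξ)
    (hat fun x => v x - v' x)).re
  set A5 := (pairT s N (fun _ => 1) (hat fun x => (v x - v' x) * deriv v' x)
    (hat fun x => v x - v' x)).re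
  set M3 := (∫ ξ, ((mu s N ξ : ℂ) * (ix ξ * hat (fun x => ζ x - ζ' x) ξ)) *
        (starRingEnd ℂ) ((mu s N ξ : ℂ) * hat (fun x => v x - v' x) ξ)).re
  set M4 := (∫ ξ, ((mu s N ξ : ℂ) * (ix ξ * hat (fun x => v x - v' x) ξ)) *
        (starRingEnd ℂ) ((mu s N ξ : ℂ) * hat (fun x => ζ x - ζ' x) ξ)).re
  have e4 : 0 ≤ 2 / 45 * e ^ 4 := by positivity
  have e6 : 0 ≤ e ^ 6 / 45 := by positivity
  -- M3 is the fifth order pairing of the velocity equation; by skewness it equals -M4, which is the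
  -- leading part of -D3 isolated before.
  have e1 : D1 + D2 + 2 / 45 * e ^ 4 * D3 =
      -A1 - A2 - A3 - e ^ 6 / 45 * A4 - e ^ 6 / 45 * A5 + 2 / 45 * e ^ 4 * (D3 + M4) := by
    linear_combination r0 - 2 / 45 * e ^ 4 * r2
  rw [e1]
  have t4 : |e ^ 6 / 45 * A4| ≤ e ^ 6 / 45 * (1 * (commC s + 2 * embC s) * C * (E / e ^ 2) ^ 2) := by
    rw [abs_mul, abs_of_nonneg e6]; exact mul_le_mul_of_nonneg_left b4 e6
  have t5 : |e ^ 6 / 45 * A5| ≤ e ^ 6 / 45 * (1 * (algC s * E * C / e ^ 2) * (E / e ^ 2)) := by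
    rw [abs_mul, abs_of_nonneg e6]; exact mul_le_mul_of_nonneg_left b5 e6
  have t6 : |2 / 45 * e ^ 4 * (D3 + M4)| ≤ 2 / 45 * e ^ 4 *
      (invC s c C * (2 * commC s + 2 * embC s) * C * E ^ 2 / e ^ 2 +
      invC s c C * (1 + 2 * algC s * C) * (e * E + F) * E / e ^ 4) := by
    rw [abs_mul, abs_of_nonneg e4]; exact mul_le_mul_of_nonneg_left r1 e4
  have hG : 0 ≤ e * E + F := by positivity
  have q : e * E * E ≤ (e * E + F) * E := mul_le_mul_of_nonneg_right (by linarith) hE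
  have q2 : e ^ 2 * E ^ 2 ≤ (e * E + F) * E := by
    have := mul_le_of_le_one_left (by positivity : 0 ≤ e * E * E) S.he1
    nlinarith
  have t4' : e ^ 6 / 45 * (1 * (commC s + 2 * embC s) * C * (E / e ^ 2) ^ 2) ≤
      (commC s + 2 * embC s) * C * ((e * E + F) * E) := by
    have h1 : e ^ 6 / 45 * (1 * (commC s + 2 * embC s) * C * (E / e ^ 2) ^ 2) =
        (commC s + 2 * embC s) * C * (e ^ 2 * E ^ 2 / 45) := by
      have := he.ne'
      field_simp
    rw [h1]
    refine mul_le_mul_of_nonneg_left ?_ (by positivity)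
    have : 0 ≤ e ^ 2 * E ^ 2 := by positivity
    linarith
  have t5' : e ^ 6 / 45 * (1 * (algC s * E * C / e ^ 2) * (E / e ^ 2)) ≤
      algC s * C * ((e * E + F) * E) := by
    have h1 : e ^ 6 / 45 * (1 * (algC s * E * C / e ^ 2) * (E / e ^ 2)) =
        algC s * C * (e ^ 2 * E ^ 2 / 45) := by
      have := he.ne'
      field_simp
    rw [h1]
    refine mul_le_mul_of_nonneg_left ?_ (by positivity)
    have : 0 ≤ e ^ 2 * E ^ 2 := by positivity
    linarith
  have t6' : 2 / 45 * e ^ 4 * (invC s c C * (2 * commC s + 2 * embC s) * C * E ^ 2 / e ^ 2 +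
      invC s c C * (1 + 2 * algC s * C) * (e * E + F) * E / e ^ 4) ≤
      (invC s c C * (2 * commC s + 2 * embC s) * C + invC s c C * (1 + 2 * algC s * C)) *
        ((e * E + F) * E) := by
    have h1 : 2 / 45 * e ^ 4 * (invC s c C * (2 * commC s + 2 * embC s) * C * E ^ 2 / e ^ 2 +
      invC s c C * (1 + 2 * algC s * C) * (e * E + F) * E / e ^ 4) =
      invC s c C * (2 * commC s + 2 * embC s) * C * (2 / 45 * (e ^ 2 * E ^ 2)) +
      invC s c C * (1 + 2 * algC s * C) * (2 / 45 * ((e * E + F) * E)) := by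
      have := he.ne'
      field_simp
    rw [h1]
    refine le_trans ?_ (add_mul _ _ _).symm.le
    have p1 : 0 ≤ e ^ 2 * E ^ 2 := by positivity
    have p2 : 0 ≤ (e * E + F) * E := by positivity
    have p3 : 2 / 45 * (e ^ 2 * E ^ 2) ≤ (e * E + F) * E := by linarith
    have p4 : 2 / 45 * ((e * E + F) * E) ≤ (e * E + F) * E := by linarith
    gcongr
  have t3' : e * (remLC s c C * (e * E + F)) * (E / e) = remLC s c C * (e * E + F) * E := by
    have := he.ne'
    field_simp
  rw [t3'] at b3
  have tri : |-A1 - A2 - A3 - e ^ 6 / 45 * A4 - e ^ 6 / 45 * A5 + 2 / 45 * e ^ 4 * (D3 + M4)| ≤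
      |A1| + |A2| + |A3| + |e ^ 6 / 45 * A4| + |e ^ 6 / 45 * A5| + |2 / 45 * e ^ 4 * (D3 + M4)| := by
    refine (abs_add_le _ _).trans (add_le_add_left ?_ _)
    refine (abs_sub _ _).trans (add_le_add_left ?_ _)
    refine (abs_sub _ _).trans (add_le_add_left ?_ _)
    refine (abs_sub _ _).trans (add_le_add_left ?_ _)
    refine (abs_sub _ _).trans (add_le_add_left ?_ _)
    rw [abs_neg]
  refine tri.trans ?_
  have : enC s c C * (e * E + F) * E = remηC s C * (e * E + F) * E + remKC s c C * (e * E + F) * E +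
      remLC s c C * (e * E + F) * E + (commC s + 2 * embC s) * C * ((e * E + F) * E) +
      algC s * C * ((e * E + F) * E) +
      (invC s c C * (2 * commC s + 2 * embC s) * C + invC s c C * (1 + 2 * algC s * C)) *
        ((e * E + F) * E) := by
    rw [enC]; ring
  rw [this]
  linarith

end Slice

/-! ### From pointwise time derivatives to time derivatives in L² -/

theorem coeFn_toL2 {f : ℝ → ℝ} (hf : MemLp (fun x => (f x : ℂ)) 2) :
    (toL2 f : ℝ → ℂ) =ᵐ[volume] fun x => (f x : ℂ) := by
  rw [toL2, dif_pos hf]; exact hf.coeFn_toLp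

theorem norm_toL2 (f : ℝ → ℝ) : ‖toL2 f‖ = (eLpNorm (hat f) 2 volume).toReal := by
  rw [← Lp.norm_fourier_eq (toL2 f), Lp.norm_def]
  rfl

theorem norm_toL2_le {r : ℝ} (hr : 0 ≤ r) {f : ℝ → ℝ} (hf : nW (jw r) (hat f) < ⊤) :
    ‖toL2 f‖ ≤ normH r f := by
  rw [norm_toL2, normH_eq, ← nW_one]
  exact ENNReal.toReal_mono hf.ne (nW_mono (fun _ => zero_le_one) (fun ξ => one_le_jap hr _) _)

theorem MemH.abs_le {f : ℝ → ℝ} (h : MemH 2 f) (x : ℝ) : |f x| ≤ jawC * normH 2 f := by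
  have hj : 0 ≤ jawC := ENNReal.toReal_nonneg
  refine rep_abs_le h.h2.1 (mul_nonneg hj (normH_nonneg _ _)) ?_ x
  rw [← nW1_one]
  refine (nW1_mono (w' := jw (2 - 1)) (fun _ => zero_le_one)
    (fun ξ => one_le_jap (by norm_num) _) _).trans ((nW1_jw_le 2 (memLp_hat f).1).trans ?_)
  rw [ENNReal.ofReal_mul hj, normH_eq, ENNReal.ofReal_toReal h.nW_lt.ne]

theorem MemLinfH.exists_bound {r L : ℝ} {f : ℝ → ℝ → ℝ} (h : MemLinfH r L f) :
    ∃ D, 0 ≤ D ∧ ∀ᵐ t ∂(volume.restrict (Icc 0 L)), MemH r (f t) ∧ normH r (f t) ≤ D := by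
  refine ⟨_, ENNReal.toReal_nonneg (a := eLpNorm (fun t => normH r (f t)) ⊤
    (volume.restrict (Icc 0 L))), ?_⟩
  have h3 := h.2.2
  rw [eLpNorm_exponent_top] at h3 ⊢
  filter_upwards [h.1, ae_le_eLpNormEssSup (f := fun t => normH r (f t))
    (μ := volume.restrict (Icc 0 L))] with t h1 h2
  refine ⟨h1, ?_⟩
  have := ENNReal.toReal_mono h3.ne h2
  rwa [toReal_enorm, Real.norm_of_nonneg (normH_nonneg _ _)] at this

theorem ae_restrict_mono_Icc {L t : ℝ} (ht : t ≤ L) {p : ℝ → Prop}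
    (h : ∀ᵐ τ ∂(volume.restrict (Icc 0 L)), p τ) : ∀ᵐ τ ∂(volume.restrict (Icc 0 t)), p τ :=
  ae_mono (Measure.restrict_mono (Icc_subset_Icc le_rfl ht) le_rfl) h

theorem tendsto_average_of_hasDerivAt {G : ℝ → ℂ} {g : ℂ} {x : ℝ} (h : HasDerivAt G g x) :
    Tendsto (fun n : ℕ => ((n + 1 : ℝ) : ℂ) * (G (x + 1 / (n + 1)) - G x)) atTop (𝓝 g) := by
  have h1 : Tendsto (fun n : ℕ => x + 1 / ((n : ℝ) + 1)) atTop (𝓝[≠] x) := by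
    refine tendsto_nhdsWithin_iff.2 ⟨?_, Eventually.of_forall fun n => ?_⟩
    · have := (tendsto_one_div_add_atTop_nhds_zero_nat (𝕜 := ℝ)).const_add x
      rwa [add_zero] at this
    · have : (0 : ℝ) < 1 / ((n : ℝ) + 1) := by positivity
      simp only [mem_compl_iff, mem_singleton_iff]
      linarith
  refine ((hasDerivAt_iff_tendsto_slope.1 h).comp h1).congr fun n => ?_
  simp only [Function.comp, slope_def_module, add_sub_cancel_left, one_div, inv_inv]
  rw [Complex.real_smul]

/-- Averages over short intervals are continuous functionals on L², unlike point values, so they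
commute with the Bochner integral in time. -/
theorem intervalIntegral_average_toL2 (F : Lp ℂ 2 (volume : Measure ℝ)) (x d : ℝ) (hd : 0 ≤ d) :
    ∫ y in x..x + d, F y = inner ℂ (indicatorConstLp 2 (measurableSet_Ioc (a := x) (b := x + d))
      (by simp) (1 : ℂ)) F := by
  rw [L2.inner_indicatorConstLp_one, intervalIntegral.integral_of_le (by linarith)]

/-- The integral in time is given for each x, whereas the energy argument needs it in L². The
Bochner integral W is identified at its Lebesgue points: averages of W converge to W(x), and,
computed under the time integral, to the integral of the point values. -/
theorem IsTimeDeriv.toL2_eq {L : ℝ} {u ut : ℝ → ℝ → ℝ} (hu : ∀ t ∈ Icc 0 L, Nice (u t))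
    (hut : MemLinfH 2 L ut) (hd : IsTimeDeriv L u ut) {t : ℝ} (ht : t ∈ Icc 0 L) :
    toL2 (u t) = toL2 (u 0) + ∫ τ in (0 : ℝ)..t, toL2 (ut τ) := by
  obtain ⟨D, hD0, hD⟩ := hut.exists_bound
  have hD' := ae_restrict_mono_Icc ht.2 hD
  have hmV : AEStronglyMeasurable (fun τ => toL2 (ut τ)) (volume.restrict (Icc 0 t)) :=
    hut.2.1.mono_measure (Measure.restrict_mono (Icc_subset_Icc le_rfl ht.2) le_rfl)
  have hIoc : volume.restrict (uIoc 0 t) = volume.restrict (Icc 0 t) := by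
    rw [uIoc_of_le ht.1, restrict_Ioc_eq_restrict_Icc]
  have hVint : IntervalIntegrable (fun τ => toL2 (ut τ)) volume 0 t := by
    rw [intervalIntegrable_iff, IntegrableOn, hIoc]
    refine Integrable.of_bound hmV D ?_
    filter_upwards [hD'] with τ hτ
    exact (norm_toL2_le zero_le_two hτ.1.nW_lt).trans hτ.2
  set W := ∫ τ in (0 : ℝ)..t, toL2 (ut τ) with hW
  have h0 : (0 : ℝ) ∈ Icc 0 L := ⟨le_rfl, ht.1.trans ht.2⟩
  have m0 : MemLp (fun x => ((u 0 x : ℝ) : ℂ)) 2 := Rep.memLp (hu 0 h0)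
  have mt : MemLp (fun x => ((u t x : ℝ) : ℂ)) 2 := Rep.memLp (hu t ht)
  have hWae : (W : ℝ → ℂ) =ᵐ[volume] fun x => ((u t x - u 0 x : ℝ) : ℂ) := by
    filter_upwards [LocallyIntegrable.ae_hasDerivAt_integral
      ((Lp.memLp W).locallyIntegrable (by norm_num))] with x hx
    have lim1 := tendsto_average_of_hasDerivAt (hx x)
    -- Dominated convergence in time: almost every ∂ₜu(τ) is continuous, so its averages converge at
    -- every x, and the uniform bound comes from the embedding of H².
    have lim2 : Tendsto (fun n : ℕ => ∫ τ in (0 : ℝ)..t, ((n + 1 : ℝ) : ℂ) *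
        ∫ y in x..x + 1 / (n + 1), (toL2 (ut τ)) y) atTop
        (𝓝 (∫ τ in (0 : ℝ)..t, ((ut τ x : ℝ) : ℂ))) := by
      refine intervalIntegral.tendsto_integral_filter_of_dominated_convergence
        (fun _ => jawC * D) (Eventually.of_forall fun n => ?_) (Eventually.of_forall fun n => ?_)
        intervalIntegrable_const ?_
      · rw [hIoc]
        have h1 : ∀ τ, ∫ y in x..x + 1 / ((n : ℝ) + 1), (toL2 (ut τ)) y = _ := fun τ =>
          intervalIntegral_average_toL2 (toL2 (ut τ)) x (1 / ((n : ℝ) + 1)) (by positivity)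
        simp_rw [h1]
        exact aestronglyMeasurable_const.mul (aestronglyMeasurable_const.inner hmV)
      · rw [uIoc_of_le ht.1, ← ae_restrict_iff' measurableSet_Ioc, restrict_Ioc_eq_restrict_Icc]
        filter_upwards [hD'] with τ hτ
        have hp : (0 : ℝ) < 1 / ((n : ℝ) + 1) := by positivity
        have h1 : ‖∫ y in x..x + 1 / ((n : ℝ) + 1), (toL2 (ut τ)) y‖ ≤
            jawC * D * |x + 1 / ((n : ℝ) + 1) - x| := by
          refine intervalIntegral.norm_integral_le_of_norm_le_const_ae ?_
          filter_upwards [coeFn_toL2 hτ.1.2.1] with y hy _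
          rw [hy, Complex.norm_real, Real.norm_eq_abs]
          exact (hτ.1.abs_le y).trans (mul_le_mul_of_nonneg_left hτ.2 ENNReal.toReal_nonneg)
        rw [add_sub_cancel_left, abs_of_pos hp] at h1
        rw [norm_mul, Complex.norm_real, Real.norm_of_nonneg (by positivity)]
        refine (mul_le_mul_of_nonneg_left h1 (by positivity)).trans (le_of_eq ?_)
        field_simp
      · rw [uIoc_of_le ht.1, ← ae_restrict_iff' measurableSet_Ioc, restrict_Ioc_eq_restrict_Icc]
        filter_upwards [hD'] with τ hτ
        have hc : Continuous fun y => ((ut τ y : ℝ) : ℂ) := Complex.continuous_ofReal.comp hτ.1.1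
        have h1 := tendsto_average_of_hasDerivAt
          (intervalIntegral.integral_hasDerivAt_right (hc.intervalIntegrable x x)
            hc.stronglyMeasurable.stronglyMeasurableAtFilter hc.continuousAt)
        refine h1.congr fun n => ?_
        rw [intervalIntegral.integral_same, sub_zero]
        congr 1
        refine intervalIntegral.integral_congr_ae ?_
        filter_upwards [coeFn_toL2 hτ.1.2.1] with y hy _
        exact hy.symm
    have e1 : ∀ n : ℕ, ((n + 1 : ℝ) : ℂ) * ((∫ y in x..x + 1 / ((n : ℝ) + 1), W y) -
        ∫ y in x..x, W y) = ∫ τ in (0 : ℝ)..t, ((n + 1 : ℝ) : ℂ) *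
        ∫ y in x..x + 1 / ((n : ℝ) + 1), (toL2 (ut τ)) y := by
      intro n
      have hp : (0 : ℝ) ≤ 1 / ((n : ℝ) + 1) := by positivity
      rw [intervalIntegral.integral_same, sub_zero, intervalIntegral.integral_const_mul,
        intervalIntegral_average_toL2 W x _ hp]
      simp_rw [intervalIntegral_average_toL2 _ x _ hp]
      congr 1
      exact (ContinuousLinearMap.intervalIntegral_comp_comm (innerSL ℂ (indicatorConstLp 2
        (measurableSet_Ioc (a := x) (b := x + 1 / ((n : ℝ) + 1))) (by simp) (1 : ℂ))) hVint).symm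
    have e2 := tendsto_nhds_unique (lim1.congr e1) lim2
    rw [e2, intervalIntegral.integral_ofReal]
    congr 1
    rw [(hd t ht x).2]; ring
  refine Lp.ext ?_
  filter_upwards [coeFn_toL2 mt, coeFn_toL2 m0, hWae, Lp.coeFn_add (toL2 (u 0)) W] with x h1 h2 h3 h4
  rw [h4, Pi.add_apply, h1, h2, h3]
  push_cast; ring

/-! ### The truncated energy as a quadratic form on L² -/

/-- The space `L²(ℝ; ℂ)`. -/
abbrev Ltwo := Lp ℂ 2 (volume : Measure ℝ)

theorem inner_eq_re {P Q : Ltwo} {p q : ℝ → ℂ} (hp : P =ᵐ[volume] p) (hq : Q =ᵐ[volume] q) :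
    inner ℝ P Q = (∫ x, q x * (starRingEnd ℂ) (p x)).re := by
  have h1 : Integrable fun x => q x * (starRingEnd ℂ) (p x) :=
    integrable_conj ((memLp_congr_ae hq).1 (Lp.memLp Q)) ((memLp_congr_ae hp).1 (Lp.memLp P))
  rw [L2.inner_def]
  have h2 := integral_re h1
  simp only [RCLike.re_to_complex] at h2
  rw [← h2]
  refine integral_congr_ae ?_
  filter_upwards [hp, hq] with x h3 h4
  rw [h3, h4, Complex.inner, mul_comm]

open Classical in
/-- Multiplication by a bounded real function on `L²`. -/
def mulOp (m : ℝ → ℝ) : Ltwo →L[ℝ] Ltwo :=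
  if h : MemLp (fun x => (m x : ℂ)) ⊤ volume then
    (ContinuousLinearMap.mul ℝ ℂ).holderL volume ⊤ 2 2 (h.toLp _) else 0

theorem mulOp_ae {m : ℝ → ℝ} (h : MemLp (fun x => (m x : ℂ)) ⊤ volume) (F : Ltwo) :
    mulOp m F =ᵐ[volume] fun x => (m x : ℂ) * F x := by
  rw [mulOp, dif_pos h]
  have := (ContinuousLinearMap.mul ℝ ℂ).coeFn_holder (r := 2) (h.toLp _) F
  filter_upwards [this, h.coeFn_toLp] with x h1 h2
  rw [ContinuousLinearMap.holderL_apply_apply, h1, h2]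
  rfl

theorem memLp_top {m : ℝ → ℝ} (hm : AEStronglyMeasurable m) {C : ℝ} (hC : ∀ x, |m x| ≤ C) :
    MemLp (fun x => (m x : ℂ)) ⊤ volume := by
  refine memLp_top_of_bound (Complex.continuous_ofReal.comp_aestronglyMeasurable hm) C
    (Eventually.of_forall fun x => ?_)
  rw [Complex.norm_real, Real.norm_eq_abs]
  exact hC x

theorem memLp_top_lam {s : ℝ} (hs : 1 ≤ s) (N : ℝ) :
    MemLp (fun ξ => (lam s N ξ : ℂ)) ⊤ volume := by
  refine memLp_top (continuous_lam s N).aestronglyMeasurable (C := 2 * |N|) fun ξ => ?_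
  rw [abs_of_nonneg (lam_nonneg _ _ _)]
  simpa using pow_mul_lam_le hs N 0 ξ

theorem memLp_top_mu {s : ℝ} (hs : 1 ≤ s) (N : ℝ) :
    MemLp (fun ξ => (mu s N ξ : ℂ)) ⊤ volume := by
  refine memLp_top (continuous_mu s N).aestronglyMeasurable (fun ξ => ?_)
    (C := (1 + 2 * |N|) ^ 2 * (2 * |N|))
  have := norm_mu_le s N ξ
  rw [Complex.norm_real, Real.norm_eq_abs, one_mul] at this
  exact this.trans (pow_mul_lam_le hs N 2 ξ)

/-- The square root of the symbol of the linear part of the velocity energy, truncated. -/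
def velW (s e N ξ : ℝ) : ℝ := Real.sqrt (psym e ξ) * lam s N ξ

theorem velW_nonneg (s e N ξ : ℝ) : 0 ≤ velW s e N ξ :=
  mul_nonneg (Real.sqrt_nonneg _) (lam_nonneg _ _ _)

theorem continuous_velW (s e N : ℝ) : Continuous (velW s e N) :=
  (continuous_psym e).sqrt.mul (continuous_lam s N)

theorem memLp_top_velW {s e : ℝ} (hs : 1 ≤ s) (he : 0 ≤ e) (he1 : e ≤ 1) (N : ℝ) :
    MemLp (fun ξ => (velW s e N ξ : ℂ)) ⊤ volume := by
  refine memLp_top (continuous_velW s e N).aestronglyMeasurable (fun ξ => ?_)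
    (C := (1 + 2 * |N|) ^ 4 * (2 * |N|))
  rw [abs_of_nonneg (velW_nonneg _ _ _ _)]
  refine le_trans (mul_le_mul_of_nonneg_right ?_ (lam_nonneg _ _ _)) (pow_mul_lam_le hs N 4 ξ)
  refine (Real.sqrt_le_iff.2 ⟨by positivity, ?_⟩ :
    Real.sqrt (psym e ξ) ≤ (1 + |2 * Real.pi * ξ|) ^ 4)
  have h1 : 1 ≤ (1 + |2 * Real.pi * ξ|) ^ 4 := one_le_pow₀ (by
    have := abs_nonneg (2 * Real.pi * ξ); linarith)
  exact (psym_le_pow he he1 ξ).trans (le_self_pow₀ h1 two_ne_zero)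

/-- The operator with symbol `mu s N`, from the Fourier side to the physical side. -/
def elevOp (s N : ℝ) : Ltwo →L[ℝ] Ltwo :=
  ((Lp.fourierTransformₗᵢ ℝ ℂ).symm.toContinuousLinearEquiv.toContinuousLinearMap.restrictScalars
    ℝ).comp (mulOp (mu s N))

theorem elevOp_apply (s N : ℝ) (F : Ltwo) : elevOp s N F = 𝓕⁻ (mulOp (mu s N) F) := rfl

theorem norm_elevOp (s N : ℝ) (F : Ltwo) : ‖elevOp s N F‖ = ‖mulOp (mu s N) F‖ := by
  rw [elevOp_apply]
  exact (Lp.fourierTransformₗᵢ ℝ ℂ).symm.norm_map _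

theorem elevOp_ae {s : ℝ} (hs : 1 ≤ s) (N : ℝ) (F : Ltwo) :
    elevOp s N F =ᵐ[volume] tf s N F := by
  have h := rep_tf hs N (Lp.memLp F)
  have e1 : mulOp (mu s N) F = h.2.1.toLp _ := by
    refine Lp.ext ?_
    filter_upwards [mulOp_ae (memLp_top_mu hs N) F, h.2.1.coeFn_toLp] with x h1 h2
    rw [h1, h2]
  rw [elevOp_apply, e1]
  exact h.ae_eq

/-- The truncated energy, with the weight `ρ` in front of the highest order part. -/
def energy (s e N : ℝ) (ρ : ℝ → ℝ) (F G : Ltwo) : ℝ :=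
  ‖mulOp (lam s N) F‖ ^ 2 + ‖mulOp (velW s e N) G‖ ^ 2 +
    2 / 45 * e ^ 4 * ‖mulOp (fun x => Real.sqrt (ρ x)) (elevOp s N F)‖ ^ 2

/-- The polar form of the energy. -/
def energyForm (s e N : ℝ) (ρ : ℝ → ℝ) (F F' G G' : Ltwo) : ℝ :=
  2 * inner ℝ (mulOp (lam s N) F) (mulOp (lam s N) F') +
    2 * inner ℝ (mulOp (velW s e N) G) (mulOp (velW s e N) G') +
    2 / 45 * e ^ 4 * (2 * inner ℝ (mulOp (fun x => Real.sqrt (ρ x)) (elevOp s N F))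
      (mulOp (fun x => Real.sqrt (ρ x)) (elevOp s N F')))

/-- For a weight frozen in time, each part is the square of the norm of a bounded operator applied
to the curve. -/
theorem hasDerivAt_energy (s e N : ℝ) (ρ : ℝ → ℝ) {F G : ℝ → Ltwo} {F' G' : Ltwo} {t : ℝ}
    (hF : HasDerivAt F F' t) (hG : HasDerivAt G G' t) :
    HasDerivAt (fun τ => energy s e N ρ (F τ) (G τ)) (energyForm s e N ρ (F t) F' (G t) G') t := by
  have h (T : Ltwo →L[ℝ] Ltwo) {H : ℝ → Ltwo} {H' : Ltwo} (hH : HasDerivAt H H' t) :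
      HasDerivAt (fun τ => ‖T (H τ)‖ ^ 2) (2 * inner ℝ (T (H t)) (T H')) t :=
    ((T.hasFDerivAt (x := H t)).comp_hasDerivAt t hH).norm_sq
  exact ((h _ hF).add (h _ hG)).add ((h ((mulOp fun x => Real.sqrt (ρ x)).comp (elevOp s N))
    hF).const_mul _)

theorem Ltwo.norm_sq_eq (P : Ltwo) : ‖P‖ ^ 2 = ∫ x, ‖P x‖ ^ 2 := by
  rw [← real_inner_self_eq_norm_sq, L2.inner_def]
  simp_rw [real_inner_self_eq_norm_sq]

theorem norm_mulOp_sqrt_sq {ρ : ℝ → ℝ} (hρ : AEStronglyMeasurable ρ) {R : ℝ} (h0 : ∀ x, 0 ≤ ρ x)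
    (hR : ∀ x, ρ x ≤ R) (P : Ltwo) :
    Integrable (fun x => ρ x * ‖P x‖ ^ 2) ∧
      ‖mulOp (fun x => Real.sqrt (ρ x)) P‖ ^ 2 = ∫ x, ρ x * ‖P x‖ ^ 2 := by
  have hm : MemLp (fun x => (Real.sqrt (ρ x) : ℂ)) ⊤ volume :=
    memLp_top (Real.continuous_sqrt.comp_aestronglyMeasurable hρ) (C := Real.sqrt R) fun x => by
      rw [abs_of_nonneg (Real.sqrt_nonneg _)]
      exact Real.sqrt_le_sqrt (hR x)
  have hP : Integrable fun x => ‖P x‖ ^ 2 := (Lp.memLp P).integrable_norm_pow two_ne_zero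
  constructor
  · refine hP.bdd_mul hρ (c := R) (Eventually.of_forall fun x => ?_)
    rw [Real.norm_of_nonneg (h0 x)]
    exact hR x
  · rw [← real_inner_self_eq_norm_sq, L2.inner_def]
    refine integral_congr_ae ?_
    filter_upwards [mulOp_ae hm P] with x hx
    rw [hx, real_inner_self_eq_norm_sq, norm_mul, mul_pow, Complex.norm_real,
      Real.norm_of_nonneg (Real.sqrt_nonneg _), Real.sq_sqrt (h0 x)]

theorem norm_mulOp_sqrt_sq_le {ρ ρ' : ℝ → ℝ} (hρ : AEStronglyMeasurable ρ)
    (hρ' : AEStronglyMeasurable ρ') {R R' D : ℝ} (h0 : ∀ x, 0 ≤ ρ x) (h0' : ∀ x, 0 ≤ ρ' x)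
    (hR : ∀ x, ρ x ≤ R) (hR' : ∀ x, ρ' x ≤ R') (hD : ∀ x, ρ' x ≤ ρ x + D) (P : Ltwo) :
    ‖mulOp (fun x => Real.sqrt (ρ' x)) P‖ ^ 2 ≤
      ‖mulOp (fun x => Real.sqrt (ρ x)) P‖ ^ 2 + D * ‖P‖ ^ 2 := by
  have hP : Integrable fun x => ‖P x‖ ^ 2 := (Lp.memLp P).integrable_norm_pow two_ne_zero
  obtain ⟨i1, h1⟩ := norm_mulOp_sqrt_sq hρ h0 hR P
  obtain ⟨i2, h2⟩ := norm_mulOp_sqrt_sq hρ' h0' hR' P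
  rw [h1, h2, Ltwo.norm_sq_eq, ← integral_const_mul, ← integral_add i1 (hP.const_mul D)]
  refine integral_mono i2 (i1.add (hP.const_mul D)) fun x => ?_
  have := mul_le_mul_of_nonneg_right (hD x) (sq_nonneg ‖P x‖)
  linarith

theorem norm_mulOp_sqrt_sq_le_const {ρ : ℝ → ℝ} (hρ : AEStronglyMeasurable ρ) {R : ℝ}
    (h0 : ∀ x, 0 ≤ ρ x) (hR : ∀ x, ρ x ≤ R) (P : Ltwo) :
    ‖mulOp (fun x => Real.sqrt (ρ x)) P‖ ^ 2 ≤ R * ‖P‖ ^ 2 := by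
  have hP : Integrable fun x => ‖P x‖ ^ 2 := (Lp.memLp P).integrable_norm_pow two_ne_zero
  obtain ⟨i1, h1⟩ := norm_mulOp_sqrt_sq hρ h0 hR P
  rw [h1, Ltwo.norm_sq_eq, ← integral_const_mul]
  exact integral_mono i1 (hP.const_mul R) fun x => mul_le_mul_of_nonneg_right (hR x) (sq_nonneg _)

theorem le_norm_mulOp_sqrt_sq {ρ : ℝ → ℝ} (hρ : AEStronglyMeasurable ρ) {r R : ℝ} (hr : 0 ≤ r)
    (h0 : ∀ x, r ≤ ρ x) (hR : ∀ x, ρ x ≤ R) (P : Ltwo) :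
    r * ‖P‖ ^ 2 ≤ ‖mulOp (fun x => Real.sqrt (ρ x)) P‖ ^ 2 := by
  have hP : Integrable fun x => ‖P x‖ ^ 2 := (Lp.memLp P).integrable_norm_pow two_ne_zero
  obtain ⟨i1, h1⟩ := norm_mulOp_sqrt_sq hρ (fun x => hr.trans (h0 x)) hR P
  rw [h1, Ltwo.norm_sq_eq, ← integral_const_mul]
  exact integral_mono (hP.const_mul r) i1 fun x => mul_le_mul_of_nonneg_right (h0 x) (sq_nonneg _)

/-- The Fourier transform of the class of a real function, as a vector of `L²`. -/
def fvec (f : ℝ → ℝ) : Ltwo := 𝓕 (toL2 f)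

theorem coeFn_fvec (f : ℝ → ℝ) : (fvec f : ℝ → ℂ) = hat f := rfl

theorem energyForm_fvec {s e : ℝ} (hs : 1 ≤ s) (he : 0 ≤ e) (he1 : e ≤ 1) (N : ℝ) {ρ : ℝ → ℝ}
    (hρ : AEStronglyMeasurable ρ) {R : ℝ} (h0 : ∀ x, 0 ≤ ρ x) (hR : ∀ x, ρ x ≤ R)
    (η ηt w wt : ℝ → ℝ) :
    energyForm s e N ρ (fvec η) (fvec ηt) (fvec w) (fvec wt) =
      2 * ((∫ ξ, ((lam s N ξ : ℂ) * hat ηt ξ) * (starRingEnd ℂ) ((lam s N ξ : ℂ) * hat η ξ)).re +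
        (∫ ξ, (((psym e ξ * lam s N ξ : ℝ) : ℂ) * hat wt ξ) *
          (starRingEnd ℂ) ((lam s N ξ : ℂ) * hat w ξ)).re +
        2 / 45 * e ^ 4 * (pairT s N ρ (hat ηt) (hat η)).re) := by
  have hm : MemLp (fun x => (Real.sqrt (ρ x) : ℂ)) ⊤ volume :=
    memLp_top (Real.continuous_sqrt.comp_aestronglyMeasurable hρ) (C := Real.sqrt R) fun x => by
      rw [abs_of_nonneg (Real.sqrt_nonneg _)]
      exact Real.sqrt_le_sqrt (hR x)
  have a1 := inner_eq_re (mulOp_ae (memLp_top_lam hs N) (fvec η))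
    (mulOp_ae (memLp_top_lam hs N) (fvec ηt))
  have a2 := inner_eq_re (mulOp_ae (memLp_top_velW hs he he1 N) (fvec w))
    (mulOp_ae (memLp_top_velW hs he he1 N) (fvec wt))
  have b0 : ∀ f : ℝ → ℝ, mulOp (fun x => Real.sqrt (ρ x)) (elevOp s N (fvec f)) =ᵐ[volume]
      fun x => (Real.sqrt (ρ x) : ℂ) * tf s N (hat f) x := by
    intro f
    filter_upwards [mulOp_ae hm (elevOp s N (fvec f)), elevOp_ae hs N (fvec f)] with x h1 h2
    rw [h1, h2, coeFn_fvec]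
  have a3 := inner_eq_re (b0 η) (b0 ηt)
  rw [energyForm, a1, a2, a3, pairT]
  simp only [coeFn_fvec]
  have b2 : ∀ ξ, (velW s e N ξ : ℂ) * hat wt ξ * (starRingEnd ℂ) ((velW s e N ξ : ℂ) * hat w ξ) =
      (((psym e ξ * lam s N ξ : ℝ) : ℂ) * hat wt ξ) *
          (starRingEnd ℂ) ((lam s N ξ : ℂ) * hat w ξ) := by
    intro ξ
    have h1 : (psym e ξ : ℂ) = (Real.sqrt (psym e ξ) : ℂ) * (Real.sqrt (psym e ξ) : ℂ) := by
      rw [← Complex.ofReal_mul, Real.mul_self_sqrt (psym_pos e ξ).le]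
    simp only [velW, map_mul, Complex.conj_ofReal, Complex.ofReal_mul, h1]
    ring
  have b3 : ∀ x, (Real.sqrt (ρ x) : ℂ) * tf s N (hat ηt) x *
      (starRingEnd ℂ) ((Real.sqrt (ρ x) : ℂ) * tf s N (hat η) x) =
      (ρ x : ℂ) * tf s N (hat ηt) x * (starRingEnd ℂ) (tf s N (hat η) x) := by
    intro x
    have h1 : (ρ x : ℂ) = (Real.sqrt (ρ x) : ℂ) * (Real.sqrt (ρ x) : ℂ) := by
      rw [← Complex.ofReal_mul, Real.mul_self_sqrt (h0 x)]
    simp only [map_mul, Complex.conj_ofReal, h1]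
    ring
  simp_rw [b2, b3]
  ring

theorem eLpNorm_eq_norm_mulOp {m : ℝ → ℝ} (h : MemLp (fun x => (m x : ℂ)) ⊤ volume) (F : Ltwo) :
    eLpNorm (fun x => (m x : ℂ) * F x) 2 volume = ENNReal.ofReal ‖mulOp m F‖ := by
  rw [← eLpNorm_congr_ae (mulOp_ae h F), Lp.norm_def, ENNReal.ofReal_toReal (Lp.eLpNorm_ne_top _)]

theorem norm_mulOp_le {m : ℝ → ℝ} (h : MemLp (fun x => (m x : ℂ)) ⊤ volume) {F : Ltwo} {A : ℝ}
    (hA : 0 ≤ A) (hF : eLpNorm (fun x => (m x : ℂ) * F x) 2 volume ≤ ENNReal.ofReal A) :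
    ‖mulOp m F‖ ≤ A := by
  rw [eLpNorm_eq_norm_mulOp h] at hF
  exact (ENNReal.ofReal_le_ofReal_iff hA).1 hF

theorem norm_elevOp_le {s e A : ℝ} (hs : 1 ≤ s) (he : 0 < e) (N : ℝ) {η : ℝ → ℝ}
    (hη : Sb s e 2 η A) : ‖elevOp s N (fvec η)‖ ≤ A / e ^ 2 := by
  rw [norm_elevOp]
  exact norm_mulOp_le (memLp_top_mu hs N) (div_nonneg hη.nonneg (by positivity))
    (nW_mu_le he N hη)

theorem velW_le_sw {s e : ℝ} (he : 0 ≤ e) (N ξ : ℝ) : velW s e N ξ ≤ sw s e 2 ξ := by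
  rw [velW, sw, mul_comm]
  refine mul_le_mul (lam_le s N ξ) ?_ (Real.sqrt_nonneg _) (jap_pos _ _).le
  refine Real.sqrt_le_iff.2 ⟨by positivity, ?_⟩
  rw [psym_eq]
  have : 0 ≤ e * |2 * Real.pi * ξ| := by positivity
  nlinarith [pow_nonneg this 3, pow_nonneg this 2, pow_nonneg this 4]

theorem energy_le {s e A B R : ℝ} (hs : 1 ≤ s) (he : 0 < e) (he1 : e ≤ 1) (N : ℝ) {ρ : ℝ → ℝ}
    (hρ : AEStronglyMeasurable ρ) (h0 : ∀ x, 0 ≤ ρ x) (hR : ∀ x, ρ x ≤ R) {η w : ℝ → ℝ}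
    (hη : Sb s e 2 η A) (hw : Sb s e 2 w B) :
    energy s e N ρ (fvec η) (fvec w) ≤ (1 + R) * (A + B) ^ 2 := by
  have hA := hη.nonneg
  have hB := hw.nonneg
  have hR0 : 0 ≤ R := (h0 0).trans (hR 0)
  have h1 : ‖mulOp (lam s N) (fvec η)‖ ≤ A :=
    norm_mulOp_le (memLp_top_lam hs N) hA (nW_lam_le he.le N hη)
  have h2 : ‖mulOp (velW s e N) (fvec w)‖ ≤ B :=
    norm_mulOp_le (memLp_top_velW hs he.le he1 N) hB
      ((nW_mono (velW_nonneg s e N) (velW_le_sw he.le N) _).trans hw.2.2)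
  have h3 := norm_elevOp_le hs he N hη
  have h4 := norm_mulOp_sqrt_sq_le_const hρ h0 hR (elevOp s N (fvec η))
  have h5 : e ^ 4 * ‖elevOp s N (fvec η)‖ ^ 2 ≤ A ^ 2 := by
    rw [le_div_iff₀ (by positivity)] at h3
    calc _ = (‖elevOp s N (fvec η)‖ * e ^ 2) ^ 2 := by ring
      _ ≤ _ := pow_le_pow_left₀ (by positivity) h3 2
  have h6 := pow_le_pow_left₀ (norm_nonneg _) h1 2
  have h7 := pow_le_pow_left₀ (norm_nonneg _) h2 2
  have h8 : 2 / 45 * e ^ 4 * ‖mulOp (fun x => Real.sqrt (ρ x)) (elevOp s N (fvec η))‖ ^ 2 ≤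
      2 / 45 * (R * A ^ 2) := by
    have := mul_le_mul_of_nonneg_left h4 (by positivity : 0 ≤ 2 / 45 * e ^ 4)
    have := mul_le_mul_of_nonneg_left h5 (by positivity : 0 ≤ 2 / 45 * R)
    linarith
  rw [energy]
  nlinarith [mul_nonneg hA hB, mul_nonneg hR0 (mul_nonneg hA hB), mul_nonneg hR0 (sq_nonneg A),
    mul_nonneg hR0 (sq_nonneg B)]

/-- Fatou's lemma in N: at a fixed frequency the truncated symbol equals ⟨X⟩^s as soon as N is
large. -/
theorem nW_le_of_lam {s : ℝ} {w : ℝ → ℝ} {F : ℝ → ℂ} (hw : Continuous w)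
    (hF : AEStronglyMeasurable F) {B : ℝ≥0∞} (h : ∀ N : ℕ, nW (fun ξ => lam s N ξ * w ξ) F ≤ B) :
    nW (fun ξ => jw s ξ * w ξ) F ≤ B := by
  have h1 := Lp.eLpNorm_lim_le_liminf_eLpNorm (p := 2) (μ := volume)
    (f := fun (N : ℕ) ξ => ((lam s N ξ * w ξ : ℝ) : ℂ) * F ξ)
    (fun N => continuous_weight_aesm ((continuous_lam s N).mul hw) hF)
    (fun ξ => ((jw s ξ * w ξ : ℝ) : ℂ) * F ξ) (Eventually.of_forall fun ξ => ?_)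
  · refine h1.trans (liminf_le_of_frequently_le' (Frequently.of_forall h))
  · refine tendsto_const_nhds.congr' ?_
    obtain ⟨n, hn⟩ := exists_nat_ge (jw s ξ)
    filter_upwards [eventually_ge_atTop n] with N hN
    have : jap s (2 * Real.pi * ξ) ≤ N := hn.trans (Nat.cast_le.2 hN)
    rw [lam, tent_eq (jap_pos _ _).le this, jw]

/-- The constant of the lower bound of the energy. -/
def lowC (r : ℝ) : ℝ := 22 + 2 * Real.sqrt (45 / (2 * r))

theorem lowC_pos (r : ℝ) : 0 < lowC r := by
  have := Real.sqrt_nonneg (45 / (2 * r))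
  unfold lowC; linarith

/-- The elevation part uses (1 + e|X|)² ≤ 2 + 2e²X² together with the first and third parts of the
energy. The velocity part uses that (1 + e|X|)² is comparable with the square root of the symbol.
The bound must hold for all N, so that the truncation can be removed. -/
theorem le_energy {s e r R G : ℝ} (hs : 1 ≤ s) (he : 0 < e) (he1 : e ≤ 1) {ρ : ℝ → ℝ}
    (hρ : AEStronglyMeasurable ρ) (hr : 0 < r) (h0 : ∀ x, r ≤ ρ x) (hR : ∀ x, ρ x ≤ R)
    {η w : ℝ → ℝ} (hG : 0 ≤ G) (h : ∀ N : ℕ, energy s e N ρ (fvec η) (fvec w) ≤ G ^ 2) :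
    Sn s e η + Sn s e w ≤ lowC r * G := by
  have hq := Real.sqrt_nonneg (45 / (2 * r))
  have key : ∀ N : ℕ, ‖mulOp (lam s N) (fvec η)‖ ≤ G ∧ ‖mulOp (velW s e N) (fvec w)‖ ≤ G ∧
      e ^ 2 * ‖mulOp (mu s N) (fvec η)‖ ≤ Real.sqrt (45 / (2 * r)) * G := by
    intro N
    have h1 := h N
    have h2 := le_norm_mulOp_sqrt_sq hρ hr.le h0 hR (elevOp s N (fvec η))
    rw [norm_elevOp] at h2
    have h3 := mul_le_mul_of_nonneg_left h2 (by positivity : 0 ≤ 2 / 45 * e ^ 4)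
    rw [energy] at h1
    have p1 := sq_nonneg ‖mulOp (lam s N) (fvec η)‖
    have p2 := sq_nonneg ‖mulOp (velW s e N) (fvec w)‖
    have p3 : 0 ≤ 2 / 45 * e ^ 4 * (r * ‖mulOp (mu s N) (fvec η)‖ ^ 2) := by positivity
    refine ⟨pow_le_pow_iff_left₀ (norm_nonneg _) hG two_ne_zero |>.1 (by linarith),
      pow_le_pow_iff_left₀ (norm_nonneg _) hG two_ne_zero |>.1 (by linarith),
      pow_le_pow_iff_left₀ (by positivity) (by positivity) two_ne_zero |>.1 ?_⟩
    rw [mul_pow, mul_pow (Real.sqrt _), Real.sq_sqrt (by positivity), div_mul_eq_mul_div,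
      le_div_iff₀ (by positivity)]
    nlinarith
  have c1 : Continuous fun ξ : ℝ => (1 + e * |2 * Real.pi * ξ|) ^ 2 := by fun_prop
  have hη : Sn s e η ≤ 2 * G + 2 * (Real.sqrt (45 / (2 * r)) * G) := by
    refine ENNReal.toReal_le_of_le_ofReal (by positivity) ?_
    refine nW_le_of_lam c1 (hat_aestronglyMeasurable η) fun N => ?_
    obtain ⟨k1, -, k3⟩ := key N
    have m1 : ∀ ξ, lam s N ξ * (1 + e * |2 * Real.pi * ξ|) ^ 2 ≤
        2 * lam s N ξ + 2 * e ^ 2 * mu s N ξ := by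
      intro ξ
      have e2 : (e * |2 * Real.pi * ξ|) ^ 2 = e ^ 2 * (2 * Real.pi * ξ) ^ 2 := by
        rw [mul_pow, sq_abs]
      have : (1 + e * |2 * Real.pi * ξ|) ^ 2 ≤ 2 + 2 * (e ^ 2 * (2 * Real.pi * ξ) ^ 2) := by
        rw [← e2]; nlinarith [sq_nonneg (1 - e * |2 * Real.pi * ξ|)]
      have := mul_le_mul_of_nonneg_left this (lam_nonneg s N ξ)
      rw [mu]; linarith
    have m0 : ∀ ξ, 0 ≤ lam s N ξ * (1 + e * |2 * Real.pi * ξ|) ^ 2 := fun ξ =>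
      mul_nonneg (lam_nonneg _ _ _) (by positivity)
    refine (nW_mono m0 m1 _).trans ?_
    have e3 : (fun ξ => ((2 * lam s N ξ + 2 * e ^ 2 * mu s N ξ : ℝ) : ℂ) * hat η ξ) =
        (fun ξ => ((2 * lam s N ξ : ℝ) : ℂ) * hat η ξ) +
          fun ξ => ((2 * e ^ 2 * mu s N ξ : ℝ) : ℂ) * hat η ξ := by
      funext ξ; simp only [Pi.add_apply]; push_cast; ring
    have aη := hat_aestronglyMeasurable η
    rw [nW, e3]
    refine (eLpNorm_add_le (continuous_weight_aesm ((continuous_lam s N).const_mul 2) aη)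
      (continuous_weight_aesm ((continuous_mu s N).const_mul (2 * e ^ 2)) aη)
      one_le_two).trans ?_
    have f1 := nW_const_mul (zero_le_two (α := ℝ)) (lam s N) (hat η)
    have f2 := nW_const_mul (by positivity : 0 ≤ 2 * e ^ 2) (mu s N) (hat η)
    have f3 := eLpNorm_eq_norm_mulOp (memLp_top_lam hs N) (fvec η)
    have f4 := eLpNorm_eq_norm_mulOp (memLp_top_mu hs N) (fvec η)
    rw [coeFn_fvec] at f3 f4
    simp only [nW] at f1 f2
    rw [f1, f2, f3, f4, ← ENNReal.ofReal_mul zero_le_two, ← ENNReal.ofReal_mul (by positivity),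
      ← ENNReal.ofReal_add (by positivity) (by positivity)]
    refine ENNReal.ofReal_le_ofReal ?_
    linarith
  have hw : Sn s e w ≤ 20 * G := by
    refine ENNReal.toReal_le_of_le_ofReal (by positivity) ?_
    refine nW_le_of_lam c1 (hat_aestronglyMeasurable w) fun N => ?_
    obtain ⟨-, k2, -⟩ := key N
    have m1 : ∀ ξ, lam s N ξ * (1 + e * |2 * Real.pi * ξ|) ^ 2 ≤ 20 * velW s e N ξ := by
      intro ξ
      -- Since (1 + x)⁴ ≤ 8(1 + x⁴), any constant whose square exceeds 8 · 45 works.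
      have h1 : (1 + e * |2 * Real.pi * ξ|) ^ 2 ≤ 20 * Real.sqrt (psym e ξ) := by
        have h2 : ((1 + e * |2 * Real.pi * ξ|) ^ 2 / 20) ^ 2 ≤ psym e ξ := by
          rw [psym_eq]
          have h3 : 0 ≤ e * |2 * Real.pi * ξ| := by positivity
          generalize e * |2 * Real.pi * ξ| = x at h3
          nlinarith [sq_nonneg (1 - x), sq_nonneg (x * (1 - x)), sq_nonneg (1 - x ^ 2),
            sq_nonneg x, sq_nonneg (x ^ 2)]
        have := Real.le_sqrt_of_sq_le h2
        linarith
      rw [velW]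
      have := mul_le_mul_of_nonneg_left h1 (lam_nonneg s N ξ)
      linarith
    have m0 : ∀ ξ, 0 ≤ lam s N ξ * (1 + e * |2 * Real.pi * ξ|) ^ 2 := fun ξ =>
      mul_nonneg (lam_nonneg _ _ _) (by positivity)
    refine (nW_mono m0 m1 _).trans ?_
    have f2 := eLpNorm_eq_norm_mulOp (memLp_top_velW hs he.le he1 N) (fvec w)
    rw [nW_const_mul (by norm_num), nW]
    rw [coeFn_fvec] at f2
    rw [f2, ← ENNReal.ofReal_mul (by norm_num)]
    exact ENNReal.ofReal_le_ofReal (mul_le_mul_of_nonneg_left k2 (by norm_num))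
  rw [lowC]
  linarith

/-! ### Lipschitz curves in L², differential inequalities and Gronwall's lemma -/

theorem toL2_sub {f g : ℝ → ℝ} (hf : Nice f) (hg : Nice g) :
    toL2 (fun x => f x - g x) = toL2 f - toL2 g := by
  refine Lp.ext ?_
  filter_upwards [coeFn_toL2 (Rep.memLp (hf.sub hg)), coeFn_toL2 (Rep.memLp hf),
    coeFn_toL2 (Rep.memLp hg), Lp.coeFn_sub (toL2 f) (toL2 g)] with x h1 h2 h3 h4
  rw [h1, h4, Pi.sub_apply, h2, h3]
  push_cast; rfl

theorem fvec_sub {f g : ℝ → ℝ} (hf : Nice f) (hg : Nice g) :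
    fvec (fun x => f x - g x) = fvec f - fvec g := by
  rw [fvec, toL2_sub hf hg]
  exact (Lp.fourierTransformₗᵢ ℝ ℂ).map_sub _ _

/-- Both claims follow from the Bochner integral formula: its integrand is bounded, and Lebesgue's
theorem differentiates it at almost every time. -/
theorem IsTimeDeriv.fvec_lipschitz {L : ℝ} {u ut : ℝ → ℝ → ℝ} (hu : ∀ t ∈ Icc 0 L, Nice (u t))
    (hut : MemLinfH 2 L ut) (hd : IsTimeDeriv L u ut) :
    (∃ D, 0 ≤ D ∧ ∀ t ∈ Icc 0 L, ∀ t' ∈ Icc 0 L, ‖fvec (u t') - fvec (u t)‖ ≤ D * |t' - t|) ∧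
      ∀ᵐ t, t ∈ Ioo 0 L → HasDerivAt (fun τ => fvec (u τ)) (fvec (ut t)) t := by
  obtain ⟨D, hD0, hD⟩ := hut.exists_bound
  have hb : ∀ᵐ τ ∂(volume.restrict (Icc 0 L)), ‖toL2 (ut τ)‖ ≤ D := by
    filter_upwards [hD] with τ hτ
    exact (norm_toL2_le zero_le_two hτ.1.nW_lt).trans hτ.2
  have hint : ∀ t ∈ Icc 0 L, ∀ t' ∈ Icc 0 L,
      IntervalIntegrable (fun τ => toL2 (ut τ)) volume t t' := by
    intro t ht t' ht'
    have h1 : IntegrableOn (fun τ => toL2 (ut τ)) (Icc 0 L) := Integrable.of_bound hut.2.1 D hb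
    exact (h1.mono_set (uIcc_subset_Icc ht ht')).intervalIntegrable
  constructor
  · refine ⟨D, hD0, fun t ht t' ht' => ?_⟩
    have h0 : (0 : ℝ) ∈ Icc 0 L := ⟨le_rfl, ht.1.trans ht.2⟩
    have h1 : ‖fvec (u t') - fvec (u t)‖ = ‖toL2 (u t') - toL2 (u t)‖ := by
      rw [fvec, fvec, ← (Lp.fourierTransformₗᵢ ℝ ℂ).norm_map (toL2 (u t') - toL2 (u t)), map_sub]
      rfl
    rw [h1, hd.toL2_eq hu hut ht, hd.toL2_eq hu hut ht', add_sub_add_left_eq_sub,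
      intervalIntegral.integral_interval_sub_left (hint 0 h0 t' ht') (hint 0 h0 t ht)]
    refine intervalIntegral.norm_integral_le_of_norm_le_const_ae ?_
    rw [ae_restrict_iff' measurableSet_Icc] at hb
    filter_upwards [hb] with τ h2 h3
    exact h2 (uIcc_subset_Icc ht ht' (uIoc_subset_uIcc h3))
  · by_cases hL : 0 ≤ L
    swap
    · exact Eventually.of_forall fun t ht => absurd (ht.1.trans ht.2).le hL
    have h0 : (0 : ℝ) ∈ Icc 0 L := ⟨le_rfl, hL⟩
    filter_upwards [(hint 0 h0 L ⟨hL, le_rfl⟩).ae_hasDerivAt_integral] with t h1 ht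
    have ht' : t ∈ Icc 0 L := Ioo_subset_Icc_self ht
    have h2 := h1 (by rwa [uIcc_of_le hL]) 0 (by rwa [uIcc_of_le hL])
    have h3 : HasDerivAt (fun τ => toL2 (u τ)) (toL2 (ut t)) t := by
      refine (h2.const_add (toL2 (u 0))).congr_of_eventuallyEq ?_
      filter_upwards [Ioo_mem_nhds ht.1 ht.2] with τ hτ
      exact hd.toL2_eq hu hut (Ioo_subset_Icc_self hτ)
    exact (((Lp.fourierTransformₗᵢ ℝ ℂ).toContinuousLinearEquiv.toContinuousLinearMap.restrictScalars
      ℝ).hasFDerivAt (x := toL2 (u t))).comp_hasDerivAt t h3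

theorem IsTimeDeriv.fvec_sub_lipschitz {L : ℝ} {u ut u' ut' : ℝ → ℝ → ℝ}
    (hu : ∀ t ∈ Icc 0 L, Nice (u t)) (hut : MemLinfH 2 L ut) (hd : IsTimeDeriv L u ut)
    (hu' : ∀ t ∈ Icc 0 L, Nice (u' t)) (hut' : MemLinfH 2 L ut') (hd' : IsTimeDeriv L u' ut') :
    (∃ D, 0 ≤ D ∧ ∀ t ∈ Icc 0 L, ∀ t' ∈ Icc 0 L,
      ‖fvec (fun x => u t' x - u' t' x) - fvec (fun x => u t x - u' t x)‖ ≤ D * |t' - t|) ∧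
      ∀ᵐ t, t ∈ Ioo 0 L → HasDerivAt (fun τ => fvec fun x => u τ x - u' τ x)
        (fvec fun x => ut t x - ut' t x) t := by
  obtain ⟨⟨D, hD0, hD⟩, h1⟩ := hd.fvec_lipschitz hu hut
  obtain ⟨⟨D', hD0', hD'⟩, h1'⟩ := hd'.fvec_lipschitz hu' hut'
  have e1 : ∀ t ∈ Icc 0 L, fvec (fun x => u t x - u' t x) = fvec (u t) - fvec (u' t) :=
    fun t ht => fvec_sub (hu t ht) (hu' t ht)
  constructor
  · refine ⟨D + D', add_nonneg hD0 hD0', fun t ht t' ht' => ?_⟩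
    rw [e1 t ht, e1 t' ht', sub_sub_sub_comm, add_mul]
    exact (norm_sub_le _ _).trans (add_le_add (hD t ht t' ht') (hD' t ht t' ht'))
  · filter_upwards [h1, h1', (ae_restrict_iff' measurableSet_Icc).1 hut.1,
      (ae_restrict_iff' measurableSet_Icc).1 hut'.1] with t a1 a2 a3 a4 ht
    have ht' : t ∈ Icc 0 L := Ioo_subset_Icc_self ht
    rw [fvec_sub ((a3 ht').nice (by norm_num)) ((a4 ht').nice (by norm_num))]
    refine ((a1 ht).sub (a2 ht)).congr_of_eventuallyEq ?_
    filter_upwards [Ioo_mem_nhds ht.1 ht.2] with τ hτ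
    exact e1 τ (Ioo_subset_Icc_self hτ)

theorem IsTimeDeriv.abs_sub_le {L D : ℝ} {u ut : ℝ → ℝ → ℝ} (hd : IsTimeDeriv L u ut)
    (hD : ∀ᵐ t ∂(volume.restrict (Icc 0 L)), ∀ x, |ut t x| ≤ D) {t t' : ℝ} (ht : t ∈ Icc 0 L)
    (ht' : t' ∈ Icc 0 L) (x : ℝ) : |u t' x - u t x| ≤ D * |t' - t| := by
  obtain ⟨i1, e1⟩ := hd t ht x
  obtain ⟨i2, e2⟩ := hd t' ht' x
  rw [e1, e2, add_sub_add_left_eq_sub, intervalIntegral.integral_interval_sub_left i2 i1,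
    ← Real.norm_eq_abs]
  refine intervalIntegral.norm_integral_le_of_norm_le_const_ae ?_
  rw [ae_restrict_iff' measurableSet_Icc] at hD
  filter_upwards [hD] with τ h2 h3
  exact h2 (uIcc_subset_Icc ht ht' (uIoc_subset_uIcc h3)) x

theorem norm_sq_le_add {S : Ltwo →L[ℝ] Ltwo} {k B : ℝ} (hk : 0 ≤ k) (hS : ∀ P, ‖S P‖ ≤ k * ‖P‖)
    {P Q : Ltwo} (hP : ‖P‖ ≤ B) (hQ : ‖Q‖ ≤ B) :
    ‖S Q‖ ^ 2 ≤ ‖S P‖ ^ 2 + 2 * k ^ 2 * B * ‖Q - P‖ := by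
  have hB : 0 ≤ B := (norm_nonneg _).trans hP
  have h1 : ‖S Q‖ - ‖S P‖ ≤ k * ‖Q - P‖ := by
    refine (norm_sub_norm_le _ _).trans ?_
    rw [← map_sub]
    exact hS _
  have h2 : ‖S Q‖ + ‖S P‖ ≤ 2 * k * B := by
    have a1 := (hS Q).trans (mul_le_mul_of_nonneg_left hQ hk)
    have a2 := (hS P).trans (mul_le_mul_of_nonneg_left hP hk)
    linarith
  have h3 := mul_le_mul h1 h2 (by positivity) (by positivity)
  nlinarith

theorem energy_le_add {s e N R B : ℝ} {ρ : ℝ → ℝ} (hρ : AEStronglyMeasurable ρ)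
    (h0 : ∀ x, 0 ≤ ρ x) (hR : ∀ x, ρ x ≤ R) {F F' G G' : Ltwo} (hF : ‖F‖ ≤ B) (hF' : ‖F'‖ ≤ B)
    (hG : ‖G‖ ≤ B) (hG' : ‖G'‖ ≤ B) :
    energy s e N ρ F' G' ≤ energy s e N ρ F G +
      (2 * ‖mulOp (lam s N)‖ ^ 2 * B + 2 / 45 * e ^ 4 * (2 * (R * ‖elevOp s N‖ ^ 2) * B)) *
        ‖F' - F‖ + 2 * ‖mulOp (velW s e N)‖ ^ 2 * B * ‖G' - G‖ := by
  have hR0 : 0 ≤ R := (h0 0).trans (hR 0)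
  have h1 := norm_sq_le_add (norm_nonneg _) (mulOp (lam s N)).le_opNorm hF hF'
  have h2 := norm_sq_le_add (norm_nonneg _) (mulOp (velW s e N)).le_opNorm hG hG'
  have h3 : ∀ P, ‖((mulOp fun x => Real.sqrt (ρ x)).comp (elevOp s N)) P‖ ≤
      Real.sqrt R * ‖elevOp s N‖ * ‖P‖ := by
    intro P
    refine (pow_le_pow_iff_left₀ (norm_nonneg _) (by positivity) two_ne_zero).1 ?_
    refine (norm_mulOp_sqrt_sq_le_const hρ h0 hR (elevOp s N P)).trans ?_
    rw [mul_assoc, mul_pow, Real.sq_sqrt hR0]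
    exact mul_le_mul_of_nonneg_left (pow_le_pow_left₀ (norm_nonneg _)
      ((elevOp s N).le_opNorm P) 2) hR0
  have h4 := norm_sq_le_add (by positivity) h3 hF hF'
  rw [mul_pow, Real.sq_sqrt hR0] at h4
  have h5 := mul_le_mul_of_nonneg_left h4 (by positivity : 0 ≤ 2 / 45 * e ^ 4)
  simp only [energy]
  simp only [ContinuousLinearMap.comp_apply] at h5
  linarith

theorem HasDerivAt.le_zero_of_right {f : ℝ → ℝ} {d t b : ℝ} (hb : t < b) (hf : HasDerivAt f d t)
    (h0 : f t = 0) (h : ∀ τ ∈ Ioo t b, f τ ≤ 0) : d ≤ 0 := by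
  have h1 := (hasDerivAt_iff_tendsto_slope.1 hf).mono_left
    (nhdsWithin_mono t (fun x (hx : x ∈ Ioi t) => ne_of_gt hx))
  refine le_of_tendsto h1 ?_
  filter_upwards [Ioo_mem_nhdsGT hb] with τ hτ
  rw [slope_def_field, h0, sub_zero]
  exact div_nonpos_of_nonpos_of_nonneg (h τ hτ) (sub_nonneg.2 hτ.1.le)

/-- The one-sided hypothesis, applied in both orders, makes E Lipschitz, hence absolutely
continuous, so it is the integral of a derivative that needs to be bounded only where it exists. -/
theorem le_add_integral_of_lipschitz {E g : ℝ → ℝ} {L K : ℝ} (hK : 0 ≤ K)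
    (hE : ∀ t ∈ Icc 0 L, ∀ t' ∈ Icc 0 L, E t' ≤ E t + K * |t' - t|) (hg : ContinuousOn g (Icc 0 L))
    (h : ∀ᵐ t, t ∈ Ioo 0 L → ∀ d, HasDerivAt E d t → d ≤ g t) {t : ℝ} (ht : t ∈ Icc 0 L) :
    E t ≤ E 0 + ∫ τ in (0 : ℝ)..t, g τ := by
  have hsub : Icc 0 t ⊆ Icc 0 L := Icc_subset_Icc le_rfl ht.2
  have hlip : LipschitzOnWith K.toNNReal E (uIcc 0 t) := by
    rw [uIcc_of_le ht.1]
    refine LipschitzOnWith.of_dist_le_mul fun x hx y hy => ?_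
    have h1 := hE x (hsub hx) y (hsub hy)
    have h2 := hE y (hsub hy) x (hsub hx)
    rw [abs_sub_comm] at h1
    rw [Real.dist_eq, Real.dist_eq, Real.coe_toNNReal _ hK, abs_le]
    constructor <;> linarith
  have hac := hlip.absolutelyContinuousOnInterval
  rw [← sub_le_iff_le_add', ← hac.integral_deriv_eq_sub]
  refine intervalIntegral.integral_mono_ae_restrict ht.1 hac.intervalIntegrable_deriv
    ((hg.mono hsub).intervalIntegrable_of_Icc ht.1) ?_
  rw [← restrict_Ioo_eq_restrict_Icc, EventuallyLE, ae_restrict_iff' measurableSet_Ioo]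
  filter_upwards [h, hac.ae_differentiableAt] with τ h1 h2 hτ
  refine h1 ⟨hτ.1, hτ.2.trans_le ht.2⟩ _ (h2 ?_).hasDerivAt
  rw [uIcc_of_le ht.1]
  exact Ioo_subset_Icc_self hτ

/-- Let G be the expression under the root. Then G' ≤ 2m(e√G + F)√G, so √G satisfies a linear
inequality with rate m e and source m F. Working with √G rather than G makes the final bound linear
in F and in y(0). -/
theorem gronwall_sqrt {y : ℝ → ℝ} {L κ A K e F : ℝ} (hκ : 0 ≤ κ) (hA : 0 ≤ A) (hK : 0 ≤ K)
    (he : 0 ≤ e) (hF : 0 ≤ F) (hy : ContinuousOn y (Icc 0 L)) (h0 : ∀ t ∈ Icc 0 L, 0 ≤ y t)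
    (h : ∀ t ∈ Icc 0 L,
      y t ≤ κ * Real.sqrt (A * y 0 ^ 2 + ∫ τ in (0 : ℝ)..t, K * (e * y τ + F) * y τ))
    {t : ℝ} (ht : t ∈ Icc 0 L) :
    y t ≤ κ * Real.exp (K * κ * (κ + 1) * e * t) *
      (Real.sqrt A * y 0 + K * κ * (κ + 1) * F * t) := by
  have hL : 0 ≤ L := ht.1.trans ht.2
  set m := K * κ * (κ + 1) with hm
  have hm0 : 0 ≤ m := by positivity
  have y00 := h0 0 ⟨le_rfl, hL⟩
  -- A continuous extension of y to the whole line, so that the integral is differentiable at every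
  -- time.
  set z : ℝ → ℝ := IccExtend hL ((Icc 0 L).domRestrict y) with hz
  have zc : Continuous z := hy.domRestrict.Icc_extend'
  have zy : ∀ τ ∈ Icc 0 L, z τ = y τ := fun τ hτ => IccExtend_of_mem hL _ hτ
  have z0 : ∀ τ, 0 ≤ z τ := fun τ => h0 _ (projIcc 0 L hL τ).2
  have gc : Continuous fun τ => K * (e * z τ + F) * z τ := by fun_prop
  have g0 : ∀ τ, 0 ≤ K * (e * z τ + F) * z τ := fun τ => by
    have := z0 τ; positivity
  have key : ∀ δ : ℝ, 0 < δ → y t ≤ κ * Real.exp (m * e * t) *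
      (Real.sqrt A * y 0 + m * F * t) + κ * Real.exp (m * e * t) * δ := by
    intro δ hδ
    -- The term δ² keeps G positive and the square root differentiable; δ tends to zero at the end.
    set G : ℝ → ℝ := fun τ => δ ^ 2 + A * y 0 ^ 2 + ∫ r in (0 : ℝ)..τ, K * (e * z r + F) * z r
      with hG
    have dG : ∀ τ, HasDerivAt G (K * (e * z τ + F) * z τ) τ := fun τ =>
      (gc.integral_hasStrictDerivAt 0 τ).hasDerivAt.const_add _
    have posG : ∀ τ, 0 ≤ τ → 0 < G τ := fun τ hτ => by
      have := intervalIntegral.integral_nonneg (μ := volume) hτ fun r _ => g0 r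
      have : 0 < δ ^ 2 := by positivity
      have : 0 ≤ A * y 0 ^ 2 := by positivity
      simp only [hG]; linarith
    have yG : ∀ τ ∈ Icc 0 L, z τ ≤ κ * Real.sqrt (G τ) := by
      intro τ hτ
      rw [zy τ hτ]
      refine (h τ hτ).trans (mul_le_mul_of_nonneg_left (Real.sqrt_le_sqrt ?_) hκ)
      have e1 : ∫ r in (0 : ℝ)..τ, K * (e * y r + F) * y r =
          ∫ r in (0 : ℝ)..τ, K * (e * z r + F) * z r := by
        refine intervalIntegral.integral_congr fun r hr => ?_
        rw [uIcc_of_le hτ.1] at hr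
        simp only [zy r ⟨hr.1, hr.2.trans hτ.2⟩]
      rw [e1]
      simp only [hG]
      nlinarith [sq_nonneg δ]
    -- An integrating factor for √G, minus the contribution of the source; H is nonincreasing
    -- because the exponential factor is at most 1.
    set H : ℝ → ℝ := fun τ => Real.exp (-(m * e * τ)) * Real.sqrt (G τ) - m * F * τ with hH
    have dH : ∀ τ, 0 ≤ τ → HasDerivAt H (Real.exp (-(m * e * τ)) * -(m * e) * Real.sqrt (G τ) +
        Real.exp (-(m * e * τ)) * (K * (e * z τ + F) * z τ / (2 * Real.sqrt (G τ))) -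
        m * F) τ := by
      intro τ hτ
      have a1 : HasDerivAt (fun τ => Real.exp (-(m * e * τ)))
          (Real.exp (-(m * e * τ)) * -(m * e)) τ := by
        have := ((hasDerivAt_id τ).const_mul (m * e)).neg.exp
        simpa using this
      have a2 := (dG τ).sqrt (posG τ hτ).ne'
      have a3 : HasDerivAt (fun τ => m * F * τ) (m * F) τ := by
        simpa using (hasDerivAt_id τ).const_mul (m * F)
      exact (a1.mul a2).sub a3
    have anti : AntitoneOn H (Icc 0 L) := by
      refine antitoneOn_of_deriv_nonpos (convex_Icc 0 L)
        (fun τ hτ => (dH τ hτ.1).continuousAt.continuousWithinAt) ?_ ?_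
      · intro τ hτ
        rw [interior_Icc] at hτ
        exact (dH τ hτ.1.le).differentiableAt.differentiableWithinAt
      · intro τ hτ
        rw [interior_Icc] at hτ
        rw [(dH τ hτ.1.le).deriv]
        have hS : 0 < Real.sqrt (G τ) := Real.sqrt_pos.2 (posG τ hτ.1.le)
        have hzS := yG τ (Ioo_subset_Icc_self hτ)
        set S := Real.sqrt (G τ)
        have b1 : K * (e * z τ + F) * z τ / (2 * S) ≤ m * (e * S + F) := by
          rw [div_le_iff₀ (by positivity)]
          calc K * (e * z τ + F) * z τ ≤ K * (e * (κ * S) + F) * (κ * S) := by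
                have := z0 τ
                gcongr
            _ ≤ m * (e * S + F) * (2 * S) := by
                have c1 : 0 ≤ K * κ * (e * S * S) := by positivity
                have c2 : 0 ≤ K * κ * (F * S) := by positivity
                have c3 := mul_nonneg hκ c1
                have c4 := mul_nonneg hκ c2
                rw [hm]; linarith
        have b2 : Real.exp (-(m * e * τ)) ≤ 1 := Real.exp_le_one_iff.2 (by
          have : 0 ≤ m * e * τ := mul_nonneg (mul_nonneg hm0 he) hτ.1.le
          linarith)
        have b3 := mul_le_mul_of_nonneg_left b1 (Real.exp_pos (-(m * e * τ))).le
        have b4 := mul_le_mul_of_nonneg_right b2 (mul_nonneg hm0 hF)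
        nlinarith
    have h1 := anti ⟨le_rfl, hL⟩ ht ht.1
    have h2 : H 0 ≤ δ + Real.sqrt A * y 0 := by
      simp only [hH, hG, mul_zero, neg_zero, Real.exp_zero, one_mul, sub_zero,
        intervalIntegral.integral_same, add_zero]
      refine Real.sqrt_le_iff.2 ⟨by positivity, ?_⟩
      have : 0 ≤ δ * (Real.sqrt A * y 0) := by positivity
      nlinarith [Real.sq_sqrt hA, mul_pow (Real.sqrt A) (y 0) 2]
    have h3 : Real.exp (-(m * e * t)) * Real.sqrt (G t) ≤
        δ + Real.sqrt A * y 0 + m * F * t := by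
      have := h1.trans h2
      simp only [hH] at this
      linarith
    have h4 : Real.sqrt (G t) ≤ Real.exp (m * e * t) * (δ + Real.sqrt A * y 0 + m * F * t) := by
      have := mul_le_mul_of_nonneg_left h3 (Real.exp_pos (m * e * t)).le
      rwa [← mul_assoc, ← Real.exp_add, add_neg_cancel, Real.exp_zero, one_mul] at this
    have h5 := yG t ht
    rw [zy t ht] at h5
    have h6 := h5.trans (mul_le_mul_of_nonneg_left h4 hκ)
    linarith
  refine le_of_forall_pos_le_add fun η hη => ?_
  set c := κ * Real.exp (m * e * t)
  have hc : 0 ≤ c := by positivity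
  refine (key (η / (c + 1)) (by positivity)).trans ?_
  have : c * (η / (c + 1)) ≤ η := by
    rw [← mul_div_assoc, div_le_iff₀ (by positivity)]
    nlinarith
  linarith

/-! ### Growth of the energy of the difference -/

/-- Two evolutions on `[0, L]` whose difference has the size `y t` at the time `t`, and which satisfy
the equations of a `Slice` at almost every time. -/
structure Evolution (s e c C D F L : ℝ) (ζ v ζ' v' f₁ f₂ ζt vt ζt' vt' : ℝ → ℝ → ℝ)
    (y : ℝ → ℝ) : Prop where
  hs : 3 / 2 < s
  he : 0 < e
  he1 : e ≤ 1
  hc : 0 < c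
  hD : 0 ≤ D
  hF : 0 ≤ F
  hζ : ∀ t ∈ Icc 0 L, Sb s e 2 (ζ t) C
  hv : ∀ t ∈ Icc 0 L, Nice (v t)
  hζ' : ∀ t ∈ Icc 0 L, Nice (ζ' t)
  hv' : ∀ t ∈ Icc 0 L, Nice (v' t)
  hη : ∀ t ∈ Icc 0 L, Sb s e 2 (fun x => ζ t x - ζ' t x) (y t)
  hw : ∀ t ∈ Icc 0 L, Sb s e 2 (fun x => v t x - v' t x) (y t)
  hy : ∀ t ∈ Icc 0 L, y t = Sn s e (fun x => ζ t x - ζ' t x) + Sn s e fun x => v t x - v' t x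
  hyc : ContinuousOn y (Icc 0 L)
  hh : ∀ t ∈ Icc 0 L, ∀ x, c ≤ 1 + e ^ 2 * ζ t x
  mζt : MemLinfH 2 L ζt
  mvt : MemLinfH 2 L vt
  mζt' : MemLinfH 2 L ζt'
  mvt' : MemLinfH 2 L vt'
  dζ : IsTimeDeriv L ζ ζt
  dv : IsTimeDeriv L v vt
  dζ' : IsTimeDeriv L ζ' ζt'
  dv' : IsTimeDeriv L v' vt'
  hζt : ∀ᵐ t ∂(volume.restrict (Icc 0 L)), ∀ x, |ζt t x| ≤ D
  hS : ∀ᵐ t ∂(volume.restrict (Icc 0 L)), ∃ a a', Slice s e c C (y t) F (ζ t) (v t) (ζ' t) (v' t)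
    a a' (f₁ t) (f₂ t) (fun x => ζt t x - ζt' t x) (fun x => vt t x - vt' t x)

/-- The growth rate of the energy. -/
def rateC (s c C D : ℝ) : ℝ := 2 * Slice.enC s c C + D / c ^ 2

namespace Evolution

variable {s e c C D F L : ℝ} {ζ v ζ' v' f₁ f₂ ζt vt ζt' vt' : ℝ → ℝ → ℝ} {y : ℝ → ℝ}

theorem inv_nonneg (S : Evolution s e c C D F L ζ v ζ' v' f₁ f₂ ζt vt ζt' vt' y) {t : ℝ}
    (ht : t ∈ Icc 0 L) (x : ℝ) : 0 ≤ (1 + e ^ 2 * ζ t x)⁻¹ :=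
  _root_.inv_nonneg.2 (S.hc.le.trans (S.hh t ht x))

theorem inv_le (S : Evolution s e c C D F L ζ v ζ' v' f₁ f₂ ζt vt ζt' vt' y) {t : ℝ}
    (ht : t ∈ Icc 0 L) (x : ℝ) : (1 + e ^ 2 * ζ t x)⁻¹ ≤ c⁻¹ :=
  inv_anti₀ S.hc (S.hh t ht x)

theorem le_inv (S : Evolution s e c C D F L ζ v ζ' v' f₁ f₂ ζt vt ζt' vt' y) {t : ℝ}
    (ht : t ∈ Icc 0 L) (x : ℝ) : (1 + embC s * C)⁻¹ ≤ (1 + e ^ 2 * ζ t x)⁻¹ := by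
  refine inv_anti₀ (S.hc.trans_le (S.hh t ht x)) ?_
  have h1 := (abs_le.1 ((S.hζ t ht).abs_le S.hs S.he.le x)).2
  have h2 : e ^ 2 ≤ 1 := pow_le_one₀ S.he.le S.he1
  have h3 : 0 ≤ embC s * C := mul_nonneg (embC_nonneg s) (S.hζ t ht).nonneg
  nlinarith [sq_nonneg e]

theorem aesm_inv (S : Evolution s e c C D F L ζ v ζ' v' f₁ f₂ ζt vt ζt' vt' y) {t : ℝ}
    (ht : t ∈ Icc 0 L) : AEStronglyMeasurable fun x => (1 + e ^ 2 * ζ t x)⁻¹ := by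
  have h1 : Continuous (ζ t) := ((S.hζ t ht).differentiable S.hs S.he.le).continuous
  exact ((continuous_const.add (continuous_const.mul h1)).inv₀ fun x =>
    (S.hc.trans_le (S.hh t ht x)).ne').aestronglyMeasurable

theorem inv_le_add (S : Evolution s e c C D F L ζ v ζ' v' f₁ f₂ ζt vt ζt' vt' y) {t t' : ℝ}
    (ht : t ∈ Icc 0 L) (ht' : t' ∈ Icc 0 L) (x : ℝ) :
    (1 + e ^ 2 * ζ t' x)⁻¹ ≤ (1 + e ^ 2 * ζ t x)⁻¹ + e ^ 2 * D / c ^ 2 * |t' - t| := by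
  have h1 := (abs_le.1 (S.dζ.abs_sub_le S.hζt ht ht' x)).1
  have p := S.hh t ht x
  have p' := S.hh t' ht' x
  have hc := S.hc
  have q : 0 < 1 + e ^ 2 * ζ t x := hc.trans_le p
  have q' : 0 < 1 + e ^ 2 * ζ t' x := hc.trans_le p'
  have e1 : (1 + e ^ 2 * ζ t' x)⁻¹ - (1 + e ^ 2 * ζ t x)⁻¹ =
      e ^ 2 * (ζ t x - ζ t' x) / ((1 + e ^ 2 * ζ t' x) * (1 + e ^ 2 * ζ t x)) := by
    field_simp; ring
  have h2 : e ^ 2 * (ζ t x - ζ t' x) / ((1 + e ^ 2 * ζ t' x) * (1 + e ^ 2 * ζ t x)) ≤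
      e ^ 2 * (D * |t' - t|) / c ^ 2 := by
    have h3 := mul_nonneg S.hD (abs_nonneg (t' - t))
    refine div_le_div₀ (by positivity) (mul_le_mul_of_nonneg_left (by linarith) (sq_nonneg e))
      (by positivity) ?_
    nlinarith
  have e2 : e ^ 2 * (D * |t' - t|) / c ^ 2 = e ^ 2 * D / c ^ 2 * |t' - t| := by ring
  linarith

/-- The truncated energy of the difference. -/
def en (s e N : ℝ) (ζ v ζ' v' : ℝ → ℝ → ℝ) (t : ℝ) : ℝ :=
  energy s e N (fun x => (1 + e ^ 2 * ζ t x)⁻¹) (fvec fun x => ζ t x - ζ' t x)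
    (fvec fun x => v t x - v' t x)

theorem one_le_s (S : Evolution s e c C D F L ζ v ζ' v' f₁ f₂ ζt vt ζt' vt' y) : 1 ≤ s := by
  have := S.hs; linarith

/-- The weight 1/h depends on time but is Lipschitz in time, uniformly in x, so it can be frozen at
the time t with an error linear in |t' - t|. No derivative of the weight is needed. -/
theorem en_le_energy (S : Evolution s e c C D F L ζ v ζ' v' f₁ f₂ ζt vt ζt' vt' y) (N : ℝ)
    {t t' : ℝ} (ht : t ∈ Icc 0 L) (ht' : t' ∈ Icc 0 L) :
    en s e N ζ v ζ' v' t' ≤ energy s e N (fun x => (1 + e ^ 2 * ζ t x)⁻¹)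
        (fvec fun x => ζ t' x - ζ' t' x) (fvec fun x => v t' x - v' t' x) +
      2 / 45 * e ^ 4 * (e ^ 2 * D / c ^ 2 * |t' - t| *
        ‖elevOp s N (fvec fun x => ζ t' x - ζ' t' x)‖ ^ 2) := by
  have h1 := norm_mulOp_sqrt_sq_le (S.aesm_inv ht) (S.aesm_inv ht') (S.inv_nonneg ht)
    (S.inv_nonneg ht') (S.inv_le ht) (S.inv_le ht') (S.inv_le_add ht ht')
    (elevOp s N (fvec fun x => ζ t' x - ζ' t' x))
  have h2 := mul_le_mul_of_nonneg_left h1 (by have := S.he; positivity : 0 ≤ 2 / 45 * e ^ 4)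
  simp only [en, energy]
  linarith

/-- The constant depends on N through the operator norms; it serves only to make the energy
absolutely continuous. -/
theorem exists_lipschitz (S : Evolution s e c C D F L ζ v ζ' v' f₁ f₂ ζt vt ζt' vt' y) (N : ℝ) :
    ∃ K, 0 ≤ K ∧ ∀ t ∈ Icc 0 L, ∀ t' ∈ Icc 0 L,
      en s e N ζ v ζ' v' t' ≤ en s e N ζ v ζ' v' t + K * |t' - t| := by
  obtain ⟨⟨D₁, hD₁, l₁⟩, -⟩ := S.dζ.fvec_sub_lipschitz (fun t ht => (S.hζ t ht).nice) S.mζt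
    S.hζ' S.mζt' S.dζ'
  obtain ⟨⟨D₂, hD₂, l₂⟩, -⟩ := S.dv.fvec_sub_lipschitz S.hv S.mvt S.hv' S.mvt' S.dv'
  by_cases hL : 0 ≤ L
  swap
  · exact ⟨0, le_rfl, fun t ht => absurd (ht.1.trans ht.2) hL⟩
  have h0 : (0 : ℝ) ∈ Icc 0 L := ⟨le_rfl, hL⟩
  have hc := S.hc
  have he := S.he
  have hD := S.hD
  set F₀ := fvec fun x => ζ 0 x - ζ' 0 x
  set G₀ := fvec fun x => v 0 x - v' 0 x
  set B := ‖F₀‖ + D₁ * L + (‖G₀‖ + D₂ * L) with hB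
  have bF : ∀ t ∈ Icc 0 L, ‖fvec fun x => ζ t x - ζ' t x‖ ≤ B := by
    intro t ht
    have h1 := (norm_sub_norm_le _ _).trans (l₁ 0 h0 t ht)
    rw [sub_zero, abs_of_nonneg ht.1] at h1
    have h2 := mul_le_mul_of_nonneg_left ht.2 hD₁
    have h3 := mul_nonneg hD₂ hL
    have h4 := norm_nonneg G₀
    linarith
  have bG : ∀ t ∈ Icc 0 L, ‖fvec fun x => v t x - v' t x‖ ≤ B := by
    intro t ht
    have h1 := (norm_sub_norm_le _ _).trans (l₂ 0 h0 t ht)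
    rw [sub_zero, abs_of_nonneg ht.1] at h1
    have h2 := mul_le_mul_of_nonneg_left ht.2 hD₂
    have h3 := mul_nonneg hD₁ hL
    have h4 := norm_nonneg F₀
    linarith
  have hB0 : 0 ≤ B := (norm_nonneg _).trans (bF 0 h0)
  refine ⟨(2 * ‖mulOp (lam s N)‖ ^ 2 * B + 2 / 45 * e ^ 4 * (2 * (c⁻¹ * ‖elevOp s N‖ ^ 2) * B)) *
    D₁ + 2 * ‖mulOp (velW s e N)‖ ^ 2 * B * D₂ +
    2 / 45 * e ^ 4 * (e ^ 2 * D / c ^ 2 * (‖elevOp s N‖ * B) ^ 2), by positivity,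
    fun t ht t' ht' => ?_⟩
  have h1 := S.en_le_energy N ht ht'
  have h2 := energy_le_add (s := s) (e := e) (N := N) (S.aesm_inv ht) (S.inv_nonneg ht)
    (S.inv_le ht) (bF t ht) (bF t' ht') (bG t ht) (bG t' ht')
  have h3 := mul_le_mul_of_nonneg_left (l₁ t ht t' ht') (by positivity : 0 ≤
    2 * ‖mulOp (lam s N)‖ ^ 2 * B + 2 / 45 * e ^ 4 * (2 * (c⁻¹ * ‖elevOp s N‖ ^ 2) * B))
  have h4 := mul_le_mul_of_nonneg_left (l₂ t ht t' ht') (by positivity : 0 ≤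
    2 * ‖mulOp (velW s e N)‖ ^ 2 * B)
  have h5 : ‖elevOp s N (fvec fun x => ζ t' x - ζ' t' x)‖ ^ 2 ≤ (‖elevOp s N‖ * B) ^ 2 :=
    pow_le_pow_left₀ (norm_nonneg _) (((elevOp s N).le_opNorm _).trans
      (mul_le_mul_of_nonneg_left (bF t' ht') (norm_nonneg _))) 2
  have h6 := mul_le_mul_of_nonneg_left h5 (by positivity : 0 ≤
    2 / 45 * e ^ 4 * (e ^ 2 * D / c ^ 2 * |t' - t|))
  rw [en] at h1 ⊢
  rw [en]
  linarith

/-- At almost every time the energy is compared with the one whose weight is frozen there. The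
frozen energy is differentiated exactly and obeys the energy inequality. The error of freezing adds
a term of size e⁶ D (E/e²)²/c², which is of order e²E². -/
theorem deriv_en_le (S : Evolution s e c C D F L ζ v ζ' v' f₁ f₂ ζt vt ζt' vt' y) (N : ℝ) :
    ∀ᵐ t, t ∈ Ioo 0 L → ∀ d, HasDerivAt (en s e N ζ v ζ' v') d t →
      d ≤ rateC s c C D * (e * y t + F) * y t := by
  obtain ⟨-, d₁⟩ := S.dζ.fvec_sub_lipschitz (fun t ht => (S.hζ t ht).nice) S.mζt
    S.hζ' S.mζt' S.dζ'
  obtain ⟨-, d₂⟩ := S.dv.fvec_sub_lipschitz S.hv S.mvt S.hv' S.mvt' S.dv'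
  filter_upwards [d₁, d₂, (ae_restrict_iff' measurableSet_Icc).1 S.hS] with t a₁ a₂ a₃ ht d hd
  have ht' : t ∈ Icc 0 L := Ioo_subset_Icc_self ht
  obtain ⟨a, a', sl⟩ := a₃ ht'
  have hc := S.hc
  have he := S.he
  have hD := S.hD
  have hF := S.hF
  have hyt := (S.hη t ht').nonneg
  set P : ℝ → ℝ := fun τ => ‖elevOp s N (fvec fun x => ζ τ x - ζ' τ x)‖ ^ 2 with hP
  have dE := hasDerivAt_energy s e N (fun x => (1 + e ^ 2 * ζ t x)⁻¹) (a₁ ht) (a₂ ht)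
  have dP : HasDerivAt P _ t :=
    (((elevOp s N).hasFDerivAt (x := fvec fun x => ζ t x - ζ' t x)).comp_hasDerivAt t
      (a₁ ht)).norm_sq
  have dQ := (((hasDerivAt_id t).sub_const t).mul dP).const_mul
    (2 / 45 * e ^ 4 * (e ^ 2 * D / c ^ 2))
  -- The energy minus the frozen energy and minus the freezing error vanishes at t and is
  -- nonpositive to its right, so its derivative at t is nonpositive.
  have key := HasDerivAt.le_zero_of_right ht.2 ((hd.sub dE).sub dQ) (by simp [en])
    (fun τ hτ => by
      have h1 := S.en_le_energy N ht' ⟨ht.1.le.trans hτ.1.le, hτ.2.le⟩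
      rw [abs_of_pos (sub_pos.2 hτ.1)] at h1
      simp only [Pi.sub_apply, Pi.mul_apply, id, hP]
      linarith)
  have h2 : P t ≤ (y t / e ^ 2) ^ 2 :=
    pow_le_pow_left₀ (norm_nonneg _) (norm_elevOp_le S.one_le_s he N (S.hη t ht')) 2
  have h3 := (abs_le.1 (sl.energy_inequality N)).2
  rw [energyForm_fvec S.one_le_s he.le S.he1 N (S.aesm_inv ht') (S.inv_nonneg ht')
    (S.inv_le ht')] at key
  simp only [id, sub_self, zero_mul, add_zero, one_mul] at key
  have h4 : 2 / 45 * e ^ 4 * (e ^ 2 * D / c ^ 2) * P t ≤ D / c ^ 2 * (e * y t + F) * y t := by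
    have h5 := mul_le_mul_of_nonneg_left h2 (by positivity : 0 ≤
      2 / 45 * e ^ 4 * (e ^ 2 * D / c ^ 2))
    have h6 : 2 / 45 * e ^ 4 * (e ^ 2 * D / c ^ 2) * (y t / e ^ 2) ^ 2 =
        2 / 45 * e * (D / c ^ 2 * (e * y t) * y t) := by field_simp
    have h7 : 2 / 45 * e * (D / c ^ 2 * (e * y t) * y t) ≤ 1 * (D / c ^ 2 * (e * y t) * y t) :=
      mul_le_mul_of_nonneg_right (by have := S.he1; linarith) (by positivity)
    have h8 : 0 ≤ D / c ^ 2 * F * y t := by positivity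
    linarith
  rw [rateC]
  linarith

theorem le_growth (S : Evolution s e c C D F L ζ v ζ' v' f₁ f₂ ζt vt ζt' vt' y)
    (hen : 0 ≤ Slice.enC s c C) {κ m : ℝ} (hκ : κ = lowC (1 + embC s * C)⁻¹)
    (hm : m = rateC s c C D * κ * (κ + 1)) {t : ℝ} (ht : t ∈ Icc 0 L) :
    y t ≤ κ * Real.exp (m * e * t) * (Real.sqrt (4 * (1 + c⁻¹)) * y 0 + m * F * t) := by
  have hc := S.hc
  have he := S.he
  have hL : (0 : ℝ) ∈ Icc 0 L := ⟨le_rfl, ht.1.trans ht.2⟩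
  have hr : 0 ≤ rateC s c C D := by
    have := S.hD
    unfold rateC; positivity
  have hκ0 : 0 ≤ κ := hκ ▸ (lowC_pos _).le
  have y0 : ∀ t ∈ Icc 0 L, 0 ≤ y t := fun t ht => (S.hη t ht).nonneg
  have gc : ContinuousOn (fun τ => rateC s c C D * (e * y τ + F) * y τ) (Icc 0 L) :=
    (continuousOn_const.mul ((continuousOn_const.mul S.hyc).add continuousOn_const)).mul S.hyc
  rw [hm]
  refine gronwall_sqrt hκ0 (by positivity) hr he.le S.hF S.hyc y0 (fun t ht => ?_) ht
  have hint : 0 ≤ ∫ τ in (0 : ℝ)..t, rateC s c C D * (e * y τ + F) * y τ := by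
    refine intervalIntegral.integral_nonneg ht.1 fun τ hτ => ?_
    have := y0 τ ⟨hτ.1, hτ.2.trans ht.2⟩
    have := S.hF
    positivity
  have hA : 0 ≤ 4 * (1 + c⁻¹) * y 0 ^ 2 := by positivity
  rw [S.hy t ht, hκ]
  -- The integrated inequality holds for every N with a right-hand side independent of N, as
  -- required for removing the truncation. At time zero the energy is at most (1 + 1/c)(2 y(0))².
  refine le_energy S.one_le_s he S.he1 (S.aesm_inv ht)
    (inv_pos.2 (by
      have := mul_nonneg (embC_nonneg s) (S.hζ t ht).nonneg
      linarith)) (S.le_inv ht) (S.inv_le ht) (Real.sqrt_nonneg _) fun N => ?_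
  rw [Real.sq_sqrt (add_nonneg hA hint)]
  obtain ⟨K, hK, hlip⟩ := S.exists_lipschitz N
  refine (le_add_integral_of_lipschitz hK hlip gc (S.deriv_en_le N) ht).trans ?_
  have h1 := energy_le S.one_le_s he S.he1 N (S.aesm_inv hL) (S.inv_nonneg hL) (S.inv_le hL)
    (S.hη 0 hL) (S.hw 0 hL)
  rw [en]
  linarith

end Evolution

/-! ### Continuity argument for the depth of the second solution -/

theorem MemLinfH.mono {r L t : ℝ} (h : t ≤ L) {f : ℝ → ℝ → ℝ} (hf : MemLinfH r L f) :
    MemLinfH r t f := by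
  have hm : volume.restrict (Icc 0 t) ≤ volume.restrict (Icc 0 L) :=
    Measure.restrict_mono (Icc_subset_Icc le_rfl h) le_rfl
  exact ⟨ae_mono hm hf.1, hf.2.1.mono_measure hm, (eLpNorm_mono_measure _ hm).trans_lt hf.2.2⟩

theorem IsTimeDeriv.mono {L t : ℝ} (h : t ≤ L) {u ut : ℝ → ℝ → ℝ} (hu : IsTimeDeriv L u ut) :
    IsTimeDeriv t u ut := fun τ hτ => hu τ ⟨hτ.1, hτ.2.trans h⟩

theorem IsSolution.mono {ε L t : ℝ} (h : t ≤ L) {ζ v f₁ f₂ : ℝ → ℝ → ℝ}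
    (hs : IsSolution ε L ζ v f₁ f₂) : IsSolution ε t ζ v f₁ f₂ := by
  obtain ⟨ζt, vt, h1, h2, h3, h4, h5⟩ := hs
  exact ⟨ζt, vt, h1.mono h, h2.mono h, h3.mono h, h4.mono h, ae_restrict_mono_Icc h h5⟩

theorem Slice.enC_nonneg {s c C : ℝ} (hs : 0 ≤ s) (hc : 0 < c) (hC : 0 ≤ C) : 0 ≤ enC s c C := by
  have h1 := one_le_algC s
  have h2 := embC_nonneg s
  have h3 := commC_nonneg hs
  have h4 := accDiffC_nonneg (s := s) hc hC
  have h5 := accC_nonneg (s := s) hc hC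
  have h6 := rhoL_nonneg (s := s) hC
  have h7 := rhoC_nonneg (s := s) hC
  have h8 := invC_nonneg (s := s) hc hC
  have h0 : 0 ≤ algC s := zero_le_one.trans h1
  unfold enC remηC remKC remLC
  positivity

theorem Sb.self {s e A : ℝ} {f : ℝ → ℝ} (h : Sb s e 2 f A) : Sb s e 2 f (Sn s e f) :=
  ⟨h.1, ENNReal.toReal_nonneg, by
    rw [Sn, ENNReal.ofReal_toReal (h.2.2.trans_lt ENNReal.ofReal_lt_top).ne]⟩

theorem Sb.sn_le {s e A : ℝ} {f : ℝ → ℝ} (h : Sb s e 2 f A) : Sn s e f ≤ A :=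
  ENNReal.toReal_le_of_le_ofReal h.2.1 h.2.2

theorem Sn_nonneg (s e : ℝ) (f : ℝ → ℝ) : 0 ≤ Sn s e f := ENNReal.toReal_nonneg

theorem abs_Sn_sub_le {s e A B : ℝ} {f g : ℝ → ℝ} (hf : Sb s e 2 f A) (hg : Sb s e 2 g B) :
    |Sn s e f - Sn s e g| ≤ Sn s e fun x => f x - g x := by
  have h := (hf.sub hg).self
  have h1 := ((hg.self.add h).congr (g := f) (fun x => by ring) le_rfl).sn_le
  have h2 := ((hf.self.sub h).congr (g := g) (fun x => by ring) le_rfl).sn_le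
  rw [abs_le]
  constructor <;> linarith

theorem Sn_le_two_normH {s e : ℝ} (he : 0 ≤ e) (he1 : e ≤ 1) {f : ℝ → ℝ}
    (h : MemH (s + 2) f) : Sn s e f ≤ 2 * normH (s + 2) f := by
  rw [normH_eq, Sn, ← ENNReal.toReal_ofReal (zero_le_two (α := ℝ)), ← ENNReal.toReal_mul,
    ← nW_const_mul zero_le_two, ENNReal.toReal_ofReal zero_le_two]
  refine ENNReal.toReal_mono ?_ (nW_mono (sw_nonneg he s 2) (sw_two_le he he1) _)
  rw [nW_const_mul zero_le_two]
  exact (ENNReal.mul_lt_top ENNReal.ofReal_lt_top h.nW_lt).ne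

/-- The essential supremum is finite by the H^{s+2} bounds, so its `toReal` is not the default value
0 and does bound almost every value. -/
theorem ae_normX_le_normLinfX {s e t : ℝ} (hs : 3 / 2 < s) (he : 0 < e) (he1 : e ≤ 1)
    {f₁ f₂ : ℝ → ℝ → ℝ} (h₁ : MemLinfH (s + 2) t f₁) (h₂ : MemLinfH (s + 2) t f₂) :
    ∀ᵐ τ ∂(volume.restrict (Icc 0 t)), normX (e ^ 2) s (f₁ τ) (f₂ τ) ≤
      normLinfX (e ^ 2) s t f₁ f₂ := by
  obtain ⟨D₁, -, b₁⟩ := h₁.exists_bound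
  obtain ⟨D₂, -, b₂⟩ := h₂.exists_bound
  have hfin : eLpNorm (fun τ => normX (e ^ 2) s (f₁ τ) (f₂ τ)) ⊤ (volume.restrict (Icc 0 t)) < ⊤ := by
    rw [eLpNorm_exponent_top]
    refine eLpNormEssSup_lt_top_of_ae_bound (C := 2 * (2 * D₁ + 2 * D₂)) ?_
    filter_upwards [b₁, b₂] with τ c₁ c₂
    rw [Real.norm_of_nonneg (normX_nonneg _ _ _ _)]
    have a₁ := Sn_le_two_normH he.le he1 c₁.1
    have a₂ := Sn_le_two_normH he.le he1 c₂.1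
    have := normX_le hs he he1 (c₁.1.sb hs he.le he1) (c₂.1.sb hs he.le he1)
    linarith [c₁.2, c₂.2]
  rw [eLpNorm_exponent_top] at hfin
  filter_upwards [ae_le_eLpNormEssSup (f := fun τ => normX (e ^ 2) s (f₁ τ) (f₂ τ))
    (μ := volume.restrict (Icc 0 t))] with τ h
  have := ENNReal.toReal_mono hfin.ne h
  rw [toReal_enorm, Real.norm_of_nonneg (normX_nonneg _ _ _ _)] at this
  rwa [normLinfX, eLpNorm_exponent_top]

theorem nice_zero : Nice fun _ => 0 := by
  have h : Rep (fun _ => ((0 : ℝ) : ℂ)) fun _ => 0 := by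
    refine ⟨integrable_zero _ _ _, MemLp.zero, ?_⟩
    funext x
    simp [Real.fourierInv_eq]
  exact nice_of_rep h

/-- The size of the difference of two pairs, in the `e`-weighted norms. -/
def gap (s e : ℝ) (ζ v ζ' v' : ℝ → ℝ → ℝ) (t : ℝ) : ℝ :=
  Sn s e (fun x => ζ t x - ζ' t x) + Sn s e fun x => v t x - v' t x

/-- The bound of the time derivative of the elevation. -/
def speedC (s C : ℝ) : ℝ := embC s * C + 2 * (embC s * C) ^ 2

theorem deriv_depth_mul {s e A B : ℝ} (hs : 3 / 2 < s) (he : 0 ≤ e) {k : ℕ} {ζ v : ℝ → ℝ}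
    (hζ : Sb s e k ζ A) (hv : Sb s e k v B) (x : ℝ) :
    deriv (fun y => depth (e ^ 2) ζ y * v y) x =
      e ^ 2 * deriv ζ x * v x + (1 + e ^ 2 * ζ x) * deriv v x := by
  have h1 := (hζ.differentiable hs he x).hasDerivAt
  have h2 := (hv.differentiable hs he x).hasDerivAt
  exact (((h1.const_mul (e ^ 2)).const_add 1).mul h2).deriv

theorem abs_deriv_depth_mul_le {s e C : ℝ} (hs : 3 / 2 < s) (he : 0 ≤ e) (he1 : e ≤ 1) {k : ℕ}
    {ζ v : ℝ → ℝ} (hζ : Sb s e k ζ C) (hv : Sb s e k v C) (x : ℝ) :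
    |deriv (fun y => depth (e ^ 2) ζ y * v y) x| ≤ speedC s C := by
  rw [deriv_depth_mul hs he hζ hv]
  have h1 := hζ.abs_le hs he x
  have h2 := hv.abs_le hs he x
  have h3 := hζ.abs_deriv_le hs he x
  have h4 := hv.abs_deriv_le hs he x
  have h5 : e ^ 2 ≤ 1 := pow_le_one₀ he he1
  have hb : 0 ≤ embC s * C := mul_nonneg (embC_nonneg s) hζ.nonneg
  set b := embC s * C
  have h6 : |e ^ 2 * deriv ζ x * v x| ≤ b ^ 2 := by
    rw [abs_mul, abs_mul, abs_of_nonneg (sq_nonneg e)]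
    calc _ ≤ 1 * b * b := by gcongr
      _ = _ := by ring
  have h7 : |(1 + e ^ 2 * ζ x) * deriv v x| ≤ (1 + b) * b := by
    rw [abs_mul]
    have : |1 + e ^ 2 * ζ x| ≤ 1 + b := by
      refine (abs_add_le _ _).trans ?_
      rw [abs_one, abs_mul, abs_of_nonneg (sq_nonneg e)]
      have := mul_le_mul h5 h1 (abs_nonneg _) zero_le_one
      linarith
    gcongr
  refine (abs_add_le _ _).trans ?_
  rw [speedC]
  linarith

theorem MemH.of_le {r q : ℝ} {f : ℝ → ℝ} (h : MemH q f) (hrq : r ≤ q) : MemH r f :=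
  ⟨h.1, h.2.1, continuous_weight_aesm (continuous_jw r) (hat_aestronglyMeasurable f),
    (nW_mono (fun ξ => (jw_pos r ξ).le) (fun _ => jap_mono hrq _) _).trans_lt h.nW_lt⟩

/-- Two solutions on `[0, L]` whose sizes are bounded by `C`; the first one has a depth of at least
`2 * c`, the second one a source bounded by `F`. -/
structure Stable (s e c C F L : ℝ) (ζ v ζ' v' f₁ f₂ : ℝ → ℝ → ℝ) : Prop where
  hs : 3 / 2 < s
  he : 0 < e
  he1 : e ≤ 1
  hc : 0 < c
  hF : 0 ≤ F
  hX : ContX (e ^ 2) s L ζ v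
  hX' : ContX (e ^ 2) (s + 1) L ζ' v'
  hU : IsSolution (e ^ 2) L ζ v (fun _ _ => 0) fun _ _ => 0
  hU' : IsSolution (e ^ 2) L ζ' v' f₁ f₂
  hM : ∀ t ∈ Icc 0 L, Sb s e 2 (ζ t) C ∧ Sb s e 2 (v t) C
  hM' : ∀ t ∈ Icc 0 L, Sb (s + 1) e 2 (ζ' t) C ∧ Sb (s + 1) e 2 (v' t) C
  hh : ∀ t ∈ Icc 0 L, ∀ x, 2 * c ≤ 1 + e ^ 2 * ζ t x
  hf : ∀ᵐ t ∂(volume.restrict (Icc 0 L)), Sb s e 2 (f₁ t) F ∧ Sb s e 2 (f₂ t) F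

namespace Stable

variable {s e c C F L : ℝ} {ζ v ζ' v' f₁ f₂ : ℝ → ℝ → ℝ}

theorem mono (S : Stable s e c C F L ζ v ζ' v' f₁ f₂) {t : ℝ} (h : t ≤ L) :
    Stable s e c C F t ζ v ζ' v' f₁ f₂ where
  hs := S.hs
  he := S.he
  he1 := S.he1
  hc := S.hc
  hF := S.hF
  hX := ⟨fun τ hτ => S.hX.1 τ (Icc_subset_Icc le_rfl h hτ), fun τ hτ =>
    (S.hX.2 τ (Icc_subset_Icc le_rfl h hτ)).mono_left (nhdsWithin_mono _ (Icc_subset_Icc le_rfl h))⟩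
  hX' := ⟨fun τ hτ => S.hX'.1 τ (Icc_subset_Icc le_rfl h hτ), fun τ hτ =>
    (S.hX'.2 τ (Icc_subset_Icc le_rfl h hτ)).mono_left
      (nhdsWithin_mono _ (Icc_subset_Icc le_rfl h))⟩
  hU := S.hU.mono h
  hU' := S.hU'.mono h
  hM := fun τ hτ => S.hM τ (Icc_subset_Icc le_rfl h hτ)
  hM' := fun τ hτ => S.hM' τ (Icc_subset_Icc le_rfl h hτ)
  hh := fun τ hτ => S.hh τ (Icc_subset_Icc le_rfl h hτ)
  hf := ae_restrict_mono_Icc h S.hf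

theorem sb_ζ' (S : Stable s e c C F L ζ v ζ' v' f₁ f₂) {t : ℝ} (ht : t ∈ Icc 0 L) :
    Sb s e 2 (ζ' t) C := (S.hM' t ht).1.of_le (by linarith) S.he.le

theorem sb_v' (S : Stable s e c C F L ζ v ζ' v' f₁ f₂) {t : ℝ} (ht : t ∈ Icc 0 L) :
    Sb s e 2 (v' t) C := (S.hM' t ht).2.of_le (by linarith) S.he.le

theorem sb_η (S : Stable s e c C F L ζ v ζ' v' f₁ f₂) {t : ℝ} (ht : t ∈ Icc 0 L) :
    Sb s e 2 (fun x => ζ t x - ζ' t x) (C + C) := (S.hM t ht).1.sub (S.sb_ζ' ht)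

theorem sb_w (S : Stable s e c C F L ζ v ζ' v' f₁ f₂) {t : ℝ} (ht : t ∈ Icc 0 L) :
    Sb s e 2 (fun x => v t x - v' t x) (C + C) := (S.hM t ht).2.sub (S.sb_v' ht)

theorem gap_le (S : Stable s e c C F L ζ v ζ' v' f₁ f₂) {t : ℝ} (ht : t ∈ Icc 0 L) :
    gap s e ζ v ζ' v' t ≤ 4 * C := by
  have h1 := (S.sb_η ht).sn_le
  have h2 := (S.sb_w ht).sn_le
  rw [gap]; linarith

/-- The weighted norms obey the triangle inequality, so the variation of the gap is dominated by the
variations of the two solutions, each continuous in its own energy norm. -/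
theorem continuousOn_gap (S : Stable s e c C F L ζ v ζ' v' f₁ f₂) :
    ContinuousOn (gap s e ζ v ζ' v') (Icc 0 L) := by
  intro t ht
  have hs1 : 3 / 2 < s + 1 := by linarith [S.hs]
  have lim := ((S.hX.2 t ht).const_mul 8).add ((S.hX'.2 t ht).const_mul 8)
  rw [mul_zero, add_zero] at lim
  refine tendsto_iff_dist_tendsto_zero.2 (squeeze_zero' (Eventually.of_forall fun _ => dist_nonneg)
    ?_ lim)
  filter_upwards [self_mem_nhdsWithin] with τ hτ
  have a1 := abs_Sn_sub_le (S.sb_η hτ) (S.sb_η ht)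
  have a2 := abs_Sn_sub_le (S.sb_w hτ) (S.sb_w ht)
  have b1 := (S.hM τ hτ).1.sub (S.hM t ht).1
  have b2 := (S.hM τ hτ).2.sub (S.hM t ht).2
  have b3 := (S.hM' τ hτ).1.sub (S.hM' t ht).1
  have b4 := (S.hM' τ hτ).2.sub (S.hM' t ht).2
  have c1 := Sn_le_normX S.hs S.he b1 b2
  have c2 := Sn_le_normX hs1 S.he b3 b4
  have b3' := (b3.self.of_le (by linarith : s ≤ s + 1) S.he.le)
  have b4' := (b4.self.of_le (by linarith : s ≤ s + 1) S.he.le)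
  have d1 := ((b1.self.sub b3').congr
    (g := fun x => ζ τ x - ζ' τ x - (ζ t x - ζ' t x)) (fun x => by ring) le_rfl).sn_le
  have d2 := ((b2.self.sub b4').congr
    (g := fun x => v τ x - v' τ x - (v t x - v' t x)) (fun x => by ring) le_rfl).sn_le
  rw [Real.dist_eq]
  have : gap s e ζ v ζ' v' τ - gap s e ζ v ζ' v' t =
      (Sn s e (fun x => ζ τ x - ζ' τ x) - Sn s e fun x => ζ t x - ζ' t x) +
        (Sn s e (fun x => v τ x - v' τ x) - Sn s e fun x => v t x - v' t x) := by
    simp only [gap]; ring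
  rw [this]
  refine (abs_add_le _ _).trans ?_
  linarith [c1.1, c1.2, c2.1, c2.2]

/-- While the sup norm of ζ - ζ' is at most c, the depth of the second solution is at least 2c - e²c
≥ c, and all requirements of a slice hold. -/
theorem evolution (S : Stable s e c C F L ζ v ζ' v' f₁ f₂) (hL : 0 ≤ L)
    (hsmall : ∀ t ∈ Ico 0 L, embC s * gap s e ζ v ζ' v' t ≤ c) :
    ∃ ζt vt ζt' vt', Evolution s e c C (speedC s C) F L ζ v ζ' v' f₁ f₂ ζt vt ζt' vt'
      (gap s e ζ v ζ' v') := by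
  obtain ⟨ζt, vt, m1, m2, d1, d2, q⟩ := S.hU
  obtain ⟨ζt', vt', m1', m2', d1', d2', q'⟩ := S.hU'
  have hs := S.hs
  have he := S.he
  have he1 := S.he1
  have hc := S.hc
  have hC : 0 ≤ C := (S.hM 0 ⟨le_rfl, hL⟩).1.nonneg
  have hη : ∀ t ∈ Icc 0 L, Sb s e 2 (fun x => ζ t x - ζ' t x) (gap s e ζ v ζ' v' t) :=
    fun t ht => (S.sb_η ht).self.mono (by
      have := Sn_nonneg s e fun x => v t x - v' t x
      rw [gap]; linarith)
  have hw : ∀ t ∈ Icc 0 L, Sb s e 2 (fun x => v t x - v' t x) (gap s e ζ v ζ' v' t) :=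
    fun t ht => (S.sb_w ht).self.mono (by
      have := Sn_nonneg s e fun x => ζ t x - ζ' t x
      rw [gap]; linarith)
  refine ⟨ζt, vt, ζt', vt', ⟨hs, he, he1, hc, ?_, S.hF, fun t ht => (S.hM t ht).1,
    fun t ht => (S.hM t ht).2.nice, fun t ht => (S.sb_ζ' ht).nice, fun t ht => (S.sb_v' ht).nice,
    hη, hw, fun t _ => rfl, S.continuousOn_gap, fun t ht x => ?_, m1, m2, m1', m2', d1, d2, d1',
    d2', ?_, ?_⟩⟩
  · have := embC_nonneg s
    unfold speedC; positivity
  · have := S.hh t ht x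
    linarith
  · filter_upwards [q, self_mem_ae_restrict measurableSet_Icc] with t qt ht x
    have h1 := qt.1 x
    rw [show ζt t x = -deriv (fun y => depth (e ^ 2) (ζ t) y * v t y) x by linarith, abs_neg]
    exact abs_deriv_depth_mul_le hs he.le he1 (S.hM t ht).1 (S.hM t ht).2 x
  -- The smallness is available only before the final time, which is negligible here.
  · rw [← restrict_Ioo_eq_restrict_Icc]
    have hr : volume.restrict (Ioo 0 L) ≤ volume.restrict (Icc 0 L) :=
      Measure.restrict_mono Ioo_subset_Icc_self le_rfl
    filter_upwards [ae_mono hr q, ae_mono hr q', ae_mono hr S.hf, ae_mono hr m2.1,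
      ae_mono hr m2'.1, self_mem_ae_restrict measurableSet_Ioo]
      with t qt qt' hf n2 n2' hto
    have ht : t ∈ Icc 0 L := Ioo_subset_Icc_self hto
    have bζ := (S.hM t ht).1
    have bv := (S.hM t ht).2
    have bζ' := S.sb_ζ' ht
    have bv' := S.sb_v' ht
    have hv2 : MemH (s + 2) (v' t) := (S.hX'.1 t ht).2.of_le (by linarith)
    have ha := h2_accel hs e (S.hX.1 t ht).2 n2
    have ha' := h2_accel hs e hv2 n2'
    have mom := momentum_fourier hs he he1 bζ bv ha nice_zero qt.2
    simp only [sub_zero] at mom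
    refine ⟨accel e (v t) (vt t), accel e (v' t) (vt' t), ⟨hs, he, he1, hc, bζ, bv, bζ', bv',
      (S.hM' t ht).1.deriv_succ hs he.le, (S.hM' t ht).2.deriv_succ hs he.le, hη t ht, hw t ht,
      hf.1, hf.2, fun x => ?_, fun x => ?_, ha, ha', mom,
      momentum_fourier hs he he1 bζ' bv' ha' hf.2.nice qt'.2, fun x => ?_, fun x => ?_⟩⟩
    · have := S.hh t ht x
      linarith
    · have h1 := (abs_le.1 ((hη t ht).abs_le hs he.le x)).2
      have h2 := hsmall t ⟨ht.1, hto.2⟩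
      have h3 := S.hh t ht x
      have h4 : e ^ 2 ≤ 1 := pow_le_one₀ he.le he1
      have h5 : e ^ 2 * (ζ t x - ζ' t x) ≤ e ^ 2 * c :=
        mul_le_mul_of_nonneg_left (h1.trans h2) (sq_nonneg e)
      have h6 := mul_le_mul_of_nonneg_right h4 hc.le
      linarith
    · have h1 := qt.1 x
      have h2 := qt'.1 x
      rw [deriv_depth_mul hs he.le bζ bv] at h1
      rw [deriv_depth_mul hs he.le bζ' bv'] at h2
      linear_combination h1 - h2
    · simp only [accel]
      ring

end Stable

/-- If the difference remains small the growth estimate applies directly. Otherwise it applies up to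
the first time at which embC times the gap reaches c, and shows there that c ≤ embC · B with B the
desired bound. The a priori bound 4C of the gap is then itself at most a multiple of B, at all
times. No smallness of the data is needed. -/
theorem exists_stable_bound {s c C : ℝ} (hs : 3 / 2 < s) (hc : 0 < c)
    (hC : 0 ≤ C) :
    ∃ K : ℝ, 0 < K ∧ ∀ (e F L : ℝ) (ζ v ζ' v' f₁ f₂ : ℝ → ℝ → ℝ),
      Stable s e c C F L ζ v ζ' v' f₁ f₂ → ∀ t ∈ Icc 0 L,
        gap s e ζ v ζ' v' t ≤ K * Real.exp (K * e * L) * (gap s e ζ v ζ' v' 0 + L * F) := by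
  have hen := Slice.enC_nonneg (by linarith : 0 ≤ s) hc hC
  have hemb := embC_nonneg s
  have hsp : 0 ≤ speedC s C := by unfold speedC; positivity
  set κ := lowC (1 + embC s * C)⁻¹ with hκ
  have hκ0 : 0 < κ := lowC_pos _
  set m := rateC s c C (speedC s C) * κ * (κ + 1) with hm
  have hm0 : 0 ≤ m := by
    have : 0 ≤ rateC s c C (speedC s C) := by unfold rateC; positivity
    positivity
  set A := Real.sqrt (4 * (1 + c⁻¹))
  have hA : 0 ≤ A := Real.sqrt_nonneg _
  -- The second summand is the ratio of the a priori bound 4C to the threshold c / embC.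
  set P := 1 + 4 * C * embC s / c with hP
  have hP1 : 1 ≤ P := by
    have : 0 ≤ 4 * C * embC s / c := by positivity
    linarith
  set K := P * κ * (A + m) + m + 1 with hK
  have hPK : 0 ≤ P * κ * (A + m) := by positivity
  have hmK : m ≤ K := by linarith
  refine ⟨K, by linarith, fun e F L ζ v ζ' v' f₁ f₂ S t ht => ?_⟩
  have he := S.he
  have hF := S.hF
  have hL : 0 ≤ L := ht.1.trans ht.2
  have hg0 : ∀ τ, 0 ≤ gap s e ζ v ζ' v' τ := fun τ => add_nonneg (Sn_nonneg _ _ _) (Sn_nonneg _ _ _)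
  set g := gap s e ζ v ζ' v' with hg
  set B := κ * Real.exp (m * e * L) * (A * g 0 + m * F * L) with hB
  have hB0 : 0 ≤ B := by have := hg0 0; positivity
  have step : ∀ τ ∈ Icc 0 L, (∀ σ ∈ Ico 0 τ, embC s * g σ ≤ c) → g τ ≤ B := by
    intro τ hτ hsmall
    obtain ⟨ζt, vt, ζt', vt', E⟩ := (S.mono hτ.2).evolution hτ.1 hsmall
    refine (E.le_growth hen hκ hm ⟨hτ.1, le_rfl⟩).trans ?_
    have := hg0 0
    have := hτ.1
    have := hτ.2
    rw [hB]
    gcongr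
  have main : g t ≤ P * B := by
    by_cases hsm : ∀ σ ∈ Ico 0 t, embC s * g σ ≤ c
    · have := step t ht hsm
      nlinarith
    · push Not at hsm
      obtain ⟨σ, hσ, hσc⟩ := hsm
      have hcont : ContinuousOn (fun τ => embC s * g τ) (Icc 0 t) :=
        continuousOn_const.mul (S.mono ht.2).continuousOn_gap
      -- The set of times above the threshold is compact by continuity, so it has a least element,
      -- before which the difference is small.
      have hZ : IsCompact (Icc 0 t ∩ (fun τ => embC s * g τ) ⁻¹' Ici c) :=
        isCompact_Icc.of_isClosed_subset (hcont.preimage_isClosed_of_isClosed isClosed_Icc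
          isClosed_Ici) inter_subset_left
      obtain ⟨r, ⟨hr, hrc⟩, hmin⟩ := hZ.exists_isLeast ⟨σ, ⟨hσ.1, hσ.2.le⟩, hσc.le⟩
      have h1 := step r ⟨hr.1, hr.2.trans ht.2⟩ fun q hq => by
        by_contra! hlt
        exact absurd (hmin ⟨⟨hq.1, hq.2.le.trans hr.2⟩, hlt.le⟩) (not_le.2 hq.2)
      have h2 : c ≤ embC s * B := le_trans hrc (mul_le_mul_of_nonneg_left h1 hemb)
      have h3 : g t ≤ 4 * C := S.gap_le ht
      have h4 : 4 * C ≤ 4 * C * embC s / c * B := by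
        rw [div_mul_eq_mul_div, le_div_iff₀ hc]
        have := mul_le_mul_of_nonneg_left h2 (by positivity : 0 ≤ 4 * C)
        linarith
      rw [hP]
      linarith
  refine main.trans ?_
  have h0 := hg0 0
  calc P * B = P * κ * Real.exp (m * e * L) * (A * g 0 + m * (L * F)) := by rw [hB]; ring
    _ ≤ P * κ * Real.exp (m * e * L) * ((A + m) * (g 0 + L * F)) := by
        have h1 : 0 ≤ A * (L * F) := by positivity
        have h2 : 0 ≤ m * g 0 := by positivity
        gcongr
        linarith
    _ = P * κ * (A + m) * Real.exp (m * e * L) * (g 0 + L * F) := by ring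
    _ ≤ K * Real.exp (K * e * L) * (g 0 + L * F) := by
        have : P * κ * (A + m) ≤ K := by linarith
        gcongr

/-- Only the final time is in question; there the bound passes to the limit because the elevation is
Lipschitz in time, its time derivative being bounded by the equation. -/
theorem IsSolution.depth_ge {s e C c L : ℝ} (hs : 3 / 2 < s) (he : 0 ≤ e) (he1 : e ≤ 1)
    {ζ v : ℝ → ℝ → ℝ} (hU : IsSolution (e ^ 2) L ζ v (fun _ _ => 0) fun _ _ => 0)
    (hM : ∀ t ∈ Icc 0 L, Sb s e 2 (ζ t) C ∧ Sb s e 2 (v t) C) (hL : 0 < L)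
    (hh : ∀ t ∈ Ico 0 L, ∀ x, c ≤ 1 + e ^ 2 * ζ t x) {t : ℝ} (ht : t ∈ Icc 0 L) (x : ℝ) :
    c ≤ 1 + e ^ 2 * ζ t x := by
  rcases ht.2.lt_or_eq with h | rfl
  · exact hh t ⟨ht.1, h⟩ x
  obtain ⟨ζt, vt, -, -, d, -, q⟩ := hU
  have hb : ∀ᵐ τ ∂(volume.restrict (Icc 0 t)), ∀ x, |ζt τ x| ≤ speedC s C := by
    filter_upwards [q, self_mem_ae_restrict measurableSet_Icc] with τ qt hτ x
    have h1 := qt.1 x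
    rw [show ζt τ x = -deriv (fun y => depth (e ^ 2) (ζ τ) y * v τ y) x by linarith, abs_neg]
    exact abs_deriv_depth_mul_le hs he he1 (hM τ hτ).1 (hM τ hτ).2 x
  have lim : Tendsto (fun τ => 1 + e ^ 2 * (ζ t x + speedC s C * |τ - t|)) (𝓝[<] t)
      (𝓝 (1 + e ^ 2 * (ζ t x + speedC s C * |t - t|))) :=
    (Continuous.tendsto (by fun_prop) t).mono_left nhdsWithin_le_nhds
  rw [sub_self, abs_zero, mul_zero, add_zero] at lim
  refine ge_of_tendsto lim ?_
  filter_upwards [Ioo_mem_nhdsLT hL] with τ hτ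
  have h1 := (abs_le.1 (d.abs_sub_le hb ht ⟨hτ.1.le, hτ.2.le⟩ x)).2
  refine (hh τ ⟨hτ.1.le, hτ.2⟩ x).trans ?_
  have := mul_le_mul_of_nonneg_left (sub_le_iff_le_add'.1 h1) (sq_nonneg e)
  linarith

end

end Boussinesq

/-! ### The stability theorem -/

theorem theorem2 (s : ℝ) (hs : 3 / 2 < s) (hmin : ℝ) (hmin_pos : 0 < hmin) (M M' : ℝ) :
    ∃ K : ℝ, 0 < K ∧
      ∀ ε : ℝ, 0 < ε → ε < 1 → ∀ T : ℝ, 0 < T →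
      ∀ ζ v : ℝ → ℝ → ℝ,
        -- the solution `U = (ζ, v)` on `[0, T/√ε]`, with non-vanishing depth
        Boussinesq.ContX ε s (T / Real.sqrt ε) ζ v →
        Boussinesq.IsSolution ε (T / Real.sqrt ε) ζ v (fun _ _ => 0) (fun _ _ => 0) →
        (∀ t ∈ Set.Ico 0 (T / Real.sqrt ε), ∀ x, hmin ≤ 1 + ε * ζ t x) →
        (∀ t ∈ Set.Icc 0 (T / Real.sqrt ε), Boussinesq.normX ε s (ζ t) (v t) ≤ M) →
      ∀ ζ' v' f₁ f₂ : ℝ → ℝ → ℝ,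
        -- the approximate solution `(ζ', v')` and its source `(f₁, f₂)`
        Boussinesq.ContX ε (s + 1) (T / Real.sqrt ε) ζ' v' →
        Boussinesq.MemLinfH (s + 2) (T / Real.sqrt ε) f₁ →
        Boussinesq.MemLinfH (s + 2) (T / Real.sqrt ε) f₂ →
        Boussinesq.IsSolution ε (T / Real.sqrt ε) ζ' v' f₁ f₂ →
        (∀ t ∈ Set.Icc 0 (T / Real.sqrt ε), Boussinesq.normX ε (s + 1) (ζ' t) (v' t) ≤ M') →
      ∀ t ∈ Set.Icc 0 (T / Real.sqrt ε), ∀ τ ∈ Set.Icc 0 t,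
        Boussinesq.normX ε s (fun x => ζ τ x - ζ' τ x) (fun x => v τ x - v' τ x) ≤
          K * Real.exp (Real.sqrt ε * K * t) *
            (Boussinesq.normX ε s (fun x => ζ 0 x - ζ' 0 x) (fun x => v 0 x - v' 0 x)
              + t * Boussinesq.normLinfX ε s t f₁ f₂) := by
  obtain ⟨K, hK, key⟩ := Boussinesq.exists_stable_bound hs (half_pos hmin_pos)
    (by positivity : 0 ≤ 4 * (|M| + |M'|))
  -- 16 = 2 · 8: the energy norm is at most 2 times the gap, while the gap at time zero and the
  -- weighted source are at most 8 and 4 times their energy norms.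
  refine ⟨16 * K, by linarith, fun ε hε hε1 T hT ζ v hX hU hh hM ζ' v' f₁ f₂ hX' h₁ h₂ hU' hM'
    t ht τ hτ => ?_⟩
  have he : 0 < Real.sqrt ε := Real.sqrt_pos.2 hε
  have he1 : Real.sqrt ε ≤ 1 := Real.sqrt_le_one.2 hε1.le
  have hL : 0 < T / Real.sqrt ε := div_pos hT he
  have hee : Real.sqrt ε ^ 2 = ε := Real.sq_sqrt hε.le
  generalize T / Real.sqrt ε = L at *
  generalize Real.sqrt ε = e at *
  subst hee
  have hs1 : 3 / 2 < s + 1 := by linarith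
  have hMC : ∀ t ∈ Set.Icc 0 L, Boussinesq.Sb s e 2 (ζ t) (4 * (|M| + |M'|)) ∧
      Boussinesq.Sb s e 2 (v t) (4 * (|M| + |M'|)) := fun t ht =>
    Boussinesq.sb_of_normX_le hs he he1 (hX.1 t ht).1 (hX.1 t ht).2 ((hM t ht).trans (by
      have := le_abs_self M
      have := abs_nonneg M'
      linarith))
  have hMC' : ∀ t ∈ Set.Icc 0 L, Boussinesq.Sb (s + 1) e 2 (ζ' t) (4 * (|M| + |M'|)) ∧
      Boussinesq.Sb (s + 1) e 2 (v' t) (4 * (|M| + |M'|)) := fun t ht =>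
    Boussinesq.sb_of_normX_le hs1 he he1 (hX'.1 t ht).1 (hX'.1 t ht).2 ((hM' t ht).trans (by
      have := le_abs_self M'
      have := abs_nonneg M
      linarith))
  have h₁' := h₁.mono ht.2
  have h₂' := h₂.mono ht.2
  have hN : 0 ≤ Boussinesq.normLinfX (e ^ 2) s t f₁ f₂ := ENNReal.toReal_nonneg
  -- The argument is run on [0, t] rather than on the whole interval, so that the exponential and
  -- the norm of the source involve t only. Half of the minimal depth is reserved for the second
  -- solution.
  have S : Boussinesq.Stable s e (hmin / 2) (4 * (|M| + |M'|))
      (4 * Boussinesq.normLinfX (e ^ 2) s t f₁ f₂) t ζ v ζ' v' f₁ f₂ := by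
    have hsub : Set.Icc 0 t ⊆ Set.Icc 0 L := Set.Icc_subset_Icc le_rfl ht.2
    refine ⟨hs, he, he1, half_pos hmin_pos, by linarith,
      ⟨fun r hr => hX.1 r (hsub hr), fun r hr =>
        (hX.2 r (hsub hr)).mono_left (nhdsWithin_mono _ hsub)⟩,
      ⟨fun r hr => hX'.1 r (hsub hr), fun r hr =>
        (hX'.2 r (hsub hr)).mono_left (nhdsWithin_mono _ hsub)⟩,
      hU.mono ht.2, hU'.mono ht.2, fun r hr => hMC r (hsub hr), fun r hr => hMC' r (hsub hr),
      fun r hr x => ?_, ?_⟩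
    · rw [mul_div_cancel₀ _ (two_ne_zero' ℝ)]
      exact hU.depth_ge hs he.le he1 hMC hL hh (hsub hr) x
    · filter_upwards [h₁'.1, h₂'.1, Boussinesq.ae_normX_le_normLinfX hs he he1 h₁' h₂']
        with r a₁ a₂ a₃
      exact Boussinesq.sb_of_normX_le hs he he1 a₁ a₂ a₃
  have h0 : (0 : ℝ) ∈ Set.Icc 0 t := ⟨le_rfl, ht.1⟩
  have b1 := Boussinesq.normX_le hs he he1 (S.sb_η hτ).self (S.sb_w hτ).self
  have b2 := key e _ t ζ v ζ' v' f₁ f₂ S τ hτ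
  have b3 := Boussinesq.Sn_le_normX hs he (S.sb_η h0) (S.sb_w h0)
  refine b1.trans ((mul_le_mul_of_nonneg_left b2 zero_le_two).trans ?_)
  have hX0 := Boussinesq.normX_nonneg (e ^ 2) s (fun x => ζ 0 x - ζ' 0 x) fun x => v 0 x - v' 0 x
  generalize Boussinesq.normX (e ^ 2) s (fun x => ζ 0 x - ζ' 0 x) (fun x => v 0 x - v' 0 x) = X at *
  generalize Boussinesq.normLinfX (e ^ 2) s t f₁ f₂ = N at *
  have ht0 := ht.1
  have b4 : Boussinesq.gap s e ζ v ζ' v' 0 + t * (4 * N) ≤ 8 * (X + t * N) := by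
    have := mul_nonneg ht0 hN
    rw [Boussinesq.gap]
    linarith [b3.1, b3.2]
  have b5 : Real.exp (K * e * t) ≤ Real.exp (e * (16 * K) * t) := by
    refine Real.exp_le_exp.2 ?_
    have : 0 ≤ K * e * t := by positivity
    linarith
  calc 2 * (K * Real.exp (K * e * t) * (Boussinesq.gap s e ζ v ζ' v' 0 + t * (4 * N)))
      ≤ 2 * (K * Real.exp (K * e * t) * (8 * (X + t * N))) := by gcongr
    _ = 16 * K * Real.exp (K * e * t) * (X + t * N) := by ring
    _ ≤ 16 * K * Real.exp (e * (16 * K) * t) * (X + t * N) := by gcongr
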